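/- **Notation.** Let $d\in\mathbb N$. For a measurable $\Psi:\mathbb R^n\to\mathbb R\cup\{\infty\}$ let $\mu_\Psi$ be the measure on $\mathbb R^n$ with Lebesgue density $e^{-\Psi}$. All function spaces are real. **Assumptions on $\Phi_1:\mathbb R^d\to\mathbb R\cup\{\infty\}$.** $\Phi_1$ is bounded from below, $\{\Phi_1<\infty\}\neq\emptyset$, and $e^{-\Phi_1}$ is continuous on $\mathbb R^d$; $\Phi_1$ is weakly differentiable on $\{\Phi_1<\infty\}$ with $\nabla\Phi_1\in L^2_{loc}(\mathbb R^d,\mu_{\Phi_1})$; the operator $(\Delta-\nabla\Phi_1\cdot\nabla,\ C_c^\infty(\{\Phi_1<\infty\}))$ is closable in $\mathcal H_0:=L^2(\mathbb R^d,\mu_{\Phi_1})$ and its closure generates a strongly continuous contraction semigroup $(T^0_t)_{t\ge0}$; and $\int|\nabla\Phi_1|^2\,d\mu_{\Phi_1}<\infty$. **Assumptions on $\Phi_2:\mathbb R^d\to\mathbb R$.** $\Phi_2$ is measurable, bounded from below, locally integrable and symmetric ($\Phi_2(v)=\Phi_2(-v)$); its distributional derivatives satisfy $\partial_i\Phi_2\in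 L^2_{loc}$ and $\partial_i^2\Phi_2\in L^1_{loc}$ for $i=1,\dots,d$; the operator $(\Delta-\nabla\Phi_2\cdot\nabla,\ C_c^\infty(\mathbb R^d))$ is essentially self-adjoint on $L^2(\mathbb R^d,\mu_{\Phi_2})$; there are $K\in(0,\infty)$ and $\alpha\in[1,2)$ with $|\Delta\Phi_2|\le K(1+|\nabla\Phi_2|^\alpha)$ almost everywhere; $\mu_{\Phi_2}(\mathbb R^d)=1$; and $\int|\nabla\Phi_2|^2\,d\mu_{\Phi_2}<\infty$. **Joint assumption.** Either (i) the measure $\mu_{\Phi_1+\Phi_2}$ with density $e^{-\Phi_1(x)-\Phi_2(v)}$ on $\mathbb R^{2d}$ is finite, or (ii) $\nabla\Phi_1\in L^q_{loc}(\mathbb R^d,\mu_{\Phi_1})$ for some $q\in[2,\infty]$ with $q>d$. **Scaled objects.** For $\varepsilon>0$ put $\Phi_2^\varepsilon(v)=\Phi_2(v/\varepsilon)+\ln(\varepsilon^d)$, let $\mu_\varepsilon$ be the measure on $\mathbb R^{2d}$ with Lebesgue density $e^{-\Phi_1(x)-\Phi_2^\varepsilon(v)}$, let $\mathcal H_\varepsilon=L^2(\mathbb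 R^{2d},\mu_\varepsilon)$, and for $f\in C_c^\infty(\{\Phi_1<\infty\}\times\mathbb R^d)$ let $$L^1_{\mathbf\Phi^\varepsilon}f=\Delta_vf-\nabla_v\Phi_2^\varepsilon\cdot\nabla_vf+\nabla_v\Phi_2^\varepsilon\cdot\nabla_xf-\nabla_x\Phi_1\cdot\nabla_vf .$$ **Comparison maps.** For $\varepsilon>0$ let $\eta_\varepsilon\in C_c^\infty(\mathbb R^d)$ be symmetric ($\eta_\varepsilon(v)=\eta_\varepsilon(-v)$), with $\eta_\varepsilon=1$ on $B_{\varepsilon^{-2}}(0)$, support in the closed ball of radius $2\varepsilon^{-2}$ about $0$, and $|\nabla\eta_\varepsilon|\le C\varepsilon^2$, $|\Delta\eta_\varepsilon|\le C\varepsilon^4$ for a finite constant $C$ independent of $\varepsilon$. Let $\mathcal C=C_c^\infty(\{\Phi_1<\infty\})$ and $$\Psi_\varepsilon:\mathcal C\to\mathcal H_\varepsilon,\qquad (\Psi_\varepsilon f)(x,v)=f(x+v)\,\eta_\varepsilon(v).$$ **Theorem.** Under these assumptions the following hold. 1. The Hilbert spaces $\mathcal H_\varepsilon$ converge to $\mathcal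 H_0$ along $(\Psi_\varepsilon)_{\varepsilon>0}$ in the sense of Kuwae and Shioya: $\mathcal C$ is (by taking classes) a dense linear subspace of $\mathcal H_0$, the maps $\Psi_\varepsilon$ are linear, and $\|\Psi_\varepsilon u\|_{\mathcal H_\varepsilon}\to\|u\|_{\mathcal H_0}$ as $\varepsilon\to0$ for all $u\in\mathcal C$. 2. For every $\varepsilon>0$ the closure of $L^1_{\mathbf\Phi^\varepsilon}$ in $L^1(\mathbb R^{2d},\mu_\varepsilon)$ generates a strongly continuous contraction semigroup on $L^1(\mathbb R^{2d},\mu_\varepsilon)$, and there is a unique strongly continuous contraction semigroup $(T^\varepsilon_{t})_{t\ge0}$ on $\mathcal H_\varepsilon$ which coincides with it on $L^1(\mu_\varepsilon)\cap L^\infty(\mu_\varepsilon)$. 3. Say that $f_\varepsilon\in\mathcal H_\varepsilon$ ($\varepsilon>0$) converges strongly to $f\in\mathcal H_0$ if $\|f_\varepsilon\|_{\mathcal H_\varepsilon}\to\|f\|_{\mathcal H_0}$ and $(f_\varepsilon,\Psi_\varepsilon\varphi)_{\mathcal H_\varepsilon}\to(f,\varphi)_{\mathcal H_0}$ for all $\varphi\in\mathcal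 C$, as $\varepsilon\to0$. Then for every $t\ge0$: if $f_\varepsilon$ converges strongly to $f$, then $T^\varepsilon_{t}f_\varepsilon$ converges strongly to $T^0_tf$. -/

import Mathlib

open MeasureTheory Filter Topology Set
open scoped ENNReal NNReal ContDiff Laplacian Gradient RealInnerProductSpace

noncomputable section

namespace Overdamped

/-- The space `ℝ^d` with its Euclidean norm. -/
abbrev E (d : ℕ) : Type := EuclideanSpace ℝ (Fin d)

/-! ### Contraction semigroups and their generators -/

section Semigroup

variable {X : Type*} [NormedAddCommGroup X] [NormedSpace ℝ X]

/-- Strongly continuous contraction semigroups `(T t)_{t ≥ 0}` of bounded operators on `X`. -/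
structure IsContractionSemigroup (T : ℝ≥0 → X →L[ℝ] X) : Prop where
  map_zero : T 0 = ContinuousLinearMap.id ℝ X
  map_add : ∀ s t, T (s + t) = (T s).comp (T t)
  norm_le_one : ∀ t, ‖T t‖ ≤ 1
  continuous : ∀ x, Continuous fun t => T t x

/-- The graph of the generator of `T`: the pairs `(x, y)` such that `(T t x - x) / t → y` in norm
as `t ↓ 0`. -/
def generatorGraph (T : ℝ≥0 → X →L[ℝ] X) : Set (X × X) :=
  {p | Tendsto (fun t : ℝ≥0 => (t : ℝ)⁻¹ • (T t p.1 - p.1)) (𝓝[>] 0) (𝓝 p.2)}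

/-- `T` is a strongly continuous contraction semigroup whose generator is the closure of the
operator with graph `Γ`. The closure of an operator is the operator whose graph is the closure of
the graph; as generators are single-valued, this contains that the operator is closable. -/
def IsGeneratedByClosure (Γ : Set (X × X)) (T : ℝ≥0 → X →L[ℝ] X) : Prop :=
  IsContractionSemigroup T ∧ generatorGraph T = closure Γ

end Semigroup

/-- An operator with graph `Γ` (and dense domain) on a real Hilbert space is essentially
self-adjoint if its closure coincides with its adjoint, the operator whose graph consists of the
pairs `(u, w)` with `⟪w, a⟫ = ⟪u, b⟫` for all `(a, b) ∈ Γ`. -/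
def IsEssentiallySelfAdjoint {H : Type*} [NormedAddCommGroup H] [InnerProductSpace ℝ H]
    (Γ : Set (H × H)) : Prop :=
  closure Γ = {p : H × H | ∀ q ∈ Γ, ⟪p.2, q.1⟫ = ⟪p.1, q.2⟫}

/-! ### Convergence of Hilbert spaces in the sense of Kuwae and Shioya -/

section KuwaeShioya

variable {I C H₀ : Type*} {H : I → Type*} [AddCommGroup C] [Module ℝ C]
  [NormedAddCommGroup H₀] [InnerProductSpace ℝ H₀]
  [∀ i, NormedAddCommGroup (H i)] [∀ i, InnerProductSpace ℝ (H i)]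

/-- The Hilbert spaces `H i` converge (as `i` tends to its limit along `l`) to `H₀` along the linear
maps `Ψ i : C → H i`, where the vector space `C` is a dense subspace of `H₀` by means of the
injective linear map `ι`. -/
structure HilbertConverges (l : Filter I) (ι : C →ₗ[ℝ] H₀) (Ψ : ∀ i, C →ₗ[ℝ] H i) : Prop where
  injective : Function.Injective ι
  denseRange : DenseRange ι
  tendsto_norm : ∀ u, Tendsto (fun i => ‖Ψ i u‖) l (𝓝 ‖ι u‖)

/-- Strong convergence of `f i ∈ H i` to `f₀ ∈ H₀` along the convergence of Hilbert spaces given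
by `ι` and `Ψ`. -/
def StrongConverges (l : Filter I) (ι : C →ₗ[ℝ] H₀) (Ψ : ∀ i, C →ₗ[ℝ] H i)
    (f : ∀ i, H i) (f₀ : H₀) : Prop :=
  Tendsto (fun i => ‖f i‖) l (𝓝 ‖f₀‖) ∧
    ∀ u, Tendsto (fun i => ⟪f i, Ψ i u⟫) l (𝓝 ⟪f₀, ι u⟫)

end KuwaeShioya

/-! ### Test functions, operators in `L^p`, weak derivatives -/

section Analysis

variable {X : Type*} [NormedAddCommGroup X] [NormedSpace ℝ X]

/-- `C_c^∞(Ω)`, as a space of functions on the whole space. -/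
def testFunctions (Ω : Set X) : Submodule ℝ (X → ℝ) where
  carrier := {f | ContDiff ℝ ∞ f ∧ HasCompactSupport f ∧ tsupport f ⊆ Ω}
  add_mem' := by
    rintro f g ⟨hf, hf', hf''⟩ ⟨hg, hg', hg''⟩
    exact ⟨hf.add hg, hf'.add hg', (tsupport_add f g).trans (union_subset hf'' hg'')⟩
  zero_mem' := by
    refine ⟨contDiff_const, HasCompactSupport.zero, ?_⟩
    rw [tsupport_eq_empty_iff.2 rfl]
    exact empty_subset _
  smul_mem' := by
    rintro c f ⟨hf, hf', hf''⟩
    refine ⟨contDiff_const.smul hf, hf'.smul_left (f := fun _ => c), ?_⟩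
    exact (closure_mono (Function.support_const_smul_subset c f)).trans hf''

/-- The graph in `L^p(μ) × L^p(μ)` of the operator `A` with domain `D`. -/
def operatorGraph [MeasurableSpace X] (p : ℝ≥0∞) (μ : Measure X) (D : Submodule ℝ (X → ℝ))
    (A : (X → ℝ) → X → ℝ) : Set (Lp ℝ p μ × Lp ℝ p μ) :=
  {q | ∃ f ∈ D, q.1 =ᵐ[μ] f ∧ q.2 =ᵐ[μ] A f}

/-- `G ∈ L^q_loc(X, μ)`, i.e. `G ∈ L^q(K, μ)` for all compact `K`. -/
def LocallyMemLp [MeasurableSpace X] {F : Type*} [NormedAddCommGroup F] (G : X → F) (q : ℝ≥0∞)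
    (μ : Measure X) : Prop :=
  ∀ K : Set X, IsCompact K → MemLp G q (μ.restrict K)

/-- `C_c^∞(Ω) → L²(μ)`, sending a function to its class. -/
def toL2 [MeasurableSpace X] [OpensMeasurableSpace X] (Ω : Set X) (μ : Measure X)
    (hμ : IsFiniteMeasureOnCompacts μ) : testFunctions Ω →ₗ[ℝ] Lp ℝ 2 μ where
  toFun f := (f.2.1.continuous.memLp_of_hasCompactSupport (p := 2) (μ := μ) f.2.2.1).toLp f.1
  map_add' _ _ := rfl
  map_smul' _ _ := rfl

end Analysis

/-- On the open set `Ω`, `g` is the `i`-th weak partial derivative of `u`. -/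
structure HasWeakPartialOn {d : ℕ} (Ω : Set (E d)) (u g : E d → ℝ) (i : Fin d) : Prop where
  left : LocallyIntegrableOn u Ω
  right : LocallyIntegrableOn g Ω
  parts : ∀ φ ∈ testFunctions Ω,
    ∫ x in Ω, u x * fderiv ℝ φ x (EuclideanSpace.single i 1) = -∫ x in Ω, g x * φ x

/-! ### Measures, potentials and differential operators -/

/-- The measure `μ_Ψ` with density `exp (-Ψ)` with respect to Lebesgue measure. -/
def gibbs {X : Type*} [MeasureSpace X] (Ψ : X → EReal) : Measure X :=
  volume.withDensity fun x => (-Ψ x).exp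

/-- The potential `(x, v) ↦ Φ₁ x + Φ₂ v` on `ℝ^d × ℝ^d`. -/
def phasePotential {d : ℕ} (Φ₁ : E d → EReal) (Φ₂ : E d → ℝ) : E d × E d → EReal :=
  fun p => Φ₁ p.1 + (Φ₂ p.2 : EReal)

/-- The measure `μ_{(Φ₁, Φ₂)}` on `ℝ^d × ℝ^d`. -/
abbrev phaseMeasure {d : ℕ} (Φ₁ : E d → EReal) (Φ₂ : E d → ℝ) : Measure (E d × E d) :=
  gibbs (phasePotential Φ₁ Φ₂)

/-- The set `{Φ < ∞}`. -/
def finiteSet {d : ℕ} (Φ : E d → EReal) : Set (E d) := {x | Φ x < ⊤}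

/-- `f ↦ Δ f - ∇Φ · ∇f`, where `G` stands for `∇Φ`. -/
def overdampedOp {d : ℕ} (G : E d → E d) (f : E d → ℝ) : E d → ℝ :=
  fun x => Δ f x - ⟪G x, ∇ f x⟫

/-- `f ↦ Δ_v f - ∇_v Φ₂ · ∇_v f + ∇_v Φ₂ · ∇_x f - ∇_x Φ₁ · ∇_v f`, where `G₁` and `G₂` stand for
`∇Φ₁` and `∇Φ₂`. -/
def hamiltonOp {d : ℕ} (G₁ G₂ : E d → E d) (f : E d × E d → ℝ) : E d × E d → ℝ :=
  fun p =>
    Δ (fun v => f (p.1, v)) p.2 - ⟪G₂ p.2, ∇ (fun v => f (p.1, v)) p.2⟫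
      + ⟪G₂ p.2, ∇ (fun x => f (x, p.2)) p.1⟫ - ⟪G₁ p.1, ∇ (fun v => f (p.1, v)) p.2⟫

/-- `Δ - ∇Φ · ∇` on `C_c^∞({Φ < ∞})`, as an operator in `L²(μ_Φ)`. -/
def overdampedGraph {d : ℕ} (Φ : E d → EReal) (G : E d → E d) :
    Set (Lp ℝ 2 (gibbs Φ) × Lp ℝ 2 (gibbs Φ)) :=
  operatorGraph 2 (gibbs Φ) (testFunctions (finiteSet Φ)) (overdampedOp G)

/-- The generalized Hamiltonian operator on `C_c^∞({Φ₁ < ∞} × ℝ^d)`, as an operator in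
`L¹(μ_{(Φ₁, Φ₂)})`. -/
def hamiltonGraph {d : ℕ} (Φ₁ : E d → EReal) (G₁ : E d → E d) (Φ₂ : E d → ℝ) (G₂ : E d → E d) :
    Set (Lp ℝ 1 (phaseMeasure Φ₁ Φ₂) × Lp ℝ 1 (phaseMeasure Φ₁ Φ₂)) :=
  operatorGraph 1 (phaseMeasure Φ₁ Φ₂) (testFunctions (finiteSet Φ₁ ×ˢ univ)) (hamiltonOp G₁ G₂)

/-- `T` is the `L²`-semigroup of the generalized Hamiltonian operator: the strongly continuous
contraction semigroup on `L²(μ_{(Φ₁, Φ₂)})` which coincides on `L¹ ∩ L^∞` with the strongly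
continuous contraction semigroup on `L¹(μ_{(Φ₁, Φ₂)})` generated by the closure of the operator. -/
def IsHamiltonSemigroup {d : ℕ} (Φ₁ : E d → EReal) (G₁ : E d → E d) (Φ₂ : E d → ℝ)
    (G₂ : E d → E d)
    (T : ℝ≥0 → Lp ℝ 2 (phaseMeasure Φ₁ Φ₂) →L[ℝ] Lp ℝ 2 (phaseMeasure Φ₁ Φ₂)) : Prop :=
  IsContractionSemigroup T ∧
    ∃ S : ℝ≥0 → Lp ℝ 1 (phaseMeasure Φ₁ Φ₂) →L[ℝ] Lp ℝ 1 (phaseMeasure Φ₁ Φ₂),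
      IsGeneratedByClosure (hamiltonGraph Φ₁ G₁ Φ₂ G₂) S ∧
        ∀ (f : Lp ℝ 1 (phaseMeasure Φ₁ Φ₂)) (g : Lp ℝ 2 (phaseMeasure Φ₁ Φ₂)),
          MemLp f ∞ (phaseMeasure Φ₁ Φ₂) → f =ᵐ[phaseMeasure Φ₁ Φ₂] g →
            ∀ t, S t f =ᵐ[phaseMeasure Φ₁ Φ₂] T t g

/-- The scaled velocity potential `Φ₂^ε(v) = Φ₂(v / ε) + ln (ε^d)`. -/
def scaledPotential {d : ℕ} (Φ₂ : E d → ℝ) (ε : ℝ) : E d → ℝ :=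
  fun v => Φ₂ (ε⁻¹ • v) + Real.log (ε ^ d)

/-- The gradient `∇Φ₂^ε(v) = ε⁻¹ ∇Φ₂(v / ε)` of the scaled potential, where `G₂` is that of `Φ₂`. -/
def scaledGradient {d : ℕ} (G₂ : E d → E d) (ε : ℝ) : E d → E d :=
  fun v => ε⁻¹ • G₂ (ε⁻¹ • v)

/-! ### Assumptions -/

/-- Assumptions on the position potential `Φ₁ : ℝ^d → ℝ ∪ {∞}` with weak gradient `G₁`. -/
structure PositionAssumptions {d : ℕ} (Φ₁ : E d → EReal) (G₁ : E d → E d) : Prop where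
  bddBelow : ∃ c : ℝ, ∀ x, (c : EReal) ≤ Φ₁ x
  nonempty : (finiteSet Φ₁).Nonempty
  continuous_exp : Continuous fun x => (-Φ₁ x).exp
  weakGradient : ∀ i, HasWeakPartialOn (finiteSet Φ₁) (fun x => (Φ₁ x).toReal) (fun x => G₁ x i) i
  gradient_loc : LocallyMemLp G₁ 2 (gibbs Φ₁)
  generates : ∃ T, IsGeneratedByClosure (overdampedGraph Φ₁ G₁) T
  gradient_memLp : MemLp G₁ 2 (gibbs Φ₁)

/-- Assumptions on the finite velocity potential `Φ₂ : ℝ^d → ℝ` with weak gradient `G₂` and weak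
second derivatives `∂ᵢ² Φ₂ = H₂ i`. -/
structure VelocityAssumptions {d : ℕ} (Φ₂ : E d → ℝ) (G₂ : E d → E d) (H₂ : Fin d → E d → ℝ) :
    Prop where
  measurable : Measurable Φ₂
  bddBelow : ∃ c : ℝ, ∀ v, c ≤ Φ₂ v
  locallyIntegrable : LocallyIntegrable Φ₂
  weakGradient : ∀ i, HasWeakPartialOn univ Φ₂ (fun v => G₂ v i) i
  gradient_loc : LocallyMemLp G₂ 2 volume
  weakSecond : ∀ i, HasWeakPartialOn univ (fun v => G₂ v i) (H₂ i) i
  essentiallySelfAdjoint :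
    IsEssentiallySelfAdjoint (overdampedGraph (fun v => (Φ₂ v : EReal)) G₂)
  laplacian_le : ∃ K α : ℝ, 0 < K ∧ 1 ≤ α ∧ α < 2 ∧
    ∀ᵐ v, |∑ i, H₂ i v| ≤ K * (1 + ‖G₂ v‖ ^ α)
  symmetric : ∀ v, Φ₂ v = Φ₂ (-v)
  /-- `μ_{Φ₂}` is finite, with total mass normalized to one. -/
  mass_one : gibbs (fun v => (Φ₂ v : EReal)) univ = 1
  gradient_memLp : MemLp G₂ 2 (gibbs fun v => (Φ₂ v : EReal))

/-- A family of symmetric cut-off functions at radius `ε⁻²`. -/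
structure IsCutoffFamily {d : ℕ} (η : ℝ → testFunctions (univ : Set (E d))) : Prop where
  symmetric : ∀ ε > 0, ∀ v, (η ε).1 v = (η ε).1 (-v)
  eq_one : ∀ ε > 0, ∀ v ∈ Metric.ball (0 : E d) (ε ^ 2)⁻¹, (η ε).1 v = 1
  support : ∀ ε > 0, tsupport (η ε).1 ⊆ Metric.closedBall 0 (2 * (ε ^ 2)⁻¹)
  bounds : ∃ C : ℝ, ∀ ε > 0, ∀ v, ‖∇ (η ε).1 v‖ ≤ C * ε ^ 2 ∧ |Δ (η ε).1 v| ≤ C * ε ^ 4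

/-! ### The comparison maps `Ψ_ε` -/

theorem isFiniteMeasureOnCompacts_gibbs {X : Type*} [MeasureSpace X] [TopologicalSpace X]
    [IsFiniteMeasureOnCompacts (volume : Measure X)] {Ψ : X → EReal} {c : ℝ}
    (h : ∀ x, (c : EReal) ≤ Ψ x) : IsFiniteMeasureOnCompacts (gibbs Ψ) := by
  refine ⟨fun K hK => ?_⟩
  have hle : gibbs Ψ ≤ volume.withDensity fun _ => (-(c : EReal)).exp :=
    withDensity_mono (ae_of_all _ fun x =>
      EReal.exp_monotone (EReal.neg_le_neg_iff.2 (h x)))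
  refine (hle K).trans_lt ?_
  rw [withDensity_const, Measure.smul_apply, smul_eq_mul, ← EReal.coe_neg, EReal.exp_coe]
  exact ENNReal.mul_lt_top ENNReal.ofReal_lt_top hK.measure_lt_top

theorem PositionAssumptions.finiteOnCompacts {d : ℕ} {Φ₁ : E d → EReal} {G₁ : E d → E d}
    (h : PositionAssumptions Φ₁ G₁) : IsFiniteMeasureOnCompacts (gibbs Φ₁) :=
  h.bddBelow.elim fun _ hc => isFiniteMeasureOnCompacts_gibbs hc

theorem phase_finiteOnCompacts {d : ℕ} {Φ₁ : E d → EReal} {G₁ : E d → E d} {Φ₂ : E d → ℝ}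
    {G₂ : E d → E d} {H₂ : Fin d → E d → ℝ} (h₁ : PositionAssumptions Φ₁ G₁)
    (h₂ : VelocityAssumptions Φ₂ G₂ H₂) (ε : ℝ) :
    IsFiniteMeasureOnCompacts (phaseMeasure Φ₁ (scaledPotential Φ₂ ε)) := by
  obtain ⟨c, hc⟩ := h₁.bddBelow
  obtain ⟨b, hb⟩ := h₂.bddBelow
  refine isFiniteMeasureOnCompacts_gibbs (c := c + (b + Real.log (ε ^ d))) fun p => ?_
  rw [EReal.coe_add]
  refine add_le_add (hc _) (EReal.coe_le_coe_iff.2 ?_)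
  have := hb (ε⁻¹ • p.2)
  unfold scaledPotential
  linarith

/-- The map `f ↦ (f ∘ σ) (η ∘ p_v)`, where `σ (x, v) = x + v` and `p_v (x, v) = v`. -/
def shearCutoff {d : ℕ} (Ω : Set (E d)) (η : testFunctions (univ : Set (E d))) :
    testFunctions Ω →ₗ[ℝ] testFunctions (univ : Set (E d × E d)) where
  toFun f := ⟨fun p => f.1 (p.1 + p.2) * η.1 p.2, by
    refine ⟨(f.2.1.comp (contDiff_fst.add contDiff_snd)).mul (η.2.1.comp contDiff_snd), ?_,
      subset_univ _⟩
    refine HasCompactSupport.intro (K := (fun q : E d × E d => (q.1 - q.2, q.2)) ''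
      (tsupport f.1 ×ˢ tsupport η.1))
      ((f.2.2.1.isCompact.prod η.2.2.1.isCompact).image (by fun_prop)) fun p hp => ?_
    by_contra hne
    obtain ⟨h1, h2⟩ := mul_ne_zero_iff.1 hne
    exact hp ⟨(p.1 + p.2, p.2), ⟨subset_tsupport _ h1, subset_tsupport _ h2⟩, by simp⟩⟩
  map_add' f g := by
    ext p
    exact add_mul _ _ _
  map_smul' c f := by
    ext p
    exact mul_assoc _ _ _

/-- The map `Ψ_ε : C_c^∞({Φ₁ < ∞}) → L²(μ_ε)`, `f ↦ (f ∘ σ) (η_ε ∘ p_v)`. -/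
def comparisonMap {d : ℕ} {Φ₁ : E d → EReal} {G₁ : E d → E d} {Φ₂ : E d → ℝ} {G₂ : E d → E d}
    {H₂ : Fin d → E d → ℝ} (h₁ : PositionAssumptions Φ₁ G₁) (h₂ : VelocityAssumptions Φ₂ G₂ H₂)
    (η : ℝ → testFunctions (univ : Set (E d))) (ε : ℝ) :
    testFunctions (finiteSet Φ₁) →ₗ[ℝ] Lp ℝ 2 (phaseMeasure Φ₁ (scaledPotential Φ₂ ε)) :=
  (toL2 univ _ (phase_finiteOnCompacts h₁ h₂ ε)).comp (shearCutoff (finiteSet Φ₁) (η ε))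

/-- The inclusion of `C_c^∞({Φ₁ < ∞})` into `L²(μ_{Φ₁})`. -/
def inclusionMap {d : ℕ} {Φ₁ : E d → EReal} {G₁ : E d → E d} (h₁ : PositionAssumptions Φ₁ G₁) :
    testFunctions (finiteSet Φ₁) →ₗ[ℝ] Lp ℝ 2 (gibbs Φ₁) :=
  toL2 (finiteSet Φ₁) (gibbs Φ₁) h₁.finiteOnCompacts

end Overdamped

end

/-! The measure `μ_ε` is the product of `μ_{Φ₁}` with the image of the probability measure `μ_{Φ₂}`
under `v ↦ ε v`, so it concentrates at `v = 0`. The limit rests on a cancellation: on functions `f(x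
+ v)` the drifts `-∇Φ₂^ε·∇_v` and `∇Φ₂^ε·∇_x`, singular as `ε → 0`, annihilate each other. What
remains is `Δf(x + v) - ∇Φ₁(x)·∇f(x + v)`, multiplied by the cut-off, plus cut-off terms of norm
`O(ε)` (`hamiltonOp_shear`, `tendsto_norm_cutoffRemainder`). After the substitution `v ↦ ε v`,
dominated convergence yields the convergence of the Hilbert spaces and of the generators on the
comparison functions (`tendsto_norm_cutoff_mul_shear`).

The semigroups then converge by a Trotter–Kato theorem on varying spaces
(`strongConverges_semigroup`), proved without resolvents. A polygon whose slopes nearly agree with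
the generator at both ends of each segment stays close to the orbit (`norm_steps_le`), and a polygon
for the limit with vertices in the core is carried by the comparison maps to such a polygon for
small `ε`. This requires the comparison functions to lie in the domain of the generator, although
their supports may reach `{Φ₁ = ∞}`. They do: since `∇Φ₁ ∈ L²(μ_{Φ₁})`, cut-offs that are functions
of the density `e^{-Φ₁}` have vanishing energy (`exists_cutoff_seq`,
`mem_of_isClosed_of_testFunctions`).

The semigroup for fixed `ε` comes from Lumer–Phillips in `L¹`. Dissipativity follows from the
invariance of `μ_ε` and the convexity of `√(s² + κ²) - κ`. The limit `κ → 0` gives the `L¹`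
estimate; after multiplication by `κ`, the limit `κ → ∞` gives the `L²` estimate. Hence `L²` balls
are invariant under the resolvents and the `L¹` semigroup extends to `L²` (`exists_semigroup_L2`).

The range condition is the hard part. By Hahn–Banach one must show that a functional `ℓ` on `L¹`
with `r ℓ(f) = ℓ(L f)` for all test functions vanishes once `r` is large. Such an `ℓ` is the same as
a bounded operator `T` from `L¹(μ_{Φ₁})` to `L²` of the velocities, `⟪T p, k⟫ = ℓ(p ⊗ k)`. For fixed
`p`, the vector `T p` solves an elliptic equation in `v` very weakly. Essential self-adjointness
upgrades it to a solution of finite energy, and the growth condition on `ΔΦ₂` makes `∇Φ₂ T p` square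
integrable (`exists_energy_identity`, `exists_relative_bound`).

Let `p` be a mollifier centred at `y` and freeze `∇Φ₁` at `y`. The energy identity becomes a local
inequality for `‖T p‖²` containing `½ ∑ (∂ᵢΦ₁ qᵢ + ∂ᵢ qᵢ)`, with a flux `q` quadratic in `T p`, and
a commutator (`local_inequality`). The velocity energy absorbs one factor of the commutator, so only
the local `L²` oscillation of `∇Φ₁` enters, which tends to zero. With `ρ = e^{-Φ₁}` one has `∂ᵢΦ₁ qᵢ
+ ∂ᵢ qᵢ = ρ ∂ᵢ(qᵢ/ρ)`; multiplying by `ζ/ρ` and integrating moves the derivative onto `ζ`. A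
polynomially decaying `ζ` satisfies `|∂ᵢζ| ≤ (d + 1) ζ`, so this term is absorbed for large `r` even
if `ρ` is not integrable. The truncations of `1/ρ` near `ρ = 0` and of `ζ` at infinity contribute
vanishing errors. Thus `T = 0`, and `ℓ = 0`. -/

noncomputable section

namespace Overdamped

/-! ### Contraction semigroups, their generators and polygonal approximation of orbits -/

section SemigroupTheory

variable {X : Type*} [NormedAddCommGroup X] [NormedSpace ℝ X] {T : ℝ≥0 → X →L[ℝ] X}

namespace IsContractionSemigroup

theorem norm_apply_le (hT : IsContractionSemigroup T) (t : ℝ≥0) (x : X) : ‖T t x‖ ≤ ‖x‖ := by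
  simpa using (T t).le_of_opNorm_le (hT.norm_le_one t) x

theorem apply_add (hT : IsContractionSemigroup T) (s t : ℝ≥0) (x : X) :
    T (s + t) x = T s (T t x) := by
  rw [hT.map_add]; rfl

theorem apply_zero (hT : IsContractionSemigroup T) (x : X) : T 0 x = x := by
  rw [hT.map_zero]; rfl

theorem continuous_toNNReal (hT : IsContractionSemigroup T) (x : X) :
    Continuous fun s : ℝ => T s.toNNReal x :=
  (hT.continuous x).comp continuous_real_toNNReal

theorem generatorGraph_add {p q : X × X} (hp : p ∈ generatorGraph T) (hq : q ∈ generatorGraph T) :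
    p + q ∈ generatorGraph T := by
  have := Tendsto.add (show Tendsto _ _ _ from hp) (show Tendsto _ _ _ from hq)
  refine this.congr fun t => ?_
  simp only [Prod.fst_add, _root_.map_add, ← smul_add]
  congr 1; abel

theorem generatorGraph_smul {p : X × X} (c : ℝ) (hp : p ∈ generatorGraph T) :
    c • p ∈ generatorGraph T := by
  have := Tendsto.const_smul (show Tendsto _ _ _ from hp) c
  refine this.congr fun t => ?_
  simp only [Prod.smul_fst, map_smul, ← smul_sub]
  rw [smul_comm]

theorem generatorGraph_map (hT : IsContractionSemigroup T) {x y : X}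
    (h : (x, y) ∈ generatorGraph T) (s : ℝ≥0) : (T s x, T s y) ∈ generatorGraph T := by
  have := ((T s).continuous.tendsto y).comp (show Tendsto _ _ _ from h)
  refine this.congr fun t => ?_
  simp only [Function.comp, map_smul, map_sub]
  rw [← hT.apply_add, ← hT.apply_add, add_comm]

/-- The generator is a right derivative at time zero, and the semigroup law transports it to every
later time. Only right derivatives are obtained, and only these are used. -/
theorem hasDerivWithinAt (hT : IsContractionSemigroup T) {x y : X}
    (h : (x, y) ∈ generatorGraph T) {s : ℝ} (hs : 0 ≤ s) :
    HasDerivWithinAt (fun r : ℝ => T r.toNNReal x) (T s.toNNReal y) (Ici s) s := by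
  rw [hasDerivWithinAt_iff_tendsto_slope, Ici_sdiff_left]
  have h' : Tendsto _ _ _ := hT.generatorGraph_map h s.toNNReal
  have hmap : Tendsto (fun r : ℝ => (r - s).toNNReal) (𝓝[>] s) (𝓝[>] 0) := by
    refine tendsto_nhdsWithin_iff.2 ⟨?_, ?_⟩
    · have : Continuous fun r : ℝ => (r - s).toNNReal := by fun_prop
      simpa using (this.tendsto s).mono_left nhdsWithin_le_nhds
    · filter_upwards [self_mem_nhdsWithin] with r hr
      simpa using hr
  refine (h'.comp hmap).congr' ?_
  filter_upwards [self_mem_nhdsWithin] with r (hr : s < r)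
  have h1 : r.toNNReal = (r - s).toNNReal + s.toNNReal := by
    rw [← Real.toNNReal_add (by linarith) hs]; simp
  simp only [Function.comp, slope, vsub_eq_sub]
  rw [h1, hT.apply_add, Real.coe_toNNReal _ (by linarith)]

theorem sub_eq_integral [CompleteSpace X] (hT : IsContractionSemigroup T) {x y : X}
    (h : (x, y) ∈ generatorGraph T) (t : ℝ≥0) :
    T t x - x = ∫ s in (0 : ℝ)..t, T s.toNNReal y := by
  rw [intervalIntegral.integral_eq_sub_of_hasDeriv_right
    (hT.continuous_toNNReal x).continuousOn (fun s hs => ?_)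
    ((hT.continuous_toNNReal y).intervalIntegrable _ _)]
  · simp [hT.apply_zero]
  · have : 0 ≤ s := by
      have := hs.1.le
      simp at this
      exact this
    exact (hT.hasDerivWithinAt h this).mono Ioi_subset_Ici_self

/-- Turns membership in the graph, a limit, into an integral identity, which is stable under
convergence of the pair. -/
theorem mem_generatorGraph_of_integral [CompleteSpace X] (hT : IsContractionSemigroup T) {x y : X}
    (h : ∀ t : ℝ≥0, T t x - x = ∫ s in (0 : ℝ)..t, T s.toNNReal y) :
    (x, y) ∈ generatorGraph T := by
  have hd : HasDerivAt (fun u : ℝ => ∫ s in (0 : ℝ)..u, T s.toNNReal y) (T (0 : ℝ).toNNReal y) 0 :=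
    intervalIntegral.integral_hasDerivAt_right ((hT.continuous_toNNReal y).intervalIntegrable _ _)
      ((hT.continuous_toNNReal y).stronglyMeasurableAtFilter _ _)
      (hT.continuous_toNNReal y).continuousAt
  rw [Real.toNNReal_zero, hT.apply_zero] at hd
  have hs := hasDerivAt_iff_tendsto_slope.1 hd
  have hmap : Tendsto (fun t : ℝ≥0 => (t : ℝ)) (𝓝[>] 0) (𝓝[≠] 0) := by
    refine tendsto_nhdsWithin_iff.2 ⟨?_, ?_⟩
    · exact (NNReal.continuous_coe.tendsto 0).mono_left nhdsWithin_le_nhds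
    · filter_upwards [self_mem_nhdsWithin] with r (hr : 0 < r)
      simpa using hr.ne'
  refine (hs.comp hmap).congr fun t => ?_
  simp [slope, h]

theorem norm_integral_le (hT : IsContractionSemigroup T) (t : ℝ≥0) (y : X) :
    ‖∫ s in (0 : ℝ)..t, T s.toNNReal y‖ ≤ t * ‖y‖ := by
  have := intervalIntegral.norm_integral_le_of_norm_le_const (a := 0) (b := (t : ℝ))
    (f := fun s : ℝ => T s.toNNReal y) (C := ‖y‖) fun s _ => hT.norm_apply_le _ _
  simpa [mul_comm] using this

/-- Both sides of the integral identity depend continuously on the pair, because the integrals are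
bounded by `t` times the norm. -/
theorem isClosed_generatorGraph [CompleteSpace X] (hT : IsContractionSemigroup T) :
    IsClosed (generatorGraph T) := by
  refine isClosed_of_closure_subset fun p hp => hT.mem_generatorGraph_of_integral fun t => ?_
  obtain ⟨q, hq, hlim⟩ := mem_closure_iff_seq_limit.1 hp
  have h1 : Tendsto (fun n => T t (q n).1 - (q n).1) atTop (𝓝 (T t p.1 - p.1)) :=
    (((T t).continuous.tendsto _).comp ((continuous_fst.tendsto p).comp hlim)).sub
      ((continuous_fst.tendsto p).comp hlim)
  refine tendsto_nhds_unique h1 ?_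
  have h2 : Tendsto (fun n => ‖(q n).2 - p.2‖) atTop (𝓝 0) :=
    tendsto_iff_norm_sub_tendsto_zero.1 ((continuous_snd.tendsto p).comp hlim)
  rw [tendsto_iff_norm_sub_tendsto_zero]
  refine squeeze_zero (fun _ => norm_nonneg _) (fun n => ?_) (by simpa using h2.const_mul (t : ℝ))
  rw [hT.sub_eq_integral (show ((q n).1, (q n).2) ∈ _ from hq n), ← intervalIntegral.integral_sub
    ((hT.continuous_toNNReal _).intervalIntegrable _ _)
    ((hT.continuous_toNNReal _).intervalIntegrable _ _)]
  simp only [← map_sub]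
  exact hT.norm_integral_le t _

/-- With the generator replaced by a difference quotient the right-hand vector is `(1 + c) x - c T_t
x`, whose norm is at least `(1 + c)‖x‖ - c‖x‖`. -/
theorem norm_le_norm_sub_smul (hT : IsContractionSemigroup T) {x y : X}
    (h : (x, y) ∈ generatorGraph T) {r : ℝ} (hr : 0 ≤ r) : ‖x‖ ≤ ‖x - r • y‖ := by
  have h1 : Tendsto (fun t : ℝ≥0 => ‖x - r • ((t : ℝ)⁻¹ • (T t x - x))‖) (𝓝[>] 0)
      (𝓝 ‖x - r • y‖) := ((Tendsto.const_smul (show Tendsto _ _ _ from h) r).const_sub x).norm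
  refine ge_of_tendsto h1 ?_
  filter_upwards [self_mem_nhdsWithin] with t (ht : 0 < t)
  have ht' : (0 : ℝ) < t := ht
  set c : ℝ := r * (t : ℝ)⁻¹ with hc
  have hc0 : 0 ≤ c := by positivity
  have e : x - r • ((t : ℝ)⁻¹ • (T t x - x)) = (1 + c) • x - c • T t x := by
    rw [smul_smul, ← hc]; module
  rw [e]
  have h2 := norm_sub_norm_le ((1 + c) • x) (c • T t x)
  rw [norm_smul, norm_smul, Real.norm_of_nonneg hc0, Real.norm_of_nonneg (by linarith)] at h2
  have := mul_le_mul_of_nonneg_left (hT.norm_apply_le t x) hc0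
  linarith

/-- One step of a piecewise linear approximation of an orbit. -/
theorem norm_step_le (hT : IsContractionSemigroup T) {h : ℝ≥0} (hh : 0 < h) {w a w' a' : X} {C : ℝ}
    (hw : (w, a) ∈ generatorGraph T) (hw' : (w', a') ∈ generatorGraph T)
    (h₁ : ‖(h : ℝ)⁻¹ • (w' - w) - a‖ ≤ C) (h₂ : ‖(h : ℝ)⁻¹ • (w' - w) - a'‖ ≤ C) :
    ‖T h w - w'‖ ≤ h * C := by
  have hh' : (0 : ℝ) < h := hh
  set D := (h : ℝ)⁻¹ • (w' - w) with hD
  have hDg : (D, (h : ℝ)⁻¹ • (a' - a)) ∈ generatorGraph T := by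
    have := generatorGraph_smul (h : ℝ)⁻¹ (generatorGraph_add hw' (generatorGraph_smul (-1) hw))
    simpa [← sub_eq_add_neg] using this
  -- The curve `r ↦ T_r (w' - r D)` runs from `w'` at `r = 0` to `T_h w` at `r = h`, so bounding its
  -- speed by `C` suffices.
  have key := norm_image_sub_le_of_norm_deriv_right_le_segment (a := 0) (b := (h : ℝ)) (C := C)
    (f := fun r : ℝ => T r.toNNReal w' - r • T r.toNNReal D)
    (f' := fun r : ℝ => T r.toNNReal a' - (r • T r.toNNReal ((h : ℝ)⁻¹ • (a' - a)) +
      (1 : ℝ) • T r.toNNReal D))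
    ((hT.continuous_toNNReal _).sub (continuous_id.smul (hT.continuous_toNNReal _))).continuousOn
    (fun r hr => (hT.hasDerivWithinAt hw' hr.1).sub
      ((hasDerivWithinAt_id r _).smul (hT.hasDerivWithinAt hDg hr.1)))
    (fun r hr => ?_) h ⟨hh'.le, le_rfl⟩
  · simp only [Real.toNNReal_coe, Real.toNNReal_zero, zero_smul, sub_zero, hT.apply_zero] at key
    have e : T h w' - (h : ℝ) • T h D = T h w := by
      rw [← map_smul, ← map_sub, hD, smul_inv_smul₀ hh'.ne']; congr 1; abel
    rw [e] at key
    linarith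
  -- As `D` has generator image `(a' - a) / h`, the velocity is minus `T_r` of a convex combination
  -- of the two defects `D - a` and `D - a'`.
  · have e : T r.toNNReal a' - (r • T r.toNNReal ((h : ℝ)⁻¹ • (a' - a)) +
        (1 : ℝ) • T r.toNNReal D) =
        -T r.toNNReal ((r / h) • (D - a) + (1 - r / h) • (D - a')) := by
      rw [← map_smul, ← map_smul, ← _root_.map_add, ← map_sub, ← map_neg]
      congr 1
      rw [div_eq_mul_inv]
      module
    have hr1 : r / h ≤ 1 := (div_le_one hh').2 hr.2.le
    have hr0 : 0 ≤ r / h := div_nonneg hr.1 hh'.le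
    rw [e, norm_neg]
    refine (hT.norm_apply_le _ _).trans ((norm_add_le _ _).trans ?_)
    rw [norm_smul, norm_smul, Real.norm_of_nonneg hr0, Real.norm_of_nonneg (by linarith)]
    nlinarith

/-- A piecewise linear approximation of an orbit. -/
theorem norm_steps_le (hT : IsContractionSemigroup T) {h : ℝ≥0} (hh : 0 < h) {w a : ℕ → X}
    {C : ℕ → ℝ} (n : ℕ) (hw : ∀ k ≤ n, (w k, a k) ∈ generatorGraph T)
    (h₁ : ∀ k < n, ‖(h : ℝ)⁻¹ • (w (k + 1) - w k) - a k‖ ≤ C k)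
    (h₂ : ∀ k < n, ‖(h : ℝ)⁻¹ • (w (k + 1) - w k) - a (k + 1)‖ ≤ C k) :
    ‖T (n * h) (w 0) - w n‖ ≤ h * ∑ k ∈ Finset.range n, C k := by
  induction n with
  | zero => simp [hT.apply_zero]
  | succ n ih =>
    have ih := ih (fun k hk => hw k (by omega)) (fun k hk => h₁ k (by omega))
      (fun k hk => h₂ k (by omega))
    have h3 := hT.norm_step_le hh (hw n (by omega)) (hw (n + 1) le_rfl) (h₁ n (by omega))
      (h₂ n (by omega))
    have e : T ((n + 1 : ℕ) * h) (w 0) - w (n + 1) =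
        T h (T (n * h) (w 0) - w n) + (T h (w n) - w (n + 1)) := by
      rw [map_sub, ← hT.apply_add]
      have : ((n + 1 : ℕ) : ℝ≥0) * h = h + n * h := by push_cast; ring
      rw [this]; abel
    rw [e, Finset.sum_range_succ, mul_add]
    exact (norm_add_le _ _).trans (add_le_add ((hT.norm_apply_le _ _).trans ih) h3)

/-- The defects of the first segment are small for a fine mesh, and the `k`-th segment is its image
under the contraction `T_{k t/n}`, so one mesh serves all `k`. The case `t = 0` is set apart because
the mesh is then zero. -/
theorem exists_step (hT : IsContractionSemigroup T) {x y : X} (h : (x, y) ∈ generatorGraph T)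
    (t : ℝ≥0) {r : ℝ} (hr : 0 < r) : ∃ n : ℕ, 0 < n ∧ ∀ k : ℕ,
      ‖((t / n : ℝ≥0) : ℝ)⁻¹ • (T ((k + 1 : ℕ) * (t / n)) x - T (k * (t / n)) x) -
        T (k * (t / n)) y‖ ≤ r ∧
      ‖((t / n : ℝ≥0) : ℝ)⁻¹ • (T ((k + 1 : ℕ) * (t / n)) x - T (k * (t / n)) x) -
        T ((k + 1 : ℕ) * (t / n)) y‖ ≤ r ∨ t = 0 := by
  rcases eq_or_ne t 0 with ht | ht
  · exact ⟨1, one_pos, fun _ => Or.inr ht⟩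
  have hmap : Tendsto (fun n : ℕ => t / n) atTop (𝓝[>] (0 : ℝ≥0)) := by
    refine tendsto_nhdsWithin_iff.2 ⟨?_, ?_⟩
    · have : Tendsto (fun n : ℕ => t * (n : ℝ≥0)⁻¹) atTop (𝓝 (t * 0)) :=
        (tendsto_inv_atTop_nhds_zero_nat (𝕜 := ℝ≥0)).const_mul t
      simpa [div_eq_mul_inv] using this
    · filter_upwards [eventually_gt_atTop 0] with n hn
      exact div_pos (pos_iff_ne_zero.2 ht) (by exact_mod_cast hn)
  have h1 : Tendsto (fun s : ℝ≥0 => ‖(s : ℝ)⁻¹ • (T s x - x) - y‖) (𝓝[>] 0) (𝓝 0) :=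
    tendsto_iff_norm_sub_tendsto_zero.1 h
  have h2 : Tendsto (fun s : ℝ≥0 => ‖(s : ℝ)⁻¹ • (T s x - x) - T s y‖) (𝓝[>] 0) (𝓝 0) := by
    have hc : Tendsto (fun s => T s y) (𝓝[>] 0) (𝓝 y) := by
      simpa [hT.apply_zero] using ((hT.continuous y).tendsto 0).mono_left nhdsWithin_le_nhds
    simpa using (Tendsto.sub (show Tendsto _ _ _ from h) hc).norm
  obtain ⟨n, hn, h3, h4⟩ := ((eventually_gt_atTop 0).and
    ((hmap.eventually (h1.eventually (gt_mem_nhds hr))).and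
      (hmap.eventually (h2.eventually (gt_mem_nhds hr))))).exists
  refine ⟨n, hn, fun k => Or.inl ?_⟩
  set s := t / n
  have e : T ((k + 1 : ℕ) * s) = (T (k * s)).comp (T s) := by
    rw [← hT.map_add]; congr 1; push_cast; ring
  rw [e]
  simp only [ContinuousLinearMap.comp_apply, ← map_sub, ← map_smul]
  exact ⟨(hT.norm_apply_le _ _).trans h3.le, (hT.norm_apply_le _ _).trans h4.le⟩

end IsContractionSemigroup

/-- Contraction semigroups with dense generator domain are determined by their generators. -/
theorem IsContractionSemigroup.eq_of_generatorGraph_eq {S : ℝ≥0 → X →L[ℝ] X}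
    (hS : IsContractionSemigroup S) (hT : IsContractionSemigroup T)
    (hg : generatorGraph S = generatorGraph T) (hd : Dense (Prod.fst '' generatorGraph T)) :
    S = T := by
  funext t
  refine ContinuousLinearMap.ext fun x => ?_
  refine congrFun (Continuous.ext_on hd (S t).continuous (T t).continuous ?_) x
  rintro _ ⟨⟨x, y⟩, hxy, rfl⟩
  rw [← sub_eq_zero, ← norm_eq_zero]
  refine le_antisymm (le_of_forall_pos_le_add fun r hr => ?_) (norm_nonneg _)
  rcases eq_or_ne t 0 with ht | ht
  · simp [ht, hS.apply_zero, hT.apply_zero, hr.le]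
  have ht0 : 0 < t := pos_iff_ne_zero.2 ht
  obtain ⟨n, hn, h⟩ := hT.exists_step hxy t (div_pos hr (NNReal.coe_pos.2 ht0))
  have hn' : (0 : ℝ≥0) < n := by exact_mod_cast hn
  -- The orbit of `T`, sampled on a fine mesh, is itself a good polygon for `S`, since the
  -- generators agree.
  have key := hS.norm_steps_le (h := t / n) (div_pos ht0 hn') (w := fun k => T (k * (t / n)) x)
    (a := fun k => T (k * (t / n)) y) (C := fun _ => r / t) n
    (fun k _ => hg ▸ hT.generatorGraph_map hxy _)
    (fun k _ => ((h k).resolve_right ht).1) (fun k _ => ((h k).resolve_right ht).2)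
  have e : (n : ℝ≥0) * (t / n) = t := by field_simp
  simp only [e, Nat.cast_zero, zero_mul, hT.apply_zero] at key
  refine key.trans (le_of_eq ?_)
  have : (t : ℝ) ≠ 0 := by exact_mod_cast ht
  have : (n : ℝ) ≠ 0 := by positivity
  simp
  field_simp

end SemigroupTheory

/-! ### Resolvents, Yosida approximation and the Lumer–Phillips theorem -/

section LumerPhillips

variable {X : Type*} [NormedAddCommGroup X] [NormedSpace ℝ X]

theorem cauchySeq_of_dense {B : ℕ → X →L[ℝ] X} (hB : ∀ n x, ‖B n x‖ ≤ ‖x‖) {D : Set X}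
    (hD : Dense D) (h : ∀ x ∈ D, CauchySeq fun n => B n x) (x : X) : CauchySeq fun n => B n x := by
  rw [Metric.cauchySeq_iff']
  intro r hr
  obtain ⟨y, hy, hxy⟩ := hD.exists_dist_lt x (div_pos hr three_pos)
  obtain ⟨N, hN⟩ := Metric.cauchySeq_iff'.1 (h y hy) (r / 3) (div_pos hr three_pos)
  refine ⟨N, fun n hn => ?_⟩
  have h1 := hN n hn
  rw [dist_eq_norm] at hxy h1 ⊢
  have e : B n x - B N x = B n (x - y) + (B n y - B N y) - B N (x - y) := by
    simp only [map_sub]; abel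
  rw [e]
  have h2 := norm_sub_le (B n (x - y) + (B n y - B N y)) (B N (x - y))
  have h3 := norm_add_le (B n (x - y)) (B n y - B N y)
  linarith [hB n (x - y), hB N (x - y)]

theorem tendsto_zero_of_dense {B : ℕ → X →L[ℝ] X} {C : ℝ} (hB : ∀ n x, ‖B n x‖ ≤ C * ‖x‖)
    {D : Set X} (hD : Dense D) (h : ∀ x ∈ D, Tendsto (fun n => B n x) atTop (𝓝 0)) (x : X) :
    Tendsto (fun n => B n x) atTop (𝓝 0) := by
  rw [Metric.tendsto_atTop]
  intro r hr
  have hC : 0 < |C| + 1 := by positivity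
  obtain ⟨y, hy, hxy⟩ := hD.exists_dist_lt x (div_pos (half_pos hr) hC)
  obtain ⟨N, hN⟩ := Metric.tendsto_atTop.1 (h y hy) (r / 2) (half_pos hr)
  refine ⟨N, fun n hn => ?_⟩
  have h1 := hN n hn
  rw [dist_eq_norm] at hxy
  rw [dist_zero_right] at h1 ⊢
  have e : B n x = B n (x - y) + B n y := by
    simp only [map_sub]; abel
  rw [e]
  have h2 := norm_add_le (B n (x - y)) (B n y)
  have h3 : ‖B n (x - y)‖ ≤ (|C| + 1) * ‖x - y‖ :=
    (hB n _).trans (mul_le_mul_of_nonneg_right (by linarith [le_abs_self C]) (norm_nonneg _))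
  have h4 : (|C| + 1) * ‖x - y‖ < r / 2 := by
    rw [lt_div_iff₀ hC] at hxy; linarith
  linarith

/-- `J` is the resolvent `(1 - h A)⁻¹` of the operator `A` with graph `G`. -/
structure IsResolventAt (G : Submodule ℝ (X × X)) (h : ℝ) (J : X →L[ℝ] X) : Prop where
  norm_le : ∀ x, ‖J x‖ ≤ ‖x‖
  mem : ∀ z, (J z, h⁻¹ • (J z - z)) ∈ G
  left_inv : ∀ p ∈ G, J (p.1 - h • p.2) = p.1

/-- Dissipativity bounds the graph norm of `p` by a multiple of `‖p.1 - h • p.2‖`. On the complete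
space `G` the map `1 - h A` is therefore injective with closed range, and density of the range makes
it bijective. -/
theorem exists_isResolventAt [CompleteSpace X] {G : Submodule ℝ (X × X)}
    (hG : IsClosed (G : Set (X × X))) {h : ℝ} (hh : 0 < h)
    (hdiss : ∀ p ∈ G, ‖p.1‖ ≤ ‖p.1 - h • p.2‖)
    (hrange : Dense ((fun p : X × X => p.1 - h • p.2) '' G)) :
    ∃ J, IsResolventAt G h J := by
  let F : G →ₗ[ℝ] X := (LinearMap.fst ℝ X X - h • LinearMap.snd ℝ X X).comp G.subtype
  have hF : ∀ p : G, F p = p.1.1 - h • p.1.2 := fun p => rfl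
  have hbound : ∀ p : G, ‖p‖ ≤ max 1 (2 * h⁻¹) * ‖F p‖ := by
    intro p
    have h1 := hdiss p.1 p.2
    rw [← hF] at h1
    have h2 : ‖h • p.1.2‖ ≤ 2 * ‖F p‖ := by
      have e : h • p.1.2 = p.1.1 - F p := by rw [hF]; abel
      rw [e]
      exact (norm_sub_le _ _).trans (by linarith)
    rw [norm_smul, Real.norm_of_nonneg hh.le] at h2
    have h3 : ‖p.1.2‖ ≤ 2 * h⁻¹ * ‖F p‖ := by
      have := mul_le_mul_of_nonneg_left h2 (inv_nonneg.2 hh.le)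
      rw [inv_mul_cancel_left₀ hh.ne'] at this
      linarith
    change max ‖p.1.1‖ ‖p.1.2‖ ≤ _
    refine max_le (h1.trans ?_) (h3.trans ?_)
    · exact le_mul_of_one_le_left (norm_nonneg _) (le_max_left _ _)
    · exact mul_le_mul_of_nonneg_right (le_max_right _ _) (norm_nonneg _)
  have hinj : Function.Injective F := by
    rw [← LinearMap.ker_eq_bot, LinearMap.ker_eq_bot']
    intro p hp
    have := hbound p
    rw [hp, norm_zero, mul_zero] at this
    exact norm_le_zero_iff.1 this
  have : CompleteSpace G := hG.completeSpace_coe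
  have hanti : AntilipschitzWith (max 1 (2 * h⁻¹)).toNNReal F := by
    refine AddMonoidHomClass.antilipschitz_of_bound F fun p => ?_
    rw [Real.coe_toNNReal _ (le_trans zero_le_one (le_max_left _ _))]
    exact hbound p
  have hcont : Continuous F := by
    change Continuous fun p : G => p.1.1 - h • p.1.2
    fun_prop
  have hclosed : IsClosed (Set.range F) :=
    hanti.isClosed_range (uniformContinuous_addMonoidHom_of_continuous (f := F.toAddMonoidHom) hcont)
  have hsurj : Function.Surjective F := by
    rw [← Set.range_eq_univ, ← hclosed.closure_eq]
    refine Dense.closure_eq (hrange.mono ?_)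
    rintro _ ⟨p, hp, rfl⟩
    exact ⟨⟨p, hp⟩, rfl⟩
  let e := LinearEquiv.ofBijective F ⟨hinj, hsurj⟩
  have he : ∀ z, (e.symm z).1.1 - h • (e.symm z).1.2 = z := fun z => e.apply_symm_apply z
  let J₀ : X →ₗ[ℝ] X := (LinearMap.fst ℝ X X).comp (G.subtype.comp e.symm.toLinearMap)
  have hJ₀ : ∀ z, J₀ z = (e.symm z).1.1 := fun z => rfl
  have hJn : ∀ z, ‖J₀ z‖ ≤ 1 * ‖z‖ := fun z => by
    rw [hJ₀, one_mul]
    refine (hdiss _ (e.symm z).2).trans (le_of_eq ?_)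
    rw [he]
  refine ⟨J₀.mkContinuous 1 hJn, fun x => by simpa using hJn x, fun z => ?_, fun p hp => ?_⟩
  · have h1 : h⁻¹ • (J₀ z - z) = (e.symm z).1.2 := by
      have h2 : J₀ z - z = h • (e.symm z).1.2 := by
        nth_rw 2 [← he z]
        rw [hJ₀]; abel
      rw [h2, inv_smul_smul₀ hh.ne']
    change (J₀ z, h⁻¹ • (J₀ z - z)) ∈ G
    rw [h1]
    exact (e.symm z).2
  · change (e.symm (p.1 - h • p.2)).1.1 = p.1
    have : e.symm (p.1 - h • p.2) = ⟨p, hp⟩ := (LinearEquiv.symm_apply_eq _).2 rfl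
    rw [this]

namespace IsResolventAt

variable {G : Submodule ℝ (X × X)} {h k : ℝ} {J J' : X →L[ℝ] X}

theorem apply_snd (hJ : IsResolventAt G h J) (hh : 0 < h) {p : X × X} (hp : p ∈ G) :
    J p.2 = h⁻¹ • (J p.1 - p.1) := by
  have h1 := hJ.left_inv p hp
  rw [map_sub, map_smul] at h1
  nth_rw 2 [← h1]
  rw [sub_sub_cancel, inv_smul_smul₀ hh.ne']

/-- A resolvent maps the graph into itself, so applying `J` to the resolvent equation of `J' z`
produces the resolvent equation whose unique solution is `J' (J z)`. -/
theorem commute (hJ : IsResolventAt G h J) (hJ' : IsResolventAt G k J') (hh : 0 < h)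
    (hk : 0 < k) : Commute J J' := by
  refine ContinuousLinearMap.ext fun z => ?_
  change J (J' z) = J' (J z)
  have h1 := hJ'.mem z
  have h2 := hJ.mem (J' z)
  rw [← hJ.apply_snd hh h1] at h2
  have h3 := hJ'.left_inv _ h2
  simp only [← map_smul, ← map_sub] at h3
  rw [smul_inv_smul₀ hk.ne', sub_sub_cancel] at h3
  exact h3.symm

end IsResolventAt

/-- The semigroup generated by the Yosida approximation `h⁻¹ (J - 1)`. -/
def yosidaExp (h : ℝ) (J : X →L[ℝ] X) (t : ℝ) : X →L[ℝ] X :=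
  NormedSpace.exp (t • (h⁻¹ • (J - 1)))

section

variable [CompleteSpace X] {h k : ℝ} {J J' : X →L[ℝ] X}

theorem yosidaExp_add (s t : ℝ) : yosidaExp h J (s + t) = yosidaExp h J s * yosidaExp h J t := by
  let _ : NormedAlgebra ℚ (X →L[ℝ] X) := NormedAlgebra.restrictScalars ℚ ℝ _
  unfold yosidaExp
  rw [add_smul, NormedSpace.exp_add_of_commute]
  exact ((Commute.refl _).smul_left _).smul_right _

omit [CompleteSpace X] in
theorem yosidaExp_zero : yosidaExp h J 0 = 1 := by
  simp [yosidaExp]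

theorem hasDerivAt_yosidaExp (t : ℝ) :
    HasDerivAt (yosidaExp h J) (yosidaExp h J t * (h⁻¹ • (J - 1))) t :=
  hasDerivAt_exp_smul_const (𝕂 := ℝ) (𝔸 := X →L[ℝ] X) (h⁻¹ • (J - 1)) t

theorem hasDerivAt_yosidaExp_apply (x : X) (t : ℝ) :
    HasDerivAt (fun t => yosidaExp h J t x) (yosidaExp h J t (h⁻¹ • (J x - x))) t := by
  simpa using (hasDerivAt_yosidaExp t).clm_apply (hasDerivAt_const t x)

/-- With `c = t / h` the exponential is `e^{-c} ∑ cⁿ/n! Jⁿ`, a Poisson average of the powers of `J`.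
Its partial sums are convex combinations of points of `K` and `0`, and `K` is closed. -/
theorem yosidaExp_mem {K : Set X} (hK : IsClosed K) (hKc : Convex ℝ K) (hK0 : (0 : X) ∈ K)
    (hJ : ∀ x ∈ K, J x ∈ K) (hh : 0 < h) {t : ℝ} (ht : 0 ≤ t) {x : X} (hx : x ∈ K) :
    yosidaExp h J t x ∈ K := by
  let _ : NormedAlgebra ℚ (X →L[ℝ] X) := NormedAlgebra.restrictScalars ℚ ℝ _
  set c : ℝ := t * h⁻¹ with hc
  have hc0 : 0 ≤ c := by positivity
  have e : t • (h⁻¹ • (J - 1)) = (-c) • (1 : X →L[ℝ] X) + c • J := by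
    rw [smul_smul, ← hc]; module
  have e1 : NormedSpace.exp ((-c) • (1 : X →L[ℝ] X)) = Real.exp (-c) • (1 : X →L[ℝ] X) := by
    have := NormedSpace.algebraMap_exp_comm (𝕂 := ℝ) (𝔸 := X →L[ℝ] X) (-c)
    rw [Algebra.algebraMap_eq_smul_one, Algebra.algebraMap_eq_smul_one] at this
    rw [← this, Real.exp_eq_exp_ℝ]
  have e2 : yosidaExp h J t x = Real.exp (-c) • (NormedSpace.exp (c • J)) x := by
    unfold yosidaExp
    rw [e, NormedSpace.exp_add_of_commute ((Commute.one_left _).smul_left _), e1]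
    simp
  have hs : HasSum (fun n => (Real.exp (-c) * ((n.factorial : ℝ)⁻¹ * c ^ n)) • (J ^ n) x)
      (yosidaExp h J t x) := by
    have h1 := NormedSpace.exp_series_hasSum_exp' (𝕂 := ℝ) (c • J)
    have h2 := ((ContinuousLinearMap.apply ℝ X x).hasSum h1).const_smul (Real.exp (-c))
    rw [e2]
    refine h2.congr_fun fun n => ?_
    simp [smul_pow, smul_smul]
  have hpow : ∀ n, (J ^ n) x ∈ K := by
    intro n
    induction n with
    | zero => simpa using hx
    | succ n ih => rw [pow_succ']; exact hJ _ ih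
  refine hK.mem_of_tendsto hs.tendsto_sum_nat (Eventually.of_forall fun m => ?_)
  set w : ℕ → ℝ := fun n => Real.exp (-c) * ((n.factorial : ℝ)⁻¹ * c ^ n) with hw
  have hw0 : ∀ n, 0 ≤ w n := fun n => by positivity
  have hw1 : ∑ n ∈ Finset.range m, w n ≤ 1 := by
    have h1 := Real.sum_le_exp_of_nonneg hc0 m
    rw [hw, ← Finset.mul_sum]
    have h2 : ∑ i ∈ Finset.range m, (i.factorial : ℝ)⁻¹ * c ^ i =
        ∑ i ∈ Finset.range m, c ^ i / (i.factorial : ℝ) :=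
      Finset.sum_congr rfl fun i _ => by rw [div_eq_inv_mul]
    rw [h2, Real.exp_neg, inv_mul_le_iff₀ (Real.exp_pos c), mul_one]
    exact h1
  -- The weights of a partial sum add up to at most one: normalise them to get a convex combination,
  -- then shrink towards `0 ∈ K`. The degenerate case of zero total weight gives `0`.
  rcases (Finset.sum_nonneg (s := Finset.range m) fun n _ => hw0 n).eq_or_lt with h0 | h0
  · have : ∀ n ∈ Finset.range m, w n = 0 :=
      (Finset.sum_eq_zero_iff_of_nonneg fun n _ => hw0 n).1 h0.symm
    rw [Finset.sum_eq_zero fun n hn => (by change w n • _ = 0; rw [this n hn, zero_smul])]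
    exact hK0
  · have h1 := hKc.sum_mem (t := Finset.range m) (w := fun n => (∑ n ∈ Finset.range m, w n)⁻¹ * w n)
      (z := fun n => (J ^ n) x) (fun n _ => mul_nonneg (inv_nonneg.2 h0.le) (hw0 n))
      (by rw [← Finset.mul_sum, inv_mul_cancel₀ h0.ne']) (fun n _ => hpow n)
    have h2 := hKc.smul_mem_of_zero_mem hK0 h1 ⟨h0.le, hw1⟩
    rw [Finset.smul_sum] at h2
    convert h2 using 2 with n
    rw [smul_smul, mul_inv_cancel_left₀ h0.ne']

theorem norm_yosidaExp_apply_le (hJ : ∀ x, ‖J x‖ ≤ ‖x‖) (hh : 0 < h) {t : ℝ} (ht : 0 ≤ t)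
    (x : X) : ‖yosidaExp h J t x‖ ≤ ‖x‖ := by
  have := yosidaExp_mem (K := Metric.closedBall 0 ‖x‖) Metric.isClosed_closedBall
    (convex_closedBall _ _) (by simp) (fun y hy => by
      rw [mem_closedBall_zero_iff] at hy ⊢
      exact (hJ y).trans hy) hh ht (x := x) (by simp)
  simpa using this

omit [CompleteSpace X] in
theorem commute_yosidaExp (hc : Commute J J') (t : ℝ) :
    Commute J (yosidaExp k J' t) := by
  let _ : NormedAlgebra ℚ (X →L[ℝ] X) := NormedAlgebra.restrictScalars ℚ ℝ _
  refine Commute.exp_right ?_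
  refine Commute.smul_right (Commute.smul_right ?_ _) _
  exact hc.sub_right (Commute.one_right _)

/-- Duhamel: interpolate by `s ↦ exp((t - s) A') exp(s A) x`; since the approximations commute, its
derivative is two contractions applied to `A x - A' x`. -/
theorem norm_yosidaExp_sub_le (hJ : ∀ x, ‖J x‖ ≤ ‖x‖) (hJ' : ∀ x, ‖J' x‖ ≤ ‖x‖)
    (hc : Commute J J') (hh : 0 < h) (hk : 0 < k) {t : ℝ} (ht : 0 ≤ t) (x : X) :
    ‖yosidaExp h J t x - yosidaExp k J' t x‖ ≤
      t * ‖h⁻¹ • (J x - x) - k⁻¹ • (J' x - x)‖ := by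
  have hd : ∀ s, HasDerivAt (fun s => (yosidaExp k J' (t - s) * yosidaExp h J s) x)
      (yosidaExp k J' (t - s) (yosidaExp h J s (h⁻¹ • (J x - x) - k⁻¹ • (J' x - x)))) s := by
    intro s
    have h1 : HasDerivAt (fun s => yosidaExp k J' (t - s))
        (-(yosidaExp k J' (t - s) * (k⁻¹ • (J' - 1)))) s := by
      have := (hasDerivAt_yosidaExp (h := k) (J := J') (t - s)).scomp s
        ((hasDerivAt_id s).const_sub t)
      rw [neg_one_smul] at this
      exact this
    have h2 := (h1.mul (hasDerivAt_yosidaExp (h := h) (J := J) s)).clm_apply (hasDerivAt_const s x)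
    refine h2.congr_deriv ?_
    have hcom : J' (yosidaExp h J s x) = yosidaExp h J s (J' x) := by
      have := congrArg (fun B : X →L[ℝ] X => B x) (commute_yosidaExp (k := h) hc.symm s)
      exact this
    change -(yosidaExp k J' (t - s) (k⁻¹ • (J' (yosidaExp h J s x) - yosidaExp h J s x))) +
      yosidaExp k J' (t - s) (yosidaExp h J s (h⁻¹ • (J x - x))) +
      yosidaExp k J' (t - s) (yosidaExp h J s 0) = _
    rw [hcom]
    simp only [map_sub, map_smul, map_zero, smul_sub]
    abel
  have key := norm_image_sub_le_of_norm_deriv_right_le_segment (a := 0) (b := t)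
    (fun s _ => (hd s).continuousAt.continuousWithinAt) (fun s _ => (hd s).hasDerivWithinAt)
    (fun s hs => (norm_yosidaExp_apply_le hJ' hk (by linarith [hs.2]) _).trans
      (norm_yosidaExp_apply_le hJ hh hs.1 _)) t ⟨ht, le_rfl⟩
  simpa [yosidaExp_zero, mul_comm] using key

/-- The Lumer–Phillips theorem, with closed convex sets invariant under the resolvents. -/
theorem exists_isGeneratedByClosure (Γ : Submodule ℝ (X × X))
    (hdiss : ∀ p ∈ Γ, ∀ h : ℝ, 0 ≤ h → ‖p.1‖ ≤ ‖p.1 - h • p.2‖)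
    (hdense : Dense (Prod.fst '' (Γ : Set (X × X)))) {h₀ : ℝ} (hh₀ : 0 < h₀)
    (hrange : ∀ h, 0 < h → h ≤ h₀ → Dense ((fun p : X × X => p.1 - h • p.2) '' Γ)) :
    ∃ T, IsGeneratedByClosure (Γ : Set (X × X)) T ∧ ∀ K : Set X, IsClosed K → Convex ℝ K →
      (0 : X) ∈ K → (∀ h, 0 < h → h ≤ h₀ → ∀ p ∈ closure (Γ : Set (X × X)),
        p.1 - h • p.2 ∈ K → p.1 ∈ K) → ∀ t, ∀ x ∈ K, T t x ∈ K := by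
  set G := Γ.topologicalClosure with hGdef
  have hGc : (G : Set (X × X)) = closure (Γ : Set (X × X)) := Γ.topologicalClosure_coe
  have hGclosed : IsClosed (G : Set (X × X)) := Γ.isClosed_topologicalClosure
  have hΓG : Γ ≤ G := Γ.le_topologicalClosure
  have hdissG : ∀ p ∈ G, ∀ h : ℝ, 0 ≤ h → ‖p.1‖ ≤ ‖p.1 - h • p.2‖ := by
    intro p hp h hh
    have hc : IsClosed {p : X × X | ‖p.1‖ ≤ ‖p.1 - h • p.2‖} :=
      isClosed_le (by fun_prop) (by fun_prop)
    exact closure_minimal (fun q hq => hdiss q hq h hh) hc (hGc ▸ hp : p ∈ closure _)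
  have hres : ∀ n : ℕ, ∃ J, IsResolventAt G (h₀ / (n + 1)) J := fun n => by
    have hn : 0 < h₀ / (n + 1) := by positivity
    refine exists_isResolventAt hGclosed hn (fun p hp => hdissG p hp _ hn.le)
      ((hrange _ hn ?_).mono (image_mono hΓG))
    exact div_le_self hh₀.le (by linarith [(Nat.cast_nonneg n : (0 : ℝ) ≤ n)])
  choose J hJ using hres
  set η : ℕ → ℝ := fun n => h₀ / (n + 1) with hη
  have hηpos : ∀ n, 0 < η n := fun n => by positivity
  have hηle : ∀ n, η n ≤ h₀ := fun n =>
    div_le_self hh₀.le (by linarith [(Nat.cast_nonneg n : (0 : ℝ) ≤ n)])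
  have hηlim : Tendsto η atTop (𝓝 0) := by
    have := (tendsto_one_div_add_atTop_nhds_zero_nat (𝕜 := ℝ)).const_mul h₀
    simpa [hη, div_eq_mul_inv] using this
  have hD : Dense (Prod.fst '' (G : Set (X × X))) := hdense.mono (image_mono hΓG)
  -- On the domain, `J n x - x = η n • J n (A x)` has norm at most `η n ‖A x‖`; uniform bounds
  -- extend the convergence to all of `X`.
  have hJlim : ∀ y, Tendsto (fun n => J n y) atTop (𝓝 y) := by
    intro y
    have h1 := tendsto_zero_of_dense (B := fun n => J n - 1) (C := 2) (fun n x => by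
      refine (norm_sub_le _ _).trans ?_
      have := (hJ n).norm_le x
      change ‖J n x‖ + ‖x‖ ≤ _
      linarith) hD (fun x hx => by
      obtain ⟨p, hp, rfl⟩ := hx
      rw [tendsto_zero_iff_norm_tendsto_zero]
      refine squeeze_zero (fun _ => norm_nonneg _) (fun n => ?_)
        (by simpa using hηlim.mul_const ‖p.2‖)
      have h2 : (J n - 1) p.1 = η n • J n p.2 := by
        rw [(hJ n).apply_snd (hηpos n) hp, smul_inv_smul₀ (hηpos n).ne']; rfl
      rw [h2, norm_smul, Real.norm_of_nonneg (hηpos n).le]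
      exact mul_le_mul_of_nonneg_left ((hJ n).norm_le _) (hηpos n).le) y
    have h2 := h1.add_const y
    simpa using h2
  set U : ℕ → ℝ → X →L[ℝ] X := fun n t => yosidaExp (η n) (J n) t with hU
  have hUle : ∀ n t, 0 ≤ t → ∀ x, ‖U n t x‖ ≤ ‖x‖ := fun n t ht x =>
    norm_yosidaExp_apply_le (hJ n).norm_le (hηpos n) ht x
  -- On the domain the Yosida approximations of `A x` are `J n (A x)`, which converge, so the
  -- Duhamel estimate gives a Cauchy sequence.
  have hcauchy : ∀ t, 0 ≤ t → ∀ x, CauchySeq fun n => U n t x := by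
    intro t ht
    refine cauchySeq_of_dense (fun n x => hUle n t ht x) hD ?_
    rintro _ ⟨p, hp, rfl⟩
    rw [Metric.cauchySeq_iff']
    intro r hr
    obtain ⟨N, hN⟩ := Metric.cauchySeq_iff'.1 (hJlim p.2).cauchySeq (r / (t + 1)) (by positivity)
    refine ⟨N, fun n hn => ?_⟩
    have h1 := hN n hn
    rw [dist_eq_norm] at h1 ⊢
    refine (norm_yosidaExp_sub_le (hJ n).norm_le (hJ N).norm_le
      ((hJ n).commute (hJ N) (hηpos n) (hηpos N)) (hηpos n) (hηpos N) ht p.1).trans_lt ?_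
    rw [← (hJ n).apply_snd (hηpos n) hp, ← (hJ N).apply_snd (hηpos N) hp]
    rw [lt_div_iff₀ (by positivity)] at h1
    nlinarith [norm_nonneg (J n p.2 - J N p.2)]
  have hlim : ∀ (t : ℝ≥0) x, ∃ z, Tendsto (fun n => U n t x) atTop (𝓝 z) := fun t x =>
    cauchySeq_tendsto_of_complete (hcauchy t t.2 x)
  choose V hV using hlim
  have hVle : ∀ t x, ‖V t x‖ ≤ 1 * ‖x‖ := fun t x => by
    rw [one_mul]
    exact le_of_tendsto (hV t x).norm (Eventually.of_forall fun n => hUle n t t.2 x)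
  let T : ℝ≥0 → X →L[ℝ] X := fun t =>
    (linearMapOfTendsto (V t) (fun n => (U n t : X →ₗ[ℝ] X)) (l := atTop)
      (tendsto_pi_nhds.2 (hV t))).mkContinuous 1 (hVle t)
  have hT : ∀ (t : ℝ≥0) x, Tendsto (fun n => U n t x) atTop (𝓝 (T t x)) := hV
  have hTle : ∀ t x, ‖T t x‖ ≤ ‖x‖ := fun t x => (hVle t x).trans_eq (one_mul _)
  -- Orbits of domain elements are Lipschitz uniformly in `n`; this is the source of strong
  -- continuity.
  have hlip : ∀ p ∈ G, ∀ s t : ℝ≥0, ‖T t p.1 - T s p.1‖ ≤ |(t : ℝ) - s| * ‖p.2‖ := by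
    intro p hp s t
    wlog hst : s ≤ t generalizing s t
    · rw [norm_sub_rev, abs_sub_comm]
      exact this t s (le_of_not_ge hst)
    refine le_of_tendsto ((hT t p.1).sub (hT s p.1)).norm (Eventually.of_forall fun n => ?_)
    have key := norm_image_sub_le_of_norm_deriv_right_le_segment (a := (s : ℝ)) (b := (t : ℝ))
      (f := fun r => U n r p.1) (C := ‖p.2‖)
      (fun r _ => (hasDerivAt_yosidaExp_apply p.1 r).continuousAt.continuousWithinAt)
      (fun r _ => (hasDerivAt_yosidaExp_apply p.1 r).hasDerivWithinAt) (fun r hr => by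
        rw [← (hJ n).apply_snd (hηpos n) hp]
        exact (hUle n r (s.2.trans hr.1) _).trans ((hJ n).norm_le _)) t ⟨hst, le_rfl⟩
    rw [abs_of_nonneg (sub_nonneg.2 (NNReal.coe_le_coe.2 hst)), mul_comm]
    exact key
  have hTsemi : IsContractionSemigroup T := by
    refine ⟨?_, fun s t => ?_, fun t => ?_, fun x => ?_⟩
    · refine ContinuousLinearMap.ext fun x => tendsto_nhds_unique (hT 0 x) ?_
      simp [hU, yosidaExp_zero]
    · refine ContinuousLinearMap.ext fun x => tendsto_nhds_unique (hT (s + t) x) ?_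
      have h1 : ∀ n, U n (s + t : ℝ≥0) x = U n s (U n t x) := fun n => by
        rw [NNReal.coe_add]
        change yosidaExp _ _ _ x = _
        rw [yosidaExp_add]; rfl
      simp only [h1]
      have h2 : Tendsto (fun n => U n s (U n t x - T t x)) atTop (𝓝 0) := by
        refine squeeze_zero_norm (fun n => hUle n s s.2 _) ?_
        exact tendsto_iff_norm_sub_tendsto_zero.1 (hT t x)
      have h3 := h2.add (hT s (T t x))
      simpa using h3
    · exact LinearMap.mkContinuous_norm_le _ zero_le_one _
    · have hclosed : ∀ y : X, (∀ r > 0, ∃ z : X, ‖y - z‖ < r ∧ Continuous fun t => T t z) →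
          Continuous fun t => T t y := by
        intro y hy
        refine continuous_of_uniform_approx_of_continuous fun u hu => ?_
        obtain ⟨r, hr, hru⟩ := Metric.mem_uniformity_dist.1 hu
        obtain ⟨z, hz, hzc⟩ := hy r hr
        refine ⟨_, hzc, fun t => hru ?_⟩
        rw [dist_eq_norm, ← map_sub]
        exact (hTle _ _).trans_lt hz
      refine hclosed x fun r hr => ?_
      obtain ⟨z, hz, hxz⟩ := hD.exists_dist_lt x hr
      refine ⟨z, by rwa [dist_eq_norm] at hxz, ?_⟩
      obtain ⟨p, hp, rfl⟩ := hz
      refine continuous_iff_continuousAt.2 fun s => ?_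
      refine tendsto_iff_norm_sub_tendsto_zero.2 (squeeze_zero (fun _ => norm_nonneg _)
        (fun t => hlip p hp s t) ?_)
      have : Continuous fun t : ℝ≥0 => |(t : ℝ) - s| * ‖p.2‖ := by fun_prop
      simpa using this.tendsto s
  have hsub : (G : Set (X × X)) ⊆ generatorGraph T := by
    intro p hp
    refine hTsemi.mem_generatorGraph_of_integral fun t => ?_
    refine tendsto_nhds_unique ((hT t p.1).sub_const p.1) ?_
    have h1 : ∀ n, U n t p.1 - p.1 = ∫ s in (0 : ℝ)..t, U n s (J n p.2) := by
      intro n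
      have hint : Continuous fun s => U n s (J n p.2) := continuous_iff_continuousAt.2 fun s =>
        (hasDerivAt_yosidaExp_apply (J n p.2) s).continuousAt
      rw [intervalIntegral.integral_eq_sub_of_hasDerivAt (f := fun s => U n s p.1)
        (fun s _ => ?_) (hint.intervalIntegrable _ _)]
      · simp [hU, yosidaExp_zero]
      · rw [(hJ n).apply_snd (hηpos n) hp]
        exact hasDerivAt_yosidaExp_apply p.1 s
    simp only [h1]
    refine intervalIntegral.tendsto_integral_filter_of_dominated_convergence (fun _ => ‖p.2‖)
      (Eventually.of_forall fun n => ?_) (Eventually.of_forall fun n => ae_of_all _ fun s hs => ?_)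
      intervalIntegrable_const (ae_of_all _ fun s hs => ?_)
    · exact (continuous_iff_continuousAt.2 fun s =>
        (hasDerivAt_yosidaExp_apply (J n p.2) s).continuousAt).aestronglyMeasurable
    · rw [uIoc_of_le t.coe_nonneg] at hs
      exact (hUle n s hs.1.le _).trans ((hJ n).norm_le _)
    · rw [uIoc_of_le t.coe_nonneg] at hs
      have h2 : Tendsto (fun n => U n s (J n p.2 - p.2)) atTop (𝓝 0) :=
        squeeze_zero_norm (fun n => hUle n s hs.1.le _)
          (tendsto_iff_norm_sub_tendsto_zero.1 (hJlim p.2))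
      have h3 := h2.add (hT s.toNNReal p.2)
      rw [Real.coe_toNNReal _ hs.1.le] at h3
      simpa using h3
  refine ⟨T, ⟨hTsemi, ?_⟩, fun K hK hKc hK0 hKJ t x hx => ?_⟩
  · rw [← hGc]
    -- No proper extension is possible: `1 - η 0 A` is already onto when restricted to `G`, and the
    -- generator, being dissipative, makes it injective.
    refine Subset.antisymm (fun p hp => ?_) hsub
    have h1 := (hJ 0).mem (p.1 - η 0 • p.2)
    set q : X × X := (J 0 (p.1 - η 0 • p.2), (η 0)⁻¹ • (J 0 (p.1 - η 0 • p.2) -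
      (p.1 - η 0 • p.2))) with hq
    have h2 : q.1 - η 0 • q.2 = p.1 - η 0 • p.2 := by
      simp only [hq, smul_inv_smul₀ (hηpos 0).ne']; abel
    have h3 := IsContractionSemigroup.generatorGraph_add hp
      (IsContractionSemigroup.generatorGraph_smul (-1) (hsub h1))
    have h4 := hTsemi.norm_le_norm_sub_smul (x := (p + (-1 : ℝ) • q).1)
      (y := (p + (-1 : ℝ) • q).2) h3 (hηpos 0).le
    have h5 : (p + (-1 : ℝ) • q).1 - η 0 • (p + (-1 : ℝ) • q).2 =
        (p.1 - η 0 • p.2) - (q.1 - η 0 • q.2) := by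
      simp only [Prod.fst_add, Prod.snd_add, Prod.smul_fst, Prod.smul_snd]
      module
    rw [h5, h2, sub_self, norm_zero] at h4
    have h6 : p.1 = q.1 := by
      have := norm_le_zero_iff.1 h4
      simpa [← sub_eq_add_neg, sub_eq_zero] using this
    have h7 : p.2 = q.2 := by
      rw [h6, sub_right_inj] at h2
      exact (smul_right_injective X (hηpos 0).ne' h2).symm
    rw [show p = q from Prod.ext h6 h7]
    exact h1
  · refine hK.mem_of_tendsto (hT t x) (Eventually.of_forall fun n => ?_)
    refine yosidaExp_mem hK hKc hK0 (fun z hz => ?_) (hηpos n) t.2 hx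
    refine hKJ (η n) (hηpos n) (hηle n) _
      (by rw [← hGc]; exact (hJ n).mem z) ?_
    change J n z - η n • ((η n)⁻¹ • (J n z - z)) ∈ K
    rwa [smul_inv_smul₀ (hηpos n).ne', sub_sub_cancel]

end

end LumerPhillips

/-! ### Strong convergence along varying Hilbert spaces and the Trotter–Kato theorem -/

section TrotterKato

variable {I C H₀ : Type*} {H : I → Type*} [AddCommGroup C] [Module ℝ C]
  [NormedAddCommGroup H₀] [InnerProductSpace ℝ H₀]
  [∀ i, NormedAddCommGroup (H i)] [∀ i, InnerProductSpace ℝ (H i)]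
  {l : Filter I} {ι : C →ₗ[ℝ] H₀} {Ψ : ∀ i, C →ₗ[ℝ] H i} {f : ∀ i, H i} {f₀ : H₀}

theorem StrongConverges.tendsto_norm_sub (hΨ : HilbertConverges l ι Ψ)
    (h : StrongConverges l ι Ψ f f₀) (u : C) :
    Tendsto (fun i => ‖f i - Ψ i u‖) l (𝓝 ‖f₀ - ι u‖) := by
  have h1 : Tendsto (fun i => ‖f i‖ ^ 2 - 2 * ⟪f i, Ψ i u⟫ + ‖Ψ i u‖ ^ 2) l
      (𝓝 (‖f₀‖ ^ 2 - 2 * ⟪f₀, ι u⟫ + ‖ι u‖ ^ 2)) :=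
    ((h.1.pow 2).sub ((h.2 u).const_mul 2)).add ((hΨ.tendsto_norm u).pow 2)
  simp only [← norm_sub_sq_real] at h1
  have h2 := (Real.continuous_sqrt.tendsto _).comp h1
  simpa [Function.comp_def, Real.sqrt_sq (norm_nonneg _)] using h2

/-- Polarization recovers the inner products from the distances, so strong convergence can be
handled through norms alone; `u = 0` gives the convergence of norms. -/
theorem strongConverges_of_tendsto_norm_sub (hΨ : HilbertConverges l ι Ψ)
    (h : ∀ u, Tendsto (fun i => ‖f i - Ψ i u‖) l (𝓝 ‖f₀ - ι u‖)) :
    StrongConverges l ι Ψ f f₀ := by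
  have h0 : Tendsto (fun i => ‖f i‖) l (𝓝 ‖f₀‖) := by simpa using h 0
  refine ⟨h0, fun u => ?_⟩
  have h1 : Tendsto (fun i => (‖f i‖ ^ 2 + ‖Ψ i u‖ ^ 2 - ‖f i - Ψ i u‖ ^ 2) / 2) l
      (𝓝 ((‖f₀‖ ^ 2 + ‖ι u‖ ^ 2 - ‖f₀ - ι u‖ ^ 2) / 2)) :=
    (((h0.pow 2).add ((hΨ.tendsto_norm u).pow 2)).sub ((h u).pow 2)).div_const 2
  simp only [norm_sub_sq_real] at h1
  convert h1 using 2 <;> ring_nf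

/-- Distances to comparison vectors change by at most the approximation error, and the distances
between comparison vectors converge. -/
theorem strongConverges_of_approx (hΨ : HilbertConverges l ι Ψ)
    (h : ∀ r > 0, ∃ u, ‖f₀ - ι u‖ < r ∧ ∀ᶠ i in l, ‖f i - Ψ i u‖ < r) :
    StrongConverges l ι Ψ f f₀ := by
  refine strongConverges_of_tendsto_norm_sub hΨ fun v => ?_
  rw [Metric.tendsto_nhds]
  intro r hr
  obtain ⟨u, hu, hfu⟩ := h (r / 3) (by positivity)
  have h1 : Tendsto (fun i => ‖Ψ i (u - v)‖) l (𝓝 ‖ι (u - v)‖) := hΨ.tendsto_norm _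
  filter_upwards [hfu, Metric.tendsto_nhds.1 h1 (r / 3) (by positivity)] with i hi1 hi2
  rw [Real.dist_eq] at hi2 ⊢
  have e1 : |‖f i - Ψ i v‖ - ‖Ψ i (u - v)‖| ≤ ‖f i - Ψ i u‖ := by
    refine (abs_norm_sub_norm_le _ _).trans (le_of_eq ?_)
    rw [map_sub]; congr 1; abel
  have e2 : |‖f₀ - ι v‖ - ‖ι (u - v)‖| ≤ ‖f₀ - ι u‖ := by
    refine (abs_norm_sub_norm_le _ _).trans (le_of_eq ?_)
    rw [map_sub]; congr 1; abel
  rw [abs_le] at e1 e2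
  rw [abs_lt] at hi2 ⊢
  constructor <;> linarith [hi2.1, hi2.2, e1.1, e1.2, e2.1, e2.2]

/-- The Trotter–Kato theorem along a convergence of Hilbert spaces: convergence of the generators on
a core implies convergence of the semigroups. -/
theorem strongConverges_semigroup (hΨ : HilbertConverges l ι Ψ)
    {T : ∀ i, ℝ≥0 → H i →L[ℝ] H i} {T₀ : ℝ≥0 → H₀ →L[ℝ] H₀}
    (hT : ∀ᶠ i in l, IsContractionSemigroup (T i)) (hT₀ : IsContractionSemigroup T₀)
    {L₀ : C → H₀} {L : ∀ i, C → H i}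
    (hcore : generatorGraph T₀ = closure (range fun u => (ι u, L₀ u)))
    (hgen : ∀ᶠ i in l, ∀ u, (Ψ i u, L i u) ∈ generatorGraph (T i))
    (hcons : ∀ u φ, Tendsto (fun i => ‖L i u - Ψ i φ‖) l (𝓝 ‖L₀ u - ι φ‖))
    (t : ℝ≥0) (hf : StrongConverges l ι Ψ f f₀) :
    StrongConverges l ι Ψ (fun i => T i t (f i)) (T₀ t f₀) := by
  rcases eq_or_ne t 0 with rfl | ht
  · rw [hT₀.apply_zero]
    refine strongConverges_of_tendsto_norm_sub hΨ fun u => ?_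
    refine (hf.tendsto_norm_sub hΨ u).congr' ?_
    filter_upwards [hT] with i hi
    rw [hi.apply_zero]
  have ht0 : 0 < t := pos_iff_ne_zero.2 ht
  have ht0' : (0 : ℝ) < t := ht0
  refine strongConverges_of_approx hΨ fun r hr => ?_
  obtain ⟨v, hv⟩ : ∃ v, ‖f₀ - ι v‖ < r / 8 := by
    obtain ⟨v, hv⟩ := hΨ.denseRange.exists_dist_lt f₀ (show 0 < r / 8 by positivity)
    exact ⟨v, by rwa [dist_eq_norm] at hv⟩
  have hvg : (ι v, L₀ v) ∈ generatorGraph T₀ := hcore ▸ subset_closure ⟨v, rfl⟩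
  -- Error budget: slopes off by less than `3 q` over total time `t` cost at most `3 r / 8`, and the
  -- initial error is less than `r / 4`.
  set q := r / (8 * t) with hq
  have hq0 : 0 < q := by positivity
  obtain ⟨n, hn, hstep⟩ := hT₀.exists_step hvg t hq0
  have hn' : (0 : ℝ≥0) < n := by exact_mod_cast hn
  set h := t / n with hh
  have hh0 : 0 < h := div_pos ht0 hn'
  have hh0' : (0 : ℝ) < h := hh0
  -- The accuracy of the vertices is chosen after the mesh `h`, because vertex errors are divided by
  -- `h` in the slopes.
  set s := min (r / 8) (q / (2 * (h : ℝ)⁻¹ + 1)) with hs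
  have hs0 : 0 < s := by positivity
  have hsr : s ≤ r / 8 := min_le_left _ _
  have hsq : 2 * (h : ℝ)⁻¹ * s + s ≤ q := by
    have : s ≤ q / (2 * (h : ℝ)⁻¹ + 1) := min_le_right _ _
    rw [le_div_iff₀ (by positivity)] at this
    linarith
  -- The orbit of `ι v` lies in the graph of the generator, so each of its points can be replaced by
  -- a core element that is close together with its image.
  have happ : ∀ k : ℕ, ∃ u, ‖T₀ (k * h) (ι v) - ι u‖ < s ∧ ‖T₀ (k * h) (L₀ v) - L₀ u‖ < s := by
    intro k
    have h1 := hT₀.generatorGraph_map hvg (k * h)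
    rw [hcore] at h1
    obtain ⟨_, ⟨u, rfl⟩, hu⟩ := Metric.mem_closure_iff.1 h1 s hs0
    rw [Prod.dist_eq, max_lt_iff, dist_eq_norm, dist_eq_norm] at hu
    exact ⟨u, hu⟩
  choose u hu1 hu2 using happ
  -- The slope of the polygon through the `u k` is again of the form `ι φ` with `φ` in the core;
  -- this is why the consistency hypothesis compares `L i u` with `Ψ i φ`.
  have hnear : ∀ k m : ℕ, ‖(h : ℝ)⁻¹ • (T₀ ((k + 1 : ℕ) * h) (ι v) - T₀ (k * h) (ι v)) -
      T₀ (m * h) (L₀ v)‖ ≤ q → ‖L₀ (u m) - ι ((h : ℝ)⁻¹ • (u (k + 1) - u k))‖ < 3 * q := by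
    intro k m hkm
    have e : L₀ (u m) - ι ((h : ℝ)⁻¹ • (u (k + 1) - u k)) =
        -((h : ℝ)⁻¹ • (T₀ ((k + 1 : ℕ) * h) (ι v) - T₀ (k * h) (ι v)) - T₀ (m * h) (L₀ v)) +
        ((h : ℝ)⁻¹ • ((T₀ ((k + 1 : ℕ) * h) (ι v) - ι (u (k + 1))) -
          (T₀ (k * h) (ι v) - ι (u k))) - (T₀ (m * h) (L₀ v) - L₀ (u m))) := by
      rw [map_smul, map_sub]; module
    rw [e]
    refine (norm_add_le _ _).trans_lt ?_
    rw [norm_neg]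
    have h1 : ‖(h : ℝ)⁻¹ • ((T₀ ((k + 1 : ℕ) * h) (ι v) - ι (u (k + 1))) -
          (T₀ (k * h) (ι v) - ι (u k))) - (T₀ (m * h) (L₀ v) - L₀ (u m))‖ ≤
          (h : ℝ)⁻¹ * (s + s) + s := by
      refine (norm_sub_le _ _).trans (add_le_add ?_ (hu2 m).le)
      rw [norm_smul, Real.norm_of_nonneg (inv_nonneg.2 hh0'.le)]
      refine mul_le_mul_of_nonneg_left ?_ (inv_nonneg.2 hh0'.le)
      exact (norm_sub_le _ _).trans (add_le_add (hu1 _).le (hu1 _).le)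
    linarith
  -- Only finitely many slope conditions occur, so they hold simultaneously from some index on.
  have hev : ∀ᶠ i in l, ∀ k ∈ Finset.range n,
      ‖L i (u k) - Ψ i ((h : ℝ)⁻¹ • (u (k + 1) - u k))‖ < 3 * q ∧
      ‖L i (u (k + 1)) - Ψ i ((h : ℝ)⁻¹ • (u (k + 1) - u k))‖ < 3 * q := by
    rw [Filter.eventually_all_finset]
    intro k _
    have h1 := (hstep k).resolve_right ht
    exact ((hcons _ _).eventually (gt_mem_nhds (hnear k k h1.1))).and
      ((hcons _ _).eventually (gt_mem_nhds (hnear k (k + 1) h1.2)))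
  have e : (n : ℝ≥0) * h = t := by rw [hh]; field_simp
  have h0 : ‖f₀ - ι (u 0)‖ < r / 4 := by
    have h1 := hu1 0
    simp only [Nat.cast_zero, zero_mul, hT₀.apply_zero] at h1
    have h2 := norm_add_le (f₀ - ι v) (ι v - ι (u 0))
    rw [sub_add_sub_cancel] at h2
    linarith
  refine ⟨u n, ?_, ?_⟩
  · have h1 := hu1 n
    rw [e] at h1
    have h2 := norm_add_le (T₀ t (f₀ - ι v)) (T₀ t (ι v) - ι (u n))
    rw [map_sub, sub_add_sub_cancel, ← map_sub] at h2
    linarith [hT₀.norm_apply_le t (f₀ - ι v)]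
  · filter_upwards [hev, hgen, hT, (hf.tendsto_norm_sub hΨ (u 0)).eventually (gt_mem_nhds h0)]
      with i hi hgi hTi hfi
    have h1 := hTi.norm_steps_le hh0 (w := fun k => Ψ i (u k)) (a := fun k => L i (u k))
      (C := fun _ => 3 * q) n (fun k _ => hgi _) (fun k hk => by
        have := (hi k (Finset.mem_range.2 hk)).1.le
        rwa [norm_sub_rev, map_smul, map_sub] at this) (fun k hk => by
        have := (hi k (Finset.mem_range.2 hk)).2.le
        rwa [norm_sub_rev, map_smul, map_sub] at this)
    rw [e, Finset.sum_const, Finset.card_range, nsmul_eq_mul, ← mul_assoc] at h1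
    have e' : (h : ℝ) * n = t := by rw [mul_comm]; exact_mod_cast e
    rw [e', hq] at h1
    have h3 : (t : ℝ) * (3 * (r / (8 * t))) = 3 * r / 8 := by field_simp
    rw [h3] at h1
    have h2 := norm_add_le (T i t (f i - Ψ i (u 0))) (T i t (Ψ i (u 0)) - Ψ i (u n))
    rw [map_sub, sub_add_sub_cancel, ← map_sub] at h2
    linarith [hTi.norm_apply_le t (f i - Ψ i (u 0))]

end TrotterKato

/-! ### Cauchy–Schwarz and a limit theorem for products in `L²` -/

section L2

variable {α F : Type*} [MeasurableSpace α] {μ : Measure α} [NormedAddCommGroup F]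

theorem lintegral_enorm_sq (f : α → F) : ∫⁻ x, ‖f x‖ₑ ^ 2 ∂μ = eLpNorm f 2 μ ^ 2 := by
  have := eLpNorm_nnreal_pow_eq_lintegral (μ := μ) (f := f) (p := 2) two_ne_zero
  simpa using this.symm

theorem lintegral_mul_sq_le {f g : α → ℝ≥0∞} (hf : AEMeasurable f μ) (hg : AEMeasurable g μ) :
    (∫⁻ x, f x * g x ∂μ) ^ 2 ≤ (∫⁻ x, f x ^ 2 ∂μ) * ∫⁻ x, g x ^ 2 ∂μ := by
  have h := ENNReal.lintegral_mul_le_Lp_mul_Lq μ (p := 2) (q := 2)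
    (Real.HolderConjugate.two_two) hf hg
  calc (∫⁻ x, f x * g x ∂μ) ^ 2
      ≤ ((∫⁻ a, f a ^ (2 : ℝ) ∂μ) ^ (1 / (2 : ℝ)) * (∫⁻ a, g a ^ (2 : ℝ) ∂μ) ^ (1 / (2 : ℝ))) ^ 2 :=
        pow_le_pow_left' h 2
    _ = _ := by
      rw [mul_pow, ← ENNReal.rpow_natCast, ← ENNReal.rpow_natCast, ← ENNReal.rpow_mul,
        ← ENNReal.rpow_mul]
      norm_num

/-- A limit theorem for products of a bounded a.e. convergent, a fixed square integrable and an
`L²`-convergent sequence. -/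
theorem tendsto_integral_mul_mul {w : ℕ → α → ℝ} {w₀ : α → ℝ} {k : α → ℝ} {h : ℕ → α → ℝ}
    {h₀ : α → ℝ} {B : ℝ} (hwm : ∀ n, AEStronglyMeasurable (w n) μ) (hwB : ∀ n, ∀ᵐ x ∂μ, |w n x| ≤ B)
    (hw : ∀ᵐ x ∂μ, Tendsto (fun n => w n x) atTop (𝓝 (w₀ x))) (hk : MemLp k 2 μ)
    (hh : ∀ n, MemLp (h n) 2 μ) (hh₀ : MemLp h₀ 2 μ)
    (hlim : Tendsto (fun n => ∫⁻ x, ‖h n x - h₀ x‖ₑ ^ 2 ∂μ) atTop (𝓝 0)) :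
    Tendsto (fun n => ∫ x, w n x * (k x * h n x) ∂μ) atTop (𝓝 (∫ x, w₀ x * (k x * h₀ x) ∂μ)) := by
  have hi : ∀ {g : α → ℝ}, MemLp g 2 μ → Integrable (fun x => k x * g x) μ := fun hg =>
    hk.integrable_mul hg
  have h1 : Tendsto (fun n => ∫ x, w n x * (k x * h₀ x) ∂μ) atTop
      (𝓝 (∫ x, w₀ x * (k x * h₀ x) ∂μ)) := by
    refine tendsto_integral_of_dominated_convergence (fun x => B * ‖k x * h₀ x‖)
      (fun n => (hwm n).mul (hi hh₀).1) ((hi hh₀).norm.const_mul B) (fun n => ?_) ?_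
    · filter_upwards [hwB n] with x hx
      rw [norm_mul]
      exact mul_le_mul_of_nonneg_right hx (norm_nonneg _)
    · filter_upwards [hw] with x hx
      exact hx.mul_const _
  -- The varying factor `h n` is first replaced by its limit at the cost of `B ‖k‖ ‖h n - h₀‖`;
  -- dominated convergence handles the rest.
  have h2 : Tendsto (fun n => ∫ x, w n x * (k x * (h n x - h₀ x)) ∂μ) atTop (𝓝 0) := by
    rw [tendsto_zero_iff_enorm_tendsto_zero]
    have hK : ∫⁻ x, ‖k x‖ₑ ^ 2 ∂μ ≠ (⊤ : ℝ≥0∞) := by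
      rw [lintegral_enorm_sq]; exact ENNReal.pow_ne_top hk.2.ne
    have hb : ∀ n, ‖∫ x, w n x * (k x * (h n x - h₀ x)) ∂μ‖ₑ ≤ ENNReal.ofReal B *
        ((∫⁻ x, ‖k x‖ₑ ^ 2 ∂μ) * ∫⁻ x, ‖h n x - h₀ x‖ₑ ^ 2 ∂μ) ^ (1 / 2 : ℝ) := by
      intro n
      refine (enorm_integral_le_lintegral_enorm _).trans ?_
      have h3 : ∫⁻ x, ‖w n x * (k x * (h n x - h₀ x))‖ₑ ∂μ ≤
          ∫⁻ x, ENNReal.ofReal B * (‖k x‖ₑ * ‖h n x - h₀ x‖ₑ) ∂μ := by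
        refine lintegral_mono_ae ?_
        filter_upwards [hwB n] with x hx
        rw [enorm_mul, enorm_mul]
        gcongr
        rw [Real.enorm_eq_ofReal_abs]
        exact ENNReal.ofReal_le_ofReal hx
      refine h3.trans ?_
      rw [lintegral_const_mul' _ _ ENNReal.ofReal_ne_top]
      gcongr
      have h4 := lintegral_mul_sq_le hk.1.enorm ((hh n).1.sub hh₀.1).enorm
      rw [one_div, ENNReal.le_rpow_inv_iff (by norm_num : (0 : ℝ) < 2)]
      simpa using h4
    refine tendsto_of_tendsto_of_tendsto_of_le_of_le tendsto_const_nhds ?_ (fun _ => zero_le) hb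
    have h5 : Tendsto (fun n => (∫⁻ x, ‖k x‖ₑ ^ 2 ∂μ) * ∫⁻ x, ‖h n x - h₀ x‖ₑ ^ 2 ∂μ) atTop
        (𝓝 0) := by
      simpa using ENNReal.Tendsto.const_mul hlim (Or.inr hK)
    have h6 := (ENNReal.continuous_rpow_const (y := (1 / 2 : ℝ))).tendsto 0 |>.comp h5
    simp only [ENNReal.zero_rpow_of_pos (by norm_num : (0 : ℝ) < 1 / 2)] at h6
    simpa using ENNReal.Tendsto.const_mul h6 (Or.inr ENNReal.ofReal_ne_top)
  have h3 := h2.add h1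
  rw [zero_add] at h3
  refine h3.congr fun n => ?_
  have hb' : ∀ {g : α → ℝ}, MemLp g 2 μ → Integrable (fun x => w n x * (k x * g x)) μ := fun hg =>
    (hi hg).bdd_mul (c := B) (hwm n) (by simpa using hwB n)
  have h4 := integral_add (hb' ((hh n).sub hh₀)) (hb' hh₀)
  simp only [Pi.sub_apply] at h4
  rw [← h4]
  congr 1 with x
  ring

end L2

/-! ### Mollifiers and local mean square oscillation -/

section Mollifier

variable {d : ℕ}

/-- A standard bump function of radius `1 / (n + 1)`. -/
def bump (d n : ℕ) : ContDiffBump (0 : E d) where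
  rIn := 1 / (2 * (n + 1))
  rOut := 1 / (n + 1)
  rIn_pos := by positivity
  rIn_lt_rOut := by
    refine one_div_lt_one_div_of_lt (by positivity) ?_
    linarith [(Nat.cast_nonneg n : (0 : ℝ) ≤ n)]

/-- A standard mollifier. -/
def moll (d n : ℕ) : E d → ℝ := (bump d n).normed volume

theorem moll_nonneg (n : ℕ) (x : E d) : 0 ≤ moll d n x := (bump d n).nonneg_normed x

theorem contDiff_moll (n : ℕ) : ContDiff ℝ ∞ (moll d n) := (bump d n).contDiff_normed

theorem hasCompactSupport_moll (n : ℕ) : HasCompactSupport (moll d n) :=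
  (bump d n).hasCompactSupport_normed

theorem continuous_moll (n : ℕ) : Continuous (moll d n) := (contDiff_moll n).continuous

theorem integral_moll (n : ℕ) : ∫ x, moll d n x = 1 := (bump d n).integral_normed

theorem integrable_moll (n : ℕ) : Integrable (moll d n) := (bump d n).integrable_normed

theorem moll_neg (n : ℕ) (x : E d) : moll d n (-x) = moll d n x := (bump d n).normed_neg x

theorem tsupport_moll (n : ℕ) : tsupport (moll d n) = Metric.closedBall 0 (1 / (n + 1) : ℝ) :=
  (bump d n).tsupport_normed_eq

theorem moll_eq_zero {n : ℕ} {x : E d} (hx : 1 / (n + 1 : ℝ) < ‖x‖) : moll d n x = 0 := by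
  refine image_eq_zero_of_notMem_tsupport ?_
  rw [tsupport_moll]
  simpa using hx

theorem lintegral_moll (n : ℕ) : ∫⁻ x, ENNReal.ofReal (moll d n x) = 1 := by
  rw [← ofReal_integral_eq_lintegral_ofReal (integrable_moll n) (ae_of_all _ (moll_nonneg n)),
    integral_moll, ENNReal.ofReal_one]

theorem tendsto_radius : Tendsto (fun n : ℕ => 1 / (n + 1 : ℝ)) atTop (𝓝 0) :=
  tendsto_one_div_add_atTop_nhds_zero_nat

/-- The squared local oscillation of `g` at scale `1 / (n + 1)`. -/
def oscSq {F : Type*} [NormedAddCommGroup F] (n : ℕ) (g : E d → F) (x : E d) : ℝ≥0∞ :=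
  ∫⁻ z, ENNReal.ofReal (moll d n z) * ‖g (x - z) - g x‖ₑ ^ 2

variable {F : Type*} [NormedAddCommGroup F]

theorem tendsto_translate {g : E d → F} (hg : MemLp g 2) :
    Tendsto (fun z => ∫⁻ x, ‖g (x - z) - g x‖ₑ ^ 2) (𝓝 (0 : E d)) (𝓝 0) := by
  let c : E d → C(E d, E d) := fun z => ⟨fun x => x - z, by fun_prop⟩
  have hc : Continuous c := by
    let f : C(E d × E d, E d) := ⟨fun p => p.2 - p.1, by fun_prop⟩
    exact f.curry.continuous
  have hmp : ∀ z, MeasurePreserving (c z) (volume : Measure (E d)) volume := fun z =>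
    measurePreserving_sub_right volume z
  have h1 := Continuous.compMeasurePreservingLp (f := fun _ : E d => hg.toLp g) (p := 2)
    continuous_const hc hmp (by simp)
  have h3 : ∀ z, ∫⁻ x, ‖g (x - z) - g x‖ₑ ^ 2 =
      ‖Lp.compMeasurePreserving (c z) (hmp z) (hg.toLp g) - hg.toLp g‖ₑ ^ 2 := by
    intro z
    rw [lintegral_enorm_sq, Lp.enorm_def]
    congr 1
    refine eLpNorm_congr_ae ?_
    filter_upwards [Lp.coeFn_sub (Lp.compMeasurePreserving (c z) (hmp z) (hg.toLp g)) (hg.toLp g),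
      Lp.coeFn_compMeasurePreserving (hg.toLp g) (hmp z), hg.coeFn_toLp,
      (hmp z).quasiMeasurePreserving.ae hg.coeFn_toLp] with x e1 e2 e3 e4
    rw [e1, Pi.sub_apply, e2, e3]
    simp only [Function.comp_apply]
    rw [e4]; rfl
  simp only [h3]
  refine ((ENNReal.continuous_pow 2).comp (h1.sub continuous_const).enorm).tendsto' 0 0 ?_
  have h4 := h3 0
  simp only [sub_zero, sub_self, enorm_zero] at h4
  simpa using h4.symm

theorem aemeasurable_osc {g : E d → F} (hg : AEStronglyMeasurable g) (n : ℕ) :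
    AEMeasurable (fun p : E d × E d => ENNReal.ofReal (moll d n p.2) * ‖g (p.1 - p.2) - g p.1‖ₑ ^ 2)
      (volume.prod volume) := by
  have h1 : AEStronglyMeasurable (fun p : E d × E d => g (p.1 - p.2)) (volume.prod volume) :=
    hg.comp_quasiMeasurePreserving (quasiMeasurePreserving_sub_of_right_invariant _ _)
  have h2 : AEStronglyMeasurable (fun p : E d × E d => g p.1) (volume.prod volume) := hg.comp_fst
  have h3 : Measurable fun p : E d × E d => ENNReal.ofReal (moll d n p.2) :=
    ENNReal.measurable_ofReal.comp ((continuous_moll n).measurable.comp measurable_snd)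
  exact h3.aemeasurable.mul ((h1.sub h2).enorm.pow_const 2)

/-- By Tonelli the integral is an average over `z` of the squared `L²` distance between `g` and its
translate by `z`, and translations are continuous in `L²`. -/
theorem tendsto_lintegral_oscSq {g : E d → F} (hg : MemLp g 2) :
    Tendsto (fun n => ∫⁻ x, oscSq n g x) atTop (𝓝 0) := by
  have hsw : ∀ n, ∫⁻ x, oscSq n g x =
      ∫⁻ z, ENNReal.ofReal (moll d n z) * ∫⁻ x, ‖g (x - z) - g x‖ₑ ^ 2 := by
    intro n
    unfold oscSq
    rw [lintegral_lintegral_swap (aemeasurable_osc hg.1 n)]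
    congr 1 with z
    rw [lintegral_const_mul' _ _ ENNReal.ofReal_ne_top]
  rw [ENNReal.tendsto_atTop_zero]
  intro r hr
  have h1 := (tendsto_translate hg).eventually (Iic_mem_nhds hr)
  obtain ⟨δ, hδ, h2⟩ := Metric.eventually_nhds_iff_ball.1 h1
  obtain ⟨N, hN⟩ := (Metric.tendsto_atTop.1 tendsto_radius δ hδ)
  refine ⟨N, fun n hn => ?_⟩
  rw [hsw]
  have h3 : ∀ z, ENNReal.ofReal (moll d n z) * ∫⁻ x, ‖g (x - z) - g x‖ₑ ^ 2 ≤
      ENNReal.ofReal (moll d n z) * r := by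
    intro z
    by_cases hz : ‖z‖ < δ
    · gcongr
      exact h2 z (by simpa using hz)
    · rw [moll_eq_zero]
      · simp
      · have := hN n hn
        rw [Real.dist_0_eq_abs, abs_of_pos (by positivity)] at this
        linarith
  refine (lintegral_mono h3).trans ?_
  rw [lintegral_mul_const (f := fun z => ENNReal.ofReal (moll d n z)) r (ENNReal.measurable_ofReal.comp (continuous_moll n).measurable),
    lintegral_moll, one_mul]

/-- The mollification of `u`. -/
def mollify (n : ℕ) (u : E d → ℝ) (x : E d) : ℝ := ∫ y, moll d n (x - y) * u y

theorem mollify_eq_convolution (n : ℕ) (u : E d → ℝ) :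
    mollify n u = convolution (moll d n) u (ContinuousLinearMap.lsmul ℝ ℝ) volume := by
  funext x
  rw [convolution_eq_swap]
  rfl

theorem mollify_eq (n : ℕ) (u : E d → ℝ) (x : E d) :
    mollify n u x = ∫ z, moll d n z * u (x - z) := by
  rw [mollify_eq_convolution, convolution_def]
  rfl

theorem contDiff_mollify (n : ℕ) {u : E d → ℝ} (hu : LocallyIntegrable u) :
    ContDiff ℝ ∞ (mollify n u) := by
  rw [mollify_eq_convolution]
  exact (hasCompactSupport_moll n).contDiff_convolution_left _ (contDiff_moll n) hu

theorem integrable_moll_mul (n : ℕ) {u : E d → ℝ} (hu : LocallyIntegrable u) (x : E d) :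
    Integrable fun y => moll d n (x - y) * u y := by
  have hc : HasCompactSupport fun y => moll d n (x - y) :=
    (hasCompactSupport_moll n).comp_homeomorph (Homeomorph.subLeft x)
  exact hu.integrable_smul_left_of_hasCompactSupport
    ((continuous_moll n).comp (continuous_const.sub continuous_id)) hc

theorem fderiv_mollify (n : ℕ) {u : E d → ℝ} (hu : LocallyIntegrable u) (x e : E d) :
    fderiv ℝ (mollify n u) x e = ∫ y, fderiv ℝ (moll d n) (x - y) e * u y := by
  rw [mollify_eq_convolution, ((hasCompactSupport_moll n).hasFDerivAt_convolution_left
    (ContinuousLinearMap.lsmul ℝ ℝ) ((contDiff_moll n).of_le (by simp)) hu x).fderiv,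
    convolution_eq_swap]
  rw [ContinuousLinearMap.integral_apply]
  · rfl
  · have hc : HasCompactSupport fun y => fderiv ℝ (moll d n) (x - y) :=
      ((hasCompactSupport_moll n).fderiv ℝ).comp_homeomorph (Homeomorph.subLeft x)
    have hcont : Continuous fun y => fderiv ℝ (moll d n) (x - y) :=
      ((contDiff_moll n).continuous_fderiv (by simp)).comp (continuous_const.sub continuous_id)
    have h1 : Integrable (fun y => u y • fderiv ℝ (moll d n) (x - y)) :=
      hu.integrable_smul_right_of_hasCompactSupport hcont hc
    refine h1.congr (ae_of_all _ fun y => ?_)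
    ext v
    simp [ContinuousLinearMap.precompL_apply, mul_comm]

/-- Lebesgue differentiation: the inner and outer radii of the bump functions have constant ratio
`2`, as the differentiation theorem requires. -/
theorem ae_tendsto_mollify {u : E d → ℝ} (hu : LocallyIntegrable u) :
    ∀ᵐ x, Tendsto (fun n => mollify n u x) atTop (𝓝 (u x)) := by
  have := ContDiffBump.ae_convolution_tendsto_right_of_locallyIntegrable (φ := bump d) (l := atTop)
    (K := 2) (μ := volume) tendsto_radius (Eventually.of_forall fun n => le_of_eq ?_) hu
  · filter_upwards [this] with x hx
    refine hx.congr fun n => ?_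
    rw [mollify_eq_convolution]; rfl
  · change 1 / ((n : ℝ) + 1) = 2 * (1 / (2 * (n + 1)))
    field_simp

/-- Cauchy–Schwarz for the probability density `moll d n`, split into two square roots. -/
theorem lintegral_moll_mul_sq_le {u : E d → ℝ} (hu : AEStronglyMeasurable u) (n : ℕ) (x : E d) :
    (∫⁻ z, ENNReal.ofReal (moll d n z) * ‖u (x - z) - u x‖ₑ) ^ 2 ≤ oscSq n u x := by
  have hj : AEMeasurable fun z => ENNReal.ofReal (moll d n z) ^ (1 / 2 : ℝ) :=
    ((ENNReal.measurable_ofReal.comp (continuous_moll n).measurable).pow_const _).aemeasurable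
  have hm : AEMeasurable fun z => ‖u (x - z) - u x‖ₑ := by
    have h1 : AEStronglyMeasurable fun z => u (x - z) :=
      hu.comp_quasiMeasurePreserving
        (quasiMeasurePreserving_sub_left_of_right_invariant volume x)
    exact (h1.sub aestronglyMeasurable_const).enorm
  have hsq : ∀ z, ENNReal.ofReal (moll d n z) ^ (1 / 2 : ℝ) * ENNReal.ofReal (moll d n z) ^
      (1 / 2 : ℝ) = ENNReal.ofReal (moll d n z) := fun z => by
    rw [← ENNReal.rpow_add_of_nonneg _ _ (by norm_num) (by norm_num)]; norm_num
  calc _ = (∫⁻ z, ENNReal.ofReal (moll d n z) ^ (1 / 2 : ℝ) *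
          (ENNReal.ofReal (moll d n z) ^ (1 / 2 : ℝ) * ‖u (x - z) - u x‖ₑ)) ^ 2 := by
        simp only [← mul_assoc, hsq]
    _ ≤ _ := lintegral_mul_sq_le hj (hj.mul hm)
    _ = oscSq n u x := by
        unfold oscSq
        simp only [mul_pow, sq (_ ^ (1 / 2 : ℝ)), hsq, lintegral_moll, one_mul]

theorem enorm_mollify_sub_sq_le {u : E d → ℝ} (hu : LocallyIntegrable u) (n : ℕ) (x : E d) :
    ‖mollify n u x - u x‖ₑ ^ 2 ≤ oscSq n u x := by
  have hi : Integrable fun z => moll d n z * u (x - z) := by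
    have := (integrable_moll_mul n hu x).comp_sub_left x
    simpa using this
  have e : mollify n u x - u x = ∫ z, moll d n z * (u (x - z) - u x) := by
    rw [mollify_eq]
    simp only [mul_sub]
    rw [integral_sub hi ((integrable_moll n).mul_const _), integral_mul_const, integral_moll,
      one_mul]
  rw [e]
  refine (pow_le_pow_left' ((enorm_integral_le_lintegral_enorm _).trans (le_of_eq ?_)) 2).trans
    (lintegral_moll_mul_sq_le hu.aestronglyMeasurable n x)
  congr 1 with z
  rw [enorm_mul, Real.enorm_eq_ofReal (moll_nonneg n z)]

end Mollifier

/-! ### Smooth approximation of weakly differentiable functions and integration by parts -/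

section WeakDerivative

variable {d : ℕ}

/-- The `i`-th partial derivative. -/
abbrev pd (i : Fin d) (f : E d → ℝ) (x : E d) : ℝ := fderiv ℝ f x (EuclideanSpace.single i 1)

theorem contDiff_moll_sub (n : ℕ) (x : E d) : ContDiff ℝ ∞ fun y => moll d n (x - y) :=
  (contDiff_moll n).comp (contDiff_const.sub contDiff_id)

theorem hasCompactSupport_moll_sub (n : ℕ) (x : E d) :
    HasCompactSupport fun y => moll d n (x - y) :=
  (hasCompactSupport_moll n).comp_homeomorph (Homeomorph.subLeft x)

theorem tsupport_moll_sub (n : ℕ) (x : E d) :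
    tsupport (fun y => moll d n (x - y)) ⊆ Metric.closedBall x (1 / (n + 1)) := by
  refine closure_minimal (fun y hy => ?_) Metric.isClosed_closedBall
  by_contra h
  refine hy (moll_eq_zero ?_)
  rw [Metric.mem_closedBall, not_le, dist_comm, dist_eq_norm] at h
  exact h

theorem moll_sub_mem_testFunctions {n : ℕ} {x : E d} {Ω : Set (E d)}
    (h : Metric.closedBall x (1 / (n + 1)) ⊆ Ω) : (fun y => moll d n (x - y)) ∈ testFunctions Ω :=
  ⟨contDiff_moll_sub n x, hasCompactSupport_moll_sub n x, (tsupport_moll_sub n x).trans h⟩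

theorem fderiv_moll_sub (n : ℕ) (x y e : E d) :
    fderiv ℝ (fun y => moll d n (x - y)) y e = -fderiv ℝ (moll d n) (x - y) e := by
  have h1 : HasFDerivAt (fun y : E d => x - y) (-ContinuousLinearMap.id ℝ (E d)) y := by
    simpa using (hasFDerivAt_id y).const_sub x
  have h2 := (((contDiff_moll (d := d) n).differentiable (by simp)) (x - y)).hasFDerivAt.comp y h1
  rw [HasFDerivAt.fderiv (f := fun y => moll d n (x - y)) h2]
  simp

theorem closedBall_subset_cthickening' {K : Set (E d)} {x : E d} (hx : x ∈ K) {r δ : ℝ}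
    (h : r ≤ δ) : Metric.closedBall x r ⊆ Metric.cthickening δ K :=
  (Metric.closedBall_subset_cthickening hx r).trans (Metric.cthickening_mono h K)

/-- The kernel `y ↦ moll d n (x - y)` is an admissible test function when its ball lies in `Ω`.
Truncation to `K` makes `u` locally integrable on the whole space and changes nothing within the
ball. -/
theorem pd_mollify_of_weak {Ω K : Set (E d)} (hΩ : IsOpen Ω) {u g : E d → ℝ} {i : Fin d}
    (hw : HasWeakPartialOn Ω u g i) (hK : IsCompact K) (hKΩ : K ⊆ Ω) {n : ℕ} {x : E d}
    (hx : Metric.closedBall x (1 / (n + 1)) ⊆ K) :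
    pd i (mollify n (K.indicator u)) x = mollify n (K.indicator g) x := by
  have hu : LocallyIntegrable (K.indicator u) :=
    ((hw.left.integrableOn_compact_subset hKΩ hK).integrable_indicator
      hK.measurableSet).locallyIntegrable
  have hzero : ∀ y ∉ K, moll d n (x - y) = 0 ∧ fderiv ℝ (moll d n) (x - y) = 0 := by
    intro y hy
    have h1 : x - y ∉ tsupport (moll d n) := by
      rw [tsupport_moll]
      intro h2
      refine hy (hx ?_)
      rw [Metric.mem_closedBall, dist_comm, dist_eq_norm]
      simpa using h2
    exact ⟨image_eq_zero_of_notMem_tsupport h1, image_eq_zero_of_notMem_tsupport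
      fun h2 => h1 (tsupport_fderiv_subset ℝ h2)⟩
  have h1 := hw.parts _ (moll_sub_mem_testFunctions (hx.trans hKΩ))
  have hind : ∀ (v F : E d → ℝ), (∀ y ∉ K, F y = 0) →
      ∫ y, F y * K.indicator v y = ∫ y in Ω, v y * F y := by
    intro v F hF
    rw [← setIntegral_eq_integral_of_forall_compl_eq_zero (s := K)
      (fun y hy => by rw [hF y hy, zero_mul]),
      setIntegral_eq_of_subset_of_forall_sdiff_eq_zero (f := fun y => v y * F y) hΩ.measurableSet
      hKΩ (fun y hy => by rw [hF y hy.2, mul_zero])]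
    refine setIntegral_congr_fun hK.measurableSet fun y hy => ?_
    rw [indicator_of_mem hy, mul_comm]
  unfold pd
  rw [fderiv_mollify n hu, hind u _ fun y hy => by rw [(hzero y hy).2]; rfl]
  unfold mollify
  rw [hind g _ fun y hy => (hzero y hy).1]
  simp only [fderiv_moll_sub, mul_neg, integral_neg] at h1
  linarith

/-- Mollify the truncation to a compact neighbourhood of `K`, starting at an index from which the
kernels centred in `K` see only that neighbourhood. Averaging preserves the lower bound, which later
keeps functions such as `e^{-U n}` bounded. -/
theorem exists_smooth_approx {Ω K : Set (E d)} (hΩ : IsOpen Ω) (hK : IsCompact K) (hKΩ : K ⊆ Ω)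
    {u : E d → ℝ} {g : Fin d → E d → ℝ} (hw : ∀ i, HasWeakPartialOn Ω u (g i) i)
    (hui : LocallyIntegrableOn u Ω)
    (hg : ∀ i, ∀ K' ⊆ Ω, IsCompact K' → MemLp (g i) 2 (volume.restrict K')) {c : ℝ}
    (hc : ∀ x ∈ Ω, c ≤ u x) :
    ∃ U : ℕ → E d → ℝ, (∀ n, ContDiff ℝ ∞ (U n)) ∧ (∀ n, ∀ x ∈ K, c ≤ U n x) ∧
      (∀ᵐ x ∂volume.restrict K, Tendsto (fun n => U n x) atTop (𝓝 (u x))) ∧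
      ∀ i, Tendsto (fun n => ∫⁻ x in K, ‖pd i (U n) x - g i x‖ₑ ^ 2) atTop (𝓝 0) := by
  obtain ⟨δ, hδ, hδΩ⟩ := hK.exists_cthickening_subset_open hΩ hKΩ
  set K' := Metric.cthickening δ K with hK'
  have hK'c : IsCompact K' := hK.cthickening
  have hu : LocallyIntegrable (K'.indicator u) :=
    ((hui.integrableOn_compact_subset hδΩ hK'c).integrable_indicator
      hK'c.measurableSet).locallyIntegrable
  obtain ⟨N, hN⟩ := Metric.tendsto_atTop.1 tendsto_radius δ hδ
  have hrad : ∀ n, (1 / ((n + N : ℕ) + 1) : ℝ) ≤ δ := fun n => by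
    have := hN (n + N) (by omega)
    rw [Real.dist_0_eq_abs, abs_of_pos (by positivity)] at this
    exact this.le
  have hball : ∀ n, ∀ x ∈ K, Metric.closedBall x (1 / ((n + N : ℕ) + 1) : ℝ) ⊆ K' := fun n x hx =>
    closedBall_subset_cthickening' hx (hrad n)
  have hKK' : K ⊆ K' := Metric.self_subset_cthickening K
  refine ⟨fun n => mollify (n + N) (K'.indicator u), fun n => contDiff_mollify _ hu,
    fun n x hx => ?_, ?_, fun i => ?_⟩
  · have h1 : c = ∫ y, moll d (n + N) (x - y) * c := by
      rw [integral_mul_const, integral_sub_left_eq_self (moll d (n + N)), integral_moll, one_mul]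
    rw [h1]
    refine integral_mono ?_ (integrable_moll_mul _ hu x) fun y => ?_
    · exact ((integrable_moll _).comp_sub_left x).mul_const c
    · by_cases hy : y ∈ Metric.closedBall x (1 / ((n + N : ℕ) + 1) : ℝ)
      · have hy' := hball n x hx hy
        simp only [indicator_of_mem hy']
        exact mul_le_mul_of_nonneg_left (hc y (hδΩ hy')) (moll_nonneg _ _)
      · rw [Metric.mem_closedBall, not_le, dist_comm, dist_eq_norm] at hy
        simp only [moll_eq_zero hy, zero_mul, le_refl]
  · filter_upwards [ae_restrict_of_ae (ae_tendsto_mollify hu), ae_restrict_mem hK.measurableSet]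
      with x hx hxK
    rw [indicator_of_mem (hKK' hxK)] at hx
    exact hx.comp (tendsto_add_atTop_nat N)
  · have hgi : MemLp (K'.indicator (g i)) 2 := (memLp_indicator_iff_restrict
      hK'c.measurableSet).2 (hg i K' hδΩ hK'c)
    have hgl : LocallyIntegrable (K'.indicator (g i)) := hgi.locallyIntegrable one_le_two
    refine tendsto_of_tendsto_of_tendsto_of_le_of_le tendsto_const_nhds
      ((tendsto_lintegral_oscSq hgi).comp (tendsto_add_atTop_nat N)) (fun _ => zero_le)
      fun n => ?_
    refine (setLIntegral_mono' hK.measurableSet fun x hx => ?_).trans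
      (setLIntegral_le_lintegral K _)
    rw [pd_mollify_of_weak hΩ (hw i) hK'c hδΩ (hball n x hx)]
    have := enorm_mollify_sub_sq_le hgl (n + N) x
    rwa [indicator_of_mem (hKK' hx)] at this

/-- Integration by parts against a bounded function of a weakly differentiable function. -/
theorem integral_comp_mul_pd {Ω : Set (E d)} (hΩ : IsOpen Ω)
    {u : E d → ℝ} {g : Fin d → E d → ℝ} (hw : ∀ i, HasWeakPartialOn Ω u (g i) i)
    (hui : LocallyIntegrableOn u Ω)
    (hg : ∀ i, ∀ K' ⊆ Ω, IsCompact K' → MemLp (g i) 2 (volume.restrict K')) {c : ℝ}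
    (hc : ∀ x ∈ Ω, c ≤ u x) {F : ℝ → ℝ} (hF : ContDiff ℝ 1 F) {B : ℝ}
    (hFB : ∀ s, c ≤ s → |F s| ≤ B) (hFB' : ∀ s, c ≤ s → |deriv F s| ≤ B) {φ : E d → ℝ}
    (hφ : ContDiff ℝ 1 φ) (hφc : HasCompactSupport φ) (hφΩ : tsupport φ ⊆ Ω) (i : Fin d) :
    ∫ x, F (u x) * pd i φ x = -∫ x, deriv F (u x) * (φ x * g i x) := by
  set K := tsupport φ with hKdef
  have hK : IsCompact K := hφc.isCompact
  obtain ⟨U, hU, hUc, hUt, hUd⟩ := exists_smooth_approx hΩ hK hφΩ hw hui hg hc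
  have hφ0 : ∀ x ∉ K, φ x = 0 := fun x hx => image_eq_zero_of_notMem_tsupport hx
  have hdφ0 : ∀ x ∉ K, pd i φ x = 0 := fun x hx => by
    have : fderiv ℝ φ x = 0 := image_eq_zero_of_notMem_tsupport fun h2 =>
      hx (tsupport_fderiv_subset ℝ h2)
    simp [pd, this]
  have hdφ : Continuous (pd i φ) := (hφ.continuous_fderiv (by simp)).clm_apply continuous_const
  have hdφc : HasCompactSupport (pd i φ) := HasCompactSupport.intro hK hdφ0
  have hF1 : Continuous (deriv F) := hF.continuous_deriv (by simp)
  have hpU : ∀ n, Continuous (pd i (U n)) := fun n =>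
    ((hU n).continuous_fderiv (by simp)).clm_apply continuous_const
  -- the classical identity for the approximations
  have hcl : ∀ n, ∫ x in K, F (U n x) * pd i φ x =
      -∫ x in K, deriv F (U n x) * (φ x * pd i (U n) x) := by
    intro n
    rw [setIntegral_eq_integral_of_forall_compl_eq_zero fun x hx => by rw [hdφ0 x hx, mul_zero],
      setIntegral_eq_integral_of_forall_compl_eq_zero fun x hx => by
        rw [hφ0 x hx, zero_mul, mul_zero]]
    have hFU : ContDiff ℝ 1 fun x => F (U n x) := hF.comp ((hU n).of_le (by simp))
    have hder : ∀ x, fderiv ℝ (fun x => F (U n x)) x (EuclideanSpace.single i 1) =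
        deriv F (U n x) * pd i (U n) x := by
      intro x
      have h1 := ((hF.differentiable (by simp)) (U n x)).hasDerivAt.comp_hasFDerivAt x
        (((hU n).differentiable (by simp)) x).hasFDerivAt
      rw [HasFDerivAt.fderiv (f := fun x => F (U n x)) h1]
      simp
    have h2 : Continuous fun x => fderiv ℝ (fun x => F (U n x)) x (EuclideanSpace.single i 1) :=
      (hFU.continuous_fderiv (by simp)).clm_apply continuous_const
    have key := integral_mul_fderiv_eq_neg_fderiv_mul_of_integrable (μ := volume)
      (f := fun x => F (U n x)) (g := φ) (v := EuclideanSpace.single i 1)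
      ((h2.mul hφ.continuous).integrable_of_hasCompactSupport hφc.mul_left)
      ((hFU.continuous.mul hdφ).integrable_of_hasCompactSupport hdφc.mul_left)
      ((hFU.continuous.mul hφ.continuous).integrable_of_hasCompactSupport hφc.mul_left)
      (fun x _ => hFU.differentiable (by simp) x) (fun x _ => hφ.differentiable (by simp) x)
    rw [key]
    congr 1
    refine integral_congr_ae (ae_of_all _ fun x => ?_)
    simp only [hder]
    ring
  have : IsFiniteMeasure (volume.restrict K) := ⟨by
    rw [Measure.restrict_apply_univ]; exact hK.measure_lt_top⟩
  -- The lower bound `c ≤ U n` on `K` is what makes `F (U n)` uniformly bounded.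
  have hl : Tendsto (fun n => ∫ x in K, F (U n x) * pd i φ x) atTop
      (𝓝 (∫ x in K, F (u x) * pd i φ x)) := by
    refine tendsto_integral_of_dominated_convergence (fun x => B * |pd i φ x|)
      (fun n => ((hF.continuous.comp (hU n).continuous).mul hdφ).aestronglyMeasurable)
      ((hdφ.integrable_of_hasCompactSupport hdφc).abs.const_mul B).integrableOn
      (fun n => ?_) ?_
    · filter_upwards [ae_restrict_mem hK.measurableSet] with x hx
      rw [norm_mul, Real.norm_eq_abs, Real.norm_eq_abs]
      exact mul_le_mul_of_nonneg_right (hFB _ (hUc n x hx)) (abs_nonneg _)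
    · filter_upwards [hUt] with x hx
      exact ((hF.continuous.tendsto _).comp hx).mul_const _
  -- Here `F'(U n)` converges boundedly almost everywhere, while the derivatives of `U n` converge
  -- in `L²` only.
  have hr : Tendsto (fun n => ∫ x in K, deriv F (U n x) * (φ x * pd i (U n) x)) atTop
      (𝓝 (∫ x in K, deriv F (u x) * (φ x * g i x))) := by
    refine tendsto_integral_mul_mul (B := B)
      (fun n => (hF1.comp (hU n).continuous).aestronglyMeasurable)
      (fun n => ?_) ?_ ((hφ.continuous.memLp_of_hasCompactSupport hφc).restrict _) (fun n => ?_)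
      (hg i K hφΩ hK) (hUd i)
    · filter_upwards [ae_restrict_mem hK.measurableSet] with x hx
      exact hFB' _ (hUc n x hx)
    · filter_upwards [hUt] with x hx
      exact (hF1.tendsto _).comp hx
    · obtain ⟨C, hC⟩ := hK.exists_bound_of_continuousOn (hpU n).continuousOn
      exact MemLp.of_bound (hpU n).aestronglyMeasurable C
        ((ae_restrict_iff' hK.measurableSet).2 (ae_of_all _ hC))
  simp only [hcl] at hl
  have h3 := tendsto_nhds_unique hl hr.neg
  rwa [setIntegral_eq_integral_of_forall_compl_eq_zero fun x hx => by rw [hdφ0 x hx, mul_zero],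
      setIntegral_eq_integral_of_forall_compl_eq_zero fun x hx => by
        rw [hφ0 x hx, zero_mul, mul_zero]] at h3

end WeakDerivative

/-! ### Integrals against a density -/

section Density

variable {α : Type*} [MeasurableSpace α] {μ : Measure α} {ρ : α → ℝ}

theorem integral_withDensity_ofReal (hρ : Measurable ρ) (h0 : ∀ x, 0 ≤ ρ x) (f : α → ℝ) :
    ∫ x, f x ∂(μ.withDensity fun x => ENNReal.ofReal (ρ x)) = ∫ x, ρ x * f x ∂μ := by
  rw [integral_withDensity_eq_integral_toReal_smul hρ.ennreal_ofReal
    (ae_of_all _ fun _ => ENNReal.ofReal_lt_top)]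
  simp only [ENNReal.toReal_ofReal (h0 _), smul_eq_mul]

theorem integrable_withDensity_ofReal (hρ : Measurable ρ) (h0 : ∀ x, 0 ≤ ρ x) (f : α → ℝ) :
    Integrable f (μ.withDensity fun x => ENNReal.ofReal (ρ x)) ↔
      Integrable (fun x => ρ x * f x) μ := by
  rw [integrable_withDensity_iff_integrable_smul' hρ.ennreal_ofReal
    (ae_of_all _ fun _ => ENNReal.ofReal_lt_top)]
  simp only [ENNReal.toReal_ofReal (h0 _), smul_eq_mul]

theorem memLp_euclidean_apply {d : ℕ} {α : Type*} [MeasurableSpace α] {μ : Measure α}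
    {G : α → E d} {p : ℝ≥0∞} (hG : MemLp G p μ) (i : Fin d) : MemLp (fun x => G x i) p μ :=
  (EuclideanSpace.proj (𝕜 := ℝ) i : E d →L[ℝ] ℝ).comp_memLp' hG

end Density

/-! ### Smooth cut-offs and a smooth step -/

section Cutoff

variable {d : ℕ}

theorem exists_cutoff {K Ω : Set (E d)} (hK : IsCompact K) (hΩ : IsOpen Ω) (h : K ⊆ Ω) :
    ∃ χ ∈ testFunctions Ω, (∀ x, χ x ∈ Icc (0 : ℝ) 1) ∧ ∀ x ∈ K, χ =ᶠ[𝓝 x] fun _ => 1 := by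
  obtain ⟨δ, hδ, hδΩ⟩ := hK.exists_cthickening_subset_open hΩ h
  have hint : K ⊆ interior (Metric.cthickening δ K) :=
    (Metric.self_subset_thickening hδ K).trans
      (Metric.isOpen_thickening.subset_interior_iff.2 (Metric.thickening_subset_cthickening δ K))
  obtain ⟨f, h1, h2, h3⟩ := exists_contMDiffMap_one_nhds_of_subset_interior
    (modelWithCornersSelf ℝ (E d)) (n := ⊤) hK.isClosed hint
  have hts : tsupport f ⊆ Metric.cthickening δ K :=
    closure_minimal (fun x hx => by by_contra h4; exact hx (h2 x h4)) Metric.isClosed_cthickening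
  refine ⟨f, ⟨f.contMDiff.contDiff, ?_, hts.trans hδΩ⟩, h3, fun x hx => ?_⟩
  · exact (hK.cthickening).of_isClosed_subset (isClosed_tsupport _) hts
  · exact h1.filter_mono (nhds_le_nhdsSet hx)

/-- A smooth function on the line vanishing below `1` and equal to one above `2`. -/
def step (s : ℝ) : ℝ := Real.smoothTransition (s - 1)

theorem contDiff_step : ContDiff ℝ ∞ step :=
  Real.smoothTransition.contDiff.comp (contDiff_id.sub contDiff_const)

theorem step_nonneg (s : ℝ) : 0 ≤ step s := Real.smoothTransition.nonneg _

theorem step_le_one (s : ℝ) : step s ≤ 1 := Real.smoothTransition.le_one _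

theorem step_eq_zero {s : ℝ} (h : s ≤ 1) : step s = 0 :=
  Real.smoothTransition.zero_of_nonpos (by linarith)

theorem step_eq_one {s : ℝ} (h : 2 ≤ s) : step s = 1 :=
  Real.smoothTransition.one_of_one_le (by linarith)

theorem deriv_step_eq_zero {s : ℝ} (h : s < 1 ∨ 2 < s) : deriv step s = 0 := by
  rcases h with h | h
  · have : step =ᶠ[𝓝 s] fun _ => 0 := by
      filter_upwards [gt_mem_nhds h] with y hy using step_eq_zero hy.le
    rw [this.deriv_eq, deriv_const]
  · have : step =ᶠ[𝓝 s] fun _ => 1 := by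
      filter_upwards [lt_mem_nhds h] with y hy using step_eq_one hy.le
    rw [this.deriv_eq, deriv_const]

theorem continuous_deriv_step : Continuous (deriv step) := contDiff_step.continuous_deriv (by simp)

theorem exists_deriv_step_bound : ∃ C : ℝ, 0 ≤ C ∧ ∀ s, |deriv step s| ≤ C := by
  obtain ⟨C, hC⟩ := (isCompact_Icc (a := (1 : ℝ)) (b := 2)).exists_bound_of_continuousOn
    continuous_deriv_step.continuousOn
  refine ⟨max C 0, le_max_right _ _, fun s => ?_⟩
  by_cases hs : s ∈ Icc (1 : ℝ) 2
  · exact (hC s hs).trans (le_max_left _ _)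
  · rw [deriv_step_eq_zero, abs_zero]
    · exact le_max_right _ _
    · rw [mem_Icc, not_and_or, not_le, not_le] at hs
      exact hs

end Cutoff

/-! ### The density `e^{-Φ₁}` and its chain rule -/

section Position

variable {d : ℕ} {Φ₁ : E d → EReal} {G₁ : E d → E d}

/-- The density `exp (-Φ)`. -/
def weight (Φ : E d → EReal) (x : E d) : ℝ := ((-Φ x).exp).toReal

theorem weight_nonneg (Φ : E d → EReal) (x : E d) : 0 ≤ weight Φ x := ENNReal.toReal_nonneg

namespace PositionAssumptions

variable (h : PositionAssumptions Φ₁ G₁)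
include h

theorem exp_ne_top (x : E d) : (-Φ₁ x).exp ≠ ⊤ := by
  obtain ⟨c, hc⟩ := h.bddBelow
  rw [Ne, EReal.exp_eq_top_iff]
  intro h1
  have h2 := hc x
  rw [EReal.neg_eq_top_iff] at h1
  rw [h1] at h2
  exact absurd h2 (by simp)

theorem ofReal_weight (x : E d) : ENNReal.ofReal (weight Φ₁ x) = (-Φ₁ x).exp :=
  ENNReal.ofReal_toReal (h.exp_ne_top x)

theorem gibbs_eq : gibbs Φ₁ = volume.withDensity fun x => ENNReal.ofReal (weight Φ₁ x) := by
  unfold gibbs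
  simp only [h.ofReal_weight]

theorem continuous_weight : Continuous (weight Φ₁) :=
  ENNReal.continuousOn_toReal.comp_continuous h.continuous_exp fun x => h.exp_ne_top x

theorem weight_pos_iff (x : E d) : 0 < weight Φ₁ x ↔ x ∈ finiteSet Φ₁ := by
  unfold weight finiteSet
  rw [ENNReal.toReal_pos_iff, EReal.zero_lt_exp_iff, Set.mem_ofPred_eq, bot_lt_iff_ne_bot, Ne,
    EReal.neg_eq_bot_iff, lt_top_iff_ne_top, lt_top_iff_ne_top]
  exact ⟨fun h1 => h1.1, fun h1 => ⟨h1, h.exp_ne_top x⟩⟩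

theorem weight_eq_zero {x : E d} (hx : x ∉ finiteSet Φ₁) : weight Φ₁ x = 0 :=
  le_antisymm (not_lt.1 fun h1 => hx ((h.weight_pos_iff x).1 h1)) (weight_nonneg _ _)

theorem isOpen_finiteSet : IsOpen (finiteSet Φ₁) := by
  have : finiteSet Φ₁ = weight Φ₁ ⁻¹' Ioi 0 := by
    ext x; exact (h.weight_pos_iff x).symm
  rw [this]
  exact isOpen_Ioi.preimage h.continuous_weight

theorem coe_toReal {x : E d} (hx : x ∈ finiteSet Φ₁) : ((Φ₁ x).toReal : EReal) = Φ₁ x := by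
  obtain ⟨c, hc⟩ := h.bddBelow
  refine EReal.coe_toReal hx.ne fun h1 => ?_
  have h2 := hc x
  rw [h1] at h2
  exact absurd h2 (by simp)

theorem weight_eq_exp {x : E d} (hx : x ∈ finiteSet Φ₁) :
    weight Φ₁ x = Real.exp (-(Φ₁ x).toReal) := by
  unfold weight
  nth_rw 1 [← h.coe_toReal hx]
  rw [← EReal.coe_neg, EReal.exp_coe, ENNReal.toReal_ofReal (Real.exp_pos _).le]

theorem exists_lower_bound : ∃ c : ℝ, (∀ x ∈ finiteSet Φ₁, c ≤ (Φ₁ x).toReal) ∧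
    ∀ x, weight Φ₁ x ≤ Real.exp (-c) := by
  obtain ⟨c, hc⟩ := h.bddBelow
  have h1 : ∀ x ∈ finiteSet Φ₁, c ≤ (Φ₁ x).toReal := fun x hx => by
    have := hc x
    rw [← h.coe_toReal hx, EReal.coe_le_coe_iff] at this
    exact this
  refine ⟨c, h1, fun x => ?_⟩
  by_cases hx : x ∈ finiteSet Φ₁
  · rw [h.weight_eq_exp hx]
    exact Real.exp_le_exp.2 (neg_le_neg (h1 x hx))
  · rw [h.weight_eq_zero hx]
    exact (Real.exp_pos _).le

/-- On `{Φ₁ < ∞}` the potential is minus the logarithm of a positive continuous density, hence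
continuous. -/
theorem locallyIntegrableOn : LocallyIntegrableOn (fun x => (Φ₁ x).toReal) (finiteSet Φ₁) := by
  refine ContinuousOn.locallyIntegrableOn (fun x hx => ?_) h.isOpen_finiteSet.measurableSet
  refine ContinuousWithinAt.congr (f := fun x => -Real.log (weight Φ₁ x)) ?_ (fun y hy => ?_) ?_
  · exact ((h.continuous_weight.continuousAt).log
      ((h.weight_pos_iff x).2 hx).ne').neg.continuousWithinAt
  · rw [h.weight_eq_exp hy, Real.log_exp, neg_neg]
  · rw [h.weight_eq_exp hx, Real.log_exp, neg_neg]

theorem integral_gibbs (f : E d → ℝ) : ∫ x, f x ∂gibbs Φ₁ = ∫ x, weight Φ₁ x * f x := by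
  rw [h.gibbs_eq]
  exact integral_withDensity_ofReal h.continuous_weight.measurable (weight_nonneg _) f

theorem integrable_gibbs (f : E d → ℝ) :
    Integrable f (gibbs Φ₁) ↔ Integrable fun x => weight Φ₁ x * f x := by
  rw [h.gibbs_eq]
  exact integrable_withDensity_ofReal h.continuous_weight.measurable (weight_nonneg _) f

theorem lintegral_gibbs (f : E d → ℝ≥0∞) :
    ∫⁻ x, f x ∂gibbs Φ₁ = ∫⁻ x, ENNReal.ofReal (weight Φ₁ x) * f x := by
  rw [h.gibbs_eq, lintegral_withDensity_eq_lintegral_mul_non_measurable _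
    h.continuous_weight.measurable.ennreal_ofReal (ae_of_all _ fun _ => ENNReal.ofReal_lt_top)]
  rfl

/-- Where the density is bounded below, Lebesgue measure is dominated by `μ_{Φ₁}`; this transfers
`∇Φ₁ ∈ L²(μ_{Φ₁})` to unweighted local `L²` bounds. -/
theorem exists_restrict_le {K : Set (E d)} (hK : IsCompact K) {s : ℝ} (hs : 0 < s)
    (hKs : ∀ x ∈ K, s ≤ weight Φ₁ x) :
    volume.restrict K ≤ (ENNReal.ofReal s)⁻¹ • (gibbs Φ₁).restrict K := by
  have h1 : ENNReal.ofReal s • volume.restrict K ≤ (gibbs Φ₁).restrict K := by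
    rw [h.gibbs_eq, restrict_withDensity hK.measurableSet, ← withDensity_const]
    refine withDensity_mono ?_
    filter_upwards [ae_restrict_mem hK.measurableSet] with x hx
    exact ENNReal.ofReal_le_ofReal (hKs x hx)
  have h2 : (ENNReal.ofReal s)⁻¹ • (ENNReal.ofReal s • volume.restrict K) = volume.restrict K := by
    rw [smul_smul, ENNReal.inv_mul_cancel (by simpa using hs) ENNReal.ofReal_ne_top, one_smul]
  rw [← h2]
  gcongr

theorem exists_weight_ge {K : Set (E d)} (hK : IsCompact K) (hKΩ : K ⊆ finiteSet Φ₁) :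
    ∃ s > 0, ∀ x ∈ K, s ≤ weight Φ₁ x := by
  rcases K.eq_empty_or_nonempty with rfl | hne
  · exact ⟨1, one_pos, fun x hx => absurd hx (notMem_empty x)⟩
  obtain ⟨x, hx, hmin⟩ := hK.exists_isMinOn hne h.continuous_weight.continuousOn
  exact ⟨weight Φ₁ x, (h.weight_pos_iff x).2 (hKΩ hx), fun y hy => hmin hy⟩

theorem memLp_restrict {K : Set (E d)} (hK : IsCompact K) (hKΩ : K ⊆ finiteSet Φ₁) :
    MemLp G₁ 2 (volume.restrict K) := by
  obtain ⟨s, hs, hKs⟩ := h.exists_weight_ge hK hKΩ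
  exact (h.gradient_memLp.restrict K).of_measure_le_smul (by simpa using hs)
    (h.exists_restrict_le hK hs hKs)

/-- The chain rule for functions of the density, on `{Φ₁ < ∞}`. -/
theorem integral_comp_weight_mul_pd_of_tsupport {a : ℝ → ℝ} (ha : ContDiff ℝ 1 a) {φ : E d → ℝ}
    (hφ : ContDiff ℝ 1 φ) (hφc : HasCompactSupport φ) (hφΩ : tsupport φ ⊆ finiteSet Φ₁)
    (i : Fin d) :
    ∫ x, a (weight Φ₁ x) * pd i φ x =
      ∫ x, deriv a (weight Φ₁ x) * (weight Φ₁ x * (G₁ x i * φ x)) := by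
  obtain ⟨c, hc, -⟩ := h.exists_lower_bound
  -- Apply the chain rule for `Φ₁` to `s ↦ a(e^{-s})`; for `s ≥ c` the argument of `a` stays in `[0,
  -- e^{-c}]`, whence the bounds.
  have hF : ContDiff ℝ 1 fun s => a (Real.exp (-s)) := ha.comp (Real.contDiff_exp.comp contDiff_neg)
  have hF' : ∀ s, deriv (fun s => a (Real.exp (-s))) s =
      -(deriv a (Real.exp (-s)) * Real.exp (-s)) := by
    intro s
    have h1 : HasDerivAt (fun s : ℝ => Real.exp (-s)) (Real.exp (-s) * (-1)) s :=
      (hasDerivAt_neg s).exp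
    have h2 := ((ha.differentiable (by simp)) (Real.exp (-s))).hasDerivAt.comp s h1
    rw [HasDerivAt.deriv (f := fun s => a (Real.exp (-s))) h2]
    ring
  obtain ⟨B₁, hB₁⟩ := (isCompact_Icc (a := (0 : ℝ)) (b := Real.exp (-c))).exists_bound_of_continuousOn
    ha.continuous.continuousOn
  obtain ⟨B₂, hB₂⟩ := (isCompact_Icc (a := (0 : ℝ)) (b := Real.exp (-c))).exists_bound_of_continuousOn
    (f := fun t => deriv a t * t)
    ((ha.continuous_deriv le_rfl).mul continuous_id).continuousOn
  have hmem : ∀ s, c ≤ s → Real.exp (-s) ∈ Icc (0 : ℝ) (Real.exp (-c)) := fun s hs =>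
    ⟨(Real.exp_pos _).le, Real.exp_le_exp.2 (neg_le_neg hs)⟩
  have key := integral_comp_mul_pd h.isOpen_finiteSet h.weakGradient h.locallyIntegrableOn
    (fun j K hK hKc => memLp_euclidean_apply (h.memLp_restrict hKc hK) j) hc hF (B := max B₁ B₂)
    (fun s hs => (hB₁ _ (hmem s hs)).trans (le_max_left _ _)) (fun s hs => by
      rw [hF', abs_neg]
      exact (hB₂ _ (hmem s hs)).trans (le_max_right _ _)) hφ hφc hφΩ i
  have e1 : ∀ x, a (weight Φ₁ x) * pd i φ x = a (Real.exp (-(Φ₁ x).toReal)) * pd i φ x := by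
    intro x
    by_cases hx : x ∈ tsupport φ
    · rw [h.weight_eq_exp (hφΩ hx)]
    · have : fderiv ℝ φ x = 0 := image_eq_zero_of_notMem_tsupport fun h2 =>
        hx (tsupport_fderiv_subset ℝ h2)
      simp [pd, this]
  simp only [e1, key, hF', ← integral_neg]
  congr 1 with x
  by_cases hx : x ∈ tsupport φ
  · rw [h.weight_eq_exp (hφΩ hx)]; ring
  · rw [image_eq_zero_of_notMem_tsupport hx]; ring

/-- The chain rule for functions of the density which vanish near zero. -/
theorem integral_comp_weight_mul_pd {a : ℝ → ℝ} (ha : ContDiff ℝ 1 a) {s₀ : ℝ} (hs₀ : 0 < s₀)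
    (ha0 : ∀ s ≤ s₀, a s = 0) {φ : E d → ℝ} (hφ : ContDiff ℝ 1 φ) (hφc : HasCompactSupport φ)
    (i : Fin d) :
    ∫ x, a (weight Φ₁ x) * pd i φ x =
      ∫ x, deriv a (weight Φ₁ x) * (weight Φ₁ x * (G₁ x i * φ x)) := by
  set K := tsupport φ ∩ weight Φ₁ ⁻¹' Ici s₀ with hKdef
  have hK : IsCompact K := hφc.isCompact.inter_right (isClosed_Ici.preimage h.continuous_weight)
  have hKΩ : K ⊆ finiteSet Φ₁ := fun x hx => (h.weight_pos_iff x).1 (hs₀.trans_le hx.2)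
  -- Replacing `φ` by `φ χ`, supported in `{Φ₁ < ∞}`, alters neither side: `χ = 1` near the part of
  -- the support where the density is at least `s₀`, and elsewhere the integrands vanish.
  obtain ⟨χ, hχ, -, hχ1⟩ := exists_cutoff hK h.isOpen_finiteSet hKΩ
  have hφχ : ContDiff ℝ 1 fun x => φ x * χ x := hφ.mul (hχ.1.of_le (by simp))
  have key := h.integral_comp_weight_mul_pd_of_tsupport ha hφχ (hφc.mul_right)
    ((tsupport_mul_subset_right (f := φ) (g := χ)).trans hχ.2.2) i
  have ha0' : ∀ s < s₀, deriv a s = 0 := fun s hs => by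
    have : a =ᶠ[𝓝 s] fun _ => 0 := by
      filter_upwards [gt_mem_nhds hs] with y hy using ha0 y hy.le
    rw [this.deriv_eq, deriv_const]
  have hcases : ∀ x, x ∈ K ∨ x ∉ tsupport φ ∨ weight Φ₁ x < s₀ := by
    intro x
    by_cases h1 : x ∈ tsupport φ
    · by_cases h2 : s₀ ≤ weight Φ₁ x
      · exact Or.inl ⟨h1, h2⟩
      · exact Or.inr (Or.inr (not_le.1 h2))
    · exact Or.inr (Or.inl h1)
  have hzero : ∀ (f : E d → ℝ) x, x ∉ tsupport f → pd i f x = 0 := fun f x hx => by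
    have : fderiv ℝ f x = 0 := image_eq_zero_of_notMem_tsupport fun h2 =>
      hx (tsupport_fderiv_subset ℝ h2)
    simp [pd, this]
  have e1 : ∀ x, a (weight Φ₁ x) * pd i φ x = a (weight Φ₁ x) * pd i (fun x => φ x * χ x) x := by
    intro x
    rcases hcases x with hx | hx | hx
    · have : (fun x => φ x * χ x) =ᶠ[𝓝 x] φ := by
        filter_upwards [hχ1 x hx] with y hy
        rw [hy, mul_one]
      simp only [pd, this.fderiv_eq]
    · rw [hzero φ x hx, hzero _ x fun h2 => hx ((tsupport_mul_subset_left (f := φ) (g := χ)) h2)]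
    · rw [ha0 _ hx.le, zero_mul, zero_mul]
  have e2 : ∀ x, deriv a (weight Φ₁ x) * (weight Φ₁ x * (G₁ x i * φ x)) =
      deriv a (weight Φ₁ x) * (weight Φ₁ x * (G₁ x i * (φ x * χ x))) := by
    intro x
    rcases hcases x with hx | hx | hx
    · rw [(hχ1 x hx).self_of_nhds, mul_one]
    · rw [image_eq_zero_of_notMem_tsupport hx, zero_mul]
    · rw [ha0' _ hx, zero_mul, zero_mul]
  simp only [e1, e2]
  exact key

end PositionAssumptions

/-- `G` is the (negative) logarithmic gradient of `μ` on `Ω`. -/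
def IsLogGradient (Ω : Set (E d)) (μ : Measure (E d)) (G : E d → E d) : Prop :=
  ∀ φ : E d → ℝ, ContDiff ℝ 1 φ → HasCompactSupport φ → tsupport φ ⊆ Ω →
    ∀ i, ∫ x, pd i φ x ∂μ = ∫ x, G x i * φ x ∂μ

theorem PositionAssumptions.isLogGradient (h : PositionAssumptions Φ₁ G₁) :
    IsLogGradient (finiteSet Φ₁) (gibbs Φ₁) G₁ := by
  intro φ hφ hφc hφΩ i
  rw [h.integral_gibbs, h.integral_gibbs]
  have := h.integral_comp_weight_mul_pd_of_tsupport contDiff_id hφ hφc hφΩ i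
  simpa using this

end Position

/-! ### The velocity potential: integration by parts and relative boundedness -/

section Velocity

variable {d : ℕ} {Φ₂ : E d → ℝ} {G₂ : E d → E d} {H₂ : Fin d → E d → ℝ}

/-- Because `α < 2`, the growth of `ΔΦ₂` is dominated by an arbitrarily small multiple of `|∇Φ₂|²`
plus a constant; the multiple `1/4` is the one needed for absorption. -/
theorem exists_rpow_le {K α : ℝ} (hK : 0 < K) (hα : α < 2) (hα0 : 0 ≤ α) :
    ∃ C : ℝ, 0 ≤ C ∧ ∀ t : ℝ, 0 ≤ t → K * (1 + t ^ α) ≤ t ^ 2 / 4 + C := by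
  -- Threshold with `T^{2-α} = 4K`: beyond it `K t^α ≤ t²/4`, below it `t^α ≤ T^α`.
  set T : ℝ := (4 * K) ^ (1 / (2 - α)) with hT
  have hT0 : 0 < T := Real.rpow_pos_of_pos (by linarith) _
  have hTα : T ^ (2 - α) = 4 * K := by
    rw [hT, ← Real.rpow_mul (by linarith), one_div, inv_mul_cancel₀ (by linarith), Real.rpow_one]
  refine ⟨K * (1 + T ^ α), by positivity, fun t ht => ?_⟩
  rcases le_total t T with h | h
  · have h1 : t ^ α ≤ T ^ α := Real.rpow_le_rpow ht h hα0
    have : K * (1 + t ^ α) ≤ K * (1 + T ^ α) := by gcongr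
    nlinarith [sq_nonneg t]
  · have ht0 : 0 < t := hT0.trans_le h
    have h1 : 4 * K ≤ t ^ (2 - α) := by
      rw [← hTα]
      exact Real.rpow_le_rpow hT0.le h (by linarith)
    have h2 : t ^ α * t ^ (2 - α) = t ^ 2 := by
      rw [← Real.rpow_add ht0, ← Real.rpow_natCast]
      norm_num
    have h3 : t ^ α * (4 * K) ≤ t ^ 2 := by
      rw [← h2]
      exact mul_le_mul_of_nonneg_left h1 (by positivity)
    have h4 : 0 ≤ K * T ^ α := by positivity
    linarith

namespace VelocityAssumptions

variable (h : VelocityAssumptions Φ₂ G₂ H₂)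
include h

theorem measurable_density : Measurable fun v => Real.exp (-Φ₂ v) :=
  Real.measurable_exp.comp h.measurable.neg

omit h in
theorem gibbs_eq : gibbs (fun v => (Φ₂ v : EReal)) =
    volume.withDensity fun v => ENNReal.ofReal (Real.exp (-Φ₂ v)) := by
  unfold gibbs
  simp only [← EReal.coe_neg, EReal.exp_coe]

theorem integral_gibbs (f : E d → ℝ) :
    ∫ v, f v ∂gibbs (fun v => (Φ₂ v : EReal)) = ∫ v, Real.exp (-Φ₂ v) * f v := by
  rw [gibbs_eq]
  exact integral_withDensity_ofReal h.measurable_density (fun _ => (Real.exp_pos _).le) f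

theorem isProbabilityMeasure : IsProbabilityMeasure (gibbs fun v => (Φ₂ v : EReal)) :=
  ⟨h.mass_one⟩

theorem memLp_restrict (i : Fin d) {K : Set (E d)} (hK : IsCompact K) :
    MemLp (fun v => G₂ v i) 2 (volume.restrict K) :=
  memLp_euclidean_apply (h.gradient_loc K hK) i

theorem isLogGradient : IsLogGradient univ (gibbs fun v => (Φ₂ v : EReal)) G₂ := by
  intro φ hφ hφc hφΩ i
  obtain ⟨c, hc⟩ := h.bddBelow
  have hF : ContDiff ℝ 1 fun s : ℝ => Real.exp (-s) := Real.contDiff_exp.comp contDiff_neg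
  have hF' : ∀ s, deriv (fun s : ℝ => Real.exp (-s)) s = -Real.exp (-s) := fun s => by
    have h1 : HasDerivAt (fun s : ℝ => Real.exp (-s)) (Real.exp (-s) * (-1)) s :=
      (hasDerivAt_neg s).exp
    rw [h1.deriv]; ring
  have hB : ∀ s, c ≤ s → |Real.exp (-s)| ≤ Real.exp (-c) := fun s hs => by
    rw [abs_of_pos (Real.exp_pos _)]
    exact Real.exp_le_exp.2 (neg_le_neg hs)
  have key := integral_comp_mul_pd isOpen_univ h.weakGradient
    (h.locallyIntegrable.locallyIntegrableOn _) (fun j K _ hK => h.memLp_restrict j hK)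
    (fun v _ => hc v) hF hB (fun s hs => by rw [hF', abs_neg]; exact hB s hs) hφ hφc hφΩ i
  rw [h.integral_gibbs, h.integral_gibbs, key, ← integral_neg]
  congr 1 with v
  rw [hF']; ring

/-- Formally this is `∂ᵢ(∂ᵢΦ₂) = H₂ i` tested with `θ² e^{-Φ₂}`. As `Φ₂` is only weakly
differentiable, `θ² e^{-U n}` is used, with `U n` smooth and converging to `Φ₂`. -/
theorem integral_sq_mul_second {θ : E d → ℝ} (hθ : θ ∈ testFunctions (univ : Set (E d)))
    (i : Fin d) :
    (∫ v, Real.exp (-Φ₂ v) * (2 * θ v * pd i θ v * G₂ v i)) -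
      ∫ v, Real.exp (-Φ₂ v) * (θ v ^ 2 * G₂ v i * G₂ v i) =
      -∫ v, Real.exp (-Φ₂ v) * (θ v ^ 2 * H₂ i v) := by
  obtain ⟨c, hc⟩ := h.bddBelow
  obtain ⟨hθ1, hθc, -⟩ := hθ
  set K := tsupport θ with hKdef
  have hK : IsCompact K := hθc.isCompact
  obtain ⟨U, hU, hUc, hUt, hUd⟩ := exists_smooth_approx isOpen_univ hK (subset_univ _)
    h.weakGradient (h.locallyIntegrable.locallyIntegrableOn _)
    (fun j K _ hK => h.memLp_restrict j hK) (fun v _ => hc v)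
  have hθ0 : ∀ x ∉ K, θ x = 0 := fun x hx => image_eq_zero_of_notMem_tsupport hx
  have hdθ0 : ∀ x ∉ K, pd i θ x = 0 := fun x hx => by
    have : fderiv ℝ θ x = 0 := image_eq_zero_of_notMem_tsupport fun h2 =>
      hx (tsupport_fderiv_subset ℝ h2)
    simp [pd, this]
  have hθcont : Continuous θ := hθ1.continuous
  have hdθ : Continuous (pd i θ) := (hθ1.continuous_fderiv (by simp)).clm_apply continuous_const
  have hpU : ∀ n, Continuous (pd i (U n)) := fun n =>
    ((hU n).continuous_fderiv (by simp)).clm_apply continuous_const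
  have hcl : ∀ n, (∫ x in K, Real.exp (-U n x) * (2 * θ x * pd i θ x * G₂ x i)) -
      ∫ x in K, Real.exp (-U n x) * ((θ x ^ 2 * G₂ x i) * pd i (U n) x) =
      -∫ x in K, Real.exp (-U n x) * (θ x ^ 2 * H₂ i x) := by
    intro n
    have hψ : ContDiff ℝ ∞ fun x => θ x ^ 2 * Real.exp (-U n x) :=
      (hθ1.pow 2).mul (hU n).neg.exp
    have hψc : HasCompactSupport fun x => θ x ^ 2 * Real.exp (-U n x) :=
      HasCompactSupport.intro hK fun x hx => by simp [hθ0 x hx]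
    have hder : ∀ x, fderiv ℝ (fun x => θ x ^ 2 * Real.exp (-U n x)) x
        (EuclideanSpace.single i 1) = Real.exp (-U n x) * (2 * θ x * pd i θ x) -
          Real.exp (-U n x) * (θ x ^ 2 * pd i (U n) x) := by
      intro x
      have h1 := ((hθ1.differentiable (by simp)) x).hasFDerivAt
      have h2 := (((hU n).differentiable (by simp)) x).hasFDerivAt
      rw [HasFDerivAt.fderiv (f := fun x => θ x ^ 2 * Real.exp (-U n x)) ((h1.pow 2).mul h2.neg.exp)]
      simp [pd]
      ring
    have key := (h.weakSecond i).parts _ ⟨hψ, hψc, subset_univ _⟩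
    simp only [hder, Measure.restrict_univ] at key
    rw [← setIntegral_eq_integral_of_forall_compl_eq_zero (s := K)
      (fun x hx => by rw [hθ0 x hx]; ring),
      ← setIntegral_eq_integral_of_forall_compl_eq_zero (s := K)
      (f := fun x => H₂ i x * (θ x ^ 2 * Real.exp (-U n x)))
      (fun x hx => by rw [hθ0 x hx]; ring)] at key
    have hGi : IntegrableOn (fun x => G₂ x i) K := by
      have : IsFiniteMeasure (volume.restrict K) := ⟨by
        rw [Measure.restrict_apply_univ]; exact hK.measure_lt_top⟩
      exact (h.memLp_restrict i hK).integrable one_le_two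
    rw [← integral_sub]
    · convert key using 1
      · congr 1 with x; ring
      · congr 2 with x; ring
    · have : Continuous fun x => Real.exp (-U n x) * (2 * θ x * pd i θ x) := by
        have := (hU n).continuous
        fun_prop
      refine (hGi.continuousOn_mul this.continuousOn hK).congr_fun (fun x _ => ?_)
        hK.measurableSet
      simp only; ring
    · have : Continuous fun x => Real.exp (-U n x) * (θ x ^ 2 * pd i (U n) x) := by
        have := (hU n).continuous
        have := hpU n
        fun_prop
      refine (hGi.continuousOn_mul this.continuousOn hK).congr_fun (fun x _ => ?_)
        hK.measurableSet
      simp only; ring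
  have hfin : IsFiniteMeasure (volume.restrict K) := ⟨by
    rw [Measure.restrict_apply_univ]; exact hK.measure_lt_top⟩
  have hexpB : ∀ n, ∀ᵐ x ∂volume.restrict K, |Real.exp (-U n x)| ≤ Real.exp (-c) := fun n => by
    filter_upwards [ae_restrict_mem hK.measurableSet] with x hx
    rw [abs_of_pos (Real.exp_pos _)]
    exact Real.exp_le_exp.2 (neg_le_neg (hUc n x hx))
  have hexpm : ∀ n, AEStronglyMeasurable (fun x => Real.exp (-U n x)) (volume.restrict K) :=
    fun n => (Real.continuous_exp.comp (hU n).continuous.neg).aestronglyMeasurable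
  have hexpt : ∀ᵐ x ∂volume.restrict K,
      Tendsto (fun n => Real.exp (-U n x)) atTop (𝓝 (Real.exp (-Φ₂ x))) := by
    filter_upwards [hUt] with x hx
    exact (Real.continuous_exp.tendsto _).comp hx.neg
  have hdom : ∀ f : E d → ℝ, IntegrableOn f K →
      Tendsto (fun n => ∫ x in K, Real.exp (-U n x) * f x) atTop
        (𝓝 (∫ x in K, Real.exp (-Φ₂ x) * f x)) := by
    intro f hf
    refine tendsto_integral_of_dominated_convergence (fun x => Real.exp (-c) * |f x|)
      (fun n => (hexpm n).mul hf.1) (hf.abs.const_mul _) (fun n => ?_) ?_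
    · filter_upwards [hexpB n] with x hx
      rw [norm_mul]
      exact mul_le_mul_of_nonneg_right hx (abs_nonneg _)
    · filter_upwards [hexpt] with x hx using hx.mul_const _
  have hGi := h.memLp_restrict i hK
  have l1 := hdom (fun x => 2 * θ x * pd i θ x * G₂ x i)
    ((show IntegrableOn (fun x => G₂ x i) K volume from hGi.integrable one_le_two).continuousOn_mul
      (by fun_prop) hK)
  have l3 := hdom (fun x => θ x ^ 2 * H₂ i x)
    ((((h.weakSecond i).right.integrableOn_compact_subset (subset_univ _) hK)).continuousOn_mul
      (by fun_prop) hK)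
  have l2 : Tendsto (fun n => ∫ x in K, Real.exp (-U n x) * ((θ x ^ 2 * G₂ x i) * pd i (U n) x))
      atTop (𝓝 (∫ x in K, Real.exp (-Φ₂ x) * ((θ x ^ 2 * G₂ x i) * G₂ x i))) := by
    refine tendsto_integral_mul_mul hexpm hexpB hexpt ?_ (fun n => ?_) hGi (hUd i)
    · obtain ⟨C, hC⟩ := hK.exists_bound_of_continuousOn
        (show Continuous fun x => θ x ^ 2 by fun_prop).continuousOn
      refine MemLp.of_le_mul (c := C) hGi ((hθcont.pow 2).aestronglyMeasurable.mul hGi.1) ?_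
      filter_upwards [ae_restrict_mem hK.measurableSet] with x hx
      rw [norm_mul]
      exact mul_le_mul_of_nonneg_right (hC x hx) (norm_nonneg _)
    · obtain ⟨C, hC⟩ := hK.exists_bound_of_continuousOn (hpU n).continuousOn
      exact MemLp.of_bound (hpU n).aestronglyMeasurable C
        ((ae_restrict_iff' hK.measurableSet).2 (ae_of_all _ hC))
  have l4 := l1.sub l2
  have h3 := tendsto_nhds_unique (l4.congr hcl) l3.neg
  rwa [setIntegral_eq_integral_of_forall_compl_eq_zero fun x hx => by rw [hθ0 x hx]; ring,
    setIntegral_eq_integral_of_forall_compl_eq_zero fun x hx => by rw [hθ0 x hx]; ring,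
    setIntegral_eq_integral_of_forall_compl_eq_zero fun x hx => by rw [hθ0 x hx]; ring] at h3

/-- Relative boundedness of multiplication by `∇Φ₂` with respect to the gradient. -/
theorem exists_relative_bound : ∃ C : ℝ, 0 ≤ C ∧ ∀ θ ∈ testFunctions (univ : Set (E d)),
    ∑ i, ∫ v, (G₂ v i * θ v) ^ 2 ∂gibbs (fun v => (Φ₂ v : EReal)) ≤
      C * (∑ i, ∫ v, pd i θ v ^ 2 ∂gibbs (fun v => (Φ₂ v : EReal)) +
        ∫ v, θ v ^ 2 ∂gibbs (fun v => (Φ₂ v : EReal))) := by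
  obtain ⟨K, α, hK, hα1, hα2, hH⟩ := h.laplacian_le
  obtain ⟨C, hC0, hC⟩ := exists_rpow_le hK hα2 (by linarith)
  obtain ⟨c, hc⟩ := h.bddBelow
  -- With `S = ∑ ∫ (∂ᵢΦ₂ θ)²`, `P = ∑ ∫ (∂ᵢθ)²` and `Q = ∫ θ²`, the estimate below is `S ≤ S/2 + 4 P
  -- + C Q`; absorbing `S/2` doubles the constants.
  refine ⟨8 + 2 * C, by linarith, fun θ hθ => ?_⟩
  simp only [h.integral_gibbs]
  obtain ⟨hθ1, hθc, -⟩ := id hθ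
  have hKc : IsCompact (tsupport θ) := hθc.isCompact
  have hθ0 : ∀ x ∉ tsupport θ, θ x = 0 := fun x hx => image_eq_zero_of_notMem_tsupport hx
  have hθcont : Continuous θ := hθ1.continuous
  have hdθ : ∀ i, Continuous (pd i θ) := fun i =>
    (hθ1.continuous_fderiv (by simp)).clm_apply continuous_const
  have hdθ0 : ∀ i, ∀ x ∉ tsupport θ, pd i θ x = 0 := fun i x hx => by
    have : fderiv ℝ θ x = 0 := image_eq_zero_of_notMem_tsupport fun h2 =>
      hx (tsupport_fderiv_subset ℝ h2)
    simp [pd, this]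
  have hint : ∀ f : E d → ℝ, (∀ x ∉ tsupport θ, f x = 0) → IntegrableOn f (tsupport θ) →
      Integrable fun v => Real.exp (-Φ₂ v) * f v := by
    intro f hf0 hf
    have h1 : Integrable f := by
      have := hf.integrable_indicator hKc.measurableSet
      refine this.congr (ae_of_all _ fun x => ?_)
      by_cases hx : x ∈ tsupport θ
      · rw [indicator_of_mem hx]
      · rw [indicator_of_notMem hx, hf0 x hx]
    refine h1.bdd_mul (c := Real.exp (-c)) h.measurable_density.aestronglyMeasurable
      (ae_of_all _ fun v => ?_)
    rw [Real.norm_of_nonneg (Real.exp_pos _).le]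
    exact Real.exp_le_exp.2 (neg_le_neg (hc v))
  have hfin : IsFiniteMeasure (volume.restrict (tsupport θ)) := ⟨by
    rw [Measure.restrict_apply_univ]; exact hKc.measure_lt_top⟩
  have iG : ∀ i, Integrable fun v => Real.exp (-Φ₂ v) * (2 * θ v * pd i θ v * G₂ v i) := fun i =>
    hint _ (fun x hx => by rw [hθ0 x hx]; ring)
      ((show IntegrableOn (fun x => G₂ x i) (tsupport θ) volume from
        (h.memLp_restrict i hKc).integrable one_le_two).continuousOn_mul
        (by have := hdθ i; fun_prop) hKc)
  have iGG : ∀ i, Integrable fun v => Real.exp (-Φ₂ v) * (θ v ^ 2 * G₂ v i * G₂ v i) := fun i => by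
    have h1 : IntegrableOn (fun v => G₂ v i * G₂ v i) (tsupport θ) :=
      (h.memLp_restrict i hKc).integrable_mul (h.memLp_restrict i hKc)
    have h2 := hint (fun v => θ v ^ 2 * (G₂ v i * G₂ v i)) (fun x hx => by rw [hθ0 x hx]; ring)
      (h1.continuousOn_mul (by fun_prop) hKc)
    simpa only [mul_assoc] using h2
  have iH : ∀ i, Integrable fun v => Real.exp (-Φ₂ v) * (θ v ^ 2 * H₂ i v) := fun i =>
    hint _ (fun x hx => by rw [hθ0 x hx]; ring)
      (((h.weakSecond i).right.integrableOn_compact_subset (subset_univ _) hKc).continuousOn_mul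
      (by fun_prop) hKc)
  have iD : ∀ i, Integrable fun v => Real.exp (-Φ₂ v) * pd i θ v ^ 2 := fun i =>
    hint _ (fun x hx => by rw [hdθ0 i x hx]; ring)
      (((hdθ i).pow 2).continuousOn.integrableOn_compact hKc)
  have iT : Integrable fun v => Real.exp (-Φ₂ v) * θ v ^ 2 :=
    hint _ (fun x hx => by rw [hθ0 x hx]; ring) ((hθcont.pow 2).continuousOn.integrableOn_compact hKc)
  have iGH : ∀ i, Integrable fun v => Real.exp (-Φ₂ v) * (2 * θ v * pd i θ v * G₂ v i) +
      Real.exp (-Φ₂ v) * (θ v ^ 2 * H₂ i v) := fun i => (iG i).add (iH i)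
  have iGD : ∀ i, Integrable fun v => 1 / 2 * (Real.exp (-Φ₂ v) * (θ v ^ 2 * G₂ v i * G₂ v i)) +
      4 * (Real.exp (-Φ₂ v) * pd i θ v ^ 2) :=
    fun i => ((iGG i).const_mul _).add ((iD i).const_mul _)
  have hid : ∑ i, ∫ v, Real.exp (-Φ₂ v) * (θ v ^ 2 * G₂ v i * G₂ v i) =
      ∫ v, ∑ i, (Real.exp (-Φ₂ v) * (2 * θ v * pd i θ v * G₂ v i) +
        Real.exp (-Φ₂ v) * (θ v ^ 2 * H₂ i v)) := by
    rw [integral_finsetSum _ fun i _ => iGH i]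
    refine Finset.sum_congr rfl fun i _ => ?_
    rw [integral_add (iG i) (iH i)]
    linarith [h.integral_sq_mul_second hθ i]
  have hle : ∫ v, ∑ i, (Real.exp (-Φ₂ v) * (2 * θ v * pd i θ v * G₂ v i) +
        Real.exp (-Φ₂ v) * (θ v ^ 2 * H₂ i v)) ≤
      ∫ v, (∑ i, (1 / 2 * (Real.exp (-Φ₂ v) * (θ v ^ 2 * G₂ v i * G₂ v i)) +
        4 * (Real.exp (-Φ₂ v) * pd i θ v ^ 2)) + C * (Real.exp (-Φ₂ v) * θ v ^ 2)) := by
    refine integral_mono_ae (integrable_finsetSum _ fun i _ => iGH i)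
      ((integrable_finsetSum _ fun i _ => iGD i).add (iT.const_mul C)) ?_
    filter_upwards [hH] with v hv
    have e1 : ∑ i, (Real.exp (-Φ₂ v) * (2 * θ v * pd i θ v * G₂ v i) +
        Real.exp (-Φ₂ v) * (θ v ^ 2 * H₂ i v)) = Real.exp (-Φ₂ v) *
        (∑ i, 2 * θ v * pd i θ v * G₂ v i + θ v ^ 2 * ∑ i, H₂ i v) := by
      rw [Finset.sum_add_distrib, ← Finset.mul_sum, ← Finset.mul_sum, ← Finset.mul_sum, mul_add]
    have e2 : ∑ i, (1 / 2 * (Real.exp (-Φ₂ v) * (θ v ^ 2 * G₂ v i * G₂ v i)) +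
        4 * (Real.exp (-Φ₂ v) * pd i θ v ^ 2)) + C * (Real.exp (-Φ₂ v) * θ v ^ 2) =
        Real.exp (-Φ₂ v) * (∑ i, (1 / 4 * (θ v ^ 2 * G₂ v i * G₂ v i) + 4 * pd i θ v ^ 2) +
          θ v ^ 2 * ((∑ i, G₂ v i ^ 2) / 4 + C)) := by
      simp only [Finset.sum_add_distrib, ← Finset.mul_sum, mul_add]
      have : ∑ i, θ v ^ 2 * G₂ v i * G₂ v i = θ v ^ 2 * ∑ i, G₂ v i ^ 2 := by
        rw [Finset.mul_sum]
        exact Finset.sum_congr rfl fun i _ => by ring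
      rw [this]
      ring
    rw [e1, e2]
    refine mul_le_mul_of_nonneg_left (add_le_add (Finset.sum_le_sum fun i _ => ?_) ?_)
      (Real.exp_pos _).le
    -- Young: `2 θ ∂ᵢθ Gᵢ ≤ ¼ θ² Gᵢ² + 4 (∂ᵢθ)²`. The other quarter of `θ² |G|²` comes from the
    -- bound on the Laplacian.
    · nlinarith [sq_nonneg (1 / 2 * (θ v * G₂ v i) - 2 * pd i θ v)]
    · refine mul_le_mul_of_nonneg_left ?_ (sq_nonneg _)
      have h1 := (le_abs_self _).trans (hv.trans (hC _ (norm_nonneg _)))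
      simpa only [EuclideanSpace.norm_sq_eq, Real.norm_eq_abs, sq_abs] using h1
  have e4 : ∀ i, ∫ v, (1 / 2 * (Real.exp (-Φ₂ v) * (θ v ^ 2 * G₂ v i * G₂ v i)) +
      4 * (Real.exp (-Φ₂ v) * pd i θ v ^ 2)) =
      1 / 2 * (∫ v, Real.exp (-Φ₂ v) * (θ v ^ 2 * G₂ v i * G₂ v i)) +
      4 * ∫ v, Real.exp (-Φ₂ v) * pd i θ v ^ 2 := fun i => by
    rw [integral_add ((iGG i).const_mul _) ((iD i).const_mul _), integral_const_mul,
      integral_const_mul]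
  rw [integral_add (integrable_finsetSum _ fun i _ => iGD i) (iT.const_mul C),
    integral_finsetSum _ fun i _ => iGD i, integral_const_mul] at hle
  simp only [e4] at hle
  rw [Finset.sum_add_distrib, ← Finset.mul_sum, ← Finset.mul_sum, ← hid] at hle
  have e3 : ∑ i, ∫ v, Real.exp (-Φ₂ v) * (G₂ v i * θ v) ^ 2 =
      ∑ i, ∫ v, Real.exp (-Φ₂ v) * (θ v ^ 2 * G₂ v i * G₂ v i) :=
    Finset.sum_congr rfl fun i _ => by congr 1 with v; ring
  rw [e3]
  have p1 : 0 ≤ ∑ i, ∫ v, Real.exp (-Φ₂ v) * pd i θ v ^ 2 :=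
    Finset.sum_nonneg fun i _ => integral_nonneg fun v => by positivity
  have p2 : 0 ≤ ∫ v, Real.exp (-Φ₂ v) * θ v ^ 2 := integral_nonneg fun v => by positivity
  nlinarith

end VelocityAssumptions

end Velocity

/-! ### Cut-offs of small energy near `{Φ₁ = ∞}` -/

section Cutoff

variable {d : ℕ}

theorem enorm_sq_le {F : Type*} [NormedAddCommGroup F] (x y : F) :
    ‖x‖ₑ ^ 2 ≤ 2 * ‖x - y‖ₑ ^ 2 + 2 * ‖y‖ₑ ^ 2 := by
  have h : ‖x‖ ^ 2 ≤ 2 * ‖x - y‖ ^ 2 + 2 * ‖y‖ ^ 2 := by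
    have := norm_add_le (x - y) y
    rw [sub_add_cancel] at this
    nlinarith [sq_nonneg (‖x - y‖ - ‖y‖), norm_nonneg x, norm_nonneg y, norm_nonneg (x - y)]
  have := ENNReal.ofReal_le_ofReal h
  rwa [ENNReal.ofReal_add (by positivity) (by positivity), ENNReal.ofReal_mul zero_le_two,
    ENNReal.ofReal_mul zero_le_two, ENNReal.ofReal_pow (norm_nonneg _),
    ENNReal.ofReal_pow (norm_nonneg _), ENNReal.ofReal_pow (norm_nonneg _), ofReal_norm, ofReal_norm,
    ofReal_norm, ENNReal.ofReal_ofNat] at this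

theorem mollify_mem_Icc {u : E d → ℝ} (hu : LocallyIntegrable u) (h01 : ∀ x, u x ∈ Icc (0 : ℝ) 1)
    (n : ℕ) (x : E d) : mollify n u x ∈ Icc (0 : ℝ) 1 := by
  refine ⟨integral_nonneg fun y => mul_nonneg (moll_nonneg _ _) (h01 y).1, ?_⟩
  have h1 : (1 : ℝ) = ∫ y, moll d n (x - y) := by
    rw [integral_sub_left_eq_self (moll d n), integral_moll]
  rw [h1]
  exact integral_mono (integrable_moll_mul n hu x) ((integrable_moll n).comp_sub_left x) fun y =>
    mul_le_of_le_one_right (moll_nonneg _ _) (h01 y).2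

theorem abs_mollify_sub_le {u : E d → ℝ} (hu : LocallyIntegrable u) (n : ℕ) {x : E d} {r : ℝ}
    (h : ∀ y ∈ Metric.ball x (1 / (n + 1) : ℝ), dist (u y) (u x) ≤ r) :
    |mollify n u x - u x| ≤ r := by
  rw [mollify_eq_convolution]
  exact ContDiffBump.dist_normed_convolution_le (φ := bump d n) hu.aestronglyMeasurable h

theorem support_mollify_subset {u : E d → ℝ} {A : Set (E d)} (hA : ∀ x ∉ A, u x = 0) (n : ℕ) :
    Function.support (mollify n u) ⊆ Metric.cthickening (1 / (n + 1) : ℝ) A := by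
  intro x hx
  by_contra hxA
  refine hx (integral_eq_zero_of_ae (ae_of_all _ fun y => ?_))
  by_cases hy : y ∈ A
  · have : 1 / (n + 1 : ℝ) < ‖x - y‖ := by
      by_contra hle
      rw [not_lt, ← dist_eq_norm] at hle
      exact hxA (Metric.mem_cthickening_of_dist_le x y _ A hy hle)
    simp [moll_eq_zero this]
  · simp [hA y hy]

namespace PositionAssumptions

variable {Φ₁ : E d → EReal} {G₁ : E d → E d} (h : PositionAssumptions Φ₁ G₁)
include h

/-- The weak derivative of a function of the density which vanishes for small densities. -/
theorem memLp_comp_weight {a : ℝ → ℝ} (ha : Continuous a) {s₀ : ℝ} (hs₀ : 0 < s₀)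
    (ha0 : ∀ s < s₀, a s = 0) {K : Set (E d)} (hK : IsCompact K) (i : Fin d) :
    MemLp (fun x => a (weight Φ₁ x) * G₁ x i) 2 (volume.restrict K) := by
  set K' := K ∩ weight Φ₁ ⁻¹' Ici s₀ with hK'
  have hK'c : IsCompact K' := hK.inter_right (isClosed_Ici.preimage h.continuous_weight)
  have hK'Ω : K' ⊆ finiteSet Φ₁ := fun x hx => (h.weight_pos_iff x).1 (hs₀.trans_le hx.2)
  obtain ⟨C, hC⟩ := hK'c.exists_bound_of_continuousOn
    (ha.comp h.continuous_weight).continuousOn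
  have h1 : MemLp (fun x => a (weight Φ₁ x) * G₁ x i) 2 (volume.restrict K') := by
    have h2 := memLp_euclidean_apply (h.memLp_restrict hK'c hK'Ω) i
    refine MemLp.of_le_mul (c := C) h2
      ((ha.comp h.continuous_weight).aestronglyMeasurable.mul h2.1) ?_
    filter_upwards [ae_restrict_mem hK'c.measurableSet] with x hx
    rw [norm_mul]
    exact mul_le_mul_of_nonneg_right (hC x hx) (norm_nonneg _)
  rw [← memLp_indicator_iff_restrict hK'c.measurableSet] at h1
  rw [← memLp_indicator_iff_restrict hK.measurableSet]
  convert h1 using 1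
  ext x
  by_cases hx : x ∈ K'
  · rw [indicator_of_mem hx, indicator_of_mem hx.1]
  · rw [indicator_of_notMem hx]
    by_cases hxK : x ∈ K
    · rw [indicator_of_mem hxK, ha0 _ (not_le.1 fun h3 => hx ⟨hxK, h3⟩), zero_mul]
    · rw [indicator_of_notMem hxK]

/-- A function of the density that vanishes for small densities is weakly differentiable on the
whole space, since it is zero near `{Φ₁ = ∞}`. -/
theorem hasWeakPartialOn_comp_weight {a : ℝ → ℝ} (ha : ContDiff ℝ 1 a) {s₀ : ℝ} (hs₀ : 0 < s₀)
    (ha0 : ∀ s ≤ s₀, a s = 0) (i : Fin d) :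
    HasWeakPartialOn univ (fun x => a (weight Φ₁ x))
      (fun x => -(deriv a (weight Φ₁ x) * weight Φ₁ x) * G₁ x i) i := by
  have ha0' : ∀ s < s₀, deriv a s = 0 := fun s hs => by
    have : a =ᶠ[𝓝 s] fun _ => 0 := by
      filter_upwards [Iio_mem_nhds hs] with t ht using ha0 t (le_of_lt ht)
    rw [this.deriv_eq, deriv_const]
  refine ⟨(ha.continuous.comp h.continuous_weight).locallyIntegrable.locallyIntegrableOn _, ?_, ?_⟩
  · rw [locallyIntegrableOn_univ, locallyIntegrable_iff]
    intro K hK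
    have hfin : IsFiniteMeasure (volume.restrict K) := ⟨by
      rw [Measure.restrict_apply_univ]; exact hK.measure_lt_top⟩
    exact (h.memLp_comp_weight (a := fun s => -(deriv a s * s))
      (((ha.continuous_deriv le_rfl).mul continuous_id).neg) hs₀
      (fun s hs => by rw [ha0' s hs]; simp) hK i).integrable one_le_two
  · intro φ hφ
    have := h.integral_comp_weight_mul_pd ha hs₀ ha0 (hφ.1.of_le (by simp)) hφ.2.1 i
    simp only [Measure.restrict_univ]
    refine this.trans ?_
    rw [← integral_neg]
    congr 1 with x
    ring

/-- The function `step((n + 1) ρ)` of the density `ρ` has gradient `-(n + 1) ρ step'((n + 1) ρ)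
∇Φ₁`. The scalar factor is bounded and vanishes eventually at each point, so the energy tends to
zero by dominated convergence with majorant `|∇Φ₁|²`. Mollification then makes these functions
smooth. -/
theorem exists_cutoff_seq {K : Set (E d)} (hK : IsCompact K) :
    ∃ p : ℕ → E d → ℝ, (∀ n, p n ∈ testFunctions (finiteSet Φ₁)) ∧
      (∀ n x, p n x ∈ Icc (0 : ℝ) 1) ∧
      (∀ x ∈ K ∩ finiteSet Φ₁, Tendsto (fun n => p n x) atTop (𝓝 1)) ∧
      ∀ i, Tendsto (fun n => ∫⁻ x in K, ‖pd i (p n) x‖ₑ ^ 2 ∂gibbs Φ₁) atTop (𝓝 0) := by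
  obtain ⟨B, hB0, hB⟩ := exists_deriv_step_bound
  obtain ⟨c, -, hc⟩ := h.exists_lower_bound
  set K' := Metric.cthickening 1 K with hK'
  have hK'c : IsCompact K' := hK.cthickening
  have hKK' : K ⊆ K' := Metric.self_subset_cthickening K
  let a : ℕ → ℝ → ℝ := fun n s => step ((n + 1) * s)
  have ha : ∀ n, ContDiff ℝ ∞ (a n) := fun n => contDiff_step.comp (contDiff_const.mul contDiff_id)
  have hpos : ∀ n : ℕ, (0 : ℝ) < n + 1 := fun n => by positivity
  have ha0 : ∀ n : ℕ, ∀ s ≤ 1 / (n + 1 : ℝ), a n s = 0 := fun n s hs => step_eq_zero (by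
    rw [le_div_iff₀ (hpos n)] at hs; linarith)
  have hda : ∀ n s, deriv (a n) s = (n + 1) * deriv step ((n + 1) * s) := fun n s => by
    have h1 := ((contDiff_step.differentiable (by simp)) ((n + 1) * s)).hasDerivAt.comp s
      ((hasDerivAt_id s).const_mul ((n : ℝ) + 1))
    have h2 : deriv (a n) s = _ := HasDerivAt.deriv h1
    rw [h2]; simp; ring
  let u : ℕ → E d → ℝ := fun n x => a n (weight Φ₁ x)
  let g : ℕ → Fin d → E d → ℝ := fun n i x =>
    -(deriv (a n) (weight Φ₁ x) * weight Φ₁ x) * G₁ x i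
  have hu : ∀ n, Continuous (u n) := fun n => (ha n).continuous.comp h.continuous_weight
  have hw : ∀ n i, HasWeakPartialOn univ (u n) (g n i) i := fun n i =>
    h.hasWeakPartialOn_comp_weight ((ha n).of_le (by simp)) (s₀ := 1 / (n + 1 : ℝ))
      (by positivity) (ha0 n) i
  have hul : ∀ n, LocallyIntegrable (K'.indicator (u n)) := fun n =>
    (((hu n).continuousOn.integrableOn_compact hK'c).integrable_indicator
      hK'c.measurableSet).locallyIntegrable
  have hgm : ∀ n i, MemLp (K'.indicator (g n i)) 2 := fun n i => by
    rw [memLp_indicator_iff_restrict hK'c.measurableSet]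
    refine h.memLp_comp_weight (a := fun s => -(deriv (a n) s * s)) (s₀ := 1 / (n + 1 : ℝ))
      ((((ha n).continuous_deriv (by simp)).mul continuous_id).neg) (by positivity)
      (fun s hs => ?_) hK'c i
    rw [hda, deriv_step_eq_zero (Or.inl _)]
    · simp
    · rw [lt_div_iff₀ (hpos n)] at hs; linarith
  have hgl : ∀ n i, LocallyIntegrable (K'.indicator (g n i)) := fun n i =>
    (hgm n i).locallyIntegrable one_le_two
  -- A mollification parameter depending on `n` keeps the support inside `{Φ₁ < ∞}` and the errors,
  -- uniform on `K` for the values and in `L²(K)` for the derivatives, of order `1/(n + 1)`.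
  have hex : ∀ n : ℕ, ∃ k, mollify k (K'.indicator (u n)) ∈ testFunctions (finiteSet Φ₁) ∧
      (∀ x ∈ K, |mollify k (K'.indicator (u n)) x - u n x| ≤ 1 / (n + 1)) ∧
      ∀ i, ∫⁻ x in K, ‖pd i (mollify k (K'.indicator (u n))) x - g n i x‖ₑ ^ 2 ≤
        ENNReal.ofReal (1 / (n + 1)) := by
    intro n
    have hrad : ∀ δ : ℝ, 0 < δ → ∀ᶠ k : ℕ in atTop, 1 / (k + 1 : ℝ) ≤ δ := fun δ hδ =>
      (tendsto_order.1 tendsto_radius).2 δ hδ |>.mono fun k hk => hk.le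
    have e1 : ∀ᶠ k in atTop, mollify k (K'.indicator (u n)) ∈ testFunctions (finiteSet Φ₁) := by
      set A := K' ∩ weight Φ₁ ⁻¹' Ici (1 / (n + 1 : ℝ)) with hA
      have hAc : IsCompact A := hK'c.inter_right (isClosed_Ici.preimage h.continuous_weight)
      have hAΩ : A ⊆ finiteSet Φ₁ := fun x hx =>
        (h.weight_pos_iff x).1 (lt_of_lt_of_le (by positivity) hx.2)
      obtain ⟨δ, hδ, hδΩ⟩ := hAc.exists_cthickening_subset_open h.isOpen_finiteSet hAΩ
      filter_upwards [hrad δ hδ] with k hk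
      have hA0 : ∀ x ∉ A, K'.indicator (u n) x = 0 := fun x hx => by
        by_cases hxK : x ∈ K'
        · rw [indicator_of_mem hxK]
          exact ha0 n _ (le_of_lt (not_le.1 fun h3 => hx ⟨hxK, h3⟩))
        · rw [indicator_of_notMem hxK]
      have hs : Function.support (mollify k (K'.indicator (u n))) ⊆ Metric.cthickening δ A :=
        (support_mollify_subset hA0 k).trans (Metric.cthickening_mono hk A)
      have hs' : tsupport (mollify k (K'.indicator (u n))) ⊆ Metric.cthickening δ A :=
        closure_minimal hs Metric.isClosed_cthickening
      exact ⟨contDiff_mollify k (hul n), hAc.cthickening.of_isClosed_subset (isClosed_tsupport _) hs',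
        hs'.trans hδΩ⟩
    have e2 : ∀ᶠ k in atTop, ∀ x ∈ K,
        |mollify k (K'.indicator (u n)) x - u n x| ≤ 1 / (n + 1) := by
      have hunif := hK'c.uniformContinuousOn_of_continuous (hu n).continuousOn
      rw [Metric.uniformContinuousOn_iff] at hunif
      obtain ⟨δ, hδ, hδu⟩ := hunif (1 / (n + 1)) (by positivity)
      filter_upwards [hrad δ hδ, hrad 1 one_pos] with k hk hk1 x hx
      have hx' : x ∈ K' := hKK' hx
      have := abs_mollify_sub_le (hul n) k (x := x) (r := 1 / (n + 1)) fun y hy => by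
        have hy' : y ∈ K' := (closedBall_subset_cthickening' hx le_rfl)
          (Metric.closedBall_subset_closedBall hk1 (Metric.ball_subset_closedBall hy))
        rw [indicator_of_mem hy', indicator_of_mem hx']
        exact (hδu y hy' x hx' (lt_of_lt_of_le hy hk)).le
      rwa [indicator_of_mem hx'] at this
    have e3 : ∀ᶠ k in atTop, ∀ i, ∫⁻ x in K,
        ‖pd i (mollify k (K'.indicator (u n))) x - g n i x‖ₑ ^ 2 ≤
          ENNReal.ofReal (1 / (n + 1)) := by
      rw [eventually_all]
      intro i
      have h1 := (tendsto_order.1 (tendsto_lintegral_oscSq (hgm n i))).2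
        (ENNReal.ofReal (1 / (n + 1))) (ENNReal.ofReal_pos.2 (by positivity))
      filter_upwards [h1, hrad 1 one_pos] with k hk hk1
      refine le_trans ?_ hk.le
      refine (setLIntegral_mono' hK.measurableSet fun x hx => ?_).trans
        (setLIntegral_le_lintegral K _)
      rw [pd_mollify_of_weak isOpen_univ (hw n i) hK'c (subset_univ _)
        (closedBall_subset_cthickening' hx hk1)]
      have := enorm_mollify_sub_sq_le (hgl n i) k x
      rwa [indicator_of_mem (hKK' hx)] at this
    exact (e1.and (e2.and e3)).exists
  choose k hk1 hk2 hk3 using hex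
  refine ⟨fun n => mollify (k n) (K'.indicator (u n)), hk1, fun n x => ?_, fun x hx => ?_,
    fun i => ?_⟩
  · refine mollify_mem_Icc (hul n) (fun y => ?_) _ _
    by_cases hy : y ∈ K'
    · rw [indicator_of_mem hy]
      exact ⟨step_nonneg _, step_le_one _⟩
    · rw [indicator_of_notMem hy]
      exact ⟨le_rfl, zero_le_one⟩
  · have hpx := (h.weight_pos_iff x).2 hx.2
    have h1 : Tendsto (fun n : ℕ => 1 / (n + 1 : ℝ)) atTop (𝓝 0) :=
      tendsto_one_div_add_atTop_nhds_zero_nat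
    have h2 : ∀ᶠ n : ℕ in atTop, u n x = 1 := by
      have h3 : Tendsto (fun n : ℕ => ((n : ℝ) + 1) * weight Φ₁ x) atTop atTop :=
        (tendsto_atTop_add_const_right _ 1 tendsto_natCast_atTop_atTop).atTop_mul_const hpx
      filter_upwards [h3.eventually_ge_atTop 2] with n hn using step_eq_one hn
    rw [tendsto_iff_dist_tendsto_zero]
    refine squeeze_zero' (Eventually.of_forall fun _ => dist_nonneg) ?_ h1
    filter_upwards [h2] with n hn
    have := hk2 n x hx.1
    rwa [hn] at this
  · have hle : ∀ n : ℕ, ∫⁻ x in K, ‖pd i (mollify (k n) (K'.indicator (u n))) x‖ₑ ^ 2 ∂gibbs Φ₁ ≤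
        2 * (ENNReal.ofReal (Real.exp (-c)) * ENNReal.ofReal (1 / (n + 1))) +
        2 * ∫⁻ x in K, ‖g n i x‖ₑ ^ 2 ∂gibbs Φ₁ := by
      intro n
      have hμ : (gibbs Φ₁).restrict K ≤ ENNReal.ofReal (Real.exp (-c)) • volume.restrict K := by
        rw [h.gibbs_eq, restrict_withDensity hK.measurableSet, ← withDensity_const]
        exact withDensity_mono (ae_of_all _ fun x => ENNReal.ofReal_le_ofReal (hc x))
      have h1 : ∫⁻ x in K, ‖pd i (mollify (k n) (K'.indicator (u n))) x - g n i x‖ₑ ^ 2 ∂gibbs Φ₁ ≤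
          ENNReal.ofReal (Real.exp (-c)) * ENNReal.ofReal (1 / (n + 1)) := by
        refine (lintegral_mono' hμ le_rfl).trans ?_
        rw [lintegral_smul_measure, smul_eq_mul]
        exact mul_le_mul_right (hk3 n i) _
      have hgmeas : AEMeasurable (fun x => ‖g n i x‖ₑ ^ 2) ((gibbs Φ₁).restrict K) := by
        have : AEStronglyMeasurable (g n i) (gibbs Φ₁) :=
          (Continuous.aestronglyMeasurable ((((ha n).continuous_deriv (by simp)).comp
            h.continuous_weight).mul h.continuous_weight).neg).mul
            (memLp_euclidean_apply h.gradient_memLp i).1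
        exact (this.restrict.enorm.pow_const 2)
      refine (lintegral_mono fun x => enorm_sq_le _ (g n i x)).trans ?_
      rw [lintegral_add_right' _ (hgmeas.const_mul 2), lintegral_const_mul' _ _ (by simp),
        lintegral_const_mul' _ _ (by simp)]
      gcongr
    -- The majorant uses `s |step' s| ≤ 2 B`, as `step'` vanishes beyond `2`; where `ρ > 0` the
    -- integrand is eventually zero, where `ρ = 0` it is zero.
    have hg0 : Tendsto (fun n => ∫⁻ x in K, ‖g n i x‖ₑ ^ 2 ∂gibbs Φ₁) atTop (𝓝 0) := by
      have hGi := memLp_euclidean_apply h.gradient_memLp i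
      have := tendsto_lintegral_of_dominated_convergence' (μ := (gibbs Φ₁).restrict K)
        (F := fun n x => ‖g n i x‖ₑ ^ 2) (f := fun _ => 0)
        (fun x => ENNReal.ofReal (2 * B) ^ 2 * ‖G₁ x i‖ₑ ^ 2) (fun n => ?_)
        (fun n => ae_of_all _ fun x => ?_) ?_ (ae_of_all _ fun x => ?_)
      · simpa using this
      · have : AEStronglyMeasurable (g n i) (gibbs Φ₁) :=
          (Continuous.aestronglyMeasurable ((((ha n).continuous_deriv (by simp)).comp
            h.continuous_weight).mul h.continuous_weight).neg).mul hGi.1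
        exact (this.restrict.enorm.pow_const 2)
      · simp only
        rw [← mul_pow]
        gcongr
        simp only [g]
        rw [enorm_mul]
        gcongr
        rw [enorm_neg, Real.enorm_eq_ofReal_abs]
        refine ENNReal.ofReal_le_ofReal ?_
        rw [hda, abs_mul, abs_mul, abs_of_pos (hpos n), abs_of_nonneg (weight_nonneg _ _)]
        by_cases h2 : 2 < (n + 1) * weight Φ₁ x
        · rw [deriv_step_eq_zero (Or.inr h2)]
          simpa using hB0
        · calc _ = |deriv step ((n + 1) * weight Φ₁ x)| * ((n + 1) * weight Φ₁ x) := by ring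
            _ ≤ B * 2 := mul_le_mul (hB _) (not_lt.1 h2)
              (mul_nonneg (hpos n).le (weight_nonneg _ _)) hB0
            _ = 2 * B := mul_comm _ _
      · rw [lintegral_const_mul' _ _ (ENNReal.pow_ne_top ENNReal.ofReal_ne_top), lintegral_enorm_sq]
        exact ENNReal.mul_ne_top (ENNReal.pow_ne_top ENNReal.ofReal_ne_top) (ENNReal.pow_ne_top (hGi.restrict K).2.ne)
      · have h2 : ∀ᶠ n : ℕ in atTop, g n i x = 0 := by
          rcases (weight_nonneg Φ₁ x).eq_or_lt with h0 | hpx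
          · refine Eventually.of_forall fun n => ?_
            simp [g, ← h0]
          · have h3 : Tendsto (fun n : ℕ => ((n : ℝ) + 1) * weight Φ₁ x) atTop atTop :=
              (tendsto_atTop_add_const_right _ 1 tendsto_natCast_atTop_atTop).atTop_mul_const hpx
            filter_upwards [h3.eventually_gt_atTop 2] with n hn
            simp only [g]
            rw [hda, deriv_step_eq_zero (Or.inr hn)]
            simp
        refine tendsto_const_nhds.congr' ?_
        filter_upwards [h2] with n hn
        simp [hn]
    refine tendsto_of_tendsto_of_tendsto_of_le_of_le tendsto_const_nhds ?_ (fun _ => zero_le) hle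
    have h1 : Tendsto (fun n : ℕ => ENNReal.ofReal (1 / (n + 1 : ℝ))) atTop (𝓝 0) := by
      simpa using ENNReal.tendsto_ofReal (tendsto_one_div_add_atTop_nhds_zero_nat (𝕜 := ℝ))
    have h2 := (ENNReal.Tendsto.const_mul (a := 2) (ENNReal.Tendsto.const_mul
      (a := ENNReal.ofReal (Real.exp (-c))) h1 (Or.inr ENNReal.ofReal_ne_top)) (Or.inr (by simp))).add
      (ENNReal.Tendsto.const_mul (a := 2) hg0 (Or.inr (by simp)))
    simpa using h2

end PositionAssumptions

end Cutoff

/-! ### Very weak solutions have finite energy -/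

section Energy

variable {Y C : Type*} [NormedAddCommGroup Y] [InnerProductSpace ℝ Y] [CompleteSpace Y]
  [AddCommGroup C] [Module ℝ C] {d : ℕ}

/-- A very weak solution of a resolvent-type equation for an essentially self-adjoint operator `N`
with Dirichlet form `∑ ⟪D i ·, D i ·⟫` has finite energy. -/
theorem exists_energy_identity {ι N : C →ₗ[ℝ] Y} {D M : Fin d → C →ₗ[ℝ] Y}
    (hDN : ∀ θ θ', ∑ i, ⟪D i θ, D i θ'⟫ = -⟪ι θ, N θ'⟫)
    (hιD : ∀ i θ, ⟪ι θ, D i θ⟫ = 1 / 2 * ⟪M i θ, ι θ⟫) {R : ℝ}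
    (hM : ∀ θ, ∑ i, ‖M i θ‖ ^ 2 ≤ R * (∑ i, ‖D i θ‖ ^ 2 + ‖ι θ‖ ^ 2))
    (hsym : ∀ i θ θ', ⟪M i θ, ι θ'⟫ = ⟪ι θ, M i θ'⟫) (hdense : DenseRange ι)
    (hN : ∀ s : ℝ, 0 < s → ∀ w, (∀ θ, ⟪w, N θ⟫ = s * ⟪w, ι θ⟫) → w = 0)
    {r : ℝ} (hr : 0 < r) {H A : Y} {B m : Fin d → Y}
    (heq : ∀ θ, r * ⟪H, ι θ⟫ - ⟪H, N θ⟫ = ⟪A, ι θ⟫ + ∑ i, ⟪B i, D i θ⟫)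
    (hm : ∀ i θ, ⟪m i, ι θ⟫ = ⟪H, M i θ⟫) :
    ∃ k : Fin d → Y, r * ‖H‖ ^ 2 + ∑ i, ‖k i‖ ^ 2 = ⟪A, H⟫ + ∑ i, ⟪B i, k i⟫ ∧
      (∀ i, ⟪H, k i⟫ = 1 / 2 * ⟪m i, H⟫) ∧
      ∑ i, ‖m i‖ ^ 2 ≤ R * (∑ i, ‖k i‖ ^ 2 + ‖H‖ ^ 2) ∧
      ∀ i z m', (∀ θ, ⟪m', ι θ⟫ = ⟪z, M i θ⟫) → ⟪m', H⟫ = ⟪z, m i⟫ := by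
  set c := √r with hc
  have hc0 : 0 < c := Real.sqrt_pos.2 hr
  have hcc : c * c = r := Real.mul_self_sqrt hr.le
  let W := PiLp 2 fun _ : Option (Fin d) => Y
  -- The map `θ ↦ (√r ι θ, D θ)` is an isometry for the form `r‖ι θ‖² + ∑‖D i θ‖²`; the closure of
  -- its range plays the role of the form domain.
  let J : C →ₗ[ℝ] W :=
    { toFun := fun θ => WithLp.toLp 2 fun o => o.elim (c • ι θ) fun i => D i θ
      map_add' := fun θ θ' => by
        ext o
        rcases o with _ | i
        · change c • ι (θ + θ') = c • ι θ + c • ι θ'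
          rw [map_add, smul_add]
        · exact map_add (D i) θ θ'
      map_smul' := fun a θ => by
        ext o
        rcases o with _ | i
        · change c • ι (a • θ) = a • c • ι θ
          rw [map_smul, smul_comm]
        · exact map_smul (D i) a θ }
  let b : W := WithLp.toLp 2 fun o => o.elim (c⁻¹ • A) B
  have hinner : ∀ z w : W, ⟪z, w⟫ = ⟪z none, w none⟫ + ∑ i : Fin d, ⟪z (some i), w (some i)⟫ :=
    fun z w => by rw [PiLp.inner_apply, Fintype.sum_option]
  let V : Submodule ℝ W := (LinearMap.range J).topologicalClosure
  have hVc : IsClosed (V : Set W) := Submodule.isClosed_topologicalClosure _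
  have : CompleteSpace V := hVc.completeSpace_coe
  -- The orthogonal projection of the data `b` represents the right-hand side on the form domain,
  -- giving a solution of finite energy as in Riesz's theorem.
  let z : W := V.starProjection b
  have hzV : z ∈ V := Submodule.starProjection_apply_mem V b
  have hzJ : ∀ θ, ⟪z, J θ⟫ = ⟪b, J θ⟫ := by
    intro θ
    have hJ : J θ ∈ V := Submodule.le_topologicalClosure _ ⟨θ, rfl⟩
    have h1 : ⟪J θ, b - z⟫ = 0 := Submodule.sub_starProjection_mem_orthogonal (K := V) b _ hJ
    rw [inner_sub_right, sub_eq_zero, real_inner_comm, real_inner_comm z] at h1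
    exact h1.symm
  obtain ⟨w, hw, hwz⟩ := mem_closure_iff_seq_limit.1 (show z ∈ closure (LinearMap.range J : Set W)
    from hzV)
  choose θ hθ using hw
  have hlim : ∀ o, Tendsto (fun n => (J (θ n)) o) atTop (𝓝 (z o)) := fun o => by
    have := ((PiLp.continuous_apply 2 (fun _ : Option (Fin d) => Y) o).tendsto z).comp hwz
    exact this.congr fun n => by rw [Function.comp, hθ]
  set k : Fin d → Y := fun i => z (some i) with hk
  set h : Y := c⁻¹ • z none with hh
  have lι : Tendsto (fun n => ι (θ n)) atTop (𝓝 h) := by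
    refine ((hlim none).const_smul c⁻¹).congr fun n => ?_
    change c⁻¹ • (c • ι (θ n)) = _
    rw [smul_smul, inv_mul_cancel₀ hc0.ne', one_smul]
  have lD : ∀ i, Tendsto (fun n => D i (θ n)) atTop (𝓝 (k i)) := fun i => hlim (some i)
  have hz : ∀ φ, r * ⟪h, ι φ⟫ + ∑ i, ⟪k i, D i φ⟫ = ⟪A, ι φ⟫ + ∑ i, ⟪B i, D i φ⟫ := by
    intro φ
    have h1 := hzJ φ
    rw [hinner, hinner] at h1
    change ⟪z none, c • ι φ⟫ + ∑ i, ⟪k i, D i φ⟫ = ⟪c⁻¹ • A, c • ι φ⟫ + ∑ i, ⟪B i, D i φ⟫ at h1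
    have h2 : z none = c • h := by rw [hh, smul_smul, mul_inv_cancel₀ hc0.ne', one_smul]
    have e1 : ⟪z none, c • ι φ⟫ = r * ⟪h, ι φ⟫ := by
      rw [h2, real_inner_smul_left, real_inner_smul_right, ← mul_assoc, hcc]
    have e2 : ⟪c⁻¹ • A, c • ι φ⟫ = ⟪A, ι φ⟫ := by
      rw [real_inner_smul_left, real_inner_smul_right, ← mul_assoc, inv_mul_cancel₀ hc0.ne',
        one_mul]
    rw [e1, e2] at h1
    exact h1
  have hkN : ∀ φ, ∑ i, ⟪k i, D i φ⟫ = -⟪h, N φ⟫ := fun φ =>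
    tendsto_nhds_unique (tendsto_finsetSum _ fun i _ => (lD i).inner tendsto_const_nhds)
      ((lι.inner tendsto_const_nhds).neg.congr fun n => (hDN _ _).symm)
  -- The energy solution `h` also satisfies the very weak equation of `H`; their difference is
  -- killed by the uniqueness hypothesis for `N`.
  have hhH : h = H := by
    rw [← sub_eq_zero]
    refine hN r hr _ fun φ => ?_
    have h1 := hz φ
    have h2 := heq φ
    rw [hkN] at h1
    rw [inner_sub_left, inner_sub_left]
    linarith
  rw [hhH] at lι hz
  -- The relative bound makes `M i` continuous for the form norm, so it converges along the
  -- approximating sequence; symmetry of `M i` identifies the limit with `m i`.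
  have hMc : ∀ i, ∃ m', Tendsto (fun n => M i (θ n)) atTop (𝓝 m') := by
    intro i
    refine cauchySeq_tendsto_of_complete ?_
    have hι : CauchySeq fun n => ι (θ n) := lι.cauchySeq
    have hD : ∀ i, CauchySeq fun n => D i (θ n) := fun i => (lD i).cauchySeq
    have hz0 : Tendsto (fun p : ℕ × ℕ => R * (∑ i, ‖D i (θ p.1 - θ p.2)‖ ^ 2 +
        ‖ι (θ p.1 - θ p.2)‖ ^ 2)) atTop (𝓝 0) := by
      have e0 : ∀ {u : ℕ → Y}, CauchySeq u →
          Tendsto (fun p : ℕ × ℕ => ‖u p.1 - u p.2‖ ^ 2) atTop (𝓝 0) := fun hu => by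
        have h1 := cauchySeq_iff_tendsto_dist_atTop_0.1 hu
        simp only [dist_eq_norm] at h1
        simpa using h1.pow 2
      have := ((tendsto_finsetSum Finset.univ fun i _ => e0 (hD i)).add (e0 hι)).const_mul R
      simpa only [map_sub, Finset.sum_const_zero, add_zero, mul_zero] using this
    rw [cauchySeq_iff_tendsto_dist_atTop_0]
    have hsq : Tendsto (fun p : ℕ × ℕ => ‖M i (θ p.1) - M i (θ p.2)‖ ^ 2) atTop (𝓝 0) := by
      refine squeeze_zero (fun _ => by positivity) (fun p => ?_) hz0
      refine le_trans ?_ (hM (θ p.1 - θ p.2))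
      rw [← map_sub]
      exact Finset.single_le_sum (f := fun i => ‖M i (θ p.1 - θ p.2)‖ ^ 2)
        (fun _ _ => by positivity) (Finset.mem_univ i)
    have := hsq.sqrt
    simpa only [Real.sqrt_sq (norm_nonneg _), Real.sqrt_zero, dist_eq_norm] using this
  have lM : ∀ i, Tendsto (fun n => M i (θ n)) atTop (𝓝 (m i)) := by
    intro i
    obtain ⟨m', hm'⟩ := hMc i
    have : m' = m i := by
      refine hdense.eq_of_inner_left ℝ fun φ => ?_
      rw [hm]
      refine tendsto_nhds_unique (hm'.inner tendsto_const_nhds)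
        ((lι.inner tendsto_const_nhds).congr fun n => (hsym i _ _).symm)
    rwa [← this]
  refine ⟨k, ?_, fun i => ?_, ?_, fun i y m' hy => ?_⟩
  · have h1 : Tendsto (fun n => r * ⟪H, ι (θ n)⟫ + ∑ i, ⟪k i, D i (θ n)⟫) atTop
        (𝓝 (r * ⟪H, H⟫ + ∑ i, ⟪k i, k i⟫)) :=
      ((tendsto_const_nhds.inner lι).const_mul r).add
        (tendsto_finsetSum _ fun i _ => tendsto_const_nhds.inner (lD i))
    have h2 : Tendsto (fun n => ⟪A, ι (θ n)⟫ + ∑ i, ⟪B i, D i (θ n)⟫) atTop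
        (𝓝 (⟪A, H⟫ + ∑ i, ⟪B i, k i⟫)) :=
      (tendsto_const_nhds.inner lι).add
        (tendsto_finsetSum _ fun i _ => tendsto_const_nhds.inner (lD i))
    have h3 := tendsto_nhds_unique (h1.congr fun n => hz _) h2
    simpa only [real_inner_self_eq_norm_sq] using h3
  · exact tendsto_nhds_unique (lι.inner (lD i))
      ((((lM i).inner lι).const_mul (1 / 2)).congr fun n => (hιD i _).symm)
  · exact le_of_tendsto_of_tendsto' (tendsto_finsetSum _ fun i _ => (lM i).norm.pow 2)
      (((tendsto_finsetSum _ fun i _ => (lD i).norm.pow 2).add (lι.norm.pow 2)).const_mul R)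
      fun n => hM _
  · exact tendsto_nhds_unique (tendsto_const_nhds.inner lι)
      ((tendsto_const_nhds.inner (lM i)).congr fun n => (hy _).symm)

end Energy

/-! ### Coordinate formulas and the velocity Dirichlet form -/

section Coordinates

variable {d : ℕ}

theorem laplacian_eq_sum_pd {f : E d → ℝ} (hf : ContDiff ℝ ∞ f) (x : E d) :
    Δ f x = ∑ i, pd i (pd i f) x := by
  rw [InnerProductSpace.laplacian_eq_iteratedFDeriv_orthonormalBasis f
    (EuclideanSpace.basisFun (Fin d) ℝ)]
  refine Finset.sum_congr rfl fun i _ => ?_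
  rw [iteratedFDeriv_two_apply]
  have h1 : DifferentiableAt ℝ (fderiv ℝ f) x :=
    ((hf.fderiv_right (m := ∞) (by simp)).differentiable (by simp)) x
  simp only [pd]
  rw [fderiv_clm_apply h1 (differentiableAt_const _)]
  simp

theorem inner_gradient_eq_sum (g x : E d) (f : E d → ℝ) : ⟪g, ∇ f x⟫ = ∑ i, g i * pd i f x := by
  rw [real_inner_comm, inner_gradient_left]
  conv_lhs => rw [← (EuclideanSpace.basisFun (Fin d) ℝ).sum_repr g]
  simp [pd]

theorem overdampedOp_eq {f : E d → ℝ} (hf : ContDiff ℝ ∞ f) (G : E d → E d) (x : E d) :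
    overdampedOp G f x = ∑ i, (pd i (pd i f) x - G x i * pd i f x) := by
  rw [overdampedOp, laplacian_eq_sum_pd hf, inner_gradient_eq_sum, Finset.sum_sub_distrib]

theorem pd_comp_smul (f : E d → ℝ) (c : ℝ) (i : Fin d) (x : E d) :
    pd i (fun y => f (c • y)) x = c * pd i f (c • x) := by
  have := fderiv_comp_smul (𝕜 := ℝ) (f := f) (x := x) c
  simp only [pd]
  rw [this]
  rfl

theorem contDiff_pd {f : E d → ℝ} (hf : ContDiff ℝ ∞ f) (i : Fin d) : ContDiff ℝ ∞ (pd i f) :=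
  (hf.fderiv_right (m := ∞) (by simp)).clm_apply contDiff_const

theorem tsupport_pd_subset (f : E d → ℝ) (i : Fin d) : tsupport (pd i f) ⊆ tsupport f := by
  refine closure_minimal (fun x hx => ?_) (isClosed_tsupport f)
  by_contra h
  have : fderiv ℝ f x = 0 := image_eq_zero_of_notMem_tsupport fun h2 =>
    h (tsupport_fderiv_subset ℝ h2)
  exact hx (by simp [pd, this])

theorem pd_mem_testFunctions {Ω : Set (E d)} {f : E d → ℝ} (hf : f ∈ testFunctions Ω) (i : Fin d) :
    pd i f ∈ testFunctions Ω :=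
  ⟨contDiff_pd hf.1 i, hf.2.1.of_isClosed_subset (isClosed_tsupport _) (tsupport_pd_subset f i),
    (tsupport_pd_subset f i).trans hf.2.2⟩

theorem mul_mem_testFunctions {X : Type*} [NormedAddCommGroup X] [NormedSpace ℝ X] {Ω : Set X}
    {f g : X → ℝ} (hf : f ∈ testFunctions Ω) (hg : ContDiff ℝ ∞ g) :
    (fun x => f x * g x) ∈ testFunctions Ω :=
  ⟨hf.1.mul hg, hf.2.1.mul_right, (tsupport_mul_subset_left (f := f)).trans hf.2.2⟩

theorem comp_smul_mem_testFunctions {f : E d → ℝ} (hf : f ∈ testFunctions (univ : Set (E d)))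
    {c : ℝ} (hc : c ≠ 0) : (fun x => f (c • x)) ∈ testFunctions (univ : Set (E d)) :=
  ⟨hf.1.comp (contDiff_const_smul c),
    hf.2.1.comp_homeomorph (Homeomorph.smulOfNeZero c hc), subset_univ _⟩

theorem pd_mul {f g : E d → ℝ} {x : E d} (hf : DifferentiableAt ℝ f x)
    (hg : DifferentiableAt ℝ g x) (i : Fin d) :
    pd i (fun y => f y * g y) x = f x * pd i g x + g x * pd i f x := by
  simp only [pd]
  rw [HasFDerivAt.fderiv (f := fun y => f y * g y) (hf.hasFDerivAt.mul hg.hasFDerivAt)]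
  simp

theorem exists_bound_of_mem_testFunctions {X : Type*} [NormedAddCommGroup X] [NormedSpace ℝ X]
    {Ω : Set X} {f : X → ℝ} (hf : f ∈ testFunctions Ω) : ∃ C : ℝ, 0 ≤ C ∧ ∀ x, ‖f x‖ ≤ C := by
  obtain ⟨C, hC⟩ := hf.1.continuous.bounded_above_of_compact_support hf.2.1
  exact ⟨max C 0, le_max_right _ _, fun x => (hC x).trans (le_max_left _ _)⟩

theorem memLp_mul_of_mem_testFunctions {X : Type*} [NormedAddCommGroup X] [NormedSpace ℝ X]
    [MeasurableSpace X] [OpensMeasurableSpace X] {Ω : Set X} {μ : Measure X} {g f : X → ℝ}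
    {p : ℝ≥0∞} (hg : MemLp g p μ) (hf : f ∈ testFunctions Ω) : MemLp (fun x => g x * f x) p μ := by
  obtain ⟨C, -, hC⟩ := exists_bound_of_mem_testFunctions hf
  refine MemLp.of_le_mul (c := C) hg (hg.1.mul hf.1.continuous.aestronglyMeasurable)
    (ae_of_all _ fun x => ?_)
  rw [norm_mul, mul_comm]
  exact mul_le_mul_of_nonneg_right (hC x) (norm_nonneg _)

theorem memLp_of_mem_testFunctions {X : Type*} [NormedAddCommGroup X] [NormedSpace ℝ X]
    [MeasurableSpace X] [OpensMeasurableSpace X] {Ω : Set X} {μ : Measure X}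
    [IsFiniteMeasureOnCompacts μ] {f : X → ℝ} (hf : f ∈ testFunctions Ω) (p : ℝ≥0∞) :
    MemLp f p μ :=
  hf.1.continuous.memLp_of_hasCompactSupport hf.2.1

section Dirichlet

variable {ν : Measure (E d)} [IsProbabilityMeasure ν] {G : E d → E d}

omit [IsProbabilityMeasure ν] in
theorem memLp_overdampedOp [IsFiniteMeasureOnCompacts ν] (hG : MemLp G 2 ν) {Ω : Set (E d)}
    {θ : E d → ℝ} (hθ : θ ∈ testFunctions Ω) : MemLp (overdampedOp G θ) 2 ν := by
  have h1 : overdampedOp G θ = fun x => ∑ i, (pd i (pd i θ) x - G x i * pd i θ x) :=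
    funext fun x => overdampedOp_eq hθ.1 G x
  rw [h1]
  refine memLp_finsetSum _ fun i _ => MemLp.sub ?_ ?_
  · exact memLp_of_mem_testFunctions (pd_mem_testFunctions (pd_mem_testFunctions hθ i) i) 2
  · exact memLp_mul_of_mem_testFunctions (memLp_euclidean_apply hG i) (pd_mem_testFunctions hθ i)

/-- Integration by parts applied to the products `θ ∂ᵢθ'`: the drift term is exactly the logarithmic
derivative of the measure. -/
theorem integral_mul_overdampedOp (hG : MemLp G 2 ν) (hlog : IsLogGradient univ ν G)
    {θ θ' : E d → ℝ} (hθ : θ ∈ testFunctions (univ : Set (E d)))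
    (hθ' : θ' ∈ testFunctions (univ : Set (E d))) :
    ∫ v, θ v * overdampedOp G θ' v ∂ν = -∑ i, ∫ v, pd i θ v * pd i θ' v ∂ν := by
  have hint : ∀ {f : E d → ℝ}, f ∈ testFunctions (univ : Set (E d)) → Integrable f ν := fun hf =>
    memLp_one_iff_integrable.1 (memLp_of_mem_testFunctions hf 1)
  have hGint : ∀ {f : E d → ℝ} (i : Fin d), f ∈ testFunctions (univ : Set (E d)) →
      Integrable (fun x => G x i * f x) ν := fun i hf =>
    (memLp_mul_of_mem_testFunctions (memLp_euclidean_apply hG i) hf).integrable one_le_two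
  have hd : ∀ {f : E d → ℝ}, f ∈ testFunctions (univ : Set (E d)) → Differentiable ℝ f :=
    fun hf => hf.1.differentiable (by simp)
  have hi : ∀ i, Integrable (fun v => θ v * (pd i (pd i θ') v - G v i * pd i θ' v)) ν := fun i => by
    have h1 := (hint (mul_mem_testFunctions hθ (contDiff_pd (contDiff_pd hθ'.1 i) i))).sub
      (hGint i (mul_mem_testFunctions hθ (contDiff_pd hθ'.1 i)))
    refine h1.congr (ae_of_all _ fun v => ?_)
    simp only [Pi.sub_apply]
    ring
  have h1 : ∀ v, θ v * overdampedOp G θ' v =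
      ∑ i, θ v * (pd i (pd i θ') v - G v i * pd i θ' v) := fun v => by
    rw [overdampedOp_eq hθ'.1, Finset.mul_sum]
  simp only [h1]
  rw [integral_finsetSum _ fun i _ => hi i, ← Finset.sum_neg_distrib]
  refine Finset.sum_congr rfl fun i _ => ?_
  have hm := mul_mem_testFunctions hθ (contDiff_pd hθ'.1 i)
  have h2 := hlog _ (hm.1.of_le (by simp)) hm.2.1 (subset_univ _) i
  have h3 : ∀ v, pd i (fun x => θ x * pd i θ' x) v =
      θ v * pd i (pd i θ') v + pd i θ v * pd i θ' v := fun v => by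
    rw [pd_mul (hd hθ v) (hd (pd_mem_testFunctions hθ' i) v), mul_comm (pd i θ' v)]
  simp only [h3] at h2
  have i1 := hint (mul_mem_testFunctions hθ (contDiff_pd (contDiff_pd hθ'.1 i) i))
  have i2 := hint (mul_mem_testFunctions (pd_mem_testFunctions hθ i) (contDiff_pd hθ'.1 i))
  have i3 := hGint i hm
  rw [integral_add i1 i2] at h2
  have e : ∫ v, θ v * (pd i (pd i θ') v - G v i * pd i θ' v) ∂ν =
      (∫ v, θ v * pd i (pd i θ') v ∂ν) - ∫ v, G v i * (θ v * pd i θ' v) ∂ν := by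
    rw [← integral_sub i1 i3]
    congr 1 with v
    ring
  rw [e, ← h2]
  ring

end Dirichlet

/-- The properties of the velocity distribution used for the generalized Hamiltonian operator. -/
structure VelocityMeasure (ν : Measure (E d)) (G : E d → E d) : Prop where
  prob : IsProbabilityMeasure ν
  memLp : MemLp G 2 ν
  isLogGradient : IsLogGradient univ ν G
  relative_bound : ∃ C : ℝ, 0 ≤ C ∧ ∀ θ ∈ testFunctions (univ : Set (E d)),
    ∑ i, ∫ v, (G v i * θ v) ^ 2 ∂ν ≤ C * (∑ i, ∫ v, pd i θ v ^ 2 ∂ν + ∫ v, θ v ^ 2 ∂ν)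
  ae_eq_zero : ∀ s : ℝ, 0 < s → ∀ w : E d → ℝ, MemLp w 2 ν →
    (∀ θ ∈ testFunctions (univ : Set (E d)),
      ∫ v, w v * overdampedOp G θ v ∂ν = s * ∫ v, w v * θ v ∂ν) → w =ᵐ[ν] 0

end Coordinates

/-! ### Scaling of the velocity measure -/

section Scaling

variable {d : ℕ} {Φ₂ : E d → ℝ} {G₂ : E d → E d} {H₂ : Fin d → E d → ℝ}

/-- The summand `ln (ε^d)` of the scaled potential compensates the Jacobian of `v ↦ ε v`. -/
theorem measurePreserving_smul (hΦ : Measurable Φ₂) {ε : ℝ} (hε : 0 < ε) :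
    MeasurePreserving (fun v : E d => ε • v) (gibbs fun v => (Φ₂ v : EReal))
      (gibbs fun v => (scaledPotential Φ₂ ε v : EReal)) := by
  have hm : Measurable fun v : E d => ε • v := measurable_const_smul ε
  refine ⟨hm, ?_⟩
  ext s hs
  rw [Measure.map_apply hm hs, VelocityAssumptions.gibbs_eq, VelocityAssumptions.gibbs_eq,
    withDensity_apply _ (hm hs), withDensity_apply _ hs]
  let F : E d → ℝ≥0∞ := s.indicator fun v => ENNReal.ofReal (Real.exp (-Φ₂ (ε⁻¹ • v)))
  have hF : Measurable F := by
    refine Measurable.indicator ?_ hs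
    exact (Real.measurable_exp.comp (hΦ.comp (measurable_const_smul _)).neg).ennreal_ofReal
  have e1 : ∫⁻ v in (fun v : E d => ε • v) ⁻¹' s, ENNReal.ofReal (Real.exp (-Φ₂ v)) =
      ∫⁻ v, F (ε • v) := by
    rw [← lintegral_indicator (hm hs)]
    congr 1 with v
    simp only [F, indicator]
    rw [smul_smul, inv_mul_cancel₀ hε.ne', one_smul]
    rfl
  rw [e1, ← lintegral_map hF hm, Measure.map_addHaar_smul _ hε.ne', lintegral_smul_measure,
    smul_eq_mul, ← lintegral_indicator hs, ← lintegral_const_mul _ hF]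
  congr 1 with v
  simp only [F, indicator]
  split_ifs
  · rw [← ENNReal.ofReal_mul (abs_nonneg _)]
    congr 1
    rw [finrank_euclideanSpace, Fintype.card_fin, abs_of_pos (by positivity), scaledPotential,
      neg_add, Real.exp_add, ← Real.log_inv, Real.exp_log (by positivity)]
    ring
  · simp

namespace VelocityAssumptions

variable (h : VelocityAssumptions Φ₂ G₂ H₂)
include h

omit h in
theorem measurableEmbedding_smul {ε : ℝ} (hε : 0 < ε) :
    MeasurableEmbedding fun v : E d => ε • v :=
  (Homeomorph.smulOfNeZero ε hε.ne').measurableEmbedding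

theorem integral_scaled {ε : ℝ} (hε : 0 < ε) (f : E d → ℝ) :
    ∫ v, f v ∂gibbs (fun v => (scaledPotential Φ₂ ε v : EReal)) =
      ∫ v, f (ε • v) ∂gibbs (fun v => (Φ₂ v : EReal)) :=
  ((measurePreserving_smul h.measurable hε).integral_comp (measurableEmbedding_smul hε) f).symm

/-- By assumption `(w, s w)` belongs to the adjoint graph, hence to the closure of the graph, where
the form is nonpositive by integration by parts; so `s‖w‖² ≤ 0`. -/
theorem ae_eq_zero {s : ℝ} (hs : 0 < s) {w : E d → ℝ}
    (hw : MemLp w 2 (gibbs fun v => (Φ₂ v : EReal)))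
    (hwθ : ∀ θ ∈ testFunctions (univ : Set (E d)),
      ∫ v, w v * overdampedOp G₂ θ v ∂gibbs (fun v => (Φ₂ v : EReal)) =
        s * ∫ v, w v * θ v ∂gibbs (fun v => (Φ₂ v : EReal))) :
    w =ᵐ[gibbs fun v => (Φ₂ v : EReal)] 0 := by
  have := h.isProbabilityMeasure
  set μ := gibbs fun v => (Φ₂ v : EReal) with hμ
  set W := hw.toLp w with hW
  have hinner : ∀ (q : Lp ℝ 2 μ) (f : E d → ℝ), q =ᵐ[μ] f → ⟪W, q⟫ = ∫ v, w v * f v ∂μ := by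
    intro q f hq
    rw [L2.inner_def]
    refine integral_congr_ae ?_
    filter_upwards [hq, hw.coeFn_toLp] with v h1 h2
    rw [h1, h2]
    exact mul_comm _ _
  have hfin : finiteSet (fun v => (Φ₂ v : EReal)) = univ :=
    eq_univ_of_forall fun v => EReal.coe_lt_top _
  have hmem : (W, s • W) ∈ closure (overdampedGraph (fun v => (Φ₂ v : EReal)) G₂) := by
    rw [h.essentiallySelfAdjoint]
    rintro ⟨a, b⟩ ⟨θ, hθ, ha, hb⟩
    rw [hfin] at hθ
    change ⟪s • W, a⟫ = ⟪W, b⟫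
    rw [real_inner_smul_left, hinner a θ ha, hinner b _ hb, hwθ θ hθ]
  obtain ⟨q, hq, hlim⟩ := mem_closure_iff_seq_limit.1 hmem
  have hneg : ∀ n, ⟪(q n).1, (q n).2⟫ ≤ 0 := by
    intro n
    obtain ⟨θ, hθ, ha, hb⟩ := hq n
    rw [hfin] at hθ
    have e : ⟪(q n).1, (q n).2⟫ = ∫ v, θ v * overdampedOp G₂ θ v ∂μ := by
      rw [L2.inner_def]
      refine integral_congr_ae ?_
      filter_upwards [ha, hb] with v h1 h2
      rw [h1, h2]
      exact mul_comm _ _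
    rw [e, integral_mul_overdampedOp h.gradient_memLp h.isLogGradient hθ hθ]
    exact neg_nonpos.2 (Finset.sum_nonneg fun i _ => integral_nonneg fun v => mul_self_nonneg _)
  have hle : ⟪W, s • W⟫ ≤ 0 :=
    le_of_tendsto' (((continuous_fst.tendsto _).comp hlim).inner
      ((continuous_snd.tendsto _).comp hlim)) hneg
  rw [real_inner_smul_right, real_inner_self_eq_norm_sq] at hle
  have hW0 : W = 0 := by
    rw [← norm_eq_zero]
    by_contra hne
    have : 0 < ‖W‖ := lt_of_le_of_ne (norm_nonneg _) (Ne.symm hne)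
    have : 0 < s * ‖W‖ ^ 2 := by positivity
    linarith
  have h1 := hw.coeFn_toLp
  rw [← hW, hW0] at h1
  filter_upwards [h1, Lp.coeFn_zero ℝ 2 μ] with v h2 h3
  rw [← h2, h3]

/-- Everything is transported along `v ↦ ε v`. The constant of the relative bound degenerates with
`ε`, harmlessly, since it only serves the existence of the semigroup for fixed `ε`. -/
theorem velocityMeasure {ε : ℝ} (hε : 0 < ε) :
    VelocityMeasure (gibbs fun v => (scaledPotential Φ₂ ε v : EReal)) (scaledGradient G₂ ε) := by
  have hp := h.isProbabilityMeasure
  have hmp := measurePreserving_smul h.measurable hε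
  have hG : ∀ v i, scaledGradient G₂ ε (ε • v) i = ε⁻¹ * G₂ v i := fun v i => by
    simp [scaledGradient, smul_smul, hε.ne']
  refine ⟨by
    rw [← hmp.map_eq]
    exact Measure.isProbabilityMeasure_map hmp.measurable.aemeasurable, ?_, ?_, ?_, ?_⟩
  · have h1 := h.gradient_memLp.const_smul ε⁻¹
    rw [← hmp.map_eq, (measurableEmbedding_smul hε).memLp_map_measure_iff]
    have e : (ε⁻¹ • G₂) = scaledGradient G₂ ε ∘ fun v => ε • v := by
      funext v
      ext i
      exact (hG v i).symm
    rwa [e] at h1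
  · intro φ hφ hφc _ i
    rw [h.integral_scaled hε, h.integral_scaled hε]
    have h1 := h.isLogGradient (fun v => φ (ε • v)) (hφ.comp (contDiff_const_smul ε))
      (hφc.comp_homeomorph (Homeomorph.smulOfNeZero ε hε.ne')) (subset_univ _) i
    simp only [pd_comp_smul] at h1
    rw [integral_const_mul] at h1
    simp only [hG, mul_assoc]
    rw [integral_const_mul, ← h1, ← mul_assoc, inv_mul_cancel₀ hε.ne', one_mul]
  · obtain ⟨C, hC0, hC⟩ := h.exists_relative_bound
    refine ⟨C * max 1 (ε⁻¹ ^ 2), by positivity, fun θ hθ => ?_⟩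
    have h1 := hC _ (comp_smul_mem_testFunctions hθ hε.ne')
    simp only [pd_comp_smul] at h1
    simp only [h.integral_scaled hε, hG]
    have e1 : ∀ i, ∫ v, (ε⁻¹ * G₂ v i * θ (ε • v)) ^ 2 ∂gibbs (fun v => (Φ₂ v : EReal)) =
        ε⁻¹ ^ 2 * ∫ v, (G₂ v i * θ (ε • v)) ^ 2 ∂gibbs (fun v => (Φ₂ v : EReal)) := fun i => by
      rw [← integral_const_mul]
      congr 1 with v
      ring
    have e2 : ∀ i, ∫ v, (ε * pd i θ (ε • v)) ^ 2 ∂gibbs (fun v => (Φ₂ v : EReal)) =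
        ε ^ 2 * ∫ v, pd i θ (ε • v) ^ 2 ∂gibbs (fun v => (Φ₂ v : EReal)) := fun i => by
      rw [← integral_const_mul]
      congr 1 with v
      ring
    simp only [e1, e2, ← Finset.mul_sum] at h1 ⊢
    have p1 : 0 ≤ ∑ i, ∫ v, pd i θ (ε • v) ^ 2 ∂gibbs (fun v => (Φ₂ v : EReal)) :=
      Finset.sum_nonneg fun i _ => integral_nonneg fun v => sq_nonneg _
    have p2 : 0 ≤ ∫ v, θ (ε • v) ^ 2 ∂gibbs (fun v => (Φ₂ v : EReal)) :=
      integral_nonneg fun v => sq_nonneg _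
    set a := ∑ i, ∫ v, pd i θ (ε • v) ^ 2 ∂gibbs (fun v => (Φ₂ v : EReal))
    set b := ∫ v, θ (ε • v) ^ 2 ∂gibbs (fun v => (Φ₂ v : EReal))
    have hε2 : ε⁻¹ ^ 2 * ε ^ 2 = 1 := by rw [← mul_pow, inv_mul_cancel₀ hε.ne', one_pow]
    calc _ ≤ ε⁻¹ ^ 2 * (C * (ε ^ 2 * a + b)) := mul_le_mul_of_nonneg_left h1 (by positivity)
      _ = C * (1 * a + ε⁻¹ ^ 2 * b) := by rw [← hε2]; ring
      _ ≤ C * (max 1 (ε⁻¹ ^ 2) * a + max 1 (ε⁻¹ ^ 2) * b) := by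
        gcongr
        · exact le_max_left _ _
        · exact le_max_right _ _
      _ = _ := by ring
  · intro s hs w hw hwθ
    have hw' : MemLp (fun v => w (ε • v)) 2 (gibbs fun v => (Φ₂ v : EReal)) :=
      hw.comp_measurePreserving hmp
    -- The dilated velocity operator is `ε⁻²` times the original one, so the spectral parameter is
    -- multiplied by `ε²`.
    have h1 := h.ae_eq_zero (s := ε ^ 2 * s) (by positivity) hw' fun θ hθ => by
      have h2 := hwθ _ (comp_smul_mem_testFunctions hθ (inv_ne_zero hε.ne'))
      rw [h.integral_scaled hε, h.integral_scaled hε] at h2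
      have e : ∀ v, overdampedOp (scaledGradient G₂ ε) (fun x => θ (ε⁻¹ • x)) (ε • v) =
          ε⁻¹ ^ 2 * overdampedOp G₂ θ v := fun v => by
        have hθ2 := (comp_smul_mem_testFunctions hθ (inv_ne_zero hε.ne')).1
        rw [overdampedOp_eq hθ2, overdampedOp_eq hθ.1,
          Finset.mul_sum]
        refine Finset.sum_congr rfl fun i _ => ?_
        have e3 : pd i (fun x => θ (ε⁻¹ • x)) = fun x => ε⁻¹ * pd i θ (ε⁻¹ • x) :=
          funext fun x => pd_comp_smul θ _ i x
        have e4 : pd i (fun x => ε⁻¹ * pd i θ (ε⁻¹ • x)) (ε • v) =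
            ε⁻¹ * (ε⁻¹ * pd i (pd i θ) v) := by
          have := pd_comp_smul (fun x => ε⁻¹ * pd i θ x) ε⁻¹ i (ε • v)
          rw [this, smul_smul, inv_mul_cancel₀ hε.ne', one_smul]
          congr 1
          simp only [pd]
          rw [fderiv_const_mul (((contDiff_pd hθ.1 i).differentiable (by simp)) v)]
          rfl
        rw [e3, e4, hG]
        simp only [smul_smul, inv_mul_cancel₀ hε.ne', one_smul]
        ring
      simp only [e, smul_smul, inv_mul_cancel₀ hε.ne', one_smul] at h2
      have e5 : ∫ v, w (ε • v) * (ε⁻¹ ^ 2 * overdampedOp G₂ θ v) ∂gibbs (fun v => (Φ₂ v : EReal)) =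
          ε⁻¹ ^ 2 * ∫ v, w (ε • v) * overdampedOp G₂ θ v ∂gibbs (fun v => (Φ₂ v : EReal)) := by
        rw [← integral_const_mul]
        congr 1 with v
        ring
      rw [e5] at h2
      have hε2 : ε ^ 2 * ε⁻¹ ^ 2 = 1 := by rw [← mul_pow, mul_inv_cancel₀ hε.ne', one_pow]
      rw [mul_assoc, ← h2, ← mul_assoc, hε2, one_mul]
    rw [← hmp.map_eq]
    exact ((measurableEmbedding_smul hε).ae_map_iff).2 h1

end VelocityAssumptions

end Scaling

/-! ### Classes in `L^p` of functions -/

section LpClass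

variable {α : Type*} [MeasurableSpace α] {p : ℝ≥0∞} {μ : Measure α} {f g : α → ℝ}

open Classical in
/-- The class of `f` in `L^p(μ)`, and `0` if `f` is not in `L^p(μ)`. -/
def lpClass (p : ℝ≥0∞) (μ : Measure α) (f : α → ℝ) : Lp ℝ p μ :=
  if hf : MemLp f p μ then hf.toLp f else 0

theorem lpClass_eq (hf : MemLp f p μ) : lpClass p μ f = hf.toLp f := dif_pos hf

theorem coeFn_lpClass (hf : MemLp f p μ) : lpClass p μ f =ᵐ[μ] f := by
  rw [lpClass_eq hf]
  exact hf.coeFn_toLp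

theorem eq_lpClass (u : Lp ℝ p μ) (h : u =ᵐ[μ] f) : u = lpClass p μ f :=
  Lp.ext (h.trans (coeFn_lpClass ((memLp_congr_ae h).1 (Lp.memLp u))).symm)

theorem lpClass_coeFn (u : Lp ℝ p μ) : lpClass p μ u = u := (eq_lpClass u (ae_eq_refl _)).symm

theorem lpClass_congr (hf : MemLp f p μ) (h : f =ᵐ[μ] g) : lpClass p μ f = lpClass p μ g :=
  eq_lpClass _ ((coeFn_lpClass hf).trans h)

theorem lpClass_add (hf : MemLp f p μ) (hg : MemLp g p μ) :
    lpClass p μ (fun x => f x + g x) = lpClass p μ f + lpClass p μ g := by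
  refine (eq_lpClass _ ?_).symm
  filter_upwards [Lp.coeFn_add (lpClass p μ f) (lpClass p μ g), coeFn_lpClass hf,
    coeFn_lpClass hg] with x h1 h2 h3
  rw [h1, Pi.add_apply, h2, h3]

theorem lpClass_sub (hf : MemLp f p μ) (hg : MemLp g p μ) :
    lpClass p μ (fun x => f x - g x) = lpClass p μ f - lpClass p μ g := by
  refine (eq_lpClass _ ?_).symm
  filter_upwards [Lp.coeFn_sub (lpClass p μ f) (lpClass p μ g), coeFn_lpClass hf,
    coeFn_lpClass hg] with x h1 h2 h3
  rw [h1, Pi.sub_apply, h2, h3]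

theorem lpClass_const_mul (c : ℝ) (hf : MemLp f p μ) :
    lpClass p μ (fun x => c * f x) = c • lpClass p μ f := by
  refine (eq_lpClass _ ?_).symm
  filter_upwards [Lp.coeFn_smul c (lpClass p μ f), coeFn_lpClass hf] with x h1 h2
  rw [h1, Pi.smul_apply, h2, smul_eq_mul]

theorem lpClass_neg (hf : MemLp f p μ) : lpClass p μ (fun x => -f x) = -lpClass p μ f := by
  refine (eq_lpClass _ ?_).symm
  filter_upwards [Lp.coeFn_neg (lpClass p μ f), coeFn_lpClass hf] with x h1 h2
  rw [h1, Pi.neg_apply, h2]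

theorem lpClass_zero : lpClass p μ (fun _ => (0 : ℝ)) = 0 :=
  (eq_lpClass _ (Lp.coeFn_zero ℝ p μ)).symm

theorem lpClass_finsetSum {κ : Type*} (s : Finset κ) {f : κ → α → ℝ}
    (hf : ∀ i ∈ s, MemLp (f i) p μ) :
    lpClass p μ (fun x => ∑ i ∈ s, f i x) = ∑ i ∈ s, lpClass p μ (f i) := by
  classical
  induction s using Finset.induction_on with
  | empty => simpa using lpClass_zero
  | insert a s ha ih =>
    simp only [Finset.sum_insert ha]
    rw [lpClass_add (hf a (Finset.mem_insert_self a s))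
      (memLp_finsetSum s fun i hi => hf i (Finset.mem_insert_of_mem hi)),
      ih fun i hi => hf i (Finset.mem_insert_of_mem hi)]

theorem norm_lpClass (hf : MemLp f p μ) : ‖lpClass p μ f‖ = (eLpNorm f p μ).toReal := by
  rw [lpClass_eq hf, Lp.norm_toLp]

theorem norm_lpClass_one (hf : MemLp f 1 μ) : ‖lpClass 1 μ f‖ = ∫ x, |f x| ∂μ := by
  rw [norm_lpClass hf, eLpNorm_one_eq_lintegral_enorm,
    ← integral_norm_eq_lintegral_enorm hf.1]
  rfl

theorem norm_sq_lpClass (hf : MemLp f 2 μ) : ‖lpClass 2 μ f‖ ^ 2 = ∫ x, f x ^ 2 ∂μ := by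
  rw [← real_inner_self_eq_norm_sq, L2.inner_def]
  refine integral_congr_ae ?_
  filter_upwards [coeFn_lpClass hf] with x hx
  rw [hx, sq]
  rfl

theorem inner_lpClass (hf : MemLp f 2 μ) (hg : MemLp g 2 μ) :
    ⟪lpClass 2 μ f, lpClass 2 μ g⟫ = ∫ x, f x * g x ∂μ := by
  rw [L2.inner_def]
  refine integral_congr_ae ?_
  filter_upwards [coeFn_lpClass hf, coeFn_lpClass hg] with x hx hy
  rw [hx, hy]
  exact mul_comm _ _

theorem norm_lpClass_le {K : Set α} (hμK : μ K ≠ ⊤) (hf : MemLp f 1 μ)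
    (h0 : ∀ x ∉ K, f x = 0) {C : ℝ} (hC : ∀ x, |f x| ≤ C) :
    ‖lpClass 1 μ f‖ ≤ C * (μ K).toReal := by
  rw [norm_lpClass_one hf, ← setIntegral_eq_integral_of_forall_compl_eq_zero (s := K)
    fun x hx => by rw [h0 x hx, abs_zero]]
  have h1 := norm_setIntegral_le_of_norm_le_const (f := fun x => |f x|) (C := C)
    (lt_top_iff_ne_top.2 hμK) fun x _ => by
    rw [Real.norm_eq_abs, abs_abs]
    exact hC x
  exact (le_abs_self _).trans h1

end LpClass

/-! ### Translates of a test function as a differentiable curve in `L¹` -/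

section Translates

variable {d : ℕ}

theorem closedBall_prod_subset {f : E d → ℝ} {R : ℝ} (hR : tsupport f ⊆ Metric.closedBall 0 R)
    {y x : E d} {r : ℝ} (hy : ‖y‖ ≤ r) (hx : x ∉ Metric.closedBall (0 : E d) (R + r)) :
    f (y - x) = 0 := by
  refine image_eq_zero_of_notMem_tsupport fun h => hx ?_
  have h1 := hR h
  rw [mem_closedBall_zero_iff] at h1 ⊢
  have h2 : x = y - (y - x) := by abel
  rw [h2]
  linarith [norm_sub_le y (y - x)]

theorem reflect_mem_testFunctions {f : E d → ℝ} (hf : f ∈ testFunctions (univ : Set (E d)))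
    (y : E d) : (fun x => f (y - x)) ∈ testFunctions (univ : Set (E d)) :=
  ⟨hf.1.comp (contDiff_const.sub contDiff_id),
    hf.2.1.comp_homeomorph (Homeomorph.subLeft y), subset_univ _⟩

variable (μ : Measure (E d)) [IsFiniteMeasureOnCompacts μ]

/-- The class of the reflected and translated function `x ↦ f (y - x)` in `L¹(μ)`. -/
def translateClass (f : E d → ℝ) (y : E d) : Lp ℝ 1 μ := lpClass 1 μ fun x => f (y - x)

variable {μ} {f : E d → ℝ}

theorem memLp_reflect (hf : f ∈ testFunctions (univ : Set (E d))) (y : E d) :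
    MemLp (fun x => f (y - x)) 1 μ :=
  memLp_of_mem_testFunctions (reflect_mem_testFunctions hf y) 1

theorem exists_fderiv_remainder (hf : f ∈ testFunctions (univ : Set (E d))) :
    ∃ L : ℝ, 0 ≤ L ∧ ∀ x y, |f y - f x - fderiv ℝ f x (y - x)| ≤ L * ‖y - x‖ ^ 2 := by
  obtain ⟨L, hL⟩ := ContDiff.lipschitzWith_of_hasCompactSupport (hf.2.1.fderiv ℝ)
    (hf.1.fderiv_right (m := ∞) (by simp)) (by simp)
  refine ⟨L, L.2, fun x y => ?_⟩
  have := (convex_closedBall x ‖y - x‖).norm_image_sub_le_of_norm_fderiv_le' (𝕜 := ℝ) (f := f)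
    (φ := fderiv ℝ f x) (C := L * ‖y - x‖) (x := x) (y := y)
    (fun z _ => (hf.1.differentiable (by simp)) z) (fun z hz => ?_)
    (Metric.mem_closedBall_self (norm_nonneg _)) (by rw [Metric.mem_closedBall, dist_eq_norm])
  · rw [Real.norm_eq_abs] at this
    rwa [pow_two, ← mul_assoc]
  · refine (hL.norm_sub_le z x).trans ?_
    gcongr
    rwa [Metric.mem_closedBall, dist_eq_norm] at hz

theorem fderiv_apply_eq_sum (f : E d → ℝ) (x e : E d) : fderiv ℝ f x e = ∑ i, e i * pd i f x := by
  conv_lhs => rw [← (EuclideanSpace.basisFun (Fin d) ℝ).sum_repr e]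
  simp [pd]

/-- The pointwise Taylor remainder is quadratic uniformly in `x`, and for nearby translates it lives
on one compact set of finite measure, so the remainder is quadratic in `L¹(μ)`. -/
theorem hasFDerivAt_translateClass (hf : f ∈ testFunctions (univ : Set (E d))) (y : E d) :
    HasFDerivAt (translateClass μ f) (∑ i, (EuclideanSpace.proj i : E d →L[ℝ] ℝ).smulRight
      (translateClass μ (pd i f) y)) y := by
  obtain ⟨L, hL0, hL⟩ := exists_fderiv_remainder hf
  obtain ⟨R, hR⟩ := hf.2.1.isCompact.isBounded.subset_closedBall (0 : E d)
  set r := ‖y‖ + 1 with hr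
  set K := Metric.closedBall (0 : E d) (R + r) with hK
  have hKc : IsCompact K := isCompact_closedBall _ _
  rw [hasFDerivAt_iff_isLittleO]
  refine Asymptotics.IsBigO.trans_isLittleO (g := fun y' => ‖y' - y‖ ^ 2) ?_
    (Asymptotics.isLittleO_pow_sub_sub y one_lt_two)
  refine Asymptotics.IsBigO.of_bound (L * (μ K).toReal) ?_
  filter_upwards [Metric.ball_mem_nhds y one_pos] with y' hy'
  have hy'r : ‖y'‖ ≤ r := by
    rw [Metric.mem_ball, dist_eq_norm] at hy'
    have : ‖y'‖ ≤ ‖y' - y‖ + ‖y‖ := by simpa using norm_add_le (y' - y) y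
    rw [hr]; linarith
  have hyr : ‖y‖ ≤ r := by rw [hr]; linarith
  have hpd : ∀ i, MemLp (fun x => pd i f (y - x)) 1 μ := fun i =>
    memLp_reflect (pd_mem_testFunctions hf i) y
  have hdm : MemLp (fun x => f (y' - x) - f (y - x)) 1 μ :=
    (memLp_reflect hf y').sub (memLp_reflect hf y)
  have hsm : MemLp (fun x => ∑ i, (y' - y) i * pd i f (y - x)) 1 μ :=
    memLp_finsetSum _ fun i _ => (hpd i).const_mul _
  have htm : MemLp (fun x => f (y' - x) - f (y - x) - ∑ i, (y' - y) i * pd i f (y - x)) 1 μ :=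
    hdm.sub hsm
  have e : translateClass μ f y' - translateClass μ f y -
      (∑ i, (EuclideanSpace.proj i : E d →L[ℝ] ℝ).smulRight (translateClass μ (pd i f) y)) (y' - y) =
      lpClass 1 μ fun x => f (y' - x) - f (y - x) - ∑ i, (y' - y) i * pd i f (y - x) := by
    rw [lpClass_sub hdm hsm, lpClass_sub (memLp_reflect hf y') (memLp_reflect hf y),
      lpClass_finsetSum _ fun i _ => (hpd i).const_mul _]
    simp only [lpClass_const_mul _ (hpd _), _root_.sum_apply,
      ContinuousLinearMap.smulRight_apply]
    rfl
  rw [e, norm_pow, norm_norm, mul_right_comm]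
  refine norm_lpClass_le hKc.measure_lt_top.ne
    htm (fun x hx => ?_) fun x => ?_
  · rw [closedBall_prod_subset hR hy'r hx, closedBall_prod_subset hR hyr hx]
    simp only [closedBall_prod_subset ((tsupport_pd_subset f _).trans hR) hyr hx]
    simp
  · have := hL (y - x) (y' - x)
    rwa [sub_sub_sub_cancel_right, fderiv_apply_eq_sum] at this

theorem continuous_translateClass (hf : f ∈ testFunctions (univ : Set (E d))) :
    Continuous (translateClass μ f) :=
  continuous_iff_continuousAt.2 fun y => (hasFDerivAt_translateClass hf y).continuousAt

theorem contDiff_translateClass (hf : f ∈ testFunctions (univ : Set (E d))) :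
    ContDiff ℝ 1 (translateClass μ f) := by
  rw [contDiff_one_iff_fderiv]
  refine ⟨fun y => (hasFDerivAt_translateClass hf y).differentiableAt, ?_⟩
  have : fderiv ℝ (translateClass μ f) = fun y =>
      ∑ i, (EuclideanSpace.proj i : E d →L[ℝ] ℝ).smulRight (translateClass μ (pd i f) y) :=
    funext fun y => (hasFDerivAt_translateClass hf y).fderiv
  rw [this]
  refine continuous_finsetSum _ fun i _ => ?_
  exact (ContinuousLinearMap.smulRightL ℝ (E d) (Lp ℝ 1 μ) (EuclideanSpace.proj i)).continuous.comp
    (continuous_translateClass (pd_mem_testFunctions hf i))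

theorem fderiv_translateClass_single (hf : f ∈ testFunctions (univ : Set (E d))) (y : E d)
    (i : Fin d) : fderiv ℝ (translateClass μ f) y (EuclideanSpace.single i 1) =
      translateClass μ (pd i f) y := by
  rw [(hasFDerivAt_translateClass hf y).fderiv, _root_.sum_apply,
    Finset.sum_eq_single i]
  · simp
  · intro j _ hj
    simp [hj]
  · simp

/-- The `L¹(μ)`-valued integral of translates of `f` is the class of a convolution. -/
theorem integral_smul_translateClass [SigmaFinite μ] {p : E d → ℝ} (hp : Continuous p)
    (hpc : HasCompactSupport p) (hf : f ∈ testFunctions (univ : Set (E d))) :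
    ∫ y, p y • translateClass μ f y = lpClass 1 μ fun x => ∫ y, p y * f (y - x) := by
  have hint : Integrable fun y => p y • translateClass μ f y :=
    (hp.smul (continuous_translateClass hf)).integrable_of_hasCompactSupport hpc.smul_right
  set I := ∫ y, p y • translateClass μ f y with hI
  refine eq_lpClass _ ?_
  have hcts : Continuous fun z : E d × E d => p z.2 * f (z.2 - z.1) :=
    (hp.comp continuous_snd).mul (hf.1.continuous.comp (continuous_snd.sub continuous_fst))
  have hcs : HasCompactSupport fun z : E d × E d => p z.2 * f (z.2 - z.1) := by
    refine HasCompactSupport.intro (K := (fun q : E d × E d => (q.1 - q.2, q.1)) ''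
      (tsupport p ×ˢ tsupport f)) ((hpc.isCompact.prod hf.2.1.isCompact).image (by fun_prop))
      fun z hz => ?_
    by_contra hne
    obtain ⟨h1, h2⟩ := mul_ne_zero_iff.1 hne
    exact hz ⟨(z.2, z.2 - z.1), ⟨subset_tsupport _ h1, subset_tsupport _ h2⟩, by simp⟩
  have hprod : Integrable (fun z : E d × E d => p z.2 * f (z.2 - z.1)) (μ.prod volume) :=
    hcts.integrable_of_hasCompactSupport hcs
  have hleft : Integrable (fun x => ∫ y, p y * f (y - x)) μ := hprod.integral_prod_left
  -- Test the identity on sets: integration over a set is a continuous functional on `L¹`, so it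
  -- commutes with the Bochner integral, and Fubini finishes.
  refine ae_eq_of_forall_setIntegral_eq_of_sigmaFinite
    (fun s _ _ => (L1.integrable_coeFn I).integrableOn) (fun s _ _ => hleft.integrableOn)
    fun s hs hμs => ?_
  have h1 : ∀ u : Lp ℝ 1 μ, ∫ x in s, u x ∂μ =
      (L1.integralCLM ∘L LpToLpRestrictCLM (E d) ℝ ℝ μ 1 s) u := fun u => by
    have := LpToLpRestrictCLM_coeFn (𝕜 := ℝ) s u
    rw [← integral_congr_ae this, ← L1.integral_eq_integral, L1.integral_eq]
    rfl
  rw [h1, hI, ← ContinuousLinearMap.integral_comp_comm _ hint]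
  have h2 : ∀ y, (L1.integralCLM ∘L LpToLpRestrictCLM (E d) ℝ ℝ μ 1 s)
      (p y • translateClass μ f y) = ∫ x in s, p y * f (y - x) ∂μ := fun y => by
    rw [map_smul, ← h1, smul_eq_mul, ← integral_const_mul]
    refine integral_congr_ae (ae_restrict_of_ae ?_)
    filter_upwards [coeFn_lpClass (memLp_reflect (μ := μ) hf y)] with x hx
    rw [translateClass, hx]
  simp only [h2]
  have h3 : Integrable (Function.uncurry fun (x y : E d) => p y * f (y - x))
      ((μ.restrict s).prod volume) := by
    refine hprod.mono_measure ?_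
    exact Measure.prod_mono Measure.restrict_le_self le_rfl
  exact (integral_integral_swap h3).symm

end Translates

/-! ### The energy inequality of a stationary kinetic equation -/

section Kinetic

variable {d : ℕ} {Φ₁ : E d → EReal} {G₁ : E d → E d}
  {Y C : Type*} [NormedAddCommGroup Y] [InnerProductSpace ℝ Y] [CompleteSpace Y]
  [AddCommGroup C] [Module ℝ C]

/-- A bounded operator `T` from `L¹(μ_{Φ₁})` to a Hilbert space which solves a stationary kinetic
equation in the very weak sense. The velocity variable is represented by operators on the Hilbert
space: the embedding `ι` of the test functions, the derivatives `D i`, the multiplications `M i` by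
the gradient of the potential and the generator `N`. -/
structure KineticSolution (Φ₁ : E d → EReal) (G₁ : E d → E d) (ι N : C →ₗ[ℝ] Y)
    (D M : Fin d → C →ₗ[ℝ] Y) (R r : ℝ) (T : Lp ℝ 1 (gibbs Φ₁) →L[ℝ] Y)
    (Q : Fin d → Lp ℝ 1 (gibbs Φ₁) →L[ℝ] Y) : Prop where
  dirichlet : ∀ θ θ', ∑ i, ⟪D i θ, D i θ'⟫ = -⟪ι θ, N θ'⟫
  inner_deriv : ∀ i θ, ⟪ι θ, D i θ⟫ = 1 / 2 * ⟪M i θ, ι θ⟫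
  nonneg : 0 ≤ R
  bound : ∀ θ, ∑ i, ‖M i θ‖ ^ 2 ≤ R * (∑ i, ‖D i θ‖ ^ 2 + ‖ι θ‖ ^ 2)
  symm : ∀ i θ θ', ⟪M i θ, ι θ'⟫ = ⟪ι θ, M i θ'⟫
  denseRange : DenseRange ι
  unique : ∀ s : ℝ, 0 < s → ∀ w, (∀ θ, ⟪w, N θ⟫ = s * ⟪w, ι θ⟫) → w = 0
  adjoint : ∀ i u θ, ⟪Q i u, ι θ⟫ = ⟪T u, M i θ⟫
  equation : ∀ p ∈ testFunctions (finiteSet Φ₁), ∀ θ,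
    r * ⟪T (lpClass 1 (gibbs Φ₁) p), ι θ⟫ - ⟪T (lpClass 1 (gibbs Φ₁) p), N θ⟫ =
      ∑ i, ⟪Q i (lpClass 1 (gibbs Φ₁) (pd i p)), ι θ⟫ -
        ∑ i, ⟪T (lpClass 1 (gibbs Φ₁) fun x => G₁ x i * p x), D i θ⟫

theorem PositionAssumptions.memLp_gradient_mul (h : PositionAssumptions Φ₁ G₁) {Ω : Set (E d)}
    {p : E d → ℝ} (hp : p ∈ testFunctions Ω) (i : Fin d) :
    MemLp (fun x => G₁ x i * p x) 1 (gibbs Φ₁) := by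
  have := h.finiteOnCompacts
  rw [memLp_one_iff_integrable]
  exact (memLp_euclidean_apply h.gradient_memLp i).integrable_mul (memLp_of_mem_testFunctions hp 2)

namespace KineticSolution

variable {ι N : C →ₗ[ℝ] Y} {D M : Fin d → C →ₗ[ℝ] Y} {R r : ℝ} {T : Lp ℝ 1 (gibbs Φ₁) →L[ℝ] Y}
  {Q : Fin d → Lp ℝ 1 (gibbs Φ₁) →L[ℝ] Y}

/-- The energy identity for `H = T p`, with `G₁` split into a frozen vector `g` and a deviation. The
frozen part is expressed by `Q` through `⟪H, k i⟫ = ½⟪Q i P, H⟫`; the deviation is paired with `k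
i`, and Young's inequality leaves only its square. The freedom in `c` later serves to absorb cut-off
derivatives. -/
theorem inequality (hs : KineticSolution Φ₁ G₁ ι N D M R r T Q) (h : PositionAssumptions Φ₁ G₁)
    {c : ℝ} (hr : 3 / 2 + c ^ 2 * d * (R + 1) / 2 ≤ r) {p : E d → ℝ}
    (hp : p ∈ testFunctions (finiteSet Φ₁)) (g : Fin d → ℝ) :
    ‖T (lpClass 1 (gibbs Φ₁) p)‖ ^ 2 +
      c * ∑ i, |⟪Q i (lpClass 1 (gibbs Φ₁) p), T (lpClass 1 (gibbs Φ₁) p)⟫| +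
      1 / 2 * ∑ i, g i * ⟪Q i (lpClass 1 (gibbs Φ₁) p), T (lpClass 1 (gibbs Φ₁) p)⟫ -
      ∑ i, ⟪Q i (lpClass 1 (gibbs Φ₁) (pd i p)), T (lpClass 1 (gibbs Φ₁) p)⟫ ≤
      1 / 2 * ∑ i, ‖T (lpClass 1 (gibbs Φ₁) fun x => (G₁ x i - g i) * p x)‖ ^ 2 ∧
    ∀ i u, ⟪Q i u, T (lpClass 1 (gibbs Φ₁) p)⟫ = ⟪T u, Q i (lpClass 1 (gibbs Φ₁) p)⟫ := by
  have hfc := h.finiteOnCompacts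
  have hR := hs.nonneg
  have hr0 : 0 < r := lt_of_lt_of_le (by positivity) hr
  set P := lpClass 1 (gibbs Φ₁) p with hP
  set H := T P with hH
  obtain ⟨k, hk1, hk2, hk3, hk4⟩ := exists_energy_identity hs.dirichlet hs.inner_deriv hs.bound
    hs.symm hs.denseRange hs.unique hr0 (H := H)
    (A := ∑ i, Q i (lpClass 1 (gibbs Φ₁) (pd i p)))
    (B := fun i => -T (lpClass 1 (gibbs Φ₁) fun x => G₁ x i * p x)) (m := fun i => Q i P)
    (fun θ => by
      rw [hs.equation p hp θ, sum_inner]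
      simp only [inner_neg_left, Finset.sum_neg_distrib, sub_eq_add_neg])
    (fun i θ => hs.adjoint i P θ)
  refine ⟨?_, fun i u => hk4 i (T u) (Q i u) fun θ => hs.adjoint i u θ⟩
  have hpm : MemLp p 1 (gibbs Φ₁) := memLp_of_mem_testFunctions hp 1
  set e : Fin d → Y := fun i => T (lpClass 1 (gibbs Φ₁) fun x => (G₁ x i - g i) * p x) with he
  have hsplit : ∀ i, T (lpClass 1 (gibbs Φ₁) fun x => G₁ x i * p x) = g i • H + e i := fun i => by
    have h1 : lpClass 1 (gibbs Φ₁) (fun x => (G₁ x i - g i) * p x) =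
        lpClass 1 (gibbs Φ₁) (fun x => G₁ x i * p x) - g i • P := by
      simp only [sub_mul]
      rw [lpClass_sub (h.memLp_gradient_mul hp i) (hpm.const_mul _), lpClass_const_mul _ hpm]
    simp only [he]
    rw [h1, _root_.map_sub, map_smul]
    abel
  simp only [hsplit, inner_neg_left, inner_add_left, real_inner_smul_left, hk2, sum_inner] at hk1
  have hE : ∀ i, -⟪e i, k i⟫ ≤ 1 / 2 * ‖e i‖ ^ 2 + 1 / 2 * ‖k i‖ ^ 2 := fun i => by
    have h1 := abs_le.1 (abs_real_inner_le_norm (e i) (k i))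
    nlinarith [sq_nonneg (‖e i‖ - ‖k i‖)]
  -- The weight `1/(2(R + 1))` is chosen so that the relative bound turns the sum of the `‖Q i P‖²`
  -- into at most half of `∑‖k i‖² + ‖H‖²`; the other half of `∑‖k i‖²` pays for the deviations.
  have hc : ∀ i, c * |⟪Q i P, H⟫| ≤
      1 / (2 * (R + 1)) * ‖Q i P‖ ^ 2 + c ^ 2 * (R + 1) / 2 * ‖H‖ ^ 2 := fun i => by
    have h1 : c * |⟪Q i P, H⟫| ≤ |c| * (‖Q i P‖ * ‖H‖) :=
      mul_le_mul (le_abs_self c) (abs_real_inner_le_norm _ _) (abs_nonneg _) (abs_nonneg _)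
    refine h1.trans ?_
    have h2 : 0 ≤ 1 / (2 * (R + 1)) * (‖Q i P‖ - |c| * (R + 1) * ‖H‖) ^ 2 := by positivity
    have h3 : 1 / (2 * (R + 1)) * (‖Q i P‖ - |c| * (R + 1) * ‖H‖) ^ 2 =
        1 / (2 * (R + 1)) * ‖Q i P‖ ^ 2 + |c| ^ 2 * (R + 1) / 2 * ‖H‖ ^ 2 -
          |c| * (‖Q i P‖ * ‖H‖) := by
      field_simp
      ring
    rw [sq_abs] at h3
    linarith
  have hsum1 := Finset.sum_le_sum fun i (_ : i ∈ Finset.univ) => hE i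
  have hsum2 := Finset.sum_le_sum fun i (_ : i ∈ Finset.univ) => hc i
  rw [Finset.sum_add_distrib, ← Finset.mul_sum, ← Finset.mul_sum] at hsum1
  rw [Finset.sum_add_distrib, ← Finset.mul_sum, ← Finset.mul_sum, Finset.sum_const,
    Finset.card_univ, Fintype.card_fin, nsmul_eq_mul] at hsum2
  have hQ : 1 / (2 * (R + 1)) * ∑ i, ‖Q i P‖ ^ 2 ≤ 1 / 2 * (∑ i, ‖k i‖ ^ 2 + ‖H‖ ^ 2) := by
    have hpos : 0 ≤ ∑ i, ‖k i‖ ^ 2 + ‖H‖ ^ 2 := by positivity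
    calc _ ≤ 1 / (2 * (R + 1)) * (R * (∑ i, ‖k i‖ ^ 2 + ‖H‖ ^ 2)) :=
          mul_le_mul_of_nonneg_left hk3 (by positivity)
      _ ≤ 1 / (2 * (R + 1)) * ((R + 1) * (∑ i, ‖k i‖ ^ 2 + ‖H‖ ^ 2)) := by gcongr; linarith
      _ = _ := by field_simp
  have hid : ∑ i, -(g i * (1 / 2 * ⟪Q i P, H⟫) + ⟪e i, k i⟫) =
      -(1 / 2 * ∑ i, g i * ⟪Q i P, H⟫) + ∑ i, -⟪e i, k i⟫ := by
    rw [Finset.mul_sum, ← Finset.sum_neg_distrib, ← Finset.sum_add_distrib]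
    exact Finset.sum_congr rfl fun i _ => by ring
  rw [hid] at hk1
  have hrH : (3 / 2 + c ^ 2 * d * (R + 1) / 2) * ‖H‖ ^ 2 ≤ r * ‖H‖ ^ 2 := by gcongr
  linarith

end KineticSolution

end Kinetic

/-! ### Localisation of the kinetic equation by mollifiers -/

section KineticLocal

variable {d : ℕ} {Φ₁ : E d → EReal} {G₁ : E d → E d}
  {Y C : Type*} [NormedAddCommGroup Y] [InnerProductSpace ℝ Y]
  [AddCommGroup C] [Module ℝ C]

theorem moll_mem_testFunctions (n : ℕ) : moll d n ∈ testFunctions (univ : Set (E d)) :=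
  ⟨contDiff_moll n, hasCompactSupport_moll n, subset_univ _⟩

theorem lpClass_pd_moll_sub {μ : Measure (E d)} [IsFiniteMeasureOnCompacts μ] (n : ℕ) (y : E d)
    (i : Fin d) : lpClass 1 μ (pd i fun x => moll d n (y - x)) =
      -translateClass μ (pd i (moll d n)) y := by
  have h1 : (pd i fun x => moll d n (y - x)) = fun x => -pd i (moll d n) (y - x) :=
    funext fun x => fderiv_moll_sub n y x _
  rw [h1]
  exact lpClass_neg (memLp_reflect (pd_mem_testFunctions (moll_mem_testFunctions n) i) y)

theorem norm_translateClass_moll (h : PositionAssumptions Φ₁ G₁) (n : ℕ) (y : E d) :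
    ‖translateClass (gibbs Φ₁) (moll d n) y‖ = mollify n (weight Φ₁) y := by
  have := h.finiteOnCompacts
  rw [translateClass, norm_lpClass_one (memLp_reflect (moll_mem_testFunctions n) y),
    h.integral_gibbs]
  refine integral_congr_ae (ae_of_all _ fun x => ?_)
  simp only [abs_of_nonneg (moll_nonneg n _)]
  exact mul_comm _ _

theorem enorm_lpClass_one {α : Type*} [MeasurableSpace α] {μ : Measure α} {f : α → ℝ}
    (hf : MemLp f 1 μ) : ‖lpClass 1 μ f‖ₑ = ∫⁻ x, ‖f x‖ₑ ∂μ := by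
  rw [lpClass_eq hf, Lp.enorm_toLp, eLpNorm_one_eq_lintegral_enorm]

/-- The commutator from freezing `∇Φ₁` at `y` is an average of `|∂ᵢΦ₁(x) - ∂ᵢΦ₁(y)|` over a small
ball with bounded density, hence controlled by the mean square oscillation there. -/
theorem enorm_lpClass_osc_le (h : PositionAssumptions Φ₁ G₁) {B : ℝ} (hB : ∀ x, weight Φ₁ x ≤ B)
    {K : Set (E d)} (hK : IsCompact K) (hKΩ : K ⊆ finiteSet Φ₁) {n : ℕ} {y : E d}
    (hy : Metric.closedBall y (1 / (n + 1) : ℝ) ⊆ K) (i : Fin d) :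
    ‖lpClass 1 (gibbs Φ₁) fun x => (G₁ x i - G₁ y i) * moll d n (y - x)‖ₑ ^ 2 ≤
      ENNReal.ofReal B ^ 2 * oscSq n (K.indicator fun x => G₁ x i) y := by
  have hfc := h.finiteOnCompacts
  have hp : (fun x => moll d n (y - x)) ∈ testFunctions (univ : Set (E d)) :=
    reflect_mem_testFunctions (moll_mem_testFunctions n) y
  have hm : MemLp (fun x => (G₁ x i - G₁ y i) * moll d n (y - x)) 1 (gibbs Φ₁) := by
    simp only [sub_mul]
    exact (h.memLp_gradient_mul hp i).sub ((memLp_of_mem_testFunctions hp 1).const_mul _)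
  have hu : AEStronglyMeasurable (K.indicator fun x => G₁ x i) := by
    have := (memLp_indicator_iff_restrict hK.measurableSet).2
      (memLp_euclidean_apply (h.memLp_restrict hK hKΩ) i)
    exact this.1
  have hyK : y ∈ K := hy (Metric.mem_closedBall_self (by positivity))
  rw [enorm_lpClass_one hm, h.lintegral_gibbs]
  refine le_trans (pow_le_pow_left' ?_ 2) ((mul_pow _ _ 2).le.trans
    (mul_le_mul_right (lintegral_moll_mul_sq_le hu n y) _))
  rw [← lintegral_sub_left_eq_self _ y, ← lintegral_const_mul' _ _ ENNReal.ofReal_ne_top]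
  refine lintegral_mono fun z => ?_
  simp only [sub_sub_cancel]
  by_cases hz : y - z ∈ K
  · rw [indicator_of_mem hz, indicator_of_mem hyK, enorm_mul, Real.enorm_eq_ofReal (moll_nonneg n z),
      mul_comm (‖G₁ (y - z) i - G₁ y i‖ₑ)]
    gcongr
    exact hB _
  · have : moll d n z = 0 := by
      refine moll_eq_zero (lt_of_not_ge fun h1 => hz (hy ?_))
      rw [Metric.mem_closedBall, dist_eq_norm]
      simpa using h1
    simp [this]

namespace KineticSolution

variable {ι N : C →ₗ[ℝ] Y} {D M : Fin d → C →ₗ[ℝ] Y} {R r : ℝ} {T : Lp ℝ 1 (gibbs Φ₁) →L[ℝ] Y}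
  {Q : Fin d → Lp ℝ 1 (gibbs Φ₁) →L[ℝ] Y}

/-- The flux of a kinetic solution, mollified. -/
def flux (T : Lp ℝ 1 (gibbs Φ₁) →L[ℝ] Y) (Q : Fin d → Lp ℝ 1 (gibbs Φ₁) →L[ℝ] Y) (n : ℕ)
    (i : Fin d) (y : E d) : ℝ :=
  ⟪Q i (translateClass (gibbs Φ₁) (moll d n) y), T (translateClass (gibbs Φ₁) (moll d n) y)⟫

theorem contDiff_flux (h : PositionAssumptions Φ₁ G₁) (n : ℕ) (i : Fin d) :
    ContDiff ℝ 1 (flux T Q n i) := by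
  have := h.finiteOnCompacts
  have h1 := contDiff_translateClass (μ := gibbs Φ₁) (moll_mem_testFunctions (d := d) n)
  exact ((Q i).contDiff.comp h1).inner ℝ (T.contDiff.comp h1)

theorem pd_flux (h : PositionAssumptions Φ₁ G₁) (n : ℕ) (i : Fin d) (y : E d) :
    pd i (flux T Q n i) y =
      ⟪Q i (translateClass (gibbs Φ₁) (moll d n) y),
        T (translateClass (gibbs Φ₁) (pd i (moll d n)) y)⟫ +
      ⟪Q i (translateClass (gibbs Φ₁) (pd i (moll d n)) y),
        T (translateClass (gibbs Φ₁) (moll d n) y)⟫ := by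
  have := h.finiteOnCompacts
  have h1 := ((contDiff_translateClass (μ := gibbs Φ₁)
    (moll_mem_testFunctions (d := d) n)).differentiable one_ne_zero y).hasFDerivAt
  have h2 := ((Q i).hasFDerivAt.comp y h1).inner ℝ (T.hasFDerivAt.comp y h1)
  rw [pd, HasFDerivAt.fderiv (f := flux T Q n i) h2]
  simp [fderivInnerCLM_apply, fderiv_translateClass_single (moll_mem_testFunctions (d := d) n)]

theorem abs_flux_le (h : PositionAssumptions Φ₁ G₁) (n : ℕ) (i : Fin d) (y : E d) :
    |flux T Q n i y| ≤ ‖Q i‖ * ‖T‖ * mollify n (weight Φ₁) y ^ 2 := by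
  rw [← norm_translateClass_moll h]
  set P := translateClass (gibbs Φ₁) (moll d n) y
  calc _ ≤ ‖Q i P‖ * ‖T P‖ := abs_real_inner_le_norm _ _
    _ ≤ (‖Q i‖ * ‖P‖) * (‖T‖ * ‖P‖) := mul_le_mul ((Q i).le_opNorm P) (T.le_opNorm P)
      (norm_nonneg _) (by positivity)
    _ = _ := by ring

/-- For the mollifier centred at `y`, derivatives in `x` are minus derivatives in `y`, so the
transport term of the energy inequality becomes half the divergence of the flux. -/
theorem local_inequality [CompleteSpace Y] (hs : KineticSolution Φ₁ G₁ ι N D M R r T Q)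
    (h : PositionAssumptions Φ₁ G₁)
    {c : ℝ} (hr : 3 / 2 + c ^ 2 * d * (R + 1) / 2 ≤ r) {n : ℕ} {y : E d}
    (hy : Metric.closedBall y (1 / (n + 1) : ℝ) ⊆ finiteSet Φ₁) :
    ‖T (translateClass (gibbs Φ₁) (moll d n) y)‖ ^ 2 + c * ∑ i, |flux T Q n i y| +
      1 / 2 * ∑ i, (G₁ y i * flux T Q n i y + pd i (flux T Q n i) y) ≤
      1 / 2 * ∑ i, ‖T (lpClass 1 (gibbs Φ₁) fun x => (G₁ x i - G₁ y i) * moll d n (y - x))‖ ^ 2 := by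
  have := h.finiteOnCompacts
  obtain ⟨h1, h2⟩ := hs.inequality h hr (moll_sub_mem_testFunctions hy) fun i => G₁ y i
  simp only [lpClass_pd_moll_sub, _root_.map_neg, inner_neg_left, Finset.sum_neg_distrib] at h1
  -- The two terms of the product rule coincide because `Q i` is symmetric with respect to `T`; this
  -- symmetry is the second half of the energy lemma.
  have h3 : ∀ i, pd i (flux T Q n i) y =
      2 * ⟪Q i (translateClass (gibbs Φ₁) (pd i (moll d n)) y),
        T (translateClass (gibbs Φ₁) (moll d n) y)⟫ := fun i => by
    have h4 : ⟪Q i (translateClass (gibbs Φ₁) (moll d n) y),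
        T (translateClass (gibbs Φ₁) (pd i (moll d n)) y)⟫ =
        ⟪Q i (translateClass (gibbs Φ₁) (pd i (moll d n)) y),
        T (translateClass (gibbs Φ₁) (moll d n) y)⟫ :=
      (real_inner_comm _ _).trans (h2 i _).symm
    rw [pd_flux h, h4, two_mul]
  simp only [h3, Finset.sum_add_distrib, ← Finset.mul_sum]
  refine le_trans (le_of_eq ?_) h1
  unfold flux translateClass
  ring

end KineticSolution

end KineticLocal

/-! ### Truncated reciprocals and decaying cut-offs -/

section DecayingCutoffs

/-- `step (m s) / s`, a smooth approximation of `1 / s` on `(0, ∞)`. -/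
def stepInv (m s : ℝ) : ℝ := step (m * s) * s⁻¹

variable {m : ℝ} (hm : 0 < m)
include hm

theorem stepInv_eq_zero {s : ℝ} (hs : s ≤ 1 / m) : stepInv m s = 0 := by
  rw [le_div_iff₀ hm] at hs
  rw [stepInv, step_eq_zero (by linarith), zero_mul]

theorem contDiff_stepInv : ContDiff ℝ 1 (stepInv m) := by
  rw [contDiff_iff_contDiffAt]
  intro s
  by_cases hs : s < 1 / m
  · refine contDiffAt_const (c := (0 : ℝ)) |>.congr_of_eventuallyEq ?_
    filter_upwards [Iio_mem_nhds hs] with t ht using stepInv_eq_zero hm (le_of_lt ht)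
  · have h0 : s ≠ 0 := (lt_of_lt_of_le (by positivity : 0 < 1 / m) (not_lt.1 hs)).ne'
    exact ((contDiff_step.comp (contDiff_const.mul contDiff_id)).of_le (by simp)).contDiffAt.mul
      (contDiffAt_inv ℝ h0)

omit hm in
theorem mul_stepInv (s : ℝ) : s * stepInv m s = step (m * s) := by
  by_cases hs : s = 0
  · rw [hs, zero_mul, mul_zero, step_eq_zero zero_le_one]
  · rw [stepInv]; field_simp

theorem stepInv_nonneg (s : ℝ) : 0 ≤ stepInv m s := by
  by_cases hs : s ≤ 1 / m
  · exact (stepInv_eq_zero hm hs).ge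
  · exact mul_nonneg (step_nonneg _)
      (inv_nonneg.2 ((by positivity : 0 < 1 / m).le.trans (not_le.1 hs).le))

theorem stepInv_le (s : ℝ) : stepInv m s ≤ m := by
  by_cases hs : s ≤ 1 / m
  · rw [stepInv_eq_zero hm hs]; exact hm.le
  · rw [not_le] at hs
    have hs0 : 0 < s := (by positivity : 0 < 1 / m).trans hs
    calc stepInv m s ≤ 1 * s⁻¹ := mul_le_mul_of_nonneg_right (step_le_one _) (by positivity)
      _ ≤ m := by rw [one_mul, inv_le_comm₀ hs0 hm, ← one_div]; exact hs.le

/-- Differentiate `s * stepInv m s = step (m * s)`; this avoids any division near `s = 0`. -/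
theorem deriv_stepInv_mul (s : ℝ) :
    deriv (stepInv m) s * s = m * deriv step (m * s) - stepInv m s := by
  have h1 := (((contDiff_stepInv hm).differentiable one_ne_zero) s).hasDerivAt
  have h2 : HasDerivAt (fun t => t * stepInv m t) (1 * stepInv m s + s * deriv (stepInv m) s) s :=
    (hasDerivAt_id s).mul h1
  have h3 : HasDerivAt (fun t => t * stepInv m t) (deriv step (m * s) * (m * 1)) s := by
    simp only [mul_stepInv]
    exact ((contDiff_step.differentiable (by simp)) (m * s)).hasDerivAt.comp s
      ((hasDerivAt_id s).const_mul m)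
  have := h2.unique h3
  linarith

omit hm

variable (d : ℕ)

/-- A polynomially decaying weight. -/
def decay (x : E d) : ℝ := ((1 + ‖x‖ ^ 2) ^ (d + 1))⁻¹

variable {d}

theorem decay_pos (x : E d) : 0 < decay d x := by unfold decay; positivity

theorem decay_le_one (x : E d) : decay d x ≤ 1 :=
  inv_le_one_of_one_le₀ (one_le_pow₀ (by nlinarith [sq_nonneg ‖x‖]))

theorem contDiff_decay : ContDiff ℝ ∞ (decay d) :=
  ((contDiff_const.add (contDiff_norm_sq ℝ)).pow _).inv fun x => by positivity

theorem integrable_decay : Integrable (decay d) := by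
  have := integrable_rpow_neg_one_add_norm_sq (E := E d) (μ := volume) (r := 2 * (d + 1)) (by
    rw [finrank_euclideanSpace, Fintype.card_fin]
    linarith [(Nat.cast_nonneg d : (0 : ℝ) ≤ d)])
  refine this.congr (ae_of_all _ fun x => ?_)
  have h1 : (-(2 * ((d : ℝ) + 1)) / 2) = -((d + 1 : ℕ) : ℝ) := by push_cast; ring
  simp only [decay]
  rw [h1, Real.rpow_neg (by positivity), Real.rpow_natCast]

theorem hasFDerivAt_norm_sq (x : E d) :
    HasFDerivAt (fun y : E d => ‖y‖ ^ 2) ((2 : ℝ) • innerSL ℝ x) x := by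
  refine (hasStrictFDerivAt_norm_sq x).hasFDerivAt.congr_fderiv ?_
  rw [← Nat.cast_smul_eq_nsmul ℝ, Nat.cast_two]

/-- The logarithmic derivative is `-2 (d + 1) xᵢ / (1 + |x|²)`, and `2|xᵢ| ≤ 1 + |x|²`. -/
theorem abs_pd_decay_le (i : Fin d) (x : E d) : |pd i (decay d) x| ≤ (d + 1) * decay d x := by
  set u : ℝ := 1 + ‖x‖ ^ 2 with hu
  have hu0 : 0 < u := by positivity
  have h1 : HasDerivAt (fun t : ℝ => ((1 + t) ^ (d + 1))⁻¹)
      (-((d + 1) * u ^ d) / (u ^ (d + 1)) ^ 2) (‖x‖ ^ 2) := by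
    have e1 : HasDerivAt (fun t : ℝ => (1 + t) ^ (d + 1)) ((d + 1) * u ^ d) (‖x‖ ^ 2) := by
      refine (((hasDerivAt_id (‖x‖ ^ 2)).const_add 1).pow (d + 1)).congr_deriv ?_
      simp [hu]
    exact e1.inv (pow_pos hu0 _).ne'
  have h2 := h1.comp_hasFDerivAt x (hasFDerivAt_norm_sq x)
  have h3 : pd i (decay d) x = -((d + 1) * u ^ d) / (u ^ (d + 1)) ^ 2 * (2 * x i) := by
    rw [pd, HasFDerivAt.fderiv (f := decay d) h2]
    simp [EuclideanSpace.inner_single_right]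
  have h4 : 2 * |x i| ≤ u := by
    have := PiLp.norm_apply_le x i
    rw [Real.norm_eq_abs] at this
    nlinarith [sq_nonneg (‖x‖ - 1)]
  rw [h3, abs_mul, abs_div, abs_neg, abs_of_pos (by positivity : 0 < ((d : ℝ) + 1) * u ^ d),
    abs_of_pos (by positivity : 0 < (u ^ (d + 1)) ^ 2), abs_mul, abs_two]
  calc _ ≤ ((d : ℝ) + 1) * u ^ d / (u ^ (d + 1)) ^ 2 * u := by gcongr
    _ = _ := by
      unfold decay
      rw [← hu]
      field_simp
      ring

/-- The decaying weight is cut off at radius of order `n`. Its own derivative is bounded by a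
multiple of itself and can be absorbed; only the derivative of the outer cut-off, of order `1/(n +
1)`, remains as an error, against an integrable weight. -/
theorem exists_decaying_cutoffs : ∃ (ζ : ℕ → E d → ℝ) (τ : ℕ → ℝ),
    (∀ n, ζ n ∈ testFunctions (univ : Set (E d))) ∧ (∀ n x, 0 ≤ ζ n x) ∧
    (∀ n x, ζ n x ≤ decay d x) ∧ (∀ (n : ℕ) x, ‖x‖ ≤ n → ζ n x = decay d x) ∧
    (∀ n i x, |pd i (ζ n) x| ≤ (d + 1) * ζ n x + τ n * decay d x) ∧ (∀ n, 0 ≤ τ n) ∧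
    Tendsto τ atTop (𝓝 0) := by
  obtain ⟨B, hB0, hB⟩ := exists_deriv_step_bound
  let c : ℕ → E d → ℝ := fun n x => ‖x‖ ^ 2 / (n + 1) ^ 2
  let ξ : ℕ → E d → ℝ := fun n x => 1 - step (c n x)
  have hc : ∀ n, ContDiff ℝ ∞ (c n) := fun n => (contDiff_norm_sq ℝ).div_const _
  have hξ : ∀ n, ContDiff ℝ ∞ (ξ n) := fun n => contDiff_const.sub (contDiff_step.comp (hc n))
  have hξc : ∀ n, HasCompactSupport (ξ n) := fun n => by
    refine HasCompactSupport.intro (isCompact_closedBall (0 : E d) (2 * (n + 1))) fun x hx => ?_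
    rw [mem_closedBall_zero_iff, not_le] at hx
    have : 2 ≤ c n x := by
      simp only [c]
      rw [le_div_iff₀ (by positivity)]
      nlinarith [(by positivity : (0 : ℝ) < n + 1)]
    simp [ξ, step_eq_one this]
  have hξ0 : ∀ n x, 0 ≤ ξ n x := fun n x => sub_nonneg.2 (step_le_one _)
  have hξ1 : ∀ n x, ξ n x ≤ 1 := fun n x => sub_le_self _ (step_nonneg _)
  refine ⟨fun n x => ξ n x * decay d x, fun n => 4 * B / (n + 1), fun n =>
    mul_mem_testFunctions ⟨hξ n, hξc n, subset_univ _⟩ contDiff_decay,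
    fun n x => mul_nonneg (hξ0 n x) (decay_pos x).le,
    fun n x => mul_le_of_le_one_left (decay_pos x).le (hξ1 n x), fun n x hx => ?_,
    fun n i x => ?_, fun n => by positivity, ?_⟩
  · have : c n x ≤ 1 := by
      simp only [c]
      rw [div_le_one (by positivity)]
      gcongr
      linarith
    simp [ξ, step_eq_zero this]
  · rw [pd_mul ((hξ n).differentiable (by simp) x) (contDiff_decay.differentiable (by simp) x)]
    have h1 : HasFDerivAt (ξ n) (-(deriv step (c n x) • (((n : ℝ) + 1) ^ 2)⁻¹ • (2 : ℝ) •
        innerSL ℝ x)) x := by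
      have e1 : HasFDerivAt (c n) ((((n : ℝ) + 1) ^ 2)⁻¹ • (2 : ℝ) • innerSL ℝ x) x := by
        refine ((hasFDerivAt_norm_sq x).const_mul (((n : ℝ) + 1) ^ 2)⁻¹).congr_of_eventuallyEq
          (Eventually.of_forall fun y => ?_)
        simp only [c]
        rw [div_eq_inv_mul]
      exact (((contDiff_step.differentiable (by simp)) (c n x)).hasDerivAt.comp_hasFDerivAt x
        e1).const_sub 1
    have h2 : |pd i (ξ n) x| ≤ 4 * B / (n + 1) := by
      have e : pd i (ξ n) x = -(deriv step (c n x) * ((((n : ℝ) + 1) ^ 2)⁻¹ * (2 * x i))) := by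
        rw [pd, h1.fderiv]
        simp [EuclideanSpace.inner_single_right]
      rw [e, abs_neg]
      by_cases h2 : 2 < c n x
      · rw [deriv_step_eq_zero (Or.inr h2), zero_mul, abs_zero]
        positivity
      · have hn : (0 : ℝ) < n + 1 := by positivity
        have h3 : ‖x‖ ≤ 2 * (n + 1) := by
          simp only [c, not_lt] at h2
          rw [div_le_iff₀ (by positivity)] at h2
          exact abs_le_of_sq_le_sq' (by nlinarith) (by positivity) |>.2
        have h4 : |x i| ≤ 2 * (n + 1) := (PiLp.norm_apply_le x i).trans h3
        rw [abs_mul, abs_mul, abs_mul, abs_of_pos (by positivity : 0 < (((n : ℝ) + 1) ^ 2)⁻¹), abs_two]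
        calc _ ≤ B * ((((n : ℝ) + 1) ^ 2)⁻¹ * (2 * (2 * (n + 1)))) := by
              gcongr
              exact hB _
          _ = _ := by field_simp; ring
    have h3 := abs_pd_decay_le i x
    calc _ ≤ |ξ n x * pd i (decay d) x| + |decay d x * pd i (ξ n) x| := abs_add_le _ _
      _ ≤ ξ n x * ((d + 1) * decay d x) + decay d x * (4 * B / (n + 1)) := by
        rw [abs_mul, abs_mul, abs_of_nonneg (hξ0 n x), abs_of_pos (decay_pos x)]
        gcongr
        · exact hξ0 n x
        · exact (decay_pos x).le
      _ = _ := by ring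
  · have := (tendsto_one_div_add_atTop_nhds_zero_nat (𝕜 := ℝ)).const_mul (4 * B)
    simpa [div_eq_mul_inv] using this

end DecayingCutoffs

/-! ### Integration of the local inequality against `ζ / ρ` -/

section KineticGlobal

variable {d : ℕ} {Φ₁ : E d → EReal} {G₁ : E d → E d}

theorem PositionAssumptions.integrable_comp_weight_mul (h : PositionAssumptions Φ₁ G₁) {a : ℝ → ℝ}
    (ha : Continuous a) {s₀ : ℝ} (hs₀ : 0 < s₀) (ha0 : ∀ s < s₀, a s = 0) {ψ : E d → ℝ}
    (hψ : Continuous ψ) (hψc : HasCompactSupport ψ) (i : Fin d) :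
    Integrable fun x => a (weight Φ₁ x) * G₁ x i * ψ x := by
  have hK : IsCompact (tsupport ψ) := hψc.isCompact
  have hfin : IsFiniteMeasure (volume.restrict (tsupport ψ)) := ⟨by
    rw [Measure.restrict_apply_univ]; exact hK.measure_lt_top⟩
  have h1 : IntegrableOn (fun x => a (weight Φ₁ x) * G₁ x i) (tsupport ψ) volume :=
    (h.memLp_comp_weight ha hs₀ ha0 hK i).integrable one_le_two
  have h2 := (h1.mul_continuousOn hψ.continuousOn hK).integrable_indicator hK.measurableSet
  refine h2.congr (ae_of_all _ fun x => ?_)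
  by_cases hx : x ∈ tsupport ψ
  · rw [indicator_of_mem hx]
  · simp only [indicator_of_notMem hx, image_eq_zero_of_notMem_tsupport hx, mul_zero]

/-- Integration by parts of the divergence of a flux against a cutoff divided by the density. -/
theorem PositionAssumptions.integral_stepInv_flux (h : PositionAssumptions Φ₁ G₁) {m : ℝ}
    (hm : 0 < m) {ζ q : E d → ℝ} (hζ : ζ ∈ testFunctions (univ : Set (E d)))
    (hq : ContDiff ℝ 1 q) (i : Fin d) :
    Integrable (fun x => stepInv m (weight Φ₁ x) * ζ x * (G₁ x i * q x + pd i q x)) ∧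
    Integrable (fun x => m * deriv step (m * weight Φ₁ x) * G₁ x i * (ζ x * q x) -
      stepInv m (weight Φ₁ x) * (q x * pd i ζ x)) ∧
    ∫ x, stepInv m (weight Φ₁ x) * ζ x * (G₁ x i * q x + pd i q x) =
      ∫ x, (m * deriv step (m * weight Φ₁ x) * G₁ x i * (ζ x * q x) -
        stepInv m (weight Φ₁ x) * (q x * pd i ζ x)) := by
  have hs₀ : 0 < 1 / m := by positivity
  have ha := contDiff_stepInv hm
  have ha0 : ∀ s ≤ 1 / m, stepInv m s = 0 := fun s hs => stepInv_eq_zero hm hs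
  have hρ := h.continuous_weight
  have hζ1 : ContDiff ℝ 1 ζ := hζ.1.of_le (by simp)
  have hζc : Continuous ζ := hζ.1.continuous
  have hqc : Continuous q := hq.continuous
  have hdq : Continuous (pd i q) := (hq.continuous_fderiv one_ne_zero).clm_apply continuous_const
  have hdζ := pd_mem_testFunctions hζ i
  have hac : Continuous fun x => stepInv m (weight Φ₁ x) := ha.continuous.comp hρ
  have i1 := h.integrable_comp_weight_mul ha.continuous hs₀ (fun s hs => ha0 s hs.le)
    (ψ := fun x => ζ x * q x) (hζc.mul hqc) hζ.2.1.mul_right i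
  have i2 : Integrable fun x => stepInv m (weight Φ₁ x) * (ζ x * pd i q x) :=
    (hac.mul (hζc.mul hdq)).integrable_of_hasCompactSupport (hζ.2.1.mul_right).mul_left
  have i3 := h.integrable_comp_weight_mul (a := fun s => m * deriv step (m * s))
    (continuous_const.mul (continuous_deriv_step.comp (continuous_const.mul continuous_id))) hs₀
    (fun s hs => by
      rw [lt_div_iff₀ hm] at hs
      rw [deriv_step_eq_zero (Or.inl (by linarith)), mul_zero]) (ψ := fun x => ζ x * q x) (hζc.mul hqc) hζ.2.1.mul_right i
  have i4 : Integrable fun x => stepInv m (weight Φ₁ x) * (q x * pd i ζ x) :=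
    (hac.mul (hqc.mul hdζ.1.continuous)).integrable_of_hasCompactSupport
      (hdζ.2.1.mul_left).mul_left
  have hI : Integrable (fun x => stepInv m (weight Φ₁ x) * ζ x * (G₁ x i * q x + pd i q x)) := by
    refine (i1.add i2).congr (ae_of_all _ fun x => ?_)
    simp only [Pi.add_apply]
    ring
  refine ⟨hI, i3.sub i4, ?_⟩
  have key := h.integral_comp_weight_mul_pd ha hs₀ ha0 (hζ1.mul hq) hζ.2.1.mul_right i
  have e1 : ∀ x, pd i (fun y => ζ y * q y) x = ζ x * pd i q x + q x * pd i ζ x := fun x =>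
    pd_mul (hζ1.differentiable one_ne_zero x) (hq.differentiable one_ne_zero x) i
  -- The derivative of the truncated reciprocal splits into a part where the truncation acts and a
  -- part that cancels the drift term `G₁ q`; this is `G₁ q + ∂q = ρ ∂(q/ρ)` in truncated form.
  have e2 : ∀ x, deriv (stepInv m) (weight Φ₁ x) * (weight Φ₁ x * (G₁ x i * (ζ x * q x))) =
      m * deriv step (m * weight Φ₁ x) * G₁ x i * (ζ x * q x) -
        stepInv m (weight Φ₁ x) * G₁ x i * (ζ x * q x) := fun x => by
    rw [← mul_assoc, deriv_stepInv_mul hm]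
    ring
  simp only [e1, e2, mul_add] at key
  have k1 := integral_add i2 i4
  have k2 := integral_sub i3 i1
  have k3 := integral_add i1 i2
  have k4 := integral_sub i3 i4
  rw [k4]
  have e3 : ∀ x, stepInv m (weight Φ₁ x) * ζ x * (G₁ x i * q x + pd i q x) =
      stepInv m (weight Φ₁ x) * G₁ x i * (ζ x * q x) +
        stepInv m (weight Φ₁ x) * (ζ x * pd i q x) := fun x => by ring
  simp only [e3]
  rw [k3]
  rw [k1, k2] at key
  linarith

/-- Cauchy–Schwarz in `L²(μ_{Φ₁})`: the decaying weight is square integrable because the density is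
bounded, although `μ_{Φ₁}` may be infinite. -/
theorem PositionAssumptions.integrable_gradient_mul_decay (h : PositionAssumptions Φ₁ G₁)
    (i : Fin d) : Integrable fun x => |G₁ x i| * (weight Φ₁ x * decay d x) := by
  obtain ⟨c, -, hc⟩ := h.exists_lower_bound
  have hdc : Continuous (decay d) := contDiff_decay.continuous
  have h1 : MemLp (decay d) 2 (gibbs Φ₁) := by
    rw [memLp_two_iff_integrable_sq hdc.aestronglyMeasurable, h.integrable_gibbs]
    refine (integrable_decay.const_mul (Real.exp (-c))).mono'
      (h.continuous_weight.mul (hdc.pow 2)).aestronglyMeasurable (ae_of_all _ fun x => ?_)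
    rw [Real.norm_of_nonneg (mul_nonneg (weight_nonneg _ _) (sq_nonneg _))]
    have := decay_pos x
    have := decay_le_one x
    exact mul_le_mul (hc x) (by nlinarith) (sq_nonneg _) (Real.exp_pos _).le
  have h2 : Integrable (fun x => |G₁ x i| * decay d x) (gibbs Φ₁) :=
    (memLp_euclidean_apply h.gradient_memLp i).abs.integrable_mul h1
  refine ((h.integrable_gibbs _).1 h2).congr (ae_of_all _ fun x => ?_)
  simp only
  ring

namespace KineticSolution

variable {Y C : Type*} [NormedAddCommGroup Y] [InnerProductSpace ℝ Y] [CompleteSpace Y]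
  [AddCommGroup C] [Module ℝ C]
  {ι N : C →ₗ[ℝ] Y} {D M : Fin d → C →ₗ[ℝ] Y} {R r : ℝ} {T : Lp ℝ 1 (gibbs Φ₁) →L[ℝ] Y}
  {Q : Fin d → Lp ℝ 1 (gibbs Φ₁) →L[ℝ] Y}

/-- Multiply the local inequality by the truncated `ζ/ρ` and integrate. Three errors survive: the
outer cut-off (factor `τ`), the truncation near the zeros of `ρ` (where `step'` acts), and the
commutator. -/
theorem integral_le (hs : KineticSolution Φ₁ G₁ ι N D M R r T Q) (h : PositionAssumptions Φ₁ G₁)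
    (hr : 3 / 2 + ((d : ℝ) + 1) ^ 2 * d * (R + 1) / 2 ≤ r) {B : ℝ} (hB : ∀ x, weight Φ₁ x ≤ B)
    {ζ : E d → ℝ} {τ m A : ℝ} (hζ : ζ ∈ testFunctions (univ : Set (E d))) (hζ0 : ∀ x, 0 ≤ ζ x)
    (hζ1 : ∀ x, ζ x ≤ decay d x) (hτ : 0 ≤ τ)
    (hdζ : ∀ i x, |pd i ζ x| ≤ (d + 1) * ζ x + τ * decay d x) (hm : 0 < m)
    (hA : ∀ i, ‖Q i‖ * ‖T‖ ≤ A) {K : Set (E d)} (hK : IsCompact K) (hKΩ : K ⊆ finiteSet Φ₁)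
    {n : ℕ} (hball : ∀ y ∈ tsupport ζ, 1 / m ≤ weight Φ₁ y →
      Metric.closedBall y (1 / (n + 1) : ℝ) ⊆ K)
    (hmoll : ∀ y ∈ tsupport ζ, 1 / m ≤ weight Φ₁ y →
      mollify n (weight Φ₁) y ≤ 2 * weight Φ₁ y) (hA0 : 0 ≤ A)
    (hfin : ∀ i, ∫⁻ y, oscSq n (K.indicator fun x => G₁ x i) y ≠ ⊤) :
    ∫ y, stepInv m (weight Φ₁ y) * ζ y * ‖T (translateClass (gibbs Φ₁) (moll d n) y)‖ ^ 2 ≤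
      ∑ i, (2 * A * τ * (∫ x, weight Φ₁ x * decay d x) +
        2 * A * ∫ x, m * |deriv step (m * weight Φ₁ x)| * weight Φ₁ x *
          (|G₁ x i| * (weight Φ₁ x * decay d x))) +
      1 / 2 * m * (‖T‖ ^ 2 * B ^ 2) *
        ∑ i, (∫⁻ y, oscSq n (K.indicator fun x => G₁ x i) y).toReal := by
  have hfc := h.finiteOnCompacts
  obtain ⟨B', hB'0, hB'⟩ := exists_deriv_step_bound
  have hρ := h.continuous_weight
  have hB0 : 0 ≤ B := (weight_nonneg Φ₁ 0).trans (hB 0)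
  set b : E d → ℝ := fun y => stepInv m (weight Φ₁ y) * ζ y with hb
  set F : E d → ℝ := fun y => ‖T (translateClass (gibbs Φ₁) (moll d n) y)‖ ^ 2 with hF
  set q : Fin d → E d → ℝ := fun i => flux T Q n i with hq
  have hq1 : ∀ i, ContDiff ℝ 1 (q i) := fun i => contDiff_flux h n i
  have hb0 : ∀ y, 0 ≤ b y := fun y => mul_nonneg (stepInv_nonneg hm _) (hζ0 y)
  have hbm : ∀ y, b y ≤ m := fun y =>
    (mul_le_mul (stepInv_le hm _) ((hζ1 y).trans (decay_le_one y)) (hζ0 y) hm.le).trans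
      (mul_one m).le
  have hbc : Continuous b := ((contDiff_stepInv hm).continuous.comp hρ).mul hζ.1.continuous
  have hbcs : HasCompactSupport b := hζ.2.1.mul_left
  have hFc : Continuous F :=
    (T.continuous.comp (continuous_translateClass (moll_mem_testFunctions n))).norm.pow 2
  have ibF : Integrable fun y => b y * F y := (hbc.mul hFc).integrable_of_hasCompactSupport
    hbcs.mul_right
  have ibq : ∀ i, Integrable fun y => b y * |q i y| := fun i =>
    (hbc.mul (hq1 i).continuous.abs).integrable_of_hasCompactSupport hbcs.mul_right
  have hJ := fun i => h.integral_stepInv_flux hm hζ (hq1 i) i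
  have iρ : Integrable fun x => weight Φ₁ x * decay d x := by
    refine (integrable_decay.const_mul B).mono'
      (hρ.mul contDiff_decay.continuous).aestronglyMeasurable (ae_of_all _ fun x => ?_)
    rw [Real.norm_of_nonneg (mul_nonneg (weight_nonneg _ _) (decay_pos x).le)]
    exact mul_le_mul_of_nonneg_right (hB x) (decay_pos x).le
  have iS : ∀ i, Integrable fun x => m * |deriv step (m * weight Φ₁ x)| * weight Φ₁ x *
      (|G₁ x i| * (weight Φ₁ x * decay d x)) := fun i => by
    refine (h.integrable_gradient_mul_decay i).bdd_mul (c := m * B' * B)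
      (((continuous_const.mul (continuous_deriv_step.comp (continuous_const.mul hρ)).abs).mul
        hρ).aestronglyMeasurable) (ae_of_all _ fun x => ?_)
    rw [Real.norm_of_nonneg (mul_nonneg (mul_nonneg hm.le (abs_nonneg _)) (weight_nonneg _ _))]
    have := weight_nonneg Φ₁ x
    gcongr
    · exact hB' _
    · exact hB x
  -- The term where the derivative falls on `ζ` is dominated by `(d + 1) ∫ b |q i|`, which the local
  -- inequality with `c = d + 1` provides with the opposite sign.
  have hlow : ∀ i, -(1 / 2) * ∫ x, stepInv m (weight Φ₁ x) * ζ x * (G₁ x i * q i x + pd i (q i) x) ≤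
      (d + 1) * (∫ y, b y * |q i y|) + (2 * A * τ * (∫ x, weight Φ₁ x * decay d x) +
        2 * A * ∫ x, m * |deriv step (m * weight Φ₁ x)| * weight Φ₁ x *
          (|G₁ x i| * (weight Φ₁ x * decay d x))) := by
    intro i
    have iρS : Integrable fun x => 2 * A * τ * (weight Φ₁ x * decay d x) +
        2 * A * (m * |deriv step (m * weight Φ₁ x)| * weight Φ₁ x *
          (|G₁ x i| * (weight Φ₁ x * decay d x))) :=
      (iρ.const_mul _).add ((iS i).const_mul _)
    rw [(hJ i).2.2, ← integral_const_mul, ← integral_const_mul, ← integral_const_mul,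
      ← integral_const_mul, ← integral_add (iρ.const_mul _) ((iS i).const_mul _),
      ← integral_add ((ibq i).const_mul _) iρS]
    refine integral_mono ((hJ i).2.1.const_mul _) (((ibq i).const_mul _).add iρS) fun x => ?_
    simp only
    have hw0 := weight_nonneg Φ₁ x
    have hd0 := (decay_pos x).le
    by_cases hx : x ∈ tsupport ζ ∧ 1 / m ≤ weight Φ₁ x
    -- The flux is quadratic in the mollified density, hence of order `ρ²`; one factor `ρ` cancels
    -- the reciprocal and the other keeps the errors integrable.
    · have hqb : |q i x| ≤ 4 * A * weight Φ₁ x ^ 2 := by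
        have h1 : mollify n (weight Φ₁) x ^ 2 ≤ (2 * weight Φ₁ x) ^ 2 := by
          refine pow_le_pow_left₀ (integral_nonneg fun y => mul_nonneg (moll_nonneg _ _)
            (weight_nonneg _ _)) (hmoll x hx.1 hx.2) 2
        calc _ ≤ ‖Q i‖ * ‖T‖ * mollify n (weight Φ₁) x ^ 2 := abs_flux_le h n i x
          _ ≤ A * (2 * weight Φ₁ x) ^ 2 := mul_le_mul (hA i) h1 (sq_nonneg _) hA0
          _ = _ := by ring
      have ha0 := stepInv_nonneg hm (weight Φ₁ x)
      have t1 : |m * deriv step (m * weight Φ₁ x) * G₁ x i * (ζ x * q i x)| ≤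
          4 * A * (m * |deriv step (m * weight Φ₁ x)| * weight Φ₁ x *
            (|G₁ x i| * (weight Φ₁ x * decay d x))) := by
        rw [abs_mul, abs_mul, abs_mul, abs_mul, abs_of_pos hm, abs_of_nonneg (hζ0 x)]
        calc _ ≤ m * |deriv step (m * weight Φ₁ x)| * |G₁ x i| *
              (decay d x * (4 * A * weight Φ₁ x ^ 2)) := by
              have := hζ1 x
              gcongr
          _ = _ := by ring
      have t2 : |stepInv m (weight Φ₁ x) * (q i x * pd i ζ x)| ≤
          (d + 1) * (b x * |q i x|) + 4 * A * τ * (weight Φ₁ x * decay d x) := by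
        rw [abs_mul, abs_mul, abs_of_nonneg ha0]
        have hstep : stepInv m (weight Φ₁ x) * weight Φ₁ x ≤ 1 := by
          rw [mul_comm, mul_stepInv]; exact step_le_one _
        calc _ ≤ stepInv m (weight Φ₁ x) * (|q i x| * ((d + 1) * ζ x + τ * decay d x)) := by
              gcongr
              exact hdζ i x
          _ = (d + 1) * (b x * |q i x|) + stepInv m (weight Φ₁ x) * |q i x| * (τ * decay d x) := by
              rw [hb]; ring
          _ ≤ (d + 1) * (b x * |q i x|) +
              stepInv m (weight Φ₁ x) * (4 * A * weight Φ₁ x ^ 2) * (τ * decay d x) := by gcongr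
          _ = (d + 1) * (b x * |q i x|) + (stepInv m (weight Φ₁ x) * weight Φ₁ x) *
              (4 * A * τ * (weight Φ₁ x * decay d x)) := by ring
          _ ≤ _ := by
              refine add_le_add le_rfl ?_
              exact mul_le_of_le_one_left (mul_nonneg (mul_nonneg (mul_nonneg (by norm_num) hA0) hτ)
                (mul_nonneg hw0 hd0)) hstep
      have t3 := (abs_le.1 t1).1
      have t4 := (abs_le.1 t2).2
      have t5 : 0 ≤ ((d : ℝ) + 1) * (b x * |q i x|) := by
        have := hb0 x
        positivity
      linarith
    · have z1 : ζ x = 0 ∨ weight Φ₁ x < 1 / m := by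
        by_contra hne
        push Not at hne
        exact hx ⟨subset_tsupport _ hne.1, hne.2⟩
      -- Outside the support of `ζ`, or where the density is below `1/m`, every factor that could
      -- contribute vanishes.
      have z2 : m * deriv step (m * weight Φ₁ x) * G₁ x i * (ζ x * q i x) -
          stepInv m (weight Φ₁ x) * (q i x * pd i ζ x) = 0 := by
        by_cases z3 : weight Φ₁ x < 1 / m
        · rw [stepInv_eq_zero hm z3.le, deriv_step_eq_zero (Or.inl _)]
          · ring
          · rw [lt_div_iff₀ hm] at z3; linarith
        · have z4 : x ∉ tsupport ζ := fun h1 => hx ⟨h1, not_lt.1 z3⟩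
          rw [image_eq_zero_of_notMem_tsupport z4,
            image_eq_zero_of_notMem_tsupport fun h1 => z4 (tsupport_pd_subset ζ i h1)]
          ring
      rw [z2, mul_zero]
      have t1 : 0 ≤ b x * |q i x| := mul_nonneg (hb0 x) (abs_nonneg _)
      have t2 : 0 ≤ weight Φ₁ x * decay d x := mul_nonneg hw0 hd0
      positivity
  have iI : Integrable fun y => b y * F y + ∑ i, ((d + 1) * (b y * |q i y|) +
      1 / 2 * (stepInv m (weight Φ₁ y) * ζ y * (G₁ y i * q i y + pd i (q i) y))) :=
    ibF.add (integrable_finsetSum _ fun i _ => ((ibq i).const_mul _).add ((hJ i).1.const_mul _))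
  have iO : ∀ i, Integrable fun y => (oscSq n (K.indicator fun x => G₁ x i) y).toReal := fun i => by
    refine integrable_toReal_of_lintegral_ne_top ?_ (hfin i)
    have h1 := (memLp_indicator_iff_restrict hK.measurableSet).2
      (memLp_euclidean_apply (h.memLp_restrict hK hKΩ) i)
    exact (aemeasurable_osc h1.1 n).lintegral_prod_right'
  have hup : ∫ y, (b y * F y + ∑ i, ((d + 1) * (b y * |q i y|) +
      1 / 2 * (stepInv m (weight Φ₁ y) * ζ y * (G₁ y i * q i y + pd i (q i) y)))) ≤
      ∫ y, 1 / 2 * m * (‖T‖ ^ 2 * B ^ 2) *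
        ∑ i, (oscSq n (K.indicator fun x => G₁ x i) y).toReal := by
    refine integral_mono_ae iI ((integrable_finsetSum _ fun i _ => iO i).const_mul _) ?_
    have hae : ∀ᵐ y, ∀ i, oscSq n (K.indicator fun x => G₁ x i) y < ⊤ := by
      rw [ae_all_iff]
      intro i
      have h1 := (memLp_indicator_iff_restrict hK.measurableSet).2
        (memLp_euclidean_apply (h.memLp_restrict hK hKΩ) i)
      exact ae_lt_top' (aemeasurable_osc h1.1 n).lintegral_prod_right' (hfin i)
    filter_upwards [hae] with y hy
    have hosc0 : 0 ≤ ∑ i, (oscSq n (K.indicator fun x => G₁ x i) y).toReal :=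
      Finset.sum_nonneg fun i _ => ENNReal.toReal_nonneg
    have e1 : b y * F y + ∑ i, ((d + 1) * (b y * |q i y|) +
        1 / 2 * (stepInv m (weight Φ₁ y) * ζ y * (G₁ y i * q i y + pd i (q i) y))) =
        b y * (F y + (d + 1) * ∑ i, |q i y| + 1 / 2 * ∑ i, (G₁ y i * q i y + pd i (q i) y)) := by
      rw [Finset.sum_add_distrib, ← Finset.mul_sum, ← Finset.mul_sum, ← Finset.mul_sum,
        ← Finset.mul_sum]
      ring
    rw [e1]
    by_cases hx : y ∈ tsupport ζ ∧ 1 / m ≤ weight Φ₁ y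
    · have hbK := hball y hx.1 hx.2
      have h1 := hs.local_inequality h hr (hbK.trans hKΩ)
      have h2 : ∑ i, ‖T (lpClass 1 (gibbs Φ₁) fun x => (G₁ x i - G₁ y i) * moll d n (y - x))‖ ^ 2 ≤
          ∑ i, ‖T‖ ^ 2 * B ^ 2 * (oscSq n (K.indicator fun x => G₁ x i) y).toReal := by
        refine Finset.sum_le_sum fun i _ => ?_
        have h3 := ENNReal.toReal_mono (ENNReal.mul_ne_top (by simp) (hy i).ne)
          (enorm_lpClass_osc_le h hB hK hKΩ hbK i)
        rw [ENNReal.toReal_pow, toReal_enorm, ENNReal.toReal_mul, ENNReal.toReal_pow,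
          ENNReal.toReal_ofReal hB0] at h3
        calc _ ≤ (‖T‖ * ‖lpClass 1 (gibbs Φ₁) fun x => (G₁ x i - G₁ y i) * moll d n (y - x)‖) ^ 2 :=
              pow_le_pow_left₀ (norm_nonneg _) (T.le_opNorm _) 2
          _ = ‖T‖ ^ 2 * ‖lpClass 1 (gibbs Φ₁) fun x => (G₁ x i - G₁ y i) * moll d n (y - x)‖ ^ 2 :=
              mul_pow _ _ _
          _ ≤ ‖T‖ ^ 2 * (B ^ 2 * (oscSq n (K.indicator fun x => G₁ x i) y).toReal) := by gcongr
          _ = _ := by ring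
      rw [← Finset.mul_sum] at h2
      calc _ ≤ b y * (1 / 2 * (‖T‖ ^ 2 * B ^ 2 *
            ∑ i, (oscSq n (K.indicator fun x => G₁ x i) y).toReal)) :=
            mul_le_mul_of_nonneg_left (h1.trans (by linarith)) (hb0 y)
        _ ≤ m * (1 / 2 * (‖T‖ ^ 2 * B ^ 2 *
            ∑ i, (oscSq n (K.indicator fun x => G₁ x i) y).toReal)) :=
            mul_le_mul_of_nonneg_right (hbm y) (by positivity)
        _ = _ := by ring
    · have : b y = 0 := by
        by_cases z3 : weight Φ₁ y < 1 / m
        · simp only [hb]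
          rw [stepInv_eq_zero hm z3.le, zero_mul]
        · have z4 : y ∉ tsupport ζ := fun h1 => hx ⟨h1, not_lt.1 z3⟩
          simp only [hb]
          rw [image_eq_zero_of_notMem_tsupport z4, mul_zero]
      rw [this, zero_mul]
      positivity
  rw [integral_const_mul, integral_finsetSum _ fun i _ => iO i] at hup
  have e2 : ∀ i, ∫ y, (oscSq n (K.indicator fun x => G₁ x i) y).toReal =
      (∫⁻ y, oscSq n (K.indicator fun x => G₁ x i) y).toReal := fun i => by
    have h1 := (memLp_indicator_iff_restrict hK.measurableSet).2
      (memLp_euclidean_apply (h.memLp_restrict hK hKΩ) i)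
    exact integral_toReal (aemeasurable_osc h1.1 n).lintegral_prod_right'
      (ae_lt_top' (aemeasurable_osc h1.1 n).lintegral_prod_right' (hfin i))
  simp only [e2] at hup
  have iIi : ∀ i, Integrable fun y => (d + 1) * (b y * |q i y|) +
      1 / 2 * (stepInv m (weight Φ₁ y) * ζ y * (G₁ y i * q i y + pd i (q i) y)) := fun i =>
    ((ibq i).const_mul _).add ((hJ i).1.const_mul _)
  have e3 : ∀ i, ∫ y, ((d + 1) * (b y * |q i y|) +
      1 / 2 * (stepInv m (weight Φ₁ y) * ζ y * (G₁ y i * q i y + pd i (q i) y))) =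
      (d + 1) * (∫ y, b y * |q i y|) +
      1 / 2 * ∫ y, stepInv m (weight Φ₁ y) * ζ y * (G₁ y i * q i y + pd i (q i) y) := fun i => by
    rw [integral_add ((ibq i).const_mul _) ((hJ i).1.const_mul _), integral_const_mul,
      integral_const_mul]
  rw [integral_add ibF (integrable_finsetSum _ fun i _ => iIi i),
    integral_finsetSum _ fun i _ => iIi i] at hup
  simp only [e3] at hup
  have hsum := Finset.sum_le_sum fun i (_ : i ∈ Finset.univ) => hlow i
  rw [← sub_nonneg, ← Finset.sum_sub_distrib] at hsum
  have e4 : ∑ i, ((d + 1) * (∫ y, b y * |q i y|) + (2 * A * τ * (∫ x, weight Φ₁ x * decay d x) +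
        2 * A * ∫ x, m * |deriv step (m * weight Φ₁ x)| * weight Φ₁ x *
          (|G₁ x i| * (weight Φ₁ x * decay d x))) -
        -(1 / 2) * ∫ x, stepInv m (weight Φ₁ x) * ζ x * (G₁ x i * q i x + pd i (q i) x)) =
      ∑ i, ((d + 1) * (∫ y, b y * |q i y|) +
        1 / 2 * ∫ y, stepInv m (weight Φ₁ y) * ζ y * (G₁ y i * q i y + pd i (q i) y)) +
      ∑ i, (2 * A * τ * (∫ x, weight Φ₁ x * decay d x) +
        2 * A * ∫ x, m * |deriv step (m * weight Φ₁ x)| * weight Φ₁ x *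
          (|G₁ x i| * (weight Φ₁ x * decay d x))) := by
    rw [← Finset.sum_add_distrib]
    exact Finset.sum_congr rfl fun i _ => by ring
  rw [e4] at hsum
  linarith

end KineticSolution

end KineticGlobal

/-! ### Removing mollification and cut-offs -/

section KineticLimit

variable {d : ℕ} {Φ₁ : E d → EReal} {G₁ : E d → E d}

/-- Near the zeros of the density, the boundary terms of the integration by parts vanish. -/
theorem PositionAssumptions.tendsto_integral_boundary (h : PositionAssumptions Φ₁ G₁) (i : Fin d) :
    Tendsto (fun N : ℕ => ∫ x, ((N : ℝ) + 1) * |deriv step (((N : ℝ) + 1) * weight Φ₁ x)| *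
      weight Φ₁ x * (|G₁ x i| * (weight Φ₁ x * decay d x))) atTop (𝓝 0) := by
  obtain ⟨B, hB0, hB⟩ := exists_deriv_step_bound
  have hρ := h.continuous_weight
  have hint := h.integrable_gradient_mul_decay i
  have hnn : ∀ x, 0 ≤ |G₁ x i| * (weight Φ₁ x * decay d x) := fun x =>
    mul_nonneg (abs_nonneg _) (mul_nonneg (weight_nonneg _ _) (decay_pos x).le)
  have := tendsto_integral_of_dominated_convergence (μ := volume)
    (F := fun (N : ℕ) x => ((N : ℝ) + 1) * |deriv step (((N : ℝ) + 1) * weight Φ₁ x)| *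
      weight Φ₁ x * (|G₁ x i| * (weight Φ₁ x * decay d x))) (f := fun _ => (0 : ℝ))
    (fun x => 2 * B * (|G₁ x i| * (weight Φ₁ x * decay d x)))
    (fun N => (((continuous_const.mul (continuous_deriv_step.comp
      (continuous_const.mul hρ)).abs).mul hρ).aestronglyMeasurable.mul hint.1))
    (hint.const_mul _) (fun N => ae_of_all _ fun x => ?_) (ae_of_all _ fun x => ?_)
  · simpa using this
  · have hm : (0 : ℝ) < N + 1 := by positivity
    have hw := weight_nonneg Φ₁ x
    rw [Real.norm_of_nonneg (mul_nonneg (by positivity) (hnn x))]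
    refine mul_le_mul_of_nonneg_right ?_ (hnn x)
    by_cases h2 : ((N : ℝ) + 1) * weight Φ₁ x ≤ 2
    · calc _ = (((N : ℝ) + 1) * weight Φ₁ x) * |deriv step (((N : ℝ) + 1) * weight Φ₁ x)| := by ring
        _ ≤ 2 * B := mul_le_mul h2 (hB _) (abs_nonneg _) zero_le_two
    · rw [deriv_step_eq_zero (Or.inr (not_le.1 h2))]
      simp only [abs_zero, mul_zero, zero_mul]
      positivity
  · rcases (weight_nonneg Φ₁ x).eq_or_lt with h0 | h0
    · simp [← h0]
    · refine tendsto_const_nhds.congr' ?_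
      obtain ⟨N₀, hN₀⟩ := exists_nat_gt (2 / weight Φ₁ x)
      filter_upwards [eventually_ge_atTop N₀] with N hN
      rw [deriv_step_eq_zero (Or.inr _)]
      · simp
      · rw [div_lt_iff₀ h0] at hN₀
        have : (N₀ : ℝ) ≤ N := Nat.cast_le.2 hN
        nlinarith

namespace KineticSolution

variable {Y C : Type*} [NormedAddCommGroup Y] [InnerProductSpace ℝ Y] [CompleteSpace Y]
  [AddCommGroup C] [Module ℝ C]
  {ι N : C →ₗ[ℝ] Y} {D M : Fin d → C →ₗ[ℝ] Y} {R r : ℝ} {T : Lp ℝ 1 (gibbs Φ₁) →L[ℝ] Y}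
  {Q : Fin d → Lp ℝ 1 (gibbs Φ₁) →L[ℝ] Y}

/-- With `ζ` and `m` fixed, only points of a compact subset of `{Φ₁ < ∞}` matter. There the
oscillation of `∇Φ₁` tends to zero, and uniform continuity of the density up to `1/m ≤ ρ(y)` gives
the bound of the mollified density by `2 ρ(y)`. -/
theorem eventually_integral_le (hs : KineticSolution Φ₁ G₁ ι N D M R r T Q)
    (h : PositionAssumptions Φ₁ G₁)
    (hr : 3 / 2 + ((d : ℝ) + 1) ^ 2 * d * (R + 1) / 2 ≤ r)
    {ζ : E d → ℝ} {τ m A : ℝ} (hζ : ζ ∈ testFunctions (univ : Set (E d))) (hζ0 : ∀ x, 0 ≤ ζ x)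
    (hζ1 : ∀ x, ζ x ≤ decay d x) (hτ : 0 ≤ τ)
    (hdζ : ∀ i x, |pd i ζ x| ≤ (d + 1) * ζ x + τ * decay d x) (hm : 0 < m)
    (hA : ∀ i, ‖Q i‖ * ‖T‖ ≤ A) (hA0 : 0 ≤ A) {e : ℝ} (he : 0 < e) :
    ∀ᶠ n : ℕ in atTop,
    ∫ y, stepInv m (weight Φ₁ y) * ζ y * ‖T (translateClass (gibbs Φ₁) (moll d n) y)‖ ^ 2 ≤
      ∑ i, (2 * A * τ * (∫ x, weight Φ₁ x * decay d x) +
        2 * A * ∫ x, m * |deriv step (m * weight Φ₁ x)| * weight Φ₁ x *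
          (|G₁ x i| * (weight Φ₁ x * decay d x))) + e := by
  have hρ := h.continuous_weight
  obtain ⟨B, hB⟩ : ∃ B, ∀ x, weight Φ₁ x ≤ B := h.exists_lower_bound.elim fun c hc => ⟨_, hc.2⟩
  set K₀ : Set (E d) := tsupport ζ ∩ {x | 1 / m ≤ weight Φ₁ x} with hK₀
  have hK₀c : IsCompact K₀ := hζ.2.1.isCompact.inter_right (isClosed_le continuous_const hρ)
  have hK₀Ω : K₀ ⊆ finiteSet Φ₁ := fun x hx =>
    (h.weight_pos_iff x).1 (lt_of_lt_of_le (by positivity) hx.2)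
  obtain ⟨δ, hδ, hδK⟩ := hK₀c.exists_cthickening_subset_open h.isOpen_finiteSet hK₀Ω
  have hK' : IsCompact (Metric.cthickening δ K₀) := hK₀c.cthickening
  have huc := hK₀c.uniformContinuousAt_of_continuousAt (weight Φ₁)
    (fun a _ => hρ.continuousAt) (Metric.dist_mem_uniformity (by positivity : 0 < 1 / m))
  obtain ⟨δ', hδ', hδ'K⟩ := Metric.mem_uniformity_dist.1 huc
  have hosc : ∀ i, Tendsto (fun n => ∫⁻ y, oscSq n
      ((Metric.cthickening δ K₀).indicator fun x => G₁ x i) y) atTop (𝓝 0) := fun i =>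
    tendsto_lintegral_oscSq ((memLp_indicator_iff_restrict hK'.measurableSet).2
      (memLp_euclidean_apply (h.memLp_restrict hK' hδK) i))
  have hlim : Tendsto (fun n => 1 / 2 * m * (‖T‖ ^ 2 * B ^ 2) * ∑ i, (∫⁻ y, oscSq n
      ((Metric.cthickening δ K₀).indicator fun x => G₁ x i) y).toReal) atTop (𝓝 0) := by
    have := (tendsto_finsetSum Finset.univ fun i _ =>
      (ENNReal.tendsto_toReal ENNReal.zero_ne_top).comp (hosc i)).const_mul
        (1 / 2 * m * (‖T‖ ^ 2 * B ^ 2))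
    simpa using this
  have hfin : ∀ᶠ n in atTop, ∀ i, ∫⁻ y, oscSq n
      ((Metric.cthickening δ K₀).indicator fun x => G₁ x i) y < ⊤ :=
    eventually_all.2 fun i => (hosc i).eventually (gt_mem_nhds ENNReal.zero_lt_top)
  filter_upwards [hlim.eventually (gt_mem_nhds he), hfin,
    tendsto_radius.eventually (gt_mem_nhds hδ), tendsto_radius.eventually (gt_mem_nhds hδ')]
    with n h1 h2 h3 h4
  refine (hs.integral_le h hr hB hζ hζ0 hζ1 hτ hdζ hm hA hK' hδK (fun y hy hy' => ?_)
    (fun y hy hy' => ?_) hA0 fun i => (h2 i).ne).trans (by linarith)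
  · exact (Metric.closedBall_subset_closedBall h3.le).trans
      (Metric.closedBall_subset_cthickening (show y ∈ K₀ from ⟨hy, hy'⟩) δ)
  · have := abs_mollify_sub_le hρ.locallyIntegrable n (x := y) (r := 1 / m) fun z hz => by
      rw [dist_comm]
      refine (hδ'K (a := y) (b := z) ?_ ⟨hy, hy'⟩).le
      rw [dist_comm]
      exact (Metric.mem_ball.1 hz).trans h4
    linarith [(abs_le.1 this).2]

/-- Order of limits: the cut-off index `k` is fixed first so that outer and boundary errors are
small, and only then is the mollification refined. -/
theorem tendsto_setIntegral_sq (hs : KineticSolution Φ₁ G₁ ι N D M R r T Q)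
    (h : PositionAssumptions Φ₁ G₁)
    (hr : 3 / 2 + ((d : ℝ) + 1) ^ 2 * d * (R + 1) / 2 ≤ r) {K : Set (E d)} (hK : IsCompact K)
    (hKΩ : K ⊆ finiteSet Φ₁) :
    Tendsto (fun n => ∫ y in K, ‖T (translateClass (gibbs Φ₁) (moll d n) y)‖ ^ 2) atTop (𝓝 0) := by
  have hfc := h.finiteOnCompacts
  have hρ := h.continuous_weight
  obtain ⟨B, hB⟩ : ∃ B, ∀ x, weight Φ₁ x ≤ B := h.exists_lower_bound.elim fun c hc => ⟨_, hc.2⟩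
  obtain ⟨x₀, hx₀⟩ := h.nonempty
  have hB0 : 0 < B := ((h.weight_pos_iff x₀).2 hx₀).trans_le (hB x₀)
  obtain ⟨s, hs0, hsK⟩ := hK.exists_forall_le' hρ.continuousOn
    fun x hx => (h.weight_pos_iff x).2 (hKΩ hx)
  obtain ⟨κ, hκ0, hκK⟩ := hK.exists_forall_le' (contDiff_decay (d := d)).continuous.continuousOn
    fun x _ => decay_pos x
  obtain ⟨ρ₀, hρ₀⟩ := hK.isBounded.subset_closedBall (0 : E d)
  obtain ⟨ζ, τ, hζ, hζ0, hζ1, hζ2, hdζ, hτ0, hτ⟩ := exists_decaying_cutoffs (d := d)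
  set A := ∑ i, ‖Q i‖ * ‖T‖ with hAdef
  have hA : ∀ i, ‖Q i‖ * ‖T‖ ≤ A := fun i =>
    Finset.single_le_sum (f := fun i => ‖Q i‖ * ‖T‖) (fun j _ => by positivity) (Finset.mem_univ i)
  have hA0 : 0 ≤ A := Finset.sum_nonneg fun i _ => by positivity
  have hrem : Tendsto (fun k : ℕ => ∑ i, (2 * A * τ k * (∫ x, weight Φ₁ x * decay d x) +
        2 * A * ∫ x, ((k : ℝ) + 1) * |deriv step (((k : ℝ) + 1) * weight Φ₁ x)| * weight Φ₁ x *
          (|G₁ x i| * (weight Φ₁ x * decay d x)))) atTop (𝓝 0) := by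
    have := tendsto_finsetSum Finset.univ fun i _ => (((hτ.const_mul (2 * A)).mul_const
      (∫ x, weight Φ₁ x * decay d x)).add ((h.tendsto_integral_boundary i).const_mul (2 * A)))
    simpa using this
  have hFc : ∀ n, Continuous fun y => ‖T (translateClass (gibbs Φ₁) (moll d n) y)‖ ^ 2 := fun n =>
    (T.continuous.comp (continuous_translateClass (moll_mem_testFunctions n))).norm.pow 2
  rw [Metric.tendsto_atTop']
  intro e he
  set e' := e * (κ / B) / 3 with he'
  have he'0 : 0 < e' := by positivity
  -- Taking `k` above the radius of `K` makes the cut-off equal to the decaying weight on `K`, and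
  -- `k ≥ 2/s` makes the truncated reciprocal exact where the density is at least `s`.
  obtain ⟨k, hk1, hk2, hk3⟩ := ((hrem.eventually (gt_mem_nhds he'0)).and
    (((tendsto_natCast_atTop_atTop (R := ℝ)).eventually_ge_atTop ρ₀).and
    ((tendsto_natCast_atTop_atTop (R := ℝ)).eventually_ge_atTop (2 / s)))).exists
  have hm : (0 : ℝ) < k + 1 := by positivity
  obtain ⟨n₀, hn₀⟩ := eventually_atTop.1 (hs.eventually_integral_le h hr (hζ k) (hζ0 k) (hζ1 k)
    (hτ0 k) (hdζ k) hm hA hA0 he'0)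
  refine ⟨n₀, fun n hn => ?_⟩
  have h1 := (hn₀ n hn.le)
  have hbc : Continuous fun y => stepInv ((k : ℝ) + 1) (weight Φ₁ y) * ζ k y :=
    ((contDiff_stepInv hm).continuous.comp hρ).mul (hζ k).1.continuous
  have ibF : Integrable fun y => stepInv ((k : ℝ) + 1) (weight Φ₁ y) * ζ k y *
      ‖T (translateClass (gibbs Φ₁) (moll d n) y)‖ ^ 2 :=
    (hbc.mul (hFc n)).integrable_of_hasCompactSupport ((hζ k).2.1.mul_left).mul_right
  have h2 : ∫ y in K, κ / B * ‖T (translateClass (gibbs Φ₁) (moll d n) y)‖ ^ 2 ≤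
      ∫ y, stepInv ((k : ℝ) + 1) (weight Φ₁ y) * ζ k y *
        ‖T (translateClass (gibbs Φ₁) (moll d n) y)‖ ^ 2 := by
    refine (setIntegral_mono_on (((hFc n).const_mul _).continuousOn.integrableOn_compact hK)
      ibF.integrableOn hK.measurableSet fun y hy => ?_).trans
      (setIntegral_le_integral ibF (ae_of_all _ fun y => mul_nonneg
        (mul_nonneg (stepInv_nonneg hm _) (hζ0 k y)) (sq_nonneg _)))
    refine mul_le_mul_of_nonneg_right ?_ (sq_nonneg _)
    have h3 : weight Φ₁ y * stepInv ((k : ℝ) + 1) (weight Φ₁ y) = 1 := by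
      rw [mul_stepInv]
      refine step_eq_one ?_
      have := hsK y hy
      rw [div_le_iff₀ hs0] at hk3
      nlinarith
    have h4 : ζ k y = decay d y := hζ2 k y ((mem_closedBall_zero_iff.1 (hρ₀ hy)).trans hk2)
    have h5 := stepInv_nonneg hm (weight Φ₁ y)
    rw [h4, div_le_iff₀ hB0]
    calc κ ≤ decay d y := hκK y hy
      _ = weight Φ₁ y * stepInv ((k : ℝ) + 1) (weight Φ₁ y) * decay d y := by rw [h3, one_mul]
      _ ≤ B * stepInv ((k : ℝ) + 1) (weight Φ₁ y) * decay d y := by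
        have := (decay_pos y).le
        gcongr
        exact hB y
      _ = _ := by ring
  rw [integral_const_mul] at h2
  have h6 : κ / B * ∫ y in K, ‖T (translateClass (gibbs Φ₁) (moll d n) y)‖ ^ 2 < κ / B * e := by
    have : κ / B * e = e' + e' + e' := by rw [he']; ring
    linarith
  rw [Real.dist_0_eq_abs, abs_of_nonneg (integral_nonneg fun y => sq_nonneg _)]
  exact lt_of_mul_lt_mul_left h6 (by positivity)

/-- The class of `p` is the `L¹` limit of its mollifications, which are the integrals `∫ p(y) P_y
dy` of translated mollifiers. By Cauchy–Schwarz, `T` of these is bounded by the `L²` norm of `T P_y`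
over the support of `p`, which tends to zero. -/
theorem apply_lpClass_eq_zero (hs : KineticSolution Φ₁ G₁ ι N D M R r T Q)
    (h : PositionAssumptions Φ₁ G₁)
    (hr : 3 / 2 + ((d : ℝ) + 1) ^ 2 * d * (R + 1) / 2 ≤ r) {p : E d → ℝ}
    (hp : p ∈ testFunctions (finiteSet Φ₁)) : T (lpClass 1 (gibbs Φ₁) p) = 0 := by
  have hfc := h.finiteOnCompacts
  have hsf : SigmaFinite (gibbs Φ₁) := inferInstance
  have hpc := hp.1.continuous
  set K := tsupport p with hKdef
  have hK : IsCompact K := hp.2.1.isCompact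
  have hconv : ∀ n, ∫ y, p y • translateClass (gibbs Φ₁) (moll d n) y =
      lpClass 1 (gibbs Φ₁) (mollify n p) := fun n => by
    rw [integral_smul_translateClass hpc hp.2.1 (moll_mem_testFunctions n)]
    congr 1
    funext x
    unfold mollify
    refine integral_congr_ae (ae_of_all _ fun y => ?_)
    simp only
    rw [mul_comm, ← neg_sub, moll_neg]
  have hlim1 : Tendsto (fun n => T (lpClass 1 (gibbs Φ₁) (mollify n p))) atTop
      (𝓝 (T (lpClass 1 (gibbs Φ₁) p))) := by
    refine (T.continuous.tendsto _).comp ?_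
    rw [tendsto_iff_norm_sub_tendsto_zero]
    set K' := Metric.cthickening 1 K with hK'def
    have hK' : IsCompact K' := hK.cthickening
    have hmp : ∀ n, MemLp (mollify n p) 1 (gibbs Φ₁) := fun n => by
      refine (contDiff_mollify n hpc.locallyIntegrable).continuous.memLp_of_hasCompactSupport ?_
      refine HasCompactSupport.of_support_subset_isCompact hK'
        ((support_mollify_subset (A := K) (fun x hx => image_eq_zero_of_notMem_tsupport hx) n).trans
        (Metric.cthickening_mono ?_ _))
      rw [div_le_one (by positivity)]
      linarith [(Nat.cast_nonneg n : (0 : ℝ) ≤ n)]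
    have hpm : MemLp p 1 (gibbs Φ₁) := memLp_of_mem_testFunctions hp 1
    have huc := hp.2.1.uniformContinuous_of_continuous hpc
    rw [Metric.tendsto_atTop]
    intro e he
    set e' := e / 2 / ((gibbs Φ₁).real K' + 1) with he'
    have hv : 0 ≤ (gibbs Φ₁).real K' := measureReal_nonneg
    have he'0 : 0 < e' := by positivity
    obtain ⟨δ, hδ, hδp⟩ := Metric.uniformContinuous_iff.1 huc e' he'0
    obtain ⟨n₀, hn₀⟩ := eventually_atTop.1 (tendsto_radius.eventually (gt_mem_nhds hδ))
    refine ⟨n₀, fun n hn => ?_⟩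
    rw [← lpClass_sub (hmp n) hpm, Real.dist_0_eq_abs, abs_of_nonneg (norm_nonneg _),
      norm_lpClass_one (f := fun x => mollify n p x - p x) ((hmp n).sub hpm)]
    have hle : ∀ x, |mollify n p x - p x| ≤ K'.indicator (fun _ => e') x := fun x => by
      by_cases hx : x ∈ K'
      · rw [indicator_of_mem hx]
        exact abs_mollify_sub_le hpc.locallyIntegrable n fun y hy =>
          (hδp ((Metric.mem_ball.1 hy).trans (hn₀ n hn))).le
      · have h1 : x ∉ K := fun hx' => hx (Metric.self_subset_cthickening _ hx')
        have h2 : mollify n p x = 0 := by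
          by_contra hne
          refine hx (Metric.cthickening_mono ?_ _ (support_mollify_subset (A := K)
            (fun x hx => image_eq_zero_of_notMem_tsupport hx) n hne))
          rw [div_le_one (by positivity)]
          linarith [(Nat.cast_nonneg n : (0 : ℝ) ≤ n)]
        rw [h2, image_eq_zero_of_notMem_tsupport h1, indicator_of_notMem hx]
        simp
    have hi : Integrable (K'.indicator fun _ => e') (gibbs Φ₁) :=
      (integrable_indicator_iff hK'.measurableSet).2 (integrableOn_const hK'.measure_lt_top.ne)
    calc ∫ x, |mollify n p x - p x| ∂gibbs Φ₁ ≤ ∫ x, K'.indicator (fun _ => e') x ∂gibbs Φ₁ :=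
          integral_mono (memLp_one_iff_integrable.1 ((hmp n).sub hpm)).abs hi hle
      _ = (gibbs Φ₁).real K' * e' := by
          rw [integral_indicator hK'.measurableSet, setIntegral_const, smul_eq_mul]
      _ < e := by
          rw [he']
          have : (gibbs Φ₁).real K' * (e / 2 / ((gibbs Φ₁).real K' + 1)) ≤ e / 2 := by
            rw [mul_div_assoc', div_le_iff₀ (by positivity)]
            nlinarith
          linarith
  have hlim2 : Tendsto (fun n => T (lpClass 1 (gibbs Φ₁) (mollify n p))) atTop (𝓝 0) := by
    rw [tendsto_zero_iff_norm_tendsto_zero]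
    set c := ∫ y in K, p y ^ 2 with hc
    have hc0 : 0 ≤ c := integral_nonneg fun y => sq_nonneg _
    have hTK := hs.tendsto_setIntegral_sq h hr hK hp.2.2
    have hsq := (hTK.const_mul c).sqrt
    rw [mul_zero, Real.sqrt_zero] at hsq
    refine squeeze_zero (fun n => norm_nonneg _) (fun n => ?_) hsq
    have hcont : Continuous fun y => T (translateClass (gibbs Φ₁) (moll d n) y) :=
      T.continuous.comp (continuous_translateClass (moll_mem_testFunctions n))
    have hint : Integrable fun y => p y • translateClass (gibbs Φ₁) (moll d n) y :=
      (hpc.smul (continuous_translateClass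
        (moll_mem_testFunctions n))).integrable_of_hasCompactSupport hp.2.1.smul_right
    rw [← hconv n, ← ContinuousLinearMap.integral_comp_comm _ hint]
    simp only [map_smul]
    have h1 : ∫ y, p y • T (translateClass (gibbs Φ₁) (moll d n) y) =
        ∫ y in K, p y • T (translateClass (gibbs Φ₁) (moll d n) y) :=
      (setIntegral_eq_integral_of_forall_compl_eq_zero fun y hy => by
        rw [image_eq_zero_of_notMem_tsupport hy, zero_smul]).symm
    rw [h1]
    refine (norm_integral_le_integral_norm _).trans (Real.le_sqrt_of_sq_le ?_)
    simp only [norm_smul, Real.norm_eq_abs]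
    have hfin : IsFiniteMeasure (volume.restrict K) := ⟨by
      rw [Measure.restrict_apply_univ]; exact hK.measure_lt_top⟩
    have i1 : IntegrableOn (fun y => |p y| * ‖T (translateClass (gibbs Φ₁) (moll d n) y)‖) K volume :=
      (hpc.abs.mul hcont.norm).continuousOn.integrableOn_compact hK
    have i2 : IntegrableOn (fun y => p y ^ 2) K volume :=
      (hpc.pow 2).continuousOn.integrableOn_compact hK
    have i3 : IntegrableOn (fun y => ‖T (translateClass (gibbs Φ₁) (moll d n) y)‖ ^ 2) K volume :=
      (hcont.norm.pow 2).continuousOn.integrableOn_compact hK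
    have hI0 : 0 ≤ ∫ y in K, |p y| * ‖T (translateClass (gibbs Φ₁) (moll d n) y)‖ :=
      integral_nonneg fun y => by positivity
    have := integral_mul_le_Lp_mul_Lq_of_nonneg (μ := volume.restrict K) Real.HolderConjugate.two_two
      (f := fun y => |p y|) (g := fun y => ‖T (translateClass (gibbs Φ₁) (moll d n) y)‖)
      (ae_of_all _ fun y => abs_nonneg _) (ae_of_all _ fun y => norm_nonneg _)
      (by
        rw [ENNReal.ofReal_ofNat]
        exact (memLp_two_iff_integrable_sq hpc.abs.aestronglyMeasurable).2 (by
          simp only [sq_abs]; exact i2))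
      (by
        rw [ENNReal.ofReal_ofNat]
        exact (memLp_two_iff_integrable_sq hcont.norm.aestronglyMeasurable).2 i3)
    simp only [Real.rpow_two, sq_abs, ← Real.sqrt_eq_rpow] at this
    calc _ ≤ (√c * √(∫ y in K, ‖T (translateClass (gibbs Φ₁) (moll d n) y)‖ ^ 2)) ^ 2 :=
          pow_le_pow_left₀ hI0 this 2
      _ = _ := by
          rw [mul_pow, Real.sq_sqrt hc0, Real.sq_sqrt (integral_nonneg fun y => sq_nonneg _)]
  exact tendsto_nhds_unique hlim1 hlim2

end KineticSolution

end KineticLimit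

/-! ### Density of test functions in `L^p` -/

section Density

variable {X : Type*} [NormedAddCommGroup X] [NormedSpace ℝ X] [FiniteDimensional ℝ X]
  [MeasurableSpace X] [BorelSpace X] {μ : Measure X} [IsFiniteMeasureOnCompacts μ]

/-- Smooth functions with compact support in an open set of full measure are dense in `L^p`. -/
theorem dense_testFunctions {p : ℝ≥0∞} [Fact (1 ≤ p)] (hp : p ≠ ⊤) {U : Set X} (hU : IsOpen U)
    (hμU : μ Uᶜ = 0) : Dense {u : Lp ℝ p μ | ∃ g ∈ testFunctions U, u = lpClass p μ g} := by
  have hp1 : 1 ≤ p := Fact.out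
  have hp0 : 0 < p.toReal := ENNReal.toReal_pos (zero_lt_one.trans_le hp1).ne' hp
  -- A smooth nonnegative `w` with nonvanishing set exactly `U` turns `step (n * w)` into cut-offs
  -- exhausting `U`.
  obtain ⟨w, hw1, hw2, hw3⟩ := hU.exists_contDiff_support_eq (n := ⊤)
  have hw0 : ∀ x, 0 ≤ w x := fun x => (hw3 (mem_range_self x)).1
  refine (Lp.dense_hasCompactSupport_contDiff (F := ℝ) (μ := μ) hp).mono ?_ |>.of_closure
  rintro u ⟨g, hug, hgc, hg⟩
  obtain ⟨M, hM⟩ := hgc.exists_bound_of_continuous hg.continuous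
  have hM0 : 0 ≤ M := (norm_nonneg _).trans (hM 0)
  let χ : ℕ → X → ℝ := fun n x => step (n * w x)
  have hχ : ∀ n, ContDiff ℝ ∞ (χ n) := fun n => contDiff_step.comp (contDiff_const.mul hw2)
  have hmem : ∀ n, (fun x => χ n x * g x) ∈ testFunctions U := fun n => by
    refine ⟨(hχ n).mul hg, hgc.mul_left, (closure_minimal (t := {x | 1 ≤ n * w x}) ?_
      (isClosed_le continuous_const (continuous_const.mul hw2.continuous))).trans fun x hx => ?_⟩
    · intro x hx
      by_contra h
      exact hx (by simp only [χ]; rw [step_eq_zero (not_le.1 h).le, zero_mul])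
    · rw [← hw1]
      intro h0
      have hx' : 1 ≤ n * w x := hx
      rw [h0, mul_zero] at hx'
      exact absurd hx' (by norm_num)
  have hgm : MemLp g p μ := hg.continuous.memLp_of_hasCompactSupport hgc
  have hm : ∀ n, MemLp (fun x => χ n x * g x) p μ := fun n =>
    (hmem n).1.continuous.memLp_of_hasCompactSupport (hmem n).2.1
  let A : ℕ → Set X := fun n => tsupport g ∩ {x | n * w x < 2}
  have hAm : ∀ n, MeasurableSet (A n) := fun n => (isClosed_tsupport g).measurableSet.inter
    (isOpen_lt (continuous_const.mul hw2.continuous) continuous_const).measurableSet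
  -- The sets where the cut-off may differ from one decrease to a subset of `Uᶜ`, inside a compact
  -- set of finite measure.
  have hA0 : Tendsto (fun n => μ (A n)) atTop (𝓝 0) := by
    have h1 := tendsto_measure_iInter_atTop (μ := μ) (s := A)
      (fun n => (hAm n).nullMeasurableSet) (fun m n hmn x hx => ⟨hx.1, lt_of_le_of_lt
        (mul_le_mul_of_nonneg_right (Nat.cast_le.2 hmn) (hw0 x)) hx.2⟩)
      ⟨0, ((measure_mono inter_subset_left).trans_lt hgc.isCompact.measure_lt_top).ne⟩
    have h2 : μ (⋂ n, A n) = 0 := measure_mono_null (t := Uᶜ) (fun x hx hxU => by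
      rw [← hw1] at hxU
      have hpos : 0 < w x := lt_of_le_of_ne (hw0 x) (Ne.symm hxU)
      obtain ⟨n, hn⟩ := exists_nat_gt (2 / w x)
      rw [div_lt_iff₀ hpos] at hn
      exact absurd (mem_iInter.1 hx n).2 (not_lt.2 hn.le)) hμU
    rwa [h2] at h1
  refine mem_closure_of_tendsto (f := fun n : ℕ => lpClass p μ fun x => χ n x * g x) (b := atTop) ?_
    (Eventually.of_forall fun n => ⟨_, hmem n, rfl⟩)
  have hu : u = lpClass p μ g := eq_lpClass u hug
  rw [hu, tendsto_iff_norm_sub_tendsto_zero]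
  have h0 : Tendsto (fun n => (‖M‖ₑ * μ (A n) ^ (1 / p.toReal)).toReal) atTop (𝓝 0) := by
    refine (ENNReal.tendsto_toReal ENNReal.zero_ne_top).comp ?_
    have h1 : Tendsto (fun n => μ (A n) ^ (1 / p.toReal)) atTop (𝓝 0) :=
      ((ENNReal.continuous_rpow_const).tendsto' 0 0
        (ENNReal.zero_rpow_of_pos (by positivity))).comp hA0
    simpa using ENNReal.Tendsto.const_mul h1 (Or.inr enorm_ne_top)
  refine squeeze_zero (fun n => norm_nonneg _) (fun n => ?_) h0
  rw [← lpClass_sub (hm n) hgm, norm_lpClass (f := fun x => χ n x * g x - g x) ((hm n).sub hgm),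
    ← eLpNorm_indicator_const (hAm n) (zero_lt_one.trans_le hp1).ne' hp]
  refine ENNReal.toReal_mono ?_ (eLpNorm_mono_real fun x => ?_)
  · exact (memLp_indicator_const p (hAm n) M (Or.inr ((measure_mono inter_subset_left).trans_lt
      hgc.isCompact.measure_lt_top).ne)).eLpNorm_ne_top
  · by_cases hx : x ∈ A n
    · rw [indicator_of_mem hx]
      have h1 : χ n x * g x - g x = -((1 - χ n x) * g x) := by ring
      have h2 := step_nonneg (n * w x)
      have h3 := step_le_one (n * w x)
      rw [h1, norm_neg, norm_mul, Real.norm_of_nonneg (sub_nonneg.2 h3)]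
      exact (mul_le_mul (by linarith) (hM x) (norm_nonneg _) zero_le_one).trans (one_mul M).le
    · rw [indicator_of_notMem hx]
      have h1 : χ n x * g x - g x = 0 := by
        by_cases hxg : x ∈ tsupport g
        · have : χ n x = 1 := step_eq_one (not_lt.1 fun h => hx ⟨hxg, h⟩)
          rw [this]; ring
        · rw [image_eq_zero_of_notMem_tsupport hxg]; ring
      rw [h1, norm_zero]

end Density

/-! ### Dominated convergence in `L¹` and a density criterion -/

section Convergence

variable {α : Type*} [MeasurableSpace α] {μ : Measure α}

/-- Dominated convergence in `L¹`. -/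
theorem tendsto_lpClass_one {F : ℕ → α → ℝ} {f b : α → ℝ}
    (hF : ∀ n, AEStronglyMeasurable (F n) μ) (hf : AEStronglyMeasurable f μ) (hb : Integrable b μ)
    (hFb : ∀ n, ∀ᵐ x ∂μ, |F n x| ≤ b x) (hlim : ∀ᵐ x ∂μ, Tendsto (fun n => F n x) atTop (𝓝 (f x))) :
    Tendsto (fun n => lpClass 1 μ (F n)) atTop (𝓝 (lpClass 1 μ f)) := by
  have hfb : ∀ᵐ x ∂μ, |f x| ≤ b x := by
    filter_upwards [ae_all_iff.2 hFb, hlim] with x h1 h2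
    exact le_of_tendsto' h2.abs h1
  have hFm : ∀ n, MemLp (F n) 1 μ := fun n => memLp_one_iff_integrable.2 (hb.mono' (hF n) (hFb n))
  have hfm : MemLp f 1 μ := memLp_one_iff_integrable.2 (hb.mono' hf hfb)
  rw [tendsto_iff_norm_sub_tendsto_zero]
  have h1 : ∀ n, ‖lpClass 1 μ (F n) - lpClass 1 μ f‖ = ∫ x, |F n x - f x| ∂μ := fun n => by
    rw [← lpClass_sub (hFm n) hfm]
    exact norm_lpClass_one (f := fun x => F n x - f x) ((hFm n).sub hfm)
  simp only [h1]
  have := tendsto_integral_of_dominated_convergence (F := fun n x => |F n x - f x|)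
    (f := fun _ => (0 : ℝ)) (fun x => b x + b x)
    (fun n => ((hF n).sub hf).norm) (hb.add hb) (fun n => ?_) ?_
  · simpa using this
  · filter_upwards [hFb n, hfb] with x h2 h3
    rw [Real.norm_eq_abs, abs_abs]
    exact (abs_sub _ _).trans (add_le_add h2 h3)
  · filter_upwards [hlim] with x h2
    simpa using (h2.sub_const (f x)).abs

end Convergence

/-- A subspace of a normed space is dense if no nonzero functional vanishes on it. -/
theorem dense_of_forall_dual {X : Type*} [NormedAddCommGroup X] [NormedSpace ℝ X]
    (S : Submodule ℝ X) (h : ∀ ℓ : X →L[ℝ] ℝ, (∀ x ∈ S, ℓ x = 0) → ℓ = 0) : Dense (S : Set X) := by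
  intro x
  by_contra hx
  obtain ⟨ℓ, u, h1, h2⟩ := geometric_hahn_banach_closed_point S.convex.closure isClosed_closure hx
  have h0 : 0 < u := by simpa using h1 0 (subset_closure S.zero_mem)
  have h3 : ℓ = 0 := h ℓ fun y hy => by
    by_contra hne
    have := h1 ((2 * u / ℓ y) • y) (subset_closure (S.smul_mem _ hy))
    rw [map_smul, smul_eq_mul, div_mul_cancel₀ _ hne] at this
    linarith
  rw [h3] at h2
  simp at h2
  linarith

/-! ### Functionals on `L¹` of a product are determined by rectangles -/

section Product

variable {α β : Type*} [MeasurableSpace α] [MeasurableSpace β] {μ : Measure α} {ν : Measure β}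
  [SigmaFinite μ] [IsFiniteMeasure ν]

/-- A functional on `L¹` of a product which vanishes on tensor products is zero. -/
theorem eq_zero_of_forall_rectangle (ℓ : Lp ℝ 1 (μ.prod ν) →L[ℝ] ℝ)
    (h : ∀ (a : Set α) (b : Set β), MeasurableSet a → MeasurableSet b → μ a < ⊤ →
      ℓ (lpClass 1 (μ.prod ν) ((a ×ˢ b).indicator fun _ => 1)) = 0) : ℓ = 0 := by
  let S : ℕ → Set (α × β) := fun n => spanningSets μ n ×ˢ univ
  have hSm : ∀ n, MeasurableSet (S n) := fun n => (measurableSet_spanningSets μ n).prod .univ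
  have hSf : ∀ n, μ.prod ν (S n) < ⊤ := fun n => by
    simp only [S]
    rw [Measure.prod_prod]
    exact ENNReal.mul_lt_top (measure_spanningSets_lt_top μ n) (measure_lt_top _ _)
  have hi : ∀ n (s : Set (α × β)), MeasurableSet s → Integrable ((s ∩ S n).indicator fun _ => (1 : ℝ))
      (μ.prod ν) := fun n s hs => (integrable_indicator_iff (hs.inter (hSm n))).2
    (integrableOn_const ((measure_mono inter_subset_right).trans_lt (hSf n)).ne)
  have hrect : ∀ n (s : Set (α × β)), MeasurableSet s →
      ℓ (lpClass 1 (μ.prod ν) ((s ∩ S n).indicator fun _ => 1)) = 0 := by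
    intro n s hs
    -- The `π`-`λ` argument is run inside the slabs `S n`, where finite measure allows complements.
    induction s, hs using MeasurableSpace.induction_on_inter generateFrom_prod.symm isPiSystem_prod with
    | empty =>
      rw [empty_inter, indicator_empty]
      exact (congrArg ℓ lpClass_zero).trans (map_zero ℓ)
    | basic t ht =>
      obtain ⟨a, ha, b, hb, rfl⟩ := ht
      have : (a ×ˢ b) ∩ S n = (a ∩ spanningSets μ n) ×ˢ b := by
        simp only [S]
        rw [prod_inter_prod, inter_univ]
      rw [this]
      exact h _ _ (ha.inter (measurableSet_spanningSets μ n)) hb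
        ((measure_mono inter_subset_right).trans_lt (measure_spanningSets_lt_top μ n))
    | compl t ht ih =>
      have e : ((tᶜ ∩ S n).indicator fun _ => (1 : ℝ)) = fun z =>
          ((univ ×ˢ univ ∩ S n).indicator (fun _ => (1 : ℝ)) z) -
            (t ∩ S n).indicator (fun _ => (1 : ℝ)) z := by
        funext z
        by_cases h1 : z ∈ S n <;> by_cases h2 : z ∈ t <;> simp [h1, h2, indicator]
      have h3 := h (spanningSets μ n) univ (measurableSet_spanningSets μ n) .univ
        (measure_spanningSets_lt_top μ n)
      have h4 : (univ : Set α) ×ˢ (univ : Set β) ∩ S n = spanningSets μ n ×ˢ univ := by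
        rw [univ_prod_univ, univ_inter]
      rw [e, lpClass_sub (memLp_one_iff_integrable.2 (hi n _ (MeasurableSet.univ.prod .univ)))
        (memLp_one_iff_integrable.2 (hi n t ht)), _root_.map_sub, ih, h4, h3, sub_zero]
    | iUnion f hd hf ih =>
      have hp : ∀ N, ℓ (lpClass 1 (μ.prod ν) fun z => ∑ k ∈ Finset.range N,
          (f k ∩ S n).indicator (fun _ => (1 : ℝ)) z) = 0 := fun N => by
        rw [lpClass_finsetSum _ fun k _ => memLp_one_iff_integrable.2 (hi n _ (hf k)), map_sum]
        exact Finset.sum_eq_zero fun k _ => ih k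
      have e : ∀ z, HasSum (fun k => (f k ∩ S n).indicator (fun _ => (1 : ℝ)) z)
          (((⋃ k, f k) ∩ S n).indicator (fun _ => (1 : ℝ)) z) := fun z => by
        by_cases hz : z ∈ (⋃ k, f k) ∩ S n
        · obtain ⟨k, hk⟩ := mem_iUnion.1 hz.1
          have h1 : (f k ∩ S n).indicator (fun _ => (1 : ℝ)) z = 1 := indicator_of_mem (s := f k ∩ S n) ⟨hk, hz.2⟩ _
          rw [indicator_of_mem hz]
          have h3 := hasSum_single (f := fun k => (f k ∩ S n).indicator (fun _ => (1 : ℝ)) z) k fun j hj => indicator_of_notMem (s := f j ∩ S n)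
            (fun h2 => (hd hj).le_bot ⟨h2.1, hk⟩) _
          rwa [h1] at h3
        · rw [indicator_of_notMem hz]
          convert hasSum_zero (α := ℝ) (β := ℕ) using 2 with k
          exact indicator_of_notMem (s := f k ∩ S n) (fun h2 => hz ⟨mem_iUnion.2 ⟨k, h2.1⟩, h2.2⟩) _
      have hlim := tendsto_lpClass_one (μ := μ.prod ν)
        (F := fun N z => ∑ k ∈ Finset.range N, (f k ∩ S n).indicator (fun _ => (1 : ℝ)) z)
        (f := ((⋃ k, f k) ∩ S n).indicator fun _ => 1)
        (b := ((⋃ k, f k) ∩ S n).indicator fun _ => 1)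
        (fun N => (integrable_finsetSum _ fun k _ => hi n _ (hf k)).1)
        (hi n _ (MeasurableSet.iUnion hf)).1 (hi n _ (MeasurableSet.iUnion hf))
        (fun N => ae_of_all _ fun z => by
          have hnn : ∀ k, 0 ≤ (f k ∩ S n).indicator (fun _ => (1 : ℝ)) z := fun k =>
            indicator_nonneg (fun _ _ => zero_le_one) z
          rw [abs_of_nonneg (Finset.sum_nonneg fun k _ => hnn k)]
          exact sum_le_hasSum _ (fun k _ => hnn k) (e z))
        (ae_of_all _ fun z => (e z).tendsto_sum_nat)
      refine tendsto_nhds_unique ((ℓ.continuous.tendsto _).comp hlim) ?_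
      simp only [Function.comp_def, hp]
      exact tendsto_const_nhds
  ext u
  rw [zero_apply]
  -- Simple functions reduce the claim to indicators of sets of finite measure, which are limits of
  -- their truncations to the slabs.
  refine Lp.induction ENNReal.one_ne_top (motive := fun u => ℓ u = 0) (fun c s hs hμs => ?_) ?_ ?_ u
  · have e : (Lp.simpleFunc.indicatorConst 1 hs hμs.ne c : Lp ℝ 1 (μ.prod ν)) =
        c • lpClass 1 (μ.prod ν) (s.indicator fun _ => 1) := by
      have hm : MemLp (s.indicator fun _ => (1 : ℝ)) 1 (μ.prod ν) :=
        memLp_indicator_const 1 hs 1 (Or.inr hμs.ne)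
      rw [Lp.simpleFunc.coe_indicatorConst, ← lpClass_const_mul _ hm]
      refine eq_lpClass _ ?_
      filter_upwards [indicatorConstLp_coeFn (p := 1) (hs := hs) (hμs := hμs.ne) (c := c)] with x hx
      rw [hx]
      by_cases hxs : x ∈ s <;> simp [hxs]
    rw [e, map_smul]
    have hlim := tendsto_lpClass_one (μ := μ.prod ν)
      (F := fun n => (s ∩ S n).indicator fun _ => (1 : ℝ)) (f := s.indicator fun _ => 1)
      (b := s.indicator fun _ => 1) (fun n => (hi n s hs).1)
      (memLp_indicator_const 1 hs (1 : ℝ) (Or.inr hμs.ne)).1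
      (memLp_one_iff_integrable.1 (memLp_indicator_const 1 hs (1 : ℝ) (Or.inr hμs.ne)))
      (fun n => ae_of_all _ fun z => by
        by_cases h1 : z ∈ s <;> by_cases h2 : z ∈ S n <;> simp [h1, h2])
      (ae_of_all _ fun z => by
        refine tendsto_const_nhds.congr' ?_
        filter_upwards [eventually_ge_atTop (spanningSetsIndex μ z.1)] with n hn
        have : z ∈ S n := ⟨monotone_spanningSets μ hn (mem_spanningSetsIndex μ z.1), mem_univ _⟩
        by_cases h1 : z ∈ s <;> simp [h1, this])
    have h0 := tendsto_nhds_unique ((ℓ.continuous.tendsto _).comp hlim)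
      (tendsto_const_nhds.congr fun n => (hrect n s hs).symm)
    rw [h0, smul_zero]
  · intro f g hf hg _ h1 h2
    rw [_root_.map_add, h1, h2, add_zero]
  · exact isClosed_eq ℓ.continuous continuous_const

end Product

/-! ### From functionals on `L¹(μ ⊗ ν)` to operators from `L¹(μ)` to `L²(ν)` -/

section Tensor

variable {α β : Type*} [MeasurableSpace α] [MeasurableSpace β] {μ : Measure α} {ν : Measure β}

theorem memLp_one_tensor {p : α → ℝ} {g k : β → ℝ} (hp : MemLp p 1 μ) (hg : MemLp g 2 ν)
    (hk : MemLp k 2 ν) : MemLp (fun z : α × β => p z.1 * (g z.2 * k z.2)) 1 (μ.prod ν) :=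
  memLp_one_iff_integrable.2 ((memLp_one_iff_integrable.1 hp).mul_prod (hg.integrable_mul hk))

theorem integral_abs_mul_le {g k : β → ℝ} (hg : MemLp g 2 ν) (hk : MemLp k 2 ν) :
    ∫ v, |g v * k v| ∂ν ≤ ‖lpClass 2 ν g‖ * ‖lpClass 2 ν k‖ := by
  have h1 : ∀ {f : β → ℝ}, MemLp f 2 ν → ‖lpClass 2 ν f‖ = ‖lpClass 2 ν fun v => |f v|‖ :=
    fun {f} hf => by
      have h2 : MemLp (fun v => |f v|) 2 ν := hf.abs
      rw [norm_lpClass hf, norm_lpClass h2]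
      congr 1
      exact eLpNorm_congr_norm_ae (ae_of_all _ fun v => by simp)
  rw [h1 hg, h1 hk]
  refine le_trans (le_of_eq ?_) (real_inner_le_norm _ _)
  rw [inner_lpClass (f := fun v => |g v|) (g := fun v => |k v|) hg.abs hk.abs]
  simp only [abs_mul]

variable [SFinite μ] [SFinite ν]

theorem norm_lpClass_tensor_le {p : α → ℝ} {g k : β → ℝ} (hp : MemLp p 1 μ) (hg : MemLp g 2 ν)
    (hk : MemLp k 2 ν) : ‖lpClass 1 (μ.prod ν) fun z => p z.1 * (g z.2 * k z.2)‖ ≤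
      ‖lpClass 2 ν g‖ * ‖lpClass 1 μ p‖ * ‖lpClass 2 ν k‖ := by
  rw [norm_lpClass_one (memLp_one_tensor hp hg hk), norm_lpClass_one hp]
  simp only [abs_mul (p _)]
  rw [integral_prod_mul (fun x => |p x|) fun v => |g v * k v|]
  calc _ ≤ (∫ x, |p x| ∂μ) * (‖lpClass 2 ν g‖ * ‖lpClass 2 ν k‖) := by
        gcongr
        exact integral_abs_mul_le hg hk
    _ = _ := by ring

omit [SFinite μ] [SFinite ν] in
theorem lpClass_tensor_congr {p p' : α → ℝ} {g k k' : β → ℝ} (hp : MemLp p 1 μ) (hg : MemLp g 2 ν)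
    (hk : MemLp k 2 ν) (hpp : p =ᵐ[μ] p') (hkk : k =ᵐ[ν] k') :
    lpClass 1 (μ.prod ν) (fun z => p z.1 * (g z.2 * k z.2)) =
      lpClass 1 (μ.prod ν) fun z => p' z.1 * (g z.2 * k' z.2) := by
  refine lpClass_congr (memLp_one_tensor hp hg hk) ?_
  filter_upwards [Measure.quasiMeasurePreserving_fst.ae hpp,
    Measure.quasiMeasurePreserving_snd.ae hkk] with z h1 h2
  rw [h1, h2]

/-- A functional on `L¹(μ ⊗ ν)` defines bounded operators from `L¹(μ)` to `L²(ν)`. -/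
theorem exists_tensorOperator (ℓ : Lp ℝ 1 (μ.prod ν) →L[ℝ] ℝ) {g : β → ℝ} (hg : MemLp g 2 ν) :
    ∃ T : Lp ℝ 1 μ →L[ℝ] Lp ℝ 2 ν, ∀ p k, MemLp p 1 μ → MemLp k 2 ν →
      ⟪T (lpClass 1 μ p), lpClass 2 ν k⟫ =
        ℓ (lpClass 1 (μ.prod ν) fun z => p z.1 * (g z.2 * k z.2)) := by
  have hp : ∀ p : Lp ℝ 1 μ, MemLp p 1 μ := Lp.memLp
  have hk : ∀ k : Lp ℝ 2 ν, MemLp k 2 ν := Lp.memLp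
  have a1 : ∀ (p p' : Lp ℝ 1 μ) (k : Lp ℝ 2 ν),
      (lpClass 1 (μ.prod ν) fun z => (p + p' : Lp ℝ 1 μ) z.1 * (g z.2 * k z.2)) =
      (lpClass 1 (μ.prod ν) fun z => p z.1 * (g z.2 * k z.2)) +
        lpClass 1 (μ.prod ν) fun z => p' z.1 * (g z.2 * k z.2) := fun p p' k => by
    rw [← lpClass_add (memLp_one_tensor (hp p) hg (hk k)) (memLp_one_tensor (hp p') hg (hk k)),
      lpClass_tensor_congr (hp _) hg (hk k) (Lp.coeFn_add p p') (ae_eq_refl _)]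
    simp only [Pi.add_apply, add_mul]
  have a2 : ∀ (c : ℝ) (p : Lp ℝ 1 μ) (k : Lp ℝ 2 ν),
      (lpClass 1 (μ.prod ν) fun z => (c • p : Lp ℝ 1 μ) z.1 * (g z.2 * k z.2)) =
      c • lpClass 1 (μ.prod ν) fun z => p z.1 * (g z.2 * k z.2) := fun c p k => by
    rw [← lpClass_const_mul _ (memLp_one_tensor (hp p) hg (hk k)),
      lpClass_tensor_congr (hp _) hg (hk k) (Lp.coeFn_smul c p) (ae_eq_refl _)]
    simp only [Pi.smul_apply, smul_eq_mul, mul_assoc]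
  have a3 : ∀ (p : Lp ℝ 1 μ) (k k' : Lp ℝ 2 ν),
      (lpClass 1 (μ.prod ν) fun z => p z.1 * (g z.2 * (k + k' : Lp ℝ 2 ν) z.2)) =
      (lpClass 1 (μ.prod ν) fun z => p z.1 * (g z.2 * k z.2)) +
        lpClass 1 (μ.prod ν) fun z => p z.1 * (g z.2 * k' z.2) := fun p k k' => by
    rw [← lpClass_add (memLp_one_tensor (hp p) hg (hk k)) (memLp_one_tensor (hp p) hg (hk k')),
      lpClass_tensor_congr (hp p) hg (hk _) (ae_eq_refl _) (Lp.coeFn_add k k')]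
    simp only [Pi.add_apply, mul_add]
  have a4 : ∀ (c : ℝ) (p : Lp ℝ 1 μ) (k : Lp ℝ 2 ν),
      (lpClass 1 (μ.prod ν) fun z => p z.1 * (g z.2 * (c • k : Lp ℝ 2 ν) z.2)) =
      c • lpClass 1 (μ.prod ν) fun z => p z.1 * (g z.2 * k z.2) := fun c p k => by
    rw [← lpClass_const_mul _ (memLp_one_tensor (hp p) hg (hk k)),
      lpClass_tensor_congr (hp p) hg (hk _) (ae_eq_refl _) (Lp.coeFn_smul c k)]
    simp only [Pi.smul_apply, smul_eq_mul, mul_left_comm]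
  -- For fixed `p` the bilinear form is a bounded functional of `k`, which Riesz's theorem
  -- represents by a vector of `L²(ν)`.
  let B : Lp ℝ 1 μ →ₗ[ℝ] Lp ℝ 2 ν →ₗ[ℝ] ℝ := LinearMap.mk₂ ℝ
    (fun p k => ℓ (lpClass 1 (μ.prod ν) fun z => p z.1 * (g z.2 * k z.2)))
    (fun p p' k => by rw [a1, _root_.map_add]) (fun c p k => by rw [a2, map_smul])
    (fun p k k' => by rw [a3, _root_.map_add]) (fun c p k => by rw [a4, map_smul])
  let A : Lp ℝ 1 μ →L[ℝ] Lp ℝ 2 ν →L[ℝ] ℝ := B.mkContinuous₂ (‖ℓ‖ * ‖lpClass 2 ν g‖) fun p k => by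
    refine (ℓ.le_opNorm _).trans ?_
    have := norm_lpClass_tensor_le (hp p) hg (hk k)
    rw [lpClass_coeFn, lpClass_coeFn] at this
    calc _ ≤ ‖ℓ‖ * (‖lpClass 2 ν g‖ * ‖p‖ * ‖k‖) := by gcongr
      _ = _ := by ring
  let T : Lp ℝ 1 μ →ₗ[ℝ] Lp ℝ 2 ν :=
    { toFun := fun p => (InnerProductSpace.toDual ℝ (Lp ℝ 2 ν)).symm (A p)
      map_add' := fun p p' => by rw [_root_.map_add, _root_.map_add]
      map_smul' := fun c p => by rw [map_smul, map_smulₛₗ]; rfl }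
  refine ⟨T.mkContinuous ‖A‖ fun p => ?_, fun p k hp hk => ?_⟩
  · change ‖(InnerProductSpace.toDual ℝ (Lp ℝ 2 ν)).symm (A p)‖ ≤ _
    rw [LinearIsometryEquiv.norm_map]
    exact A.le_opNorm p
  · change ⟪(InnerProductSpace.toDual ℝ (Lp ℝ 2 ν)).symm (A (lpClass 1 μ p)), _⟫ = _
    rw [InnerProductSpace.toDual_symm_apply]
    change ℓ _ = _
    rw [lpClass_tensor_congr (Lp.memLp _) hg (Lp.memLp _) (coeFn_lpClass hp) (coeFn_lpClass hk)]

end Tensor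

/-! ### Partial derivatives on phase space -/

section PhaseCoordinates

variable {d : ℕ}

/-- The partial derivative in the direction of the `i`-th position coordinate. -/
def pdx (i : Fin d) (f : E d × E d → ℝ) (z : E d × E d) : ℝ :=
  fderiv ℝ f z (EuclideanSpace.single i 1, 0)

/-- The partial derivative in the direction of the `i`-th velocity coordinate. -/
def pdv (i : Fin d) (f : E d × E d → ℝ) (z : E d × E d) : ℝ :=
  fderiv ℝ f z (0, EuclideanSpace.single i 1)

theorem contDiff_pdv {f : E d × E d → ℝ} (hf : ContDiff ℝ ∞ f) (i : Fin d) :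
    ContDiff ℝ ∞ (pdv i f) := (hf.fderiv_right (m := ∞) (by simp)).clm_apply contDiff_const

theorem fderiv_apply_mem_testFunctions {X : Type*} [NormedAddCommGroup X] [NormedSpace ℝ X]
    {U : Set X} {f : X → ℝ} (hf : f ∈ testFunctions U) (e : X) :
    (fun z => fderiv ℝ f z e) ∈ testFunctions U := by
  have h : tsupport (fun z => fderiv ℝ f z e) ⊆ tsupport f := by
    refine closure_minimal (fun z hz => ?_) (isClosed_tsupport f)
    by_contra h
    have : fderiv ℝ f z = 0 := image_eq_zero_of_notMem_tsupport fun h2 =>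
      h (tsupport_fderiv_subset ℝ h2)
    exact hz (by simp [this])
  exact ⟨(hf.1.fderiv_right (m := ∞) (by simp)).clm_apply contDiff_const,
    hf.2.1.of_isClosed_subset (isClosed_tsupport _) h, h.trans hf.2.2⟩

theorem pdx_mem_testFunctions {U : Set (E d × E d)} {f : E d × E d → ℝ} (hf : f ∈ testFunctions U)
    (i : Fin d) : pdx i f ∈ testFunctions U := fderiv_apply_mem_testFunctions hf _

theorem pdv_mem_testFunctions {U : Set (E d × E d)} {f : E d × E d → ℝ} (hf : f ∈ testFunctions U)
    (i : Fin d) : pdv i f ∈ testFunctions U := fderiv_apply_mem_testFunctions hf _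

theorem pd_slice_left {f : E d × E d → ℝ} {x v : E d} (hf : DifferentiableAt ℝ f (x, v))
    (i : Fin d) : pd i (fun y => f (y, v)) x = pdx i f (x, v) := by
  simp only [pd]
  rw [HasFDerivAt.fderiv (f := fun y => f (y, v)) (hf.hasFDerivAt.comp x (hasFDerivAt_prodMk_left x v))]
  simp [pdx]

theorem pd_slice_right {f : E d × E d → ℝ} {x v : E d} (hf : DifferentiableAt ℝ f (x, v))
    (i : Fin d) : pd i (fun w => f (x, w)) v = pdv i f (x, v) := by
  simp only [pd]
  rw [HasFDerivAt.fderiv (f := fun w => f (x, w)) (hf.hasFDerivAt.comp v (hasFDerivAt_prodMk_right x v))]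
  simp [pdv]

theorem hamiltonOp_eq {f : E d × E d → ℝ} (hf : ContDiff ℝ ∞ f) (G₁ G : E d → E d)
    (z : E d × E d) : hamiltonOp G₁ G f z = ∑ i, (pdv i (pdv i f) z - G z.2 i * pdv i f z +
      G z.2 i * pdx i f z - G₁ z.1 i * pdv i f z) := by
  obtain ⟨x, v⟩ := z
  have hd : Differentiable ℝ f := hf.differentiable (by simp)
  have h1 : ∀ i, pd i (fun w => f (x, w)) = fun w => pdv i f (x, w) := fun i =>
    funext fun w => pd_slice_right (hd _) i
  have h2 : ContDiff ℝ ∞ fun w => f (x, w) := hf.comp (contDiff_const.prodMk contDiff_id)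
  rw [hamiltonOp]
  simp only
  rw [laplacian_eq_sum_pd h2, inner_gradient_eq_sum, inner_gradient_eq_sum, inner_gradient_eq_sum,
    ← Finset.sum_sub_distrib, ← Finset.sum_add_distrib, ← Finset.sum_sub_distrib]
  refine Finset.sum_congr rfl fun i _ => ?_
  rw [h1, pd_slice_right (f := pdv i f) ((contDiff_pdv hf i).differentiable (by simp) _),
    pd_slice_left (hd _)]

theorem tensor_mem_testFunctions {Ω : Set (E d)} {p θ : E d → ℝ} (hp : p ∈ testFunctions Ω)
    (hθ : θ ∈ testFunctions (univ : Set (E d))) :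
    (fun z : E d × E d => p z.1 * θ z.2) ∈ testFunctions (Ω ×ˢ (univ : Set (E d))) := by
  have h1 : tsupport (fun z : E d × E d => p z.1 * θ z.2) ⊆ tsupport p ×ˢ tsupport θ := by
    refine closure_minimal (fun z hz => ?_) ((isClosed_tsupport p).prod (isClosed_tsupport θ))
    obtain ⟨h1, h2⟩ := mul_ne_zero_iff.1 hz
    exact ⟨subset_tsupport _ h1, subset_tsupport _ h2⟩
  exact ⟨(hp.1.comp contDiff_fst).mul (hθ.1.comp contDiff_snd),
    (hp.2.1.isCompact.prod hθ.2.1.isCompact).of_isClosed_subset (isClosed_tsupport _) h1,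
    fun z hz => ⟨hp.2.2 (h1 hz).1, mem_univ _⟩⟩

/-- Tensor products separate position from velocity; the three groups of terms correspond to the
operators `N`, `M i` and `D i` of the kinetic equation. -/
theorem hamiltonOp_tensor {p θ : E d → ℝ} (hp : ContDiff ℝ ∞ p) (hθ : ContDiff ℝ ∞ θ)
    (G₁ G : E d → E d) (z : E d × E d) :
    hamiltonOp G₁ G (fun z => p z.1 * θ z.2) z = p z.1 * overdampedOp G θ z.2 +
      ((∑ i, pd i p z.1 * (G z.2 i * θ z.2)) - ∑ i, G₁ z.1 i * p z.1 * pd i θ z.2) := by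
  have hd : ∀ {f : E d → ℝ}, ContDiff ℝ ∞ f → Differentiable ℝ f := fun hf =>
    hf.differentiable (by simp)
  have hc : ∀ {f : E d → ℝ}, ContDiff ℝ ∞ f → ∀ z : E d × E d,
      DifferentiableAt ℝ (fun z : E d × E d => p z.1 * f z.2) z := fun hf z =>
    (((hp.comp contDiff_fst).mul (hf.comp contDiff_snd)).differentiable (by simp)) z
  have h1 : ∀ {f : E d → ℝ}, ContDiff ℝ ∞ f → ∀ i, pdv i (fun z : E d × E d => p z.1 * f z.2) =
      fun z => p z.1 * pd i f z.2 := fun {f} hf i => by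
    funext ⟨x, v⟩
    rw [← pd_slice_right (hc hf _)]
    simp only [pd]
    rw [fderiv_const_mul (hd hf v)]
    rfl
  have h2 : ∀ i, pdx i (fun z : E d × E d => p z.1 * θ z.2) z = pd i p z.1 * θ z.2 := fun i => by
    rw [← pd_slice_left (hc hθ _)]
    simp only [pd]
    rw [fderiv_mul_const (hd hp z.1)]
    simp [mul_comm]
  rw [hamiltonOp_eq (f := fun z : E d × E d => p z.1 * θ z.2)
    ((hp.comp contDiff_fst).mul (hθ.comp contDiff_snd)), overdampedOp_eq hθ,
    Finset.mul_sum, ← Finset.sum_sub_distrib, ← Finset.sum_add_distrib]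
  refine Finset.sum_congr rfl fun i _ => ?_
  rw [h1 hθ, h1 (contDiff_pd hθ i), h2]
  ring

end PhaseCoordinates

/-! ### Functionals annihilating the range vanish -/

section Range

variable {d : ℕ} {Φ₁ : E d → EReal} {G₁ : E d → E d} {ν : Measure (E d)} {G : E d → E d}

/-- A linear operation on test functions as an operator with values in `L²`. -/
def lpLinear (ν : Measure (E d)) (A : testFunctions (univ : Set (E d)) → E d → ℝ)
    (hA : ∀ θ, MemLp (A θ) 2 ν) (hadd : ∀ θ θ', A (θ + θ') = fun v => A θ v + A θ' v)
    (hsmul : ∀ (c : ℝ) θ, A (c • θ) = fun v => c * A θ v) :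
    testFunctions (univ : Set (E d)) →ₗ[ℝ] Lp ℝ 2 ν where
  toFun θ := lpClass 2 ν (A θ)
  map_add' θ θ' := by rw [hadd, lpClass_add (hA θ) (hA θ')]
  map_smul' c θ := by rw [hsmul, lpClass_const_mul c (hA θ), RingHom.id_apply]

theorem pd_add {f g : E d → ℝ} (hf : ContDiff ℝ ∞ f) (hg : ContDiff ℝ ∞ g) (i : Fin d) :
    pd i (f + g) = fun v => pd i f v + pd i g v := by
  funext v
  simp only [pd]
  rw [fderiv_add (hf.differentiable (by simp) v) (hg.differentiable (by simp) v)]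
  rfl

theorem pd_smul {f : E d → ℝ} (hf : ContDiff ℝ ∞ f) (c : ℝ) (i : Fin d) :
    pd i (c • f) = fun v => c * pd i f v := by
  funext v
  simp only [pd]
  rw [fderiv_const_smul (hf.differentiable (by simp) v)]
  rfl

theorem overdampedOp_add {f g : E d → ℝ} (hf : ContDiff ℝ ∞ f) (hg : ContDiff ℝ ∞ g) :
    overdampedOp G (f + g) = fun v => overdampedOp G f v + overdampedOp G g v := by
  funext v
  rw [overdampedOp_eq (f := f + g) (hf.add hg), overdampedOp_eq hf, overdampedOp_eq hg,
    ← Finset.sum_add_distrib]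
  refine Finset.sum_congr rfl fun i _ => ?_
  have := pd_add (contDiff_pd hf i) (contDiff_pd hg i) i
  rw [pd_add hf hg]
  rw [show (fun v => pd i f v + pd i g v) = pd i f + pd i g from rfl, this]
  simp only [Pi.add_apply]
  ring

theorem overdampedOp_smul {f : E d → ℝ} (hf : ContDiff ℝ ∞ f) (c : ℝ) :
    overdampedOp G (c • f) = fun v => c * overdampedOp G f v := by
  funext v
  rw [overdampedOp_eq (f := c • f) (contDiff_const.smul hf), overdampedOp_eq hf, Finset.mul_sum]
  refine Finset.sum_congr rfl fun i _ => ?_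
  have := pd_smul (contDiff_pd hf i) c i
  rw [pd_smul hf]
  rw [show (fun v => c * pd i f v) = c • pd i f from rfl, this]
  simp only [Pi.smul_apply, smul_eq_mul]
  ring

/-- A functional annihilating the range of `1 - h L` defines a solution of a kinetic equation. -/
theorem exists_kineticSolution (h₁ : PositionAssumptions Φ₁ G₁) (hν : VelocityMeasure ν G) :
    ∃ R : ℝ, 0 ≤ R ∧ ∀ r : ℝ, 0 < r → ∀ ℓ : Lp ℝ 1 ((gibbs Φ₁).prod ν) →L[ℝ] ℝ,
    (∀ f ∈ testFunctions (finiteSet Φ₁ ×ˢ (univ : Set (E d))),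
      r * ℓ (lpClass 1 ((gibbs Φ₁).prod ν) f) =
        ℓ (lpClass 1 ((gibbs Φ₁).prod ν) (hamiltonOp G₁ G f))) →
    ∃ (ι N : testFunctions (univ : Set (E d)) →ₗ[ℝ] Lp ℝ 2 ν)
      (D M : Fin d → testFunctions (univ : Set (E d)) →ₗ[ℝ] Lp ℝ 2 ν)
      (T : Lp ℝ 1 (gibbs Φ₁) →L[ℝ] Lp ℝ 2 ν) (Q : Fin d → Lp ℝ 1 (gibbs Φ₁) →L[ℝ] Lp ℝ 2 ν),
      KineticSolution Φ₁ G₁ ι N D M R r T Q ∧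
      ∀ p k, MemLp p 1 (gibbs Φ₁) → MemLp k 2 ν → ⟪T (lpClass 1 (gibbs Φ₁) p), lpClass 2 ν k⟫ =
        ℓ (lpClass 1 ((gibbs Φ₁).prod ν) fun z => p z.1 * k z.2) := by
  have hprob := hν.prob
  have hfc := h₁.finiteOnCompacts
  obtain ⟨R, hR0, hR⟩ := hν.relative_bound
  refine ⟨R, hR0, fun r hr ℓ hℓ => ?_⟩
  have hGi : ∀ i, MemLp (fun v => G v i) 2 ν := memLp_euclidean_apply hν.memLp
  have mι : ∀ θ : testFunctions (univ : Set (E d)), MemLp θ.1 2 ν := fun θ =>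
    memLp_of_mem_testFunctions θ.2 2
  have mD : ∀ (i : Fin d) (θ : testFunctions (univ : Set (E d))), MemLp (pd i θ.1) 2 ν := fun i θ =>
    memLp_of_mem_testFunctions (pd_mem_testFunctions θ.2 i) 2
  have mM : ∀ (i : Fin d) (θ : testFunctions (univ : Set (E d))),
      MemLp (fun v => G v i * θ.1 v) 2 ν := fun i θ => memLp_mul_of_mem_testFunctions (hGi i) θ.2
  have mN : ∀ θ : testFunctions (univ : Set (E d)), MemLp (overdampedOp G θ.1) 2 ν := fun θ =>
    memLp_overdampedOp hν.memLp θ.2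
  let ι := lpLinear ν (fun θ => θ.1) mι (fun _ _ => rfl) fun _ _ => rfl
  let D := fun i => lpLinear ν (fun θ => pd i θ.1) (mD i) (fun θ θ' => pd_add θ.2.1 θ'.2.1 i)
    fun c θ => pd_smul θ.2.1 c i
  let M := fun i => lpLinear ν (fun θ v => G v i * θ.1 v) (mM i)
    (fun θ θ' => funext fun v => mul_add _ _ _) fun c θ => funext fun v => mul_left_comm _ _ _
  let N := lpLinear ν (fun θ => overdampedOp G θ.1) mN (fun θ θ' => overdampedOp_add θ.2.1 θ'.2.1)
    fun c θ => overdampedOp_smul θ.2.1 c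
  -- The same functional gives `T` with weight one and `Q i` with weight `G i`; formally `Q i` is
  -- `T` followed by multiplication by `G i`.
  obtain ⟨T, hT⟩ := exists_tensorOperator ℓ (memLp_const (1 : ℝ) (μ := ν) (p := 2))
  choose Q hQ using fun i => exists_tensorOperator ℓ (hGi i)
  simp only [one_mul] at hT
  refine ⟨ι, N, D, M, T, Q, ?_, hT⟩
  have mp : ∀ {p : E d → ℝ}, p ∈ testFunctions (finiteSet Φ₁) → MemLp p 1 (gibbs Φ₁) := fun hp =>
    memLp_of_mem_testFunctions hp 1
  have hunit : ∀ u : Lp ℝ 1 (gibbs Φ₁), MemLp u 1 (gibbs Φ₁) := Lp.memLp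
  refine ⟨fun θ θ' => ?_, fun i θ => ?_, hR0, fun θ => ?_, fun i θ θ' => ?_, ?_, fun s hs w hw => ?_,
    fun i u θ => ?_, fun p hp θ => ?_⟩
  · change ∑ i, ⟪lpClass 2 ν (pd i θ.1), lpClass 2 ν (pd i θ'.1)⟫ =
      -⟪lpClass 2 ν θ.1, lpClass 2 ν (overdampedOp G θ'.1)⟫
    rw [inner_lpClass (mι θ) (mN θ'), integral_mul_overdampedOp hν.memLp hν.isLogGradient θ.2 θ'.2,
      neg_neg]
    exact Finset.sum_congr rfl fun i _ => inner_lpClass (mD i θ) (mD i θ')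
  · change ⟪lpClass 2 ν θ.1, lpClass 2 ν (pd i θ.1)⟫ =
      1 / 2 * ⟪lpClass 2 ν fun v => G v i * θ.1 v, lpClass 2 ν θ.1⟫
    rw [inner_lpClass (mι θ) (mD i θ), inner_lpClass (mM i θ) (mι θ)]
    have hθ2 := mul_mem_testFunctions θ.2 θ.2.1
    have h1 := hν.isLogGradient _ (hθ2.1.of_le (by simp)) hθ2.2.1 (subset_univ _) i
    have h2 : ∀ v, pd i (fun x => θ.1 x * θ.1 x) v = 2 * (θ.1 v * pd i θ.1 v) := fun v => by
      rw [pd_mul (θ.2.1.differentiable (by simp) v) (θ.2.1.differentiable (by simp) v)]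
      ring
    simp only [h2, ← mul_assoc] at h1
    simp only [mul_assoc (2 : ℝ)] at h1
    rw [integral_const_mul] at h1
    rw [← h1]
    ring
  · change ∑ i, ‖lpClass 2 ν fun v => G v i * θ.1 v‖ ^ 2 ≤
      R * (∑ i, ‖lpClass 2 ν (pd i θ.1)‖ ^ 2 + ‖lpClass 2 ν θ.1‖ ^ 2)
    simp only [norm_sq_lpClass (mM _ θ), norm_sq_lpClass (mD _ θ), norm_sq_lpClass (mι θ)]
    exact hR θ.1 θ.2
  · change ⟪lpClass 2 ν fun v => G v i * θ.1 v, lpClass 2 ν θ'.1⟫ =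
      ⟪lpClass 2 ν θ.1, lpClass 2 ν fun v => G v i * θ'.1 v⟫
    rw [inner_lpClass (mM i θ) (mι θ'), inner_lpClass (mι θ) (mM i θ')]
    exact integral_congr_ae (ae_of_all _ fun v => by ring)
  · refine (dense_testFunctions (p := 2) (by simp) isOpen_univ (by simp)).mono ?_
    rintro u ⟨g, hg, rfl⟩
    exact ⟨⟨g, hg⟩, rfl⟩
  · have h0 := hν.ae_eq_zero s hs w (Lp.memLp w) fun θ hθ => by
      have h1 : ⟪w, lpClass 2 ν (overdampedOp G θ)⟫ = s * ⟪w, lpClass 2 ν θ⟫ := hw ⟨θ, hθ⟩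
      rw [← lpClass_coeFn w, inner_lpClass (Lp.memLp w) (mN ⟨θ, hθ⟩),
        inner_lpClass (Lp.memLp w) (mι ⟨θ, hθ⟩)] at h1
      exact h1
    exact Lp.eq_zero_iff_ae_eq_zero.2 h0
  · change ⟪Q i u, lpClass 2 ν θ.1⟫ = ⟪T u, lpClass 2 ν fun v => G v i * θ.1 v⟫
    rw [← lpClass_coeFn u, hQ i _ _ (hunit u) (mι θ), hT _ _ (hunit u) (mM i θ)]
  · change r * ⟪T (lpClass 1 (gibbs Φ₁) p), lpClass 2 ν θ.1⟫ -
      ⟪T (lpClass 1 (gibbs Φ₁) p), lpClass 2 ν (overdampedOp G θ.1)⟫ =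
      ∑ i, ⟪Q i (lpClass 1 (gibbs Φ₁) (pd i p)), lpClass 2 ν θ.1⟫ -
        ∑ i, ⟪T (lpClass 1 (gibbs Φ₁) fun x => G₁ x i * p x), lpClass 2 ν (pd i θ.1)⟫
    rw [hT _ _ (mp hp) (mι θ), hT _ _ (mp hp) (mN θ)]
    simp only [hQ _ _ _ (mp (pd_mem_testFunctions hp _)) (mι θ),
      hT _ _ (h₁.memLp_gradient_mul hp _) (mD _ θ)]
    have t1 : ∀ {p k : E d → ℝ}, MemLp p 1 (gibbs Φ₁) → MemLp k 2 ν →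
        MemLp (fun z : E d × E d => p z.1 * k z.2) 1 ((gibbs Φ₁).prod ν) := fun hp hk =>
      memLp_one_iff_integrable.2 ((memLp_one_iff_integrable.1 hp).mul_prod (hk.integrable one_le_two))
    rw [hℓ _ (tensor_mem_testFunctions hp θ.2), funext (hamiltonOp_tensor hp.1 θ.2.1 G₁ G),
      lpClass_add (t1 (mp hp) (mN θ)), lpClass_sub, lpClass_finsetSum, lpClass_finsetSum,
      _root_.map_add, _root_.map_sub, map_sum, map_sum, add_sub_cancel_left]
    · exact fun i _ => t1 (h₁.memLp_gradient_mul hp i) (mD i θ)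
    · exact fun i _ => t1 (mp (pd_mem_testFunctions hp i)) (mM i θ)
    · exact memLp_finsetSum _ fun i _ => t1 (mp (pd_mem_testFunctions hp i)) (mM i θ)
    · exact memLp_finsetSum _ fun i _ => t1 (h₁.memLp_gradient_mul hp i) (mD i θ)
    · exact (memLp_finsetSum _ fun i _ => t1 (mp (pd_mem_testFunctions hp i)) (mM i θ)).sub
        (memLp_finsetSum _ fun i _ => t1 (h₁.memLp_gradient_mul hp i) (mD i θ))

theorem PositionAssumptions.gibbs_compl (h : PositionAssumptions Φ₁ G₁) :
    gibbs Φ₁ (finiteSet Φ₁)ᶜ = 0 := by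
  have hm : MeasurableSet (finiteSet Φ₁)ᶜ := h.isOpen_finiteSet.measurableSet.compl
  rw [h.gibbs_eq, withDensity_apply _ hm]
  refine (setLIntegral_congr_fun hm fun x hx => ?_).trans lintegral_zero
  rw [h.weight_eq_zero hx, ENNReal.ofReal_zero]

/-- For small `h`, no nonzero functional annihilates the range of `1 - h L`. -/
theorem exists_forall_functional_eq_zero (h₁ : PositionAssumptions Φ₁ G₁)
    (hν : VelocityMeasure ν G) : ∃ r₀ : ℝ, 0 < r₀ ∧ ∀ r, r₀ ≤ r →
    ∀ ℓ : Lp ℝ 1 ((gibbs Φ₁).prod ν) →L[ℝ] ℝ,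
    (∀ f ∈ testFunctions (finiteSet Φ₁ ×ˢ (univ : Set (E d))),
      r * ℓ (lpClass 1 ((gibbs Φ₁).prod ν) f) =
        ℓ (lpClass 1 ((gibbs Φ₁).prod ν) (hamiltonOp G₁ G f))) → ℓ = 0 := by
  have hprob := hν.prob
  have hfc := h₁.finiteOnCompacts
  obtain ⟨R, hR0, hR⟩ := exists_kineticSolution h₁ hν
  -- This is the threshold of the energy inequality for `c = d + 1`, the constant of the decaying
  -- cut-offs.
  refine ⟨3 / 2 + ((d : ℝ) + 1) ^ 2 * d * (R + 1) / 2, by positivity, fun r hr ℓ hℓ => ?_⟩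
  have hr0 : 0 < r := lt_of_lt_of_le (by positivity) hr
  obtain ⟨ι, N, D, M, T, Q, hs, hT⟩ := hR r hr0 ℓ hℓ
  have hT0 : ∀ u, T u = 0 := by
    have hd := dense_testFunctions (μ := gibbs Φ₁) (p := 1) (by simp) h₁.isOpen_finiteSet
      h₁.gibbs_compl
    have hcl : IsClosed {u | T u = 0} := isClosed_eq T.continuous continuous_const
    have : {u : Lp ℝ 1 (gibbs Φ₁) | ∃ g ∈ testFunctions (finiteSet Φ₁), u = lpClass 1 (gibbs Φ₁) g} ⊆
        {u | T u = 0} := by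
      rintro u ⟨g, hg, rfl⟩
      exact hs.apply_lpClass_eq_zero h₁ hr hg
    exact fun u => closure_minimal this hcl (hd u)
  -- Once `T = 0`, the functional vanishes on indicators of rectangles, which are tensor products.
  refine eq_zero_of_forall_rectangle ℓ fun a b ha hb hμa => ?_
  have m1 : MemLp (a.indicator fun _ => (1 : ℝ)) 1 (gibbs Φ₁) :=
    memLp_indicator_const 1 ha 1 (Or.inr hμa.ne)
  have m2 : MemLp (b.indicator fun _ => (1 : ℝ)) 2 ν :=
    memLp_indicator_const 2 hb 1 (Or.inr (measure_ne_top _ _))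
  have h1 := hT _ _ m1 m2
  rw [hT0, inner_zero_left] at h1
  rw [h1]
  congr 2
  funext z
  by_cases hz1 : z.1 ∈ a <;> by_cases hz2 : z.2 ∈ b <;> simp [hz1, hz2, indicator]

end Range

/-! ### A smooth convex family between `|s|` and `s²` -/

section ConvexFunctions

/-- A smooth approximation of the absolute value. -/
def softAbs (κ s : ℝ) : ℝ := √(s ^ 2 + κ ^ 2) - κ

variable {κ : ℝ} (hκ : 0 < κ)
include hκ

theorem contDiff_softAbs : ContDiff ℝ ∞ (softAbs κ) :=
  (((contDiff_id.pow 2).add contDiff_const).sqrt fun s => by positivity).sub contDiff_const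

theorem softAbs_zero : softAbs κ 0 = 0 := by
  simp [softAbs, Real.sqrt_sq hκ.le]

theorem hasDerivAt_softAbs (s : ℝ) : HasDerivAt (softAbs κ) (s / √(s ^ 2 + κ ^ 2)) s := by
  have h1 : HasDerivAt (fun s : ℝ => s ^ 2 + κ ^ 2) (2 * s) s := by
    simpa using (hasDerivAt_pow 2 s).add_const (κ ^ 2)
  refine ((h1.sqrt (by positivity)).sub_const κ).congr_deriv ?_
  field_simp

theorem deriv_deriv_softAbs_nonneg (s : ℝ) : 0 ≤ deriv (deriv (softAbs κ)) s := by
  have h0 : deriv (softAbs κ) = fun s => s / √(s ^ 2 + κ ^ 2) :=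
    funext fun s => (hasDerivAt_softAbs hκ s).deriv
  have h1 : HasDerivAt (fun s : ℝ => s ^ 2 + κ ^ 2) (2 * s) s := by
    simpa using (hasDerivAt_pow 2 s).add_const (κ ^ 2)
  have hw : 0 < √(s ^ 2 + κ ^ 2) := Real.sqrt_pos.2 (by positivity)
  have h2 := (hasDerivAt_id s).div (h1.sqrt (by positivity)) hw.ne'
  rw [h0]
  have h3 : deriv (fun s => s / √(s ^ 2 + κ ^ 2)) s = _ := h2.deriv
  rw [h3]
  refine div_nonneg ?_ (sq_nonneg _)
  simp only [id]
  have h4 : √(s ^ 2 + κ ^ 2) * √(s ^ 2 + κ ^ 2) = s ^ 2 + κ ^ 2 :=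
    Real.mul_self_sqrt (by positivity)
  rw [one_mul, sub_nonneg, mul_div_assoc', div_le_iff₀ (by positivity)]
  nlinarith

/-- Convexity in tangent form, here from Cauchy–Schwarz for the plane vectors `(a, κ)` and `(b, κ)`.
-/
theorem softAbs_sub_le (a b : ℝ) :
    softAbs κ a - softAbs κ b ≤ a / √(a ^ 2 + κ ^ 2) * (a - b) := by
  have hA : 0 < √(a ^ 2 + κ ^ 2) := Real.sqrt_pos.2 (by positivity)
  have hB : 0 < √(b ^ 2 + κ ^ 2) := Real.sqrt_pos.2 (by positivity)
  have hA2 : √(a ^ 2 + κ ^ 2) * √(a ^ 2 + κ ^ 2) = a ^ 2 + κ ^ 2 := Real.mul_self_sqrt (by positivity)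
  have hAB : κ ^ 2 + a * b ≤ √(a ^ 2 + κ ^ 2) * √(b ^ 2 + κ ^ 2) := by
    rw [← Real.sqrt_mul (by positivity)]
    refine Real.le_sqrt_of_sq_le ?_
    nlinarith [sq_nonneg (κ * (a - b))]
  rw [div_mul_eq_mul_div, le_div_iff₀ hA, softAbs, softAbs]
  nlinarith

omit hκ in
theorem softAbs_nonneg (s : ℝ) : 0 ≤ softAbs κ s :=
  sub_nonneg.2 (Real.le_sqrt_of_sq_le (by nlinarith [sq_nonneg s]))

theorem softAbs_le_abs (s : ℝ) : softAbs κ s ≤ |s| := by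
  rw [softAbs, sub_le_iff_le_add]
  refine Real.sqrt_le_iff.2 ⟨by positivity, ?_⟩
  nlinarith [sq_abs s, abs_nonneg s]

omit hκ in
theorem abs_le_softAbs_add (s : ℝ) : |s| ≤ softAbs κ s + κ := by
  rw [softAbs, sub_add_cancel]
  exact Real.abs_le_sqrt (by nlinarith [sq_nonneg κ])

theorem abs_softAbs_sub_le (a b : ℝ) : |softAbs κ a - softAbs κ b| ≤ |a - b| := by
  have h1 : ∀ a b, softAbs κ a - softAbs κ b ≤ |a - b| := fun a b => by
    refine (softAbs_sub_le hκ a b).trans ((le_abs_self _).trans ?_)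
    rw [abs_mul]
    refine mul_le_of_le_one_left (abs_nonneg _) ?_
    have hA : 0 < √(a ^ 2 + κ ^ 2) := Real.sqrt_pos.2 (by positivity)
    rw [abs_div, abs_of_pos hA, div_le_one hA]
    exact Real.abs_le_sqrt (by nlinarith [sq_nonneg κ])
  exact abs_sub_le_iff.2 ⟨h1 a b, (h1 b a).trans_eq (abs_sub_comm b a)⟩

/-- Rationalising the difference displays `κ softAbs` as `s²` over a denominator at least `2` that
tends to `2` as `κ → ∞`. -/
theorem mul_softAbs_eq (s : ℝ) : κ * softAbs κ s = s ^ 2 / (√((s / κ) ^ 2 + 1) + 1) := by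
  have h1 : √(s ^ 2 + κ ^ 2) = κ * √((s / κ) ^ 2 + 1) := by
    have : s ^ 2 + κ ^ 2 = κ ^ 2 * ((s / κ) ^ 2 + 1) := by field_simp
    rw [this, Real.sqrt_mul (by positivity), Real.sqrt_sq hκ.le]
  have h2 : √((s / κ) ^ 2 + 1) * √((s / κ) ^ 2 + 1) = (s / κ) ^ 2 + 1 :=
    Real.mul_self_sqrt (by positivity)
  rw [softAbs, h1, eq_div_iff (by positivity)]
  have h3 : κ * (κ * √((s / κ) ^ 2 + 1) - κ) * (√((s / κ) ^ 2 + 1) + 1) =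
      κ ^ 2 * (√((s / κ) ^ 2 + 1) * √((s / κ) ^ 2 + 1) - 1) := by ring
  rw [h3, h2]
  field_simp
  ring

theorem mul_softAbs_le (s : ℝ) : κ * softAbs κ s ≤ s ^ 2 / 2 := by
  rw [mul_softAbs_eq hκ]
  have : 1 ≤ √((s / κ) ^ 2 + 1) := Real.one_le_sqrt.2 (by nlinarith [sq_nonneg (s / κ)])
  exact div_le_div_of_nonneg_left (sq_nonneg s) two_pos (by linarith)

omit hκ in
theorem tendsto_mul_softAbs (s : ℝ) :
    Tendsto (fun n : ℕ => ((n : ℝ) + 1) * softAbs ((n : ℝ) + 1) s) atTop (𝓝 (s ^ 2 / 2)) := by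
  have h0 : Tendsto (fun n : ℕ => s / ((n : ℝ) + 1)) atTop (𝓝 0) := by
    simpa [div_eq_mul_inv] using (tendsto_one_div_add_atTop_nhds_zero_nat (𝕜 := ℝ)).const_mul s
  have hc : Continuous fun u : ℝ => s ^ 2 / (√(u ^ 2 + 1) + 1) :=
    continuous_const.div (by fun_prop) fun u => by positivity
  have := (hc.tendsto 0).comp h0
  have e : s ^ 2 / (√((0 : ℝ) ^ 2 + 1) + 1) = s ^ 2 / 2 := by norm_num
  rw [e] at this
  refine this.congr fun n => ?_
  exact (mul_softAbs_eq (by positivity) s).symm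

end ConvexFunctions

/-! ### Invariance of the measure and dissipativity -/

section Dissipativity

variable {d : ℕ} {Φ₁ : E d → EReal} {G₁ : E d → E d} {ν : Measure (E d)} {G : E d → E d}

theorem phaseMeasure_eq (h₁ : PositionAssumptions Φ₁ G₁) {Φ : E d → ℝ} (hΦ : Measurable Φ) :
    phaseMeasure Φ₁ Φ = (gibbs Φ₁).prod (gibbs fun v => (Φ v : EReal)) := by
  have hm : Measurable fun v => (-(Φ v : EReal)).exp := by
    have : (fun v => (-(Φ v : EReal)).exp) = fun v => ENNReal.ofReal (Real.exp (-Φ v)) := by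
      funext v
      rw [← EReal.coe_neg, EReal.exp_coe]
    rw [this]
    exact (Real.measurable_exp.comp hΦ.neg).ennreal_ofReal
  rw [gibbs, gibbs, prod_withDensity h₁.continuous_exp.measurable hm, phaseMeasure, gibbs,
    Measure.volume_eq_prod]
  congr 1 with z
  rw [phasePotential, EReal.neg_add (Or.inr (EReal.coe_ne_top _)) (Or.inr (EReal.coe_ne_bot _)),
    sub_eq_add_neg, EReal.exp_add]

variable [IsFiniteMeasureOnCompacts (gibbs Φ₁)] [IsProbabilityMeasure ν]

omit [IsFiniteMeasureOnCompacts (gibbs Φ₁)] [IsProbabilityMeasure ν] in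
theorem memLp_two_tensor [SFinite ν] {μ : Measure (E d)} {a b : E d → ℝ}
    (ha : MemLp a 2 μ) (hb : MemLp b 2 ν) :
    MemLp (fun z : E d × E d => a z.1 * b z.2) 2 (μ.prod ν) := by
  have hm : AEStronglyMeasurable (fun z : E d × E d => a z.1 * b z.2) (μ.prod ν) :=
    ha.1.comp_fst.mul hb.1.comp_snd
  rw [memLp_two_iff_integrable_sq hm]
  simp only [mul_pow]
  exact ha.integrable_sq.mul_prod hb.integrable_sq

omit [IsFiniteMeasureOnCompacts (gibbs Φ₁)] in
theorem memLp_mul_mul {U : Set (E d × E d)} {a b : E d → ℝ} (ha : MemLp a 2 (gibbs Φ₁))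
    (hb : MemLp b 2 ν) {f : E d × E d → ℝ} (hf : f ∈ testFunctions U) :
    MemLp (fun z => a z.1 * b z.2 * f z) 2 ((gibbs Φ₁).prod ν) :=
  memLp_mul_of_mem_testFunctions (memLp_two_tensor ha hb) hf

/-- The measure `μ_{Φ₁}` may be infinite; compact support of `f` lets the indicator of a compact set
replace the constant position factor. -/
theorem memLp_snd_mul {U : Set (E d × E d)} {b : E d → ℝ}
    (hb : MemLp b 2 ν) {f : E d × E d → ℝ} (hf : f ∈ testFunctions U) :
    MemLp (fun z => b z.2 * f z) 2 ((gibbs Φ₁).prod ν) := by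
  have hK : IsCompact (Prod.fst '' tsupport f) := hf.2.1.isCompact.image continuous_fst
  have h1 : MemLp ((Prod.fst '' tsupport f).indicator fun _ => (1 : ℝ)) 2 (gibbs Φ₁) :=
    memLp_indicator_const 2 hK.measurableSet 1 (Or.inr hK.measure_lt_top.ne)
  refine (memLp_congr_ae (ae_of_all _ fun z => ?_)).1 (memLp_mul_mul h1 hb hf)
  by_cases hz : z ∈ tsupport f
  · simp only [indicator_of_mem (mem_image_of_mem Prod.fst hz), one_mul]
  · simp only [image_eq_zero_of_notMem_tsupport hz, mul_zero]

omit [IsFiniteMeasureOnCompacts (gibbs Φ₁)] in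
theorem memLp_fst_mul {U : Set (E d × E d)} {a : E d → ℝ} (ha : MemLp a 2 (gibbs Φ₁))
    {f : E d × E d → ℝ} (hf : f ∈ testFunctions U) :
    MemLp (fun z => a z.1 * f z) 2 ((gibbs Φ₁).prod ν) :=
  memLp_mul_of_mem_testFunctions (ha.comp_fst ν) hf

theorem integrable_of_memLp_two {U : Set (E d × E d)} {f g : E d × E d → ℝ}
    (hf : f ∈ testFunctions U) (hg : MemLp g 2 ((gibbs Φ₁).prod ν))
    (h : ∀ z ∉ tsupport f, g z = 0) : Integrable g ((gibbs Φ₁).prod ν) :=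
  memLp_one_iff_integrable.1 (hg.mono_exponent_of_measure_support_ne_top h
    hf.2.1.isCompact.measure_lt_top.ne one_le_two)

theorem hamiltonOp_eq_zero {f : E d × E d → ℝ} (hf : ContDiff ℝ ∞ f) {z : E d × E d}
    (hz : z ∉ tsupport f) : hamiltonOp G₁ G f z = 0 := by
  have h1 : ∀ {g : E d × E d → ℝ} e, z ∉ tsupport g → fderiv ℝ g z e = 0 := fun {g} e h => by
    rw [image_eq_zero_of_notMem_tsupport fun h2 => h (tsupport_fderiv_subset ℝ h2)]
    rfl
  rw [hamiltonOp_eq hf]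
  refine Finset.sum_eq_zero fun i _ => ?_
  have h2 : z ∉ tsupport (pdv i f) := fun h => hz (closure_minimal (fun w hw => by
    by_contra h3
    refine hw ?_
    rw [pdv, image_eq_zero_of_notMem_tsupport fun h2 => h3 (tsupport_fderiv_subset ℝ h2)]
    rfl) (isClosed_tsupport f) h)
  have e1 : pdv i (pdv i f) z = 0 := h1 _ h2
  have e2 : pdv i f z = 0 := h1 _ hz
  have e3 : pdx i f z = 0 := h1 _ hz
  rw [e1, e2, e3]
  ring

variable (hG₁ : MemLp G₁ 2 (gibbs Φ₁)) (hG : MemLp G 2 ν)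
include hG₁ hG

theorem memLp_hamiltonOp {U : Set (E d × E d)} {f : E d × E d → ℝ} (hf : f ∈ testFunctions U) :
    MemLp (hamiltonOp G₁ G f) 2 ((gibbs Φ₁).prod ν) ∧
      MemLp (hamiltonOp G₁ G f) 1 ((gibbs Φ₁).prod ν) := by
  have h2 : MemLp (hamiltonOp G₁ G f) 2 ((gibbs Φ₁).prod ν) := by
    rw [funext (hamiltonOp_eq hf.1 G₁ G)]
    refine memLp_finsetSum _ fun i _ => ?_
    have m1 : MemLp (pdv i (pdv i f)) 2 ((gibbs Φ₁).prod ν) :=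
      memLp_of_mem_testFunctions (pdv_mem_testFunctions (pdv_mem_testFunctions hf i) i) 2
    have m2 : MemLp (fun z => G z.2 i * pdv i f z) 2 ((gibbs Φ₁).prod ν) :=
      memLp_snd_mul (memLp_euclidean_apply hG i) (pdv_mem_testFunctions hf i)
    have m3 : MemLp (fun z => G z.2 i * pdx i f z) 2 ((gibbs Φ₁).prod ν) :=
      memLp_snd_mul (memLp_euclidean_apply hG i) (pdx_mem_testFunctions hf i)
    have m4 : MemLp (fun z => G₁ z.1 i * pdv i f z) 2 ((gibbs Φ₁).prod ν) :=
      memLp_fst_mul (memLp_euclidean_apply hG₁ i) (pdv_mem_testFunctions hf i)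
    exact ((m1.sub m2).add m3).sub m4
  exact ⟨h2, memLp_one_iff_integrable.2 (integrable_of_memLp_two hf h2 fun z hz =>
    hamiltonOp_eq_zero hf.1 hz)⟩

omit [IsFiniteMeasureOnCompacts (gibbs Φ₁)] [IsProbabilityMeasure ν] hG₁ hG in
theorem slice_right_mem_testFunctions {Ω : Set (E d)} {g : E d × E d → ℝ}
    (hg : g ∈ testFunctions (Ω ×ˢ (univ : Set (E d)))) (x : E d) :
    (fun v => g (x, v)) ∈ testFunctions (univ : Set (E d)) := by
  refine ⟨hg.1.comp (contDiff_const.prodMk contDiff_id), ?_, subset_univ _⟩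
  exact HasCompactSupport.intro (hg.2.1.isCompact.image continuous_snd) fun v hv =>
    image_eq_zero_of_notMem_tsupport fun h => hv ⟨_, h, rfl⟩

omit [IsFiniteMeasureOnCompacts (gibbs Φ₁)] [IsProbabilityMeasure ν] hG₁ hG in
theorem slice_left_mem_testFunctions {Ω : Set (E d)} {g : E d × E d → ℝ}
    (hg : g ∈ testFunctions (Ω ×ˢ (univ : Set (E d)))) (v : E d) :
    (fun x => g (x, v)) ∈ testFunctions Ω := by
  have hc : IsCompact (Prod.fst '' tsupport g) := hg.2.1.isCompact.image continuous_fst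
  have hs : tsupport (fun x => g (x, v)) ⊆ Prod.fst '' tsupport g :=
    closure_minimal (fun x hx => ⟨(x, v), subset_tsupport _ hx, rfl⟩) hc.isClosed
  refine ⟨hg.1.comp (contDiff_id.prodMk contDiff_const), hc.of_isClosed_subset
    (isClosed_tsupport _) hs, hs.trans ?_⟩
  rintro _ ⟨z, hz, rfl⟩
  exact (hg.2.2 hz).1

omit [IsFiniteMeasureOnCompacts (gibbs Φ₁)] hG₁ hG in
theorem integral_mul_pdv [SFinite (gibbs Φ₁)] (hlog : IsLogGradient univ ν G) {Ω : Set (E d)}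
    (i : Fin d) (a : E d → ℝ) {g : E d × E d → ℝ} (hg : g ∈ testFunctions (Ω ×ˢ (univ : Set (E d))))
    (i1 : Integrable (fun z => a z.1 * pdv i g z) ((gibbs Φ₁).prod ν))
    (i2 : Integrable (fun z => a z.1 * G z.2 i * g z) ((gibbs Φ₁).prod ν)) :
    ∫ z, a z.1 * pdv i g z ∂(gibbs Φ₁).prod ν =
      ∫ z, a z.1 * G z.2 i * g z ∂(gibbs Φ₁).prod ν := by
  rw [integral_prod _ i1, integral_prod _ i2]
  congr 1 with x
  have h1 := slice_right_mem_testFunctions hg x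
  have h2 := hlog _ (h1.1.of_le (by simp)) h1.2.1 (subset_univ _) i
  simp only [pd_slice_right (hg.1.differentiable (by simp) _)] at h2
  simp only [mul_assoc]
  rw [integral_const_mul, integral_const_mul, h2]

omit [IsFiniteMeasureOnCompacts (gibbs Φ₁)] hG₁ hG in
theorem integral_mul_pdx [SFinite (gibbs Φ₁)] {Ω : Set (E d)}
    (hlog₁ : IsLogGradient Ω (gibbs Φ₁) G₁)
    (i : Fin d) (b : E d → ℝ) {g : E d × E d → ℝ} (hg : g ∈ testFunctions (Ω ×ˢ (univ : Set (E d))))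
    (i1 : Integrable (fun z => b z.2 * pdx i g z) ((gibbs Φ₁).prod ν))
    (i2 : Integrable (fun z => G₁ z.1 i * b z.2 * g z) ((gibbs Φ₁).prod ν)) :
    ∫ z, b z.2 * pdx i g z ∂(gibbs Φ₁).prod ν =
      ∫ z, G₁ z.1 i * b z.2 * g z ∂(gibbs Φ₁).prod ν := by
  rw [integral_prod_symm _ i1, integral_prod_symm _ i2]
  congr 1 with v
  have h1 := slice_left_mem_testFunctions hg v
  have h2 := hlog₁ _ (h1.1.of_le (by simp)) h1.2.1 h1.2.2 i
  simp only [pd_slice_left (hg.1.differentiable (by simp) _)] at h2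
  simp only [mul_left_comm _ (b v), mul_assoc]
  rw [integral_const_mul, integral_const_mul, h2]

variable (hlog₁ : IsLogGradient (finiteSet Φ₁) (gibbs Φ₁) G₁) (hlog : IsLogGradient univ ν G)
include hlog₁ hlog

/-- The diffusion and friction terms cancel by integration by parts in `v`. The two transport terms
both reduce to the integral of `∂ᵢΦ₁ ∂ᵢΦ₂ f`, one by parts in `x`, the other in `v`. -/
theorem integral_hamiltonOp {f : E d × E d → ℝ}
    (hf : f ∈ testFunctions (finiteSet Φ₁ ×ˢ (univ : Set (E d)))) :
    ∫ z, hamiltonOp G₁ G f z ∂(gibbs Φ₁).prod ν = 0 := by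
  have hsupp : ∀ {g : E d × E d → ℝ}, g ∈ testFunctions (finiteSet Φ₁ ×ˢ (univ : Set (E d))) →
      ∀ {k : E d × E d → ℝ}, MemLp (fun z => k z * g z) 2 ((gibbs Φ₁).prod ν) →
      Integrable (fun z => k z * g z) ((gibbs Φ₁).prod ν) := fun {g} hg k hk =>
    integrable_of_memLp_two hg hk fun z hz => by rw [image_eq_zero_of_notMem_tsupport hz, mul_zero]
  have hG₁i : ∀ i, MemLp (fun x => G₁ x i) 2 (gibbs Φ₁) := memLp_euclidean_apply hG₁
  have hGi : ∀ i, MemLp (fun v => G v i) 2 ν := memLp_euclidean_apply hG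
  have hv := fun i => pdv_mem_testFunctions hf i
  have hx := fun i => pdx_mem_testFunctions hf i
  have j1 : ∀ i, Integrable (pdv i (pdv i f)) ((gibbs Φ₁).prod ν) := fun i =>
    memLp_one_iff_integrable.1 (memLp_of_mem_testFunctions (pdv_mem_testFunctions (hv i) i) 1)
  have j2 : ∀ i, Integrable (fun z => G z.2 i * pdv i f z) ((gibbs Φ₁).prod ν) := fun i =>
    hsupp (hv i) (memLp_snd_mul (hGi i) (hv i))
  have j3 : ∀ i, Integrable (fun z => G z.2 i * pdx i f z) ((gibbs Φ₁).prod ν) := fun i =>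
    hsupp (hx i) (memLp_snd_mul (hGi i) (hx i))
  have j4 : ∀ i, Integrable (fun z => G₁ z.1 i * pdv i f z) ((gibbs Φ₁).prod ν) := fun i =>
    hsupp (hv i) (memLp_fst_mul (hG₁i i) (hv i))
  have j5 : ∀ i, Integrable (fun z => G₁ z.1 i * G z.2 i * f z) ((gibbs Φ₁).prod ν) := fun i =>
    hsupp hf (memLp_mul_mul (hG₁i i) (hGi i) hf)
  have e1 : ∀ i, ∫ z, pdv i (pdv i f) z ∂(gibbs Φ₁).prod ν =
      ∫ z, G z.2 i * pdv i f z ∂(gibbs Φ₁).prod ν := fun i => by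
    have := integral_mul_pdv (Φ₁ := Φ₁) hlog i (fun _ => 1) (hv i) (by simpa only [one_mul] using j1 i)
      (by simpa only [one_mul] using j2 i)
    simpa only [one_mul] using this
  rw [funext (hamiltonOp_eq hf.1 G₁ G), integral_finsetSum]
  · refine Finset.sum_eq_zero fun i _ => ?_
    have k12 : Integrable (fun z => pdv i (pdv i f) z - G z.2 i * pdv i f z) ((gibbs Φ₁).prod ν) :=
      (j1 i).sub (j2 i)
    have k123 : Integrable (fun z => pdv i (pdv i f) z - G z.2 i * pdv i f z + G z.2 i * pdx i f z)
      ((gibbs Φ₁).prod ν) := k12.add (j3 i)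
    rw [integral_sub k123 (j4 i), integral_add k12 (j3 i), integral_sub (j1 i) (j2 i), e1,
      integral_mul_pdx hlog₁ i (fun v => G v i) hf (j3 i) (j5 i), integral_mul_pdv hlog i (fun x => G₁ x i) hf (j4 i) (j5 i)]
    ring
  · exact fun i _ => (((j1 i).sub (j2 i)).add (j3 i)).sub (j4 i)

omit [IsFiniteMeasureOnCompacts (gibbs Φ₁)] [IsProbabilityMeasure ν] hG₁ hG hlog₁ hlog in
-- The operator is of second order in `v` only, so the chain rule leaves just a squared velocity
-- gradient, which is nonnegative for convex `φ`.
theorem hamiltonOp_comp {f : E d × E d → ℝ} (hf : ContDiff ℝ ∞ f) {φ : ℝ → ℝ}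
    (hφ : ContDiff ℝ ∞ φ) (z : E d × E d) :
    hamiltonOp G₁ G (fun z => φ (f z)) z = deriv φ (f z) * hamiltonOp G₁ G f z +
      deriv (deriv φ) (f z) * ∑ i, pdv i f z ^ 2 := by
  have hd : Differentiable ℝ f := hf.differentiable (by simp)
  have hφ' : ContDiff ℝ ∞ (deriv φ) := (contDiff_infty_iff_deriv.1 hφ).2
  have h1 : ∀ {χ : ℝ → ℝ}, ContDiff ℝ ∞ χ → ∀ w e,
      fderiv ℝ (fun z => χ (f z)) w e = deriv χ (f w) * fderiv ℝ f w e := fun {χ} hχ w e => by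
    rw [HasFDerivAt.fderiv (f := fun z => χ (f z))
      (((hχ.differentiable (by simp)) (f w)).hasDerivAt.comp_hasFDerivAt w (hd w).hasFDerivAt)]
    rfl
  have h2 : ∀ i, pdv i (fun z => φ (f z)) = fun w => deriv φ (f w) * pdv i f w := fun i =>
    funext fun w => h1 hφ w _
  have h3 : ∀ i, pdv i (fun w => deriv φ (f w) * pdv i f w) z =
      deriv φ (f z) * pdv i (pdv i f) z + deriv (deriv φ) (f z) * pdv i f z ^ 2 := fun i => by
    have hd2 : DifferentiableAt ℝ (fun w => deriv φ (f w)) z :=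
      (hφ'.comp hf).differentiable (by simp) z
    have hd3 : DifferentiableAt ℝ (pdv i f) z := (contDiff_pdv hf i).differentiable (by simp) z
    have := h1 hφ' z (0, EuclideanSpace.single i 1)
    rw [pdv, HasFDerivAt.fderiv (f := fun w => deriv φ (f w) * pdv i f w)
      (hd2.hasFDerivAt.mul hd3.hasFDerivAt)]
    change deriv φ (f z) * pdv i (pdv i f) z + pdv i f z * fderiv ℝ _ z _ = _
    rw [this, ← pdv]
    ring
  rw [hamiltonOp_eq (f := fun z => φ (f z)) (hφ.comp hf), hamiltonOp_eq hf, Finset.mul_sum,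
    Finset.mul_sum, ← Finset.sum_add_distrib]
  refine Finset.sum_congr rfl fun i _ => ?_
  rw [h2, h3, pdx, h1 hφ, ← pdx]
  ring

/-- By convexity, `φ(f) - φ(f - h L f) ≤ h φ'(f) L f`. The right side has nonpositive integral,
because `φ'(f) L f ≤ L(φ(f))` and the measure is invariant. -/
theorem integral_softAbs_le {κ : ℝ} (hκ : 0 < κ) {f : E d × E d → ℝ}
    (hf : f ∈ testFunctions (finiteSet Φ₁ ×ˢ (univ : Set (E d)))) {h : ℝ} (hh : 0 ≤ h) :
    ∫ z, softAbs κ (f z) ∂(gibbs Φ₁).prod ν ≤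
      ∫ z, softAbs κ (f z - h * hamiltonOp G₁ G f z) ∂(gibbs Φ₁).prod ν := by
  have hφ := contDiff_softAbs hκ
  have hLf := (memLp_one_iff_integrable.1 (memLp_hamiltonOp hG₁ hG hf).2)
  have hfi : Integrable f ((gibbs Φ₁).prod ν) :=
    memLp_one_iff_integrable.1 (memLp_of_mem_testFunctions hf 1)
  have hi : ∀ {g : E d × E d → ℝ}, Integrable g ((gibbs Φ₁).prod ν) →
      Integrable (fun z => softAbs κ (g z)) ((gibbs Φ₁).prod ν) := fun {g} hg =>
    hg.mono (hφ.continuous.comp_aestronglyMeasurable hg.1) (ae_of_all _ fun z => by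
      rw [Real.norm_of_nonneg (softAbs_nonneg _)]
      exact softAbs_le_abs hκ _)
  have hφf : (fun z => softAbs κ (f z)) ∈ testFunctions (finiteSet Φ₁ ×ˢ (univ : Set (E d))) := by
    have h1 : tsupport (fun z => softAbs κ (f z)) ⊆ tsupport f :=
      closure_mono fun z hz h => hz (by simp only; rw [h, softAbs_zero hκ])
    exact ⟨hφ.comp hf.1, hf.2.1.of_isClosed_subset (isClosed_tsupport _) h1, h1.trans hf.2.2⟩
  have hdi : Integrable (fun z => deriv (softAbs κ) (f z) * hamiltonOp G₁ G f z)
      ((gibbs Φ₁).prod ν) := by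
    refine hLf.bdd_mul (c := 1) (((hφ.continuous_deriv (by simp)).comp
      hf.1.continuous).aestronglyMeasurable) (ae_of_all _ fun z => ?_)
    have hA : 0 < √(f z ^ 2 + κ ^ 2) := Real.sqrt_pos.2 (by positivity)
    rw [(hasDerivAt_softAbs hκ (f z)).deriv, norm_div, Real.norm_of_nonneg hA.le, div_le_one hA]
    exact Real.abs_le_sqrt (by nlinarith [sq_nonneg κ])
  have h0 := integral_hamiltonOp hG₁ hG hlog₁ hlog hφf
  have hle : ∫ z, deriv (softAbs κ) (f z) * hamiltonOp G₁ G f z ∂(gibbs Φ₁).prod ν ≤ 0 := by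
    rw [← h0]
    refine integral_mono hdi (memLp_one_iff_integrable.1 (memLp_hamiltonOp hG₁ hG hφf).2) fun z => ?_
    simp only
    rw [hamiltonOp_comp hf.1 hφ]
    have := deriv_deriv_softAbs_nonneg hκ (f z)
    have h2 : 0 ≤ ∑ i, pdv i f z ^ 2 := Finset.sum_nonneg fun i _ => sq_nonneg _
    nlinarith [mul_nonneg this h2]
  have hfin : Integrable (fun z => softAbs κ (f z - h * hamiltonOp G₁ G f z))
    ((gibbs Φ₁).prod ν) := hi (hfi.sub (hLf.const_mul h))
  rw [← sub_nonpos, ← integral_sub (hi hfi) hfin]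
  refine (integral_mono ((hi hfi).sub hfin) (hdi.const_mul h) fun z => ?_).trans ?_
  · simp only [Pi.sub_apply]
    rw [(hasDerivAt_softAbs hκ (f z)).deriv]
    refine (softAbs_sub_le hκ _ _).trans (le_of_eq ?_)
    ring
  · rw [integral_const_mul]
    exact mul_nonpos_of_nonneg_of_nonpos hh hle

end Dissipativity

/-! ### `L¹` and `L²` estimates from one convex family -/

section SoftAbsIntegral

variable {α : Type*} [MeasurableSpace α] {μ : Measure α}

theorem integrable_softAbs {κ : ℝ} (hκ : 0 < κ) {a : α → ℝ} (ha : Integrable a μ) :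
    Integrable (fun x => softAbs κ (a x)) μ :=
  ha.mono ((contDiff_softAbs hκ).continuous.comp_aestronglyMeasurable ha.1) (ae_of_all _ fun z => by
    rw [Real.norm_of_nonneg (softAbs_nonneg _)]
    exact softAbs_le_abs hκ _)

theorem continuous_integral_softAbs {κ : ℝ} (hκ : 0 < κ) :
    Continuous fun u : Lp ℝ 1 μ => ∫ x, softAbs κ (u x) ∂μ := by
  refine (LipschitzWith.of_dist_le_mul (K := 1) fun u v => ?_).continuous
  have hi : ∀ u : Lp ℝ 1 μ, Integrable u μ := L1.integrable_coeFn
  rw [NNReal.coe_one, one_mul, Real.dist_eq, dist_eq_norm,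
    ← integral_sub (integrable_softAbs hκ (hi u)) (integrable_softAbs hκ (hi v)), L1.norm_eq_integral_norm]
  refine (abs_integral_le_integral_abs).trans (integral_mono_ae
    ((integrable_softAbs hκ (hi u)).sub (integrable_softAbs hκ (hi v))).abs (hi _).norm ?_)
  filter_upwards [Lp.coeFn_sub u v] with x hx
  rw [hx, Real.norm_eq_abs]
  exact abs_softAbs_sub_le hκ _ _

/-- Let `κ → 0` by dominated convergence, since `|s| - κ ≤ softAbs κ s ≤ |s|`. -/
theorem integral_abs_le_of_softAbs {a b : α → ℝ} (ha : Integrable a μ) (hb : Integrable b μ)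
    (h : ∀ κ : ℝ, 0 < κ → ∫ x, softAbs κ (a x) ∂μ ≤ ∫ x, softAbs κ (b x) ∂μ) :
    ∫ x, |a x| ∂μ ≤ ∫ x, |b x| ∂μ := by
  have hpos : ∀ n : ℕ, 0 < 1 / ((n : ℝ) + 1) := fun n => by positivity
  have hlim : ∀ {c : α → ℝ}, Integrable c μ → Tendsto (fun n : ℕ =>
      ∫ x, softAbs (1 / ((n : ℝ) + 1)) (c x) ∂μ) atTop (𝓝 (∫ x, |c x| ∂μ)) := fun {c} hc =>
    tendsto_integral_of_dominated_convergence (fun x => |c x|)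
      (fun n => (integrable_softAbs (hpos n) hc).1) hc.abs
      (fun n => ae_of_all _ fun x => by
        rw [Real.norm_of_nonneg (softAbs_nonneg _)]
        exact softAbs_le_abs (hpos n) _)
      (ae_of_all _ fun x => by
        have h0 : Tendsto (fun n : ℕ => |c x| - 1 / ((n : ℝ) + 1)) atTop (𝓝 (|c x| - 0)) :=
          tendsto_const_nhds.sub tendsto_one_div_add_atTop_nhds_zero_nat
        rw [sub_zero] at h0
        exact tendsto_of_tendsto_of_tendsto_of_le_of_le h0 tendsto_const_nhds
          (fun n => sub_le_iff_le_add.2 (abs_le_softAbs_add _)) fun n => softAbs_le_abs (hpos n) _)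
  exact le_of_tendsto_of_tendsto' (hlim ha) (hlim hb) fun n => h _ (hpos n)

/-- Let `κ → ∞`: `2 κ softAbs κ s` tends to `s²` and never exceeds it, so Fatou on the left and the
upper bound on the right suffice. No square integrability is required. -/
theorem eLpNorm_two_le_of_softAbs {a b : α → ℝ} (ha : Integrable a μ) (hb : Integrable b μ)
    (h : ∀ κ : ℝ, 0 < κ → ∫ x, softAbs κ (a x) ∂μ ≤ ∫ x, softAbs κ (b x) ∂μ) :
    eLpNorm a 2 μ ≤ eLpNorm b 2 μ := by
  have hpos : ∀ n : ℕ, 0 < (n : ℝ) + 1 := fun n => by positivity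
  have hsq : ∀ s : ℝ, ENNReal.ofReal (s ^ 2) = ‖s‖ₑ ^ 2 := fun s => by
    rw [← sq_abs, ENNReal.ofReal_pow (abs_nonneg s), ← Real.norm_eq_abs, ofReal_norm]
  have hint : ∀ {c : α → ℝ}, Integrable c μ → ∀ n : ℕ,
      ∫⁻ x, ENNReal.ofReal (2 * ((n + 1) * softAbs (n + 1) (c x))) ∂μ =
        ENNReal.ofReal (2 * ((n + 1) * ∫ x, softAbs (n + 1) (c x) ∂μ)) := fun {c} hc n => by
    rw [← integral_const_mul, ← integral_const_mul, ofReal_integral_eq_lintegral_ofReal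
      (((integrable_softAbs (hpos n) hc).const_mul _).const_mul _)]
    exact ae_of_all _ fun x => mul_nonneg two_pos.le (mul_nonneg (hpos n).le (softAbs_nonneg _))
  have key : ∫⁻ x, ‖a x‖ₑ ^ 2 ∂μ ≤ ∫⁻ x, ‖b x‖ₑ ^ 2 ∂μ := by
    have h1 : ∀ x, ‖a x‖ₑ ^ 2 = liminf (fun n : ℕ =>
        ENNReal.ofReal (2 * (((n : ℝ) + 1) * softAbs (n + 1) (a x)))) atTop := fun x => by
      refine (Tendsto.liminf_eq ?_).symm
      rw [← hsq]
      refine (ENNReal.continuous_ofReal.tendsto _).comp ?_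
      have := (tendsto_mul_softAbs (a x)).const_mul 2
      rwa [mul_div_cancel₀ _ (two_ne_zero' ℝ)] at this
    simp only [h1]
    refine (lintegral_liminf_le' fun n => ((((integrable_softAbs (hpos n)
      ha).const_mul _).const_mul _).1.aemeasurable.ennreal_ofReal)).trans ?_
    refine liminf_le_of_le (by isBoundedDefault) fun c hc => ?_
    obtain ⟨n, hn⟩ := hc.exists
    refine hn.trans ?_
    rw [hint ha]
    refine (ENNReal.ofReal_le_ofReal (q := 2 * ((n + 1) * ∫ x, softAbs (n + 1) (b x) ∂μ)) ?_).trans ?_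
    · have := h _ (hpos n)
      have := hpos n
      gcongr
    · rw [← hint hb]
      refine lintegral_mono fun x => ?_
      rw [← hsq]
      refine ENNReal.ofReal_le_ofReal ?_
      linarith [mul_softAbs_le (hpos n) (b x)]
  rw [lintegral_enorm_sq, lintegral_enorm_sq] at key
  exact (ENNReal.pow_le_pow_left_iff two_ne_zero).1 key

end SoftAbsIntegral

/-! ### `L²` balls inside `L¹` -/

section BoundedSet

variable {α : Type*} [MeasurableSpace α] {μ : Measure α}

/-- Closed balls of `L²` as subsets of `L¹`. -/
def l2Ball (μ : Measure α) (r : ℝ≥0∞) : Set (Lp ℝ 1 μ) := {u | eLpNorm u 2 μ ≤ r}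

/-- Fatou along an almost everywhere convergent subsequence. -/
theorem isClosed_l2Ball (r : ℝ≥0∞) : IsClosed (l2Ball μ r) := by
  refine isClosed_of_closure_subset fun u hu => ?_
  obtain ⟨w, hw, hlim⟩ := mem_closure_iff_seq_limit.1 hu
  obtain ⟨ns, -, hns⟩ := (tendstoInMeasure_of_tendsto_Lp hlim).exists_seq_tendsto_ae
  refine (Lp.eLpNorm_lim_le_liminf_eLpNorm (f := fun n => w (ns n))
    (fun n => Lp.aestronglyMeasurable _) _ hns).trans ?_
  exact liminf_le_of_le (by isBoundedDefault) fun c hc => (hc.exists).elim fun n hn =>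
    hn.trans (hw _)

theorem convex_l2Ball (r : ℝ≥0∞) : Convex ℝ (l2Ball μ r) := by
  intro u hu v hv s t hs ht hst
  have h1 : (s • u + t • v : Lp ℝ 1 μ) =ᵐ[μ] s • (u : α → ℝ) + t • (v : α → ℝ) :=
    (Lp.coeFn_add _ _).trans ((Lp.coeFn_smul s u).add (Lp.coeFn_smul t v))
  change eLpNorm _ 2 μ ≤ r
  rw [eLpNorm_congr_ae h1]
  refine (eLpNorm_add_le ((Lp.aestronglyMeasurable u).const_smul s)
    ((Lp.aestronglyMeasurable v).const_smul t) one_le_two).trans ?_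
  rw [eLpNorm_const_smul, eLpNorm_const_smul]
  calc _ ≤ ‖s‖ₑ * r + ‖t‖ₑ * r := by gcongr <;> assumption
    _ = r := by
      rw [← add_mul, Real.enorm_of_nonneg hs, Real.enorm_of_nonneg ht,
        ← ENNReal.ofReal_add hs ht, hst, ENNReal.ofReal_one, one_mul]

theorem zero_mem_l2Ball (r : ℝ≥0∞) : (0 : Lp ℝ 1 μ) ∈ l2Ball μ r := by
  change eLpNorm _ 2 μ ≤ r
  rw [eLpNorm_congr_ae (Lp.coeFn_zero ℝ 1 μ), eLpNorm_zero]
  exact zero_le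

end BoundedSet

/-! ### The semigroup on `L¹` -/

section SemigroupL1

variable {d : ℕ} {Φ₁ : E d → EReal} {G₁ : E d → E d} {ν : Measure (E d)} {G : E d → E d}

theorem hamiltonOp_add {f g : E d × E d → ℝ} (hf : ContDiff ℝ ∞ f) (hg : ContDiff ℝ ∞ g)
    (z : E d × E d) : hamiltonOp G₁ G (f + g) z = hamiltonOp G₁ G f z + hamiltonOp G₁ G g z := by
  have h1 : ∀ {a b : E d × E d → ℝ}, ContDiff ℝ ∞ a → ContDiff ℝ ∞ b → ∀ w e,
      fderiv ℝ (a + b) w e = fderiv ℝ a w e + fderiv ℝ b w e := fun ha hb w e => by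
    rw [fderiv_add (ha.differentiable (by simp) w) (hb.differentiable (by simp) w)]
    rfl
  have h2 : ∀ i, pdv i (f + g) = pdv i f + pdv i g := fun i => funext fun w => h1 hf hg w _
  rw [hamiltonOp_eq (f := f + g) (hf.add hg), hamiltonOp_eq hf, hamiltonOp_eq hg,
    ← Finset.sum_add_distrib]
  refine Finset.sum_congr rfl fun i _ => ?_
  rw [h2, pdv, h1 (contDiff_pdv hf i) (contDiff_pdv hg i), pdx, h1 hf hg]
  simp only [Pi.add_apply, pdv, pdx]
  ring

theorem hamiltonOp_smul {f : E d × E d → ℝ} (hf : ContDiff ℝ ∞ f) (c : ℝ)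
    (z : E d × E d) : hamiltonOp G₁ G (c • f) z = c * hamiltonOp G₁ G f z := by
  have h1 : ∀ {a : E d × E d → ℝ}, ContDiff ℝ ∞ a → ∀ w e,
      fderiv ℝ (c • a) w e = c * fderiv ℝ a w e := fun ha w e => by
    rw [fderiv_const_smul (ha.differentiable (by simp) w)]
    rfl
  have h2 : ∀ i, pdv i (c • f) = c • pdv i f := fun i => funext fun w => h1 hf w _
  rw [hamiltonOp_eq (f := c • f) (contDiff_const.smul hf), hamiltonOp_eq hf, Finset.mul_sum]
  refine Finset.sum_congr rfl fun i _ => ?_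
  rw [h2, pdv, h1 (contDiff_pdv hf i), pdx, h1 hf]
  simp only [Pi.smul_apply, pdv, pdx, smul_eq_mul]
  ring

/-- The graph of the Hamiltonian operator in `L¹` as a subspace. -/
def hamiltonSubmodule (Φ₁ : E d → EReal) (G₁ : E d → E d) (ν : Measure (E d)) (G : E d → E d) :
    Submodule ℝ (Lp ℝ 1 ((gibbs Φ₁).prod ν) × Lp ℝ 1 ((gibbs Φ₁).prod ν)) where
  carrier := operatorGraph 1 ((gibbs Φ₁).prod ν) (testFunctions (finiteSet Φ₁ ×ˢ univ))
    (hamiltonOp G₁ G)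
  add_mem' := by
    rintro p q ⟨f, hf, h1, h2⟩ ⟨g, hg, h3, h4⟩
    refine ⟨f + g, add_mem hf hg, (Lp.coeFn_add _ _).trans (h1.add h3), ?_⟩
    rw [funext (hamiltonOp_add (G₁ := G₁) (G := G) hf.1 hg.1)]
    exact (Lp.coeFn_add _ _).trans (h2.add h4)
  zero_mem' := by
    refine ⟨0, zero_mem _, Lp.coeFn_zero _ _ _, (Lp.coeFn_zero _ _ _).trans (ae_of_all _ fun z => ?_)⟩
    have := hamiltonOp_smul (G₁ := G₁) (G := G) (contDiff_const (c := (0 : ℝ))) 0 z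
    rw [zero_mul, zero_smul] at this
    exact this.symm
  smul_mem' := by
    rintro c p ⟨f, hf, h1, h2⟩
    refine ⟨c • f, Submodule.smul_mem _ c hf, (Lp.coeFn_smul _ _).trans (h1.const_smul c), ?_⟩
    rw [funext (hamiltonOp_smul (G₁ := G₁) (G := G) hf.1 c)]
    exact (Lp.coeFn_smul _ _).trans (h2.const_smul c)

variable (h₁ : PositionAssumptions Φ₁ G₁) (hν : VelocityMeasure ν G)
include h₁ hν

/-- For fixed `κ` both sides are continuous in `L¹`, so the estimate passes to the closure, where
resolvents take their values. -/
theorem integral_softAbs_le_of_mem_closure {κ : ℝ} (hκ : 0 < κ)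
    {p : Lp ℝ 1 ((gibbs Φ₁).prod ν) × Lp ℝ 1 ((gibbs Φ₁).prod ν)}
    (hp : p ∈ closure (hamiltonSubmodule Φ₁ G₁ ν G :
      Set (Lp ℝ 1 ((gibbs Φ₁).prod ν) × Lp ℝ 1 ((gibbs Φ₁).prod ν)))) {h : ℝ} (hh : 0 ≤ h) :
    ∫ z, softAbs κ (p.1 z) ∂(gibbs Φ₁).prod ν ≤
      ∫ z, softAbs κ ((p.1 - h • p.2 : Lp ℝ 1 ((gibbs Φ₁).prod ν)) z) ∂(gibbs Φ₁).prod ν := by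
  have := h₁.finiteOnCompacts
  have := hν.prob
  have hc := continuous_integral_softAbs (μ := (gibbs Φ₁).prod ν) hκ
  refine closure_minimal (fun q hq => ?_) (isClosed_le (hc.comp continuous_fst)
    (hc.comp (continuous_fst.sub (continuous_snd.const_smul h)))) hp
  obtain ⟨f, hf, h1, h2⟩ := hq
  change ∫ z, softAbs κ (q.1 z) ∂(gibbs Φ₁).prod ν ≤
      ∫ z, softAbs κ ((q.1 - h • q.2 : Lp ℝ 1 ((gibbs Φ₁).prod ν)) z) ∂(gibbs Φ₁).prod ν
  have e1 : ∫ z, softAbs κ (q.1 z) ∂(gibbs Φ₁).prod ν =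
      ∫ z, softAbs κ (f z) ∂(gibbs Φ₁).prod ν :=
    integral_congr_ae (h1.mono fun z hz => congrArg (softAbs κ) hz)
  rw [e1]
  refine (integral_softAbs_le h₁.gradient_memLp hν.memLp h₁.isLogGradient hν.isLogGradient hκ hf
    hh).trans (le_of_eq (integral_congr_ae ?_))
  filter_upwards [h1, h2, Lp.coeFn_sub q.1 (h • q.2), Lp.coeFn_smul h q.2] with z e1 e2 e3 e4
  rw [e3, Pi.sub_apply, e4, Pi.smul_apply, e1, e2, smul_eq_mul]

/-- The closure of the Hamiltonian operator generates a contraction semigroup on `L¹`, which is also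
contractive in `L²`. -/
theorem exists_hamiltonSemigroup_L1 :
    ∃ S, IsGeneratedByClosure (operatorGraph 1 ((gibbs Φ₁).prod ν)
      (testFunctions (finiteSet Φ₁ ×ˢ univ)) (hamiltonOp G₁ G)) S ∧
      ∀ t (u : Lp ℝ 1 ((gibbs Φ₁).prod ν)), eLpNorm (S t u) 2 ((gibbs Φ₁).prod ν) ≤
        eLpNorm u 2 ((gibbs Φ₁).prod ν) := by
  have hfc := h₁.finiteOnCompacts
  have hprob := hν.prob
  obtain ⟨r₀, hr₀, hℓ⟩ := exists_forall_functional_eq_zero h₁ hν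
  have hi : ∀ u : Lp ℝ 1 ((gibbs Φ₁).prod ν), Integrable u ((gibbs Φ₁).prod ν) :=
    L1.integrable_coeFn
  have hmem : ∀ f ∈ testFunctions (finiteSet Φ₁ ×ˢ (univ : Set (E d))),
      (lpClass 1 ((gibbs Φ₁).prod ν) f, lpClass 1 ((gibbs Φ₁).prod ν) (hamiltonOp G₁ G f)) ∈
        hamiltonSubmodule Φ₁ G₁ ν G := fun f hf =>
    ⟨f, hf, coeFn_lpClass (memLp_of_mem_testFunctions hf 1),
      coeFn_lpClass (memLp_hamiltonOp h₁.gradient_memLp hν.memLp hf).2⟩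
  obtain ⟨S, hS, hK⟩ := exists_isGeneratedByClosure (hamiltonSubmodule Φ₁ G₁ ν G)
    (fun p hp h hh => by
      rw [L1.norm_eq_integral_norm, L1.norm_eq_integral_norm]
      exact integral_abs_le_of_softAbs (hi _) (hi _) fun κ hκ =>
        integral_softAbs_le_of_mem_closure h₁ hν hκ (subset_closure hp) hh)
    (by
      refine (dense_testFunctions (μ := (gibbs Φ₁).prod ν) (p := 1) (by simp)
        (h₁.isOpen_finiteSet.prod isOpen_univ) ?_).mono ?_
      · have : (finiteSet Φ₁ ×ˢ (univ : Set (E d)))ᶜ = (finiteSet Φ₁)ᶜ ×ˢ univ := by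
          ext z
          simp
        rw [this, Measure.prod_prod, h₁.gibbs_compl, zero_mul]
      · rintro u ⟨f, hf, rfl⟩
        exact ⟨_, hmem f hf, rfl⟩)
    (h₀ := r₀⁻¹) (by positivity) (fun h hh hhr => by
      have := dense_of_forall_dual ((hamiltonSubmodule Φ₁ G₁ ν G).map
        (LinearMap.fst ℝ (Lp ℝ 1 ((gibbs Φ₁).prod ν)) (Lp ℝ 1 ((gibbs Φ₁).prod ν)) -
          h • LinearMap.snd ℝ (Lp ℝ 1 ((gibbs Φ₁).prod ν)) (Lp ℝ 1 ((gibbs Φ₁).prod ν))))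
        fun ℓ h0 => by
          -- Annihilating the range of `1 - h L` is the functional equation with `r = h⁻¹`, and `h ≤
          -- r₀⁻¹` places `r` above the threshold.
          refine hℓ h⁻¹ ((le_inv_comm₀ hh hr₀).1 hhr) ℓ fun f hf => ?_
          have h1 := h0 _ (Submodule.mem_map_of_mem (hmem f hf))
          have h2 : ℓ (lpClass 1 ((gibbs Φ₁).prod ν) f -
            h • lpClass 1 ((gibbs Φ₁).prod ν) (hamiltonOp G₁ G f)) = 0 := h1
          rw [_root_.map_sub, map_smul, smul_eq_mul, sub_eq_zero] at h2
          rw [h2, ← mul_assoc, inv_mul_cancel₀ hh.ne', one_mul]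
      rw [Submodule.map_coe] at this
      exact this)
  refine ⟨S, hS, fun t u => ?_⟩
  -- Invariance is applied to the ball whose radius is the `L²` norm of `u` itself; an infinite
  -- radius is allowed and gives nothing.
  refine hK (l2Ball _ (eLpNorm u 2 ((gibbs Φ₁).prod ν))) (isClosed_l2Ball _) (convex_l2Ball _)
    (zero_mem_l2Ball _) (fun h hh _ p hp hpK => ?_) t u (le_refl (eLpNorm u 2 _))
  exact (eLpNorm_two_le_of_softAbs (hi _) (hi _) fun κ hκ =>
    integral_softAbs_le_of_mem_closure h₁ hν hκ hp hh.le).trans hpK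

end SemigroupL1

/-- Allows `L²` bounds to be read off from `L¹`-valued time integrals: averages of a curve in an
`L²` ball stay in the ball. -/
theorem average_mem {X : Type*} [NormedAddCommGroup X] [NormedSpace ℝ X] [CompleteSpace X]
    {K : Set X} (hK : Convex ℝ K) (hKc : IsClosed K) {f : ℝ → X} (hf : Continuous f) {t : ℝ}
    (ht : 0 < t) (h : ∀ s ∈ Ioc 0 t, f s ∈ K) : t⁻¹ • ∫ s in (0 : ℝ)..t, f s ∈ K := by
  have h1 := hK.set_average_mem hKc (μ := volume) (t := Ioc 0 t) (f := f) (by simp [ht]) (by simp)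
    ((ae_restrict_iff' measurableSet_Ioc).2 (ae_of_all _ h))
    ((hf.integrableOn_Icc (a := 0) (b := t)).mono_set Ioc_subset_Icc_self)
  rw [setAverage_eq, measureReal_def, Real.volume_Ioc, sub_zero, ENNReal.toReal_ofReal ht.le] at h1
  rwa [intervalIntegral.integral_of_le ht.le]

/-! ### Extension of the semigroup from `L¹` to `L²` -/

section Interpolation

variable {α : Type*} [MeasurableSpace α] {μ : Measure α}

theorem memLp_two_of_mem_l2Ball {u : Lp ℝ 1 μ} {r : ℝ≥0∞} (hu : u ∈ l2Ball μ r) (hr : r ≠ ⊤) :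
    MemLp u 2 μ := ⟨Lp.aestronglyMeasurable u, lt_of_le_of_lt hu hr.lt_top⟩

theorem norm_lpClass_le_of_mem_l2Ball {u : Lp ℝ 1 μ} {r : ℝ} (hr : 0 ≤ r)
    (hu : u ∈ l2Ball μ (ENNReal.ofReal r)) : ‖lpClass 2 μ u‖ ≤ r := by
  rw [norm_lpClass (memLp_two_of_mem_l2Ball hu ENNReal.ofReal_ne_top)]
  exact ENNReal.toReal_le_of_le_ofReal hr hu

theorem mem_l2Ball_norm {u : Lp ℝ 1 μ} (hu : MemLp u 2 μ) :
    u ∈ l2Ball μ (ENNReal.ofReal ‖lpClass 2 μ u‖) := by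
  rw [norm_lpClass hu, ENNReal.ofReal_toReal hu.eLpNorm_ne_top]
  exact le_refl (eLpNorm u 2 μ)

theorem lpClass_two_coe_sub {u v : Lp ℝ 1 μ} (hu : MemLp u 2 μ) (hv : MemLp v 2 μ) :
    MemLp (u - v : Lp ℝ 1 μ) 2 μ ∧
      lpClass 2 μ (u - v : Lp ℝ 1 μ) = lpClass 2 μ u - lpClass 2 μ v := by
  have h := (memLp_congr_ae (Lp.coeFn_sub u v)).2 (hu.sub hv)
  exact ⟨h, (lpClass_congr h (Lp.coeFn_sub u v)).trans (lpClass_sub hu hv)⟩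

theorem lpClass_two_coe_add {u v : Lp ℝ 1 μ} (hu : MemLp u 2 μ) (hv : MemLp v 2 μ) :
    MemLp (u + v : Lp ℝ 1 μ) 2 μ ∧
      lpClass 2 μ (u + v : Lp ℝ 1 μ) = lpClass 2 μ u + lpClass 2 μ v := by
  have h := (memLp_congr_ae (Lp.coeFn_add u v)).2 (hu.add hv)
  exact ⟨h, (lpClass_congr h (Lp.coeFn_add u v)).trans (lpClass_add hu hv)⟩

theorem lpClass_two_coe_smul {u : Lp ℝ 1 μ} (hu : MemLp u 2 μ) (c : ℝ) :
    MemLp (c • u : Lp ℝ 1 μ) 2 μ ∧ lpClass 2 μ (c • u : Lp ℝ 1 μ) = c • lpClass 2 μ u := by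
  have h := (memLp_congr_ae (Lp.coeFn_smul c u)).2 (hu.const_smul c)
  exact ⟨h, (lpClass_congr h (Lp.coeFn_smul c u)).trans (lpClass_const_mul c hu)⟩

variable {S : ℝ≥0 → Lp ℝ 1 μ →L[ℝ] Lp ℝ 1 μ} (hS : IsContractionSemigroup S)
  (hS2 : ∀ t (u : Lp ℝ 1 μ), eLpNorm (S t u) 2 μ ≤ eLpNorm u 2 μ)
  {D : Set (Lp ℝ 1 μ × Lp ℝ 1 μ)} (hDS : D ⊆ generatorGraph S)
  (hD2 : ∀ p ∈ D, MemLp p.1 2 μ ∧ MemLp p.2 2 μ)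
  (hDd : Dense ((fun p : Lp ℝ 1 μ × Lp ℝ 1 μ => lpClass 2 μ p.1) '' D))
include hS2

theorem memLp_two_semigroup {u : Lp ℝ 1 μ} (hu : MemLp u 2 μ) (t : ℝ≥0) : MemLp (S t u) 2 μ :=
  ⟨Lp.aestronglyMeasurable _, (hS2 t u).trans_lt hu.2⟩

include hS hDS hD2 hDd

/-- A contraction semigroup on `L¹` which is contractive in `L²` extends to `L²`. -/
theorem exists_semigroup_L2 : ∃ T : ℝ≥0 → Lp ℝ 2 μ →L[ℝ] Lp ℝ 2 μ, IsContractionSemigroup T ∧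
    (∀ t (u : Lp ℝ 1 μ), MemLp u 2 μ → T t (lpClass 2 μ u) = lpClass 2 μ (S t u)) ∧
    ∀ p ∈ D, (lpClass 2 μ p.1, lpClass 2 μ p.2) ∈ generatorGraph T := by
  let P : Submodule ℝ (Lp ℝ 1 μ) :=
    { carrier := {u | MemLp u 2 μ}
      add_mem' := fun hu hv => (lpClass_two_coe_add hu hv).1
      zero_mem' := (memLp_congr_ae (Lp.coeFn_zero ℝ 1 μ)).2 MemLp.zero
      smul_mem' := fun c u hu => (lpClass_two_coe_smul hu c).1 }
  let e : P →ₗ[ℝ] Lp ℝ 2 μ :=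
    { toFun := fun u => lpClass 2 μ u.1
      map_add' := fun u v => (lpClass_two_coe_add u.2 v.2).2
      map_smul' := fun c u => (lpClass_two_coe_smul u.2 c).2 }
  let F : ℝ≥0 → P →ₗ[ℝ] Lp ℝ 2 μ := fun t =>
    { toFun := fun u => lpClass 2 μ (S t u.1)
      map_add' := fun u v => by
        rw [Submodule.coe_add, _root_.map_add]
        exact (lpClass_two_coe_add (memLp_two_semigroup hS2 u.2 t)
          (memLp_two_semigroup hS2 v.2 t)).2
      map_smul' := fun c u => by
        rw [Submodule.coe_smul, map_smul]
        exact (lpClass_two_coe_smul (memLp_two_semigroup hS2 u.2 t) c).2 }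
  have hed : DenseRange e := hDd.mono (by
    rintro _ ⟨p, hp, rfl⟩
    exact ⟨⟨p.1, (hD2 p hp).1⟩, rfl⟩)
  have hFn : ∀ t (u : P), ‖F t u‖ ≤ 1 * ‖e u‖ := fun t u => by
    change ‖lpClass 2 μ (S t u.1)‖ ≤ 1 * ‖lpClass 2 μ u.1‖
    rw [one_mul, norm_lpClass u.2, norm_lpClass (memLp_two_semigroup hS2 u.2 t)]
    exact ENNReal.toReal_mono u.2.eLpNorm_ne_top (hS2 t _)
  let T : ℝ≥0 → Lp ℝ 2 μ →L[ℝ] Lp ℝ 2 μ := fun t => (F t).extendOfNorm e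
  have hT : ∀ t (u : Lp ℝ 1 μ), MemLp u 2 μ → T t (lpClass 2 μ u) = lpClass 2 μ (S t u) :=
    fun t u hu => LinearMap.extendOfNorm_eq hed ⟨1, hFn t⟩ (⟨u, hu⟩ : P)
  have hext : ∀ {A B : Lp ℝ 2 μ →L[ℝ] Lp ℝ 2 μ}, (∀ u : Lp ℝ 1 μ, MemLp u 2 μ →
      A (lpClass 2 μ u) = B (lpClass 2 μ u)) → A = B := fun {A B} h =>
    ContinuousLinearMap.coeFn_injective (hed.equalizer A.continuous B.continuous
      (funext fun u => h u.1 u.2))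
  have hT1 : ∀ t, ‖T t‖ ≤ 1 := fun t => LinearMap.opNorm_extendOfNorm_le hed zero_le_one (hFn t)
  have hTadd : ∀ s t, T (s + t) = (T s).comp (T t) := fun s t => hext fun u hu => by
    rw [ContinuousLinearMap.comp_apply, hT _ _ hu, hT _ _ hu,
      hT _ _ (memLp_two_semigroup hS2 hu t), hS.apply_add]
  have hT0 : T 0 = ContinuousLinearMap.id ℝ _ := hext fun u hu => by
    rw [hT _ _ hu, hS.apply_zero]
    rfl
  -- The difference quotient is the time average of `S_s p.2`, which never leaves the `L²` ball of
  -- radius `‖p.2‖₂`; this Lipschitz bound yields strong continuity in `L²`.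
  have hdiff : ∀ p ∈ D, ∀ t : ℝ≥0, ‖T t (lpClass 2 μ p.1) - lpClass 2 μ p.1‖ ≤
      t * ‖lpClass 2 μ p.2‖ := fun p hp t => by
    rcases eq_or_ne t 0 with rfl | ht
    · rw [hT0]; simp
    have ht' : (0 : ℝ) < t := NNReal.coe_pos.2 (pos_iff_ne_zero.2 ht)
    have h1 := average_mem (convex_l2Ball (ENNReal.ofReal ‖lpClass 2 μ p.2‖)) (isClosed_l2Ball _)
      (hS.continuous_toNNReal p.2) ht' fun s _ =>
        (hS2 s.toNNReal p.2).trans (mem_l2Ball_norm (hD2 p hp).2)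
    rw [← hS.sub_eq_integral (hDS hp)] at h1
    have h2 := norm_lpClass_le_of_mem_l2Ball (norm_nonneg _) h1
    have h3 := lpClass_two_coe_sub (memLp_two_semigroup hS2 (hD2 p hp).1 t) (hD2 p hp).1
    rw [(lpClass_two_coe_smul h3.1 _).2, h3.2, ← hT _ _ (hD2 p hp).1, norm_smul, norm_inv,
      Real.norm_of_nonneg ht'.le, inv_mul_le_iff₀ ht'] at h2
    exact h2
  have hTx : ∀ t x, ‖T t x‖ ≤ ‖x‖ := fun t x => by simpa using (T t).le_of_opNorm_le (hT1 t) x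
  have hcD : ∀ p ∈ D, Continuous fun t => T t (lpClass 2 μ p.1) := fun p hp => by
    have hst : ∀ s t : ℝ≥0, s ≤ t → ‖T t (lpClass 2 μ p.1) - T s (lpClass 2 μ p.1)‖ ≤
        ‖lpClass 2 μ p.2‖ * dist t s := fun s t hst => by
      obtain ⟨r, rfl⟩ := exists_add_of_le hst
      have : T (s + r) (lpClass 2 μ p.1) - T s (lpClass 2 μ p.1) =
          T s (T r (lpClass 2 μ p.1) - lpClass 2 μ p.1) := by
        rw [hTadd, ContinuousLinearMap.comp_apply, _root_.map_sub]
      rw [this]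
      refine (hTx _ _).trans ((hdiff p hp r).trans (le_of_eq ?_))
      rw [NNReal.dist_eq, NNReal.coe_add, add_sub_cancel_left, NNReal.abs_eq, mul_comm]
    refine (LipschitzWith.of_dist_le_mul (K := ‖lpClass 2 μ p.2‖₊) fun t s => ?_).continuous
    rw [dist_eq_norm, coe_nnnorm]
    rcases le_total s t with h | h
    · exact hst s t h
    · rw [norm_sub_rev, dist_comm]
      exact hst t s h
  have hTs : IsContractionSemigroup T := by
    refine ⟨hT0, hTadd, hT1, fun x => continuous_of_uniform_approx_of_continuous fun u hu => ?_⟩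
    obtain ⟨r, hr, hru⟩ := Metric.mem_uniformity_dist.1 hu
    obtain ⟨_, hy, p, hp, rfl⟩ := Metric.dense_iff.1 hDd x r hr
    refine ⟨_, hcD p hp, fun t => hru ?_⟩
    rw [dist_eq_norm, ← _root_.map_sub]
    refine (hTx _ _).trans_lt ?_
    rw [← dist_eq_norm, dist_comm]
    exact hy
  refine ⟨T, hTs, hT, fun p hp => ?_⟩
  have h1 := hD2 p hp
  change Tendsto _ _ _
  rw [Metric.tendsto_nhds]
  intro r hr
  have h0 : Tendsto (fun t => T t (lpClass 2 μ p.2)) (𝓝 0) (𝓝 (lpClass 2 μ p.2)) := by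
    have := (hTs.continuous (lpClass 2 μ p.2)).tendsto 0
    rwa [hTs.apply_zero] at this
  obtain ⟨δ, hδ, hδr⟩ := Metric.eventually_nhds_iff.1 (Metric.tendsto_nhds.1 h0 (r / 2) (by positivity))
  filter_upwards [self_mem_nhdsWithin, mem_nhdsWithin_of_mem_nhds (Metric.ball_mem_nhds 0 hδ)]
    with t ht htδ
  have ht' : (0 : ℝ) < t := ht
  have hm2 := h1.2
  -- The same averaging argument for `S_s p.2 - p.2`, now small in `L²` by the strong continuity
  -- already proved, identifies the generator on `D`.
  have h2 := average_mem (convex_l2Ball (ENNReal.ofReal (r / 2))) (isClosed_l2Ball (μ := μ) _)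
    (f := fun s : ℝ => S s.toNNReal p.2 - p.2) ((hS.continuous_toNNReal p.2).sub continuous_const)
    ht' fun s hs => by
      have h3 := lpClass_two_coe_sub (memLp_two_semigroup hS2 hm2 s.toNNReal) hm2
      have h4 := mem_l2Ball_norm h3.1
      refine le_trans h4 (ENNReal.ofReal_le_ofReal ?_)
      rw [h3.2, ← hT _ _ hm2, ← dist_eq_norm]
      refine (hδr ?_).le
      rw [NNReal.dist_eq, NNReal.coe_zero, sub_zero, NNReal.abs_eq, Real.coe_toNNReal _ hs.1.le]
      refine hs.2.trans_lt ?_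
      rw [Metric.mem_ball, NNReal.dist_eq, NNReal.coe_zero, sub_zero, NNReal.abs_eq] at htδ
      exact htδ
  rw [intervalIntegral.integral_sub ((hS.continuous_toNNReal p.2).intervalIntegrable _ _)
    (continuous_const.intervalIntegrable _ _), intervalIntegral.integral_const, sub_zero,
    ← hS.sub_eq_integral (hDS hp), smul_sub, smul_smul, inv_mul_cancel₀ ht'.ne', one_smul] at h2
  have h5 := lpClass_two_coe_sub (memLp_two_semigroup hS2 h1.1 t) h1.1
  have h6 := lpClass_two_coe_smul h5.1 (t : ℝ)⁻¹
  have h7 := norm_lpClass_le_of_mem_l2Ball (by positivity) h2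
  rw [(lpClass_two_coe_sub h6.1 hm2).2, h6.2, h5.2, ← hT _ _ h1.1, ← dist_eq_norm] at h7
  exact h7.trans_lt (by linarith)

end Interpolation

/-! ### Existence and uniqueness of the semigroup on `L²` -/

section PhaseSemigroup

variable {d : ℕ} {Φ₁ : E d → EReal} {G₁ : E d → E d} {ν : Measure (E d)} {G : E d → E d}

theorem PositionAssumptions.prod_compl (h₁ : PositionAssumptions Φ₁ G₁) :
    ((gibbs Φ₁).prod ν) (finiteSet Φ₁ ×ˢ univ)ᶜ = 0 := by
  have : (finiteSet Φ₁ ×ˢ (univ : Set (E d)))ᶜ = (finiteSet Φ₁)ᶜ ×ˢ univ := by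
    ext z
    simp
  rw [this]
  refine measure_mono_null ?_ (Measure.quasiMeasurePreserving_fst.preimage_null h₁.gibbs_compl)
  exact fun z hz => hz.1

/-- Existence and uniqueness of the `L²`-semigroup extending the `L¹`-semigroup generated by the
generalized Hamiltonian operator, and the test functions in the domain of its generator. -/
theorem exists_unique_hamiltonSemigroup (h₁ : PositionAssumptions Φ₁ G₁)
    (hν : VelocityMeasure ν G) {μ : Measure (E d × E d)} (hμ : μ = (gibbs Φ₁).prod ν) :
    ∃ T : ℝ≥0 → Lp ℝ 2 μ →L[ℝ] Lp ℝ 2 μ,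
      (∀ T' : ℝ≥0 → Lp ℝ 2 μ →L[ℝ] Lp ℝ 2 μ, (IsContractionSemigroup T' ∧ ∃ S, IsGeneratedByClosure (operatorGraph 1 μ
          (testFunctions (finiteSet Φ₁ ×ˢ univ)) (hamiltonOp G₁ G)) S ∧
          ∀ (f : Lp ℝ 1 μ) (g : Lp ℝ 2 μ), MemLp f (⊤ : ℝ≥0∞) μ → f =ᵐ[μ] g →
            ∀ t, S t f =ᵐ[μ] T' t g) ↔ T' = T) ∧
      IsContractionSemigroup T ∧
      ∀ f ∈ testFunctions (finiteSet Φ₁ ×ˢ (univ : Set (E d))),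
        (lpClass 2 μ f, lpClass 2 μ (hamiltonOp G₁ G f)) ∈ generatorGraph T := by
  have := h₁.finiteOnCompacts
  have := hν.prob
  subst hμ
  set μ := (gibbs Φ₁).prod ν with hμ
  set U := finiteSet Φ₁ ×ˢ (univ : Set (E d)) with hU
  have hUo : IsOpen U := h₁.isOpen_finiteSet.prod isOpen_univ
  obtain ⟨S, hS, hS2⟩ := exists_hamiltonSemigroup_L1 h₁ hν
  have hL : ∀ f ∈ testFunctions U, MemLp (hamiltonOp G₁ G f) 2 μ ∧ MemLp (hamiltonOp G₁ G f) 1 μ :=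
    fun f hf => memLp_hamiltonOp h₁.gradient_memLp hν.memLp hf
  have hm : ∀ f ∈ testFunctions U, ∀ p, MemLp f p μ := fun f hf p =>
    memLp_of_mem_testFunctions hf p
  have hmem : ∀ f ∈ testFunctions U,
      (lpClass 1 μ f, lpClass 1 μ (hamiltonOp G₁ G f)) ∈ generatorGraph S := fun f hf => by
    rw [hS.2]
    exact subset_closure ⟨f, hf, coeFn_lpClass (hm f hf 1), coeFn_lpClass (hL f hf).2⟩
  let D : Set (Lp ℝ 1 μ × Lp ℝ 1 μ) :=
    {p | ∃ f ∈ testFunctions U, p = (lpClass 1 μ f, lpClass 1 μ (hamiltonOp G₁ G f))}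
  have hc : ∀ {f : E d × E d → ℝ}, MemLp f 1 μ → MemLp f 2 μ →
      MemLp (lpClass 1 μ f) 2 μ ∧ lpClass 2 μ (lpClass 1 μ f) = lpClass 2 μ f := fun h1 h2 => by
    have e := coeFn_lpClass h1
    have h3 := (memLp_congr_ae e).2 h2
    exact ⟨h3, lpClass_congr h3 e⟩
  have hdense2 := dense_testFunctions (μ := μ) (p := 2) (by simp) hUo h₁.prod_compl
  obtain ⟨T, hT, hTS, hTD⟩ := exists_semigroup_L2 (D := D) hS.1 hS2
    (by rintro _ ⟨f, hf, rfl⟩; exact hmem f hf)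
    (by
      rintro _ ⟨f, hf, rfl⟩
      exact ⟨(hc (hm f hf 1) (hm f hf 2)).1, (hc (hL f hf).2 (hL f hf).1).1⟩)
    (hdense2.mono (by
      rintro _ ⟨g, hg, rfl⟩
      exact ⟨_, ⟨g, hg, rfl⟩, (hc (hm g hg 1) (hm g hg 2)).2⟩))
  refine ⟨T, fun T' => ⟨?_, ?_⟩, hT, fun f hf => ?_⟩
  · rintro ⟨-, S', hS', hST'⟩
    -- A competing `L¹` semigroup has the same generator, which is densely defined, so it coincides;
    -- then the `L²` semigroups agree on test functions.
    have hSS : S' = S := by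
      refine hS'.1.eq_of_generatorGraph_eq hS.1 (hS'.2.trans hS.2.symm) ?_
      refine (dense_testFunctions (μ := μ) (p := 1) (by simp) hUo h₁.prod_compl).mono ?_
      rintro _ ⟨g, hg, rfl⟩
      exact ⟨_, hmem g hg, rfl⟩
    subst hSS
    funext t
    refine ContinuousLinearMap.coeFn_injective
      (Continuous.ext_on hdense2 (T' t).continuous (T t).continuous ?_)
    rintro _ ⟨g, hg, rfl⟩
    have e1 := coeFn_lpClass (hm g hg 1)
    have h2 := hST' (lpClass 1 μ g) (lpClass 2 μ g) ((memLp_congr_ae e1).2 (hm g hg _))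
      (e1.trans (coeFn_lpClass (hm g hg 2)).symm) t
    have h3 := hTS t (lpClass 1 μ g) (hc (hm g hg 1) (hm g hg 2)).1
    rw [(hc (hm g hg 1) (hm g hg 2)).2] at h3
    rw [h3]
    exact eq_lpClass _ h2.symm
  · rintro rfl
    refine ⟨hT, S, hS, fun f g _ hfg t => ?_⟩
    have hf2 : MemLp f 2 μ := (memLp_congr_ae hfg).2 (Lp.memLp g)
    have hg : g = lpClass 2 μ f := eq_lpClass g hfg.symm
    rw [hg, hTS t f hf2]
    exact (coeFn_lpClass (memLp_two_semigroup hS2 hf2 t)).symm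
  · have := hTD _ ⟨f, hf, rfl⟩
    rwa [(hc (hm f hf 1) (hm f hf 2)).2, (hc (hL f hf).2 (hL f hf).1).2] at this

end PhaseSemigroup

/-! ### Test functions in the limit space -/

section Convergence

variable {d : ℕ} {Φ₁ : E d → EReal} {G₁ : E d → E d}

/-- On `{Φ₁ < ∞}` a null set of `μ_{Φ₁}` is Lebesgue null, and outside both functions vanish;
continuity upgrades the equality to every point. -/
theorem PositionAssumptions.eq_of_ae_eq (h₁ : PositionAssumptions Φ₁ G₁) {f g : E d → ℝ}
    (hf : f ∈ testFunctions (finiteSet Φ₁)) (hg : g ∈ testFunctions (finiteSet Φ₁))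
    (h : f =ᵐ[gibbs Φ₁] g) : f = g := by
  have hae : ∀ᵐ x, x ∈ finiteSet Φ₁ → f x = g x := by
    have h2 := (ae_withDensity_iff h₁.continuous_exp.measurable).1 h
    filter_upwards [h2] with x hx hxΩ
    refine hx ?_
    rw [Ne, EReal.exp_eq_zero_iff, EReal.neg_eq_bot_iff]
    exact (show Φ₁ x < ⊤ from hxΩ).ne
  have hz : ∀ᵐ x, f x = g x := by
    filter_upwards [hae] with x hx
    by_cases hxΩ : x ∈ finiteSet Φ₁
    · exact hx hxΩ
    · rw [image_eq_zero_of_notMem_tsupport fun h => hxΩ (hf.2.2 h),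
        image_eq_zero_of_notMem_tsupport fun h => hxΩ (hg.2.2 h)]
  exact Continuous.ae_eq_iff_eq volume hf.1.continuous hg.1.continuous |>.1 hz

theorem coe_inclusionMap (h₁ : PositionAssumptions Φ₁ G₁) (u : testFunctions (finiteSet Φ₁)) :
    inclusionMap h₁ u = lpClass 2 (gibbs Φ₁) u.1 := by
  have := h₁.finiteOnCompacts
  exact (lpClass_eq (memLp_of_mem_testFunctions u.2 2)).symm

theorem injective_inclusionMap (h₁ : PositionAssumptions Φ₁ G₁) :
    Function.Injective (inclusionMap h₁) := by
  have := h₁.finiteOnCompacts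
  intro u v huv
  rw [coe_inclusionMap, coe_inclusionMap] at huv
  refine Subtype.ext (h₁.eq_of_ae_eq u.2 v.2 ?_)
  refine (coeFn_lpClass (memLp_of_mem_testFunctions u.2 2)).symm.trans ?_
  rw [huv]
  exact coeFn_lpClass (memLp_of_mem_testFunctions v.2 2)

theorem denseRange_inclusionMap (h₁ : PositionAssumptions Φ₁ G₁) :
    DenseRange (inclusionMap h₁) := by
  have := h₁.finiteOnCompacts
  refine (dense_testFunctions (μ := gibbs Φ₁) (p := 2) (by simp) h₁.isOpen_finiteSet
    h₁.gibbs_compl).mono ?_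
  rintro _ ⟨g, hg, rfl⟩
  exact ⟨⟨g, hg⟩, coe_inclusionMap h₁ _⟩

/-- The graph of the overdamped operator is the range of a map on the test functions. -/
theorem overdampedGraph_eq (h₁ : PositionAssumptions Φ₁ G₁) :
    overdampedGraph Φ₁ G₁ = range fun u : testFunctions (finiteSet Φ₁) =>
      (inclusionMap h₁ u, lpClass 2 (gibbs Φ₁) (overdampedOp G₁ u.1)) := by
  have := h₁.finiteOnCompacts
  ext ⟨a, b⟩
  constructor
  · rintro ⟨f, hf, ha, hb⟩
    refine ⟨⟨f, hf⟩, Prod.ext ?_ ?_⟩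
    · exact (coe_inclusionMap h₁ _).trans (eq_lpClass a ha).symm
    · exact (eq_lpClass b hb).symm
  · rintro ⟨u, hu⟩
    obtain ⟨rfl, rfl⟩ := Prod.mk.inj hu
    refine ⟨u.1, u.2, ?_, coeFn_lpClass (memLp_overdampedOp h₁.gradient_memLp u.2)⟩
    rw [coe_inclusionMap]
    exact coeFn_lpClass (memLp_of_mem_testFunctions u.2 2)

end Convergence

/-! ### Product rules and the shear computation -/

section ProductRules

variable {d : ℕ} (G₁ G : E d → E d)

theorem hamiltonOp_slice {f : E d × E d → ℝ} (hf : ContDiff ℝ ∞ f) (x v : E d) :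
    hamiltonOp G₁ G f (x, v) = ∑ i, (pd i (pd i fun w => f (x, w)) v
      - G v i * pd i (fun w => f (x, w)) v + G v i * pd i (fun y => f (y, v)) x
      - G₁ x i * pd i (fun w => f (x, w)) v) := by
  have hs : ContDiff ℝ ∞ fun w => f (x, w) := hf.comp (contDiff_const.prodMk contDiff_id)
  simp only [hamiltonOp, inner_gradient_eq_sum, laplacian_eq_sum_pd hs, Finset.sum_sub_distrib,
    Finset.sum_add_distrib]

theorem pd_comp_add (f : E d → ℝ) (x v : E d) (i : Fin d) :
    pd i (fun w => f (x + w)) v = pd i f (x + v) := by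
  simp only [pd]
  rw [fderiv_comp_add_left]

theorem pd_comp_add_right (f : E d → ℝ) (x v : E d) (i : Fin d) :
    pd i (fun y => f (y + v)) x = pd i f (x + v) := by
  simp only [pd]
  rw [fderiv_comp_add_right]

/-- The product rule for a factor depending on the position only. -/
theorem hamiltonOp_fst_mul {p : E d → ℝ} (hp : ContDiff ℝ ∞ p) {f : E d × E d → ℝ}
    (hf : ContDiff ℝ ∞ f) (z : E d × E d) :
    hamiltonOp G₁ G (fun z => p z.1 * f z) z =
      p z.1 * hamiltonOp G₁ G f z + ∑ i, G z.2 i * (pd i p z.1 * f z) := by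
  obtain ⟨x, v⟩ := z
  have hs : ContDiff ℝ ∞ fun w => f (x, w) := hf.comp (contDiff_const.prodMk contDiff_id)
  have hs' : ContDiff ℝ ∞ fun y => f (y, v) := hf.comp (contDiff_id.prodMk contDiff_const)
  have hc : ∀ {g : E d → ℝ}, ContDiff ℝ ∞ g → ∀ i,
      pd i (fun w => p x * g w) = fun w => p x * pd i g w := fun {g} hg i => funext fun w => by
    rw [pd_mul (differentiableAt_const _) (hg.differentiable (by simp) w)]
    simp [pd]
  rw [hamiltonOp_slice (f := fun z => p z.1 * f z) _ _ ((hp.comp contDiff_fst).mul hf),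
    hamiltonOp_slice _ _ hf,
    Finset.mul_sum, ← Finset.sum_add_distrib]
  refine Finset.sum_congr rfl fun i _ => ?_
  have a1 : pd i (fun w => p x * f (x, w)) = fun w => p x * pd i (fun w => f (x, w)) w := hc hs i
  have a2 := congrFun (hc (contDiff_pd hs i) i) v
  dsimp only at a2 ⊢
  rw [a1, a2, pd_mul (hp.differentiable (by simp) x) (hs'.differentiable (by simp) x)]
  ring

/-- The generalized Hamiltonian operator applied to a sheared function with a velocity cut-off. -/
theorem hamiltonOp_shear {u h : E d → ℝ} (hu : ContDiff ℝ ∞ u) (hh : ContDiff ℝ ∞ h)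
    (x v : E d) :
    hamiltonOp G₁ G (fun z => u (z.1 + z.2) * h z.2) (x, v) =
      h v * (Δ u (x + v) - ⟪G₁ x, ∇ u (x + v)⟫) + (2 * ⟪∇ h v, ∇ u (x + v)⟫ +
        u (x + v) * (Δ h v - ⟪G v, ∇ h v⟫ - ⟪G₁ x, ∇ h v⟫)) := by
  have hs : ContDiff ℝ ∞ fun w => u (x + w) := hu.comp (contDiff_const.add contDiff_id)
  have hs' : ContDiff ℝ ∞ fun y => u (y + v) := hu.comp (contDiff_id.add contDiff_const)
  have hd : ∀ {g : E d → ℝ}, ContDiff ℝ ∞ g → Differentiable ℝ g := fun hg =>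
    hg.differentiable (by simp)
  have e0 : ∀ i, pd i (fun w => u (x + w)) = fun w => pd i u (x + w) := fun i =>
    funext fun w => pd_comp_add u x w i
  have hsi : ∀ i, ContDiff ℝ ∞ fun w => pd i u (x + w) := fun i =>
    (contDiff_pd hu i).comp (contDiff_const.add contDiff_id)
  have e1 : ∀ i, pd i (fun w => u (x + w) * h w) =
      fun w => u (x + w) * pd i h w + h w * pd i u (x + w) := fun i => funext fun w => by
    rw [pd_mul (hd hs w) (hd hh w), e0]
  have e2 : ∀ i, pd i (fun w => u (x + w) * pd i h w + h w * pd i u (x + w)) v = u (x + v) * pd i (pd i h) v +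
      2 * (pd i h v * pd i u (x + v)) + h v * pd i (pd i u) (x + v) := fun i => by
    have := congrFun (pd_add (hs.mul (contDiff_pd hh i)) (hh.mul (hsi i)) i) v
    refine this.trans ?_
    rw [pd_mul (hd hs v) (hd (contDiff_pd hh i) v), pd_mul (hd hh v) (hd (hsi i) v), e0,
      pd_comp_add]
    ring
  have e3 : ∀ i, pd i (fun y => u (y + v) * h v) x = h v * pd i u (x + v) := fun i => by
    rw [pd_mul (hd hs' x) (differentiableAt_const _), pd_comp_add_right]
    simp [pd]
  rw [hamiltonOp_slice (f := fun z => u (z.1 + z.2) * h z.2) _ _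
    ((hu.comp (contDiff_fst.add contDiff_snd)).mul (hh.comp contDiff_snd))]
  have e5 := fun i => congrFun (e1 i) v
  simp only [e1, e2, e3] at e5 ⊢
  simp only [e5]
  rw [real_inner_comm (∇ u (x + v)) (∇ h v), inner_gradient_eq_sum (∇ u (x + v)),
    laplacian_eq_sum_pd hu, laplacian_eq_sum_pd hh, inner_gradient_eq_sum, inner_gradient_eq_sum,
    inner_gradient_eq_sum]
  have e4 : ∀ i, (∇ u (x + v)) i = pd i u (x + v) := fun i => by
    have := inner_gradient_eq_sum (EuclideanSpace.single i 1) (x + v) u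
    rw [EuclideanSpace.inner_single_left] at this
    simpa using this
  simp only [e4, Finset.mul_sum, ← Finset.sum_sub_distrib, ← Finset.sum_add_distrib]
  -- In each coordinate the velocity drift acting on `u (x + v)` through `∂_v` and through `∂_x`
  -- cancels; `G v` survives only next to the gradient of `h`.
  refine Finset.sum_congr rfl fun i _ => ?_
  ring

end ProductRules

/-! ### Comparison functions belong to the generator domain -/

section GeneratorDomain

variable {α : Type*} [MeasurableSpace α] {μ : Measure α}

theorem tendsto_lpClass_mul {w : α → ℝ} (hw : MemLp w 2 μ) {q : ℕ → α → ℝ}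
    (hq : ∀ n, AEStronglyMeasurable (q n) μ) (hq1 : ∀ n x, q n x ∈ Icc (0 : ℝ) 1)
    (hlim : ∀ᵐ x ∂μ, w x ≠ 0 → Tendsto (fun n => q n x) atTop (𝓝 1)) :
    Tendsto (fun n => lpClass 2 μ fun x => q n x * w x) atTop (𝓝 (lpClass 2 μ w)) := by
  have hm : ∀ n, MemLp (fun x => q n x * w x) 2 μ := fun n =>
    MemLp.of_le hw ((hq n).mul hw.1) (ae_of_all _ fun x => by
      rw [norm_mul, Real.norm_of_nonneg (hq1 n x).1]
      exact mul_le_of_le_one_left (norm_nonneg _) (hq1 n x).2)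
  rw [tendsto_iff_norm_sub_tendsto_zero]
  have h0 : Tendsto (fun n => ∫ x, (q n x * w x - w x) ^ 2 ∂μ) atTop (𝓝 0) := by
    have := tendsto_integral_of_dominated_convergence (μ := μ)
      (F := fun n x => (q n x * w x - w x) ^ 2) (f := fun _ => 0) (fun x => w x ^ 2)
      (fun n => ((hm n).1.sub hw.1).pow 2) hw.integrable_sq (fun n => ae_of_all _ fun x => ?_) ?_
    · simpa using this
    · rw [Real.norm_of_nonneg (sq_nonneg _)]
      have : (q n x * w x - w x) ^ 2 = (1 - q n x) ^ 2 * w x ^ 2 := by ring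
      rw [this]
      refine mul_le_of_le_one_left (sq_nonneg _) ?_
      have := hq1 n x
      exact pow_le_one₀ (by linarith [this.2]) (by linarith [this.1])
    · filter_upwards [hlim] with x hx
      rcases eq_or_ne (w x) 0 with h | h
      · simp [h]
      · have := (((hx h).mul_const (w x)).sub_const (w x)).pow 2
        simpa using this
  have h1 := h0.sqrt
  rw [Real.sqrt_zero] at h1
  refine h1.congr fun n => ?_
  rw [← norm_sq_lpClass (f := fun x => q n x * w x - w x) ((hm n).sub hw),
    Real.sqrt_sq (norm_nonneg _), lpClass_sub (hm n) hw]

variable {d : ℕ} {Φ₁ : E d → EReal} {G₁ : E d → E d} {ν : Measure (E d)} {G : E d → E d}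

/-- Test functions on the whole space lie in the domain of every closed extension of the
generalized Hamiltonian operator on `{Φ₁ < ∞} × ℝ^d`. -/
theorem mem_of_isClosed_of_testFunctions (h₁ : PositionAssumptions Φ₁ G₁)
    (hν : VelocityMeasure ν G) {μ : Measure (E d × E d)} (hμ : μ = (gibbs Φ₁).prod ν)
    {Γ : Set (Lp ℝ 2 μ × Lp ℝ 2 μ)} (hΓ : IsClosed Γ)
    (hmem : ∀ f ∈ testFunctions (finiteSet Φ₁ ×ˢ (univ : Set (E d))),
      (lpClass 2 μ f, lpClass 2 μ (hamiltonOp G₁ G f)) ∈ Γ) {f : E d × E d → ℝ}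
    (hf : f ∈ testFunctions (univ : Set (E d × E d))) :
    (lpClass 2 μ f, lpClass 2 μ (hamiltonOp G₁ G f)) ∈ Γ := by
  have := h₁.finiteOnCompacts
  have := hν.prob
  subst hμ
  set μ := (gibbs Φ₁).prod ν with hμ
  set K : Set (E d) := Prod.fst '' tsupport f with hKdef
  have hK : IsCompact K := hf.2.1.isCompact.image continuous_fst
  obtain ⟨p, hpt, hp1, hplim, hpd⟩ := h₁.exists_cutoff_seq hK
  obtain ⟨C, hC0, hC⟩ := exists_bound_of_mem_testFunctions hf
  have hfK : ∀ z : E d × E d, z.1 ∉ K → z ∉ tsupport f := fun z hz h => hz ⟨z, h, rfl⟩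
  have hLf : MemLp (hamiltonOp G₁ G f) 2 μ :=
    (memLp_hamiltonOp h₁.gradient_memLp hν.memLp hf).1
  have hΩ : ∀ᵐ z ∂μ, z.1 ∈ finiteSet Φ₁ := by
    filter_upwards [mem_ae_iff.2 h₁.prod_compl] with z hz using hz.1
  have hpm : ∀ n, AEStronglyMeasurable (fun z : E d × E d => p n z.1) μ := fun n =>
    ((hpt n).1.continuous.comp continuous_fst).aestronglyMeasurable
  have hpf : ∀ n, (fun z : E d × E d => p n z.1 * f z) ∈
      testFunctions (finiteSet Φ₁ ×ˢ (univ : Set (E d))) := fun n => by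
    have hs : tsupport (fun z : E d × E d => p n z.1 * f z) ⊆ tsupport (p n) ×ˢ univ :=
      closure_minimal (fun z hz => ⟨subset_tsupport _ (left_ne_zero_of_mul hz), mem_univ _⟩)
        ((isClosed_tsupport _).prod isClosed_univ)
    exact ⟨((hpt n).1.comp contDiff_fst).mul hf.1, hf.2.1.mul_left,
      hs.trans (prod_mono (hpt n).2.2 subset_rfl)⟩
  have hG : ∀ i, MemLp (fun v => G v i) 2 ν := memLp_euclidean_apply hν.memLp
  have hRm : ∀ n i, MemLp (fun z : E d × E d => G z.2 i * (pd i (p n) z.1 * f z)) 2 μ :=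
    fun n i => memLp_snd_mul (hG i) (U := univ)
      ⟨((contDiff_pd (hpt n).1 i).comp contDiff_fst).mul hf.1, hf.2.1.mul_left, subset_univ _⟩
  -- The only error of the position cut-off is `∇Φ₂·∇p n` times `f`. Its squared norm is at most the
  -- energy of `p n` over `K` times `C² ∫ G_i² dν`, by the product structure.
  have hR : ∀ i, Tendsto (fun n => lpClass 2 μ fun z : E d × E d =>
      G z.2 i * (pd i (p n) z.1 * f z)) atTop (𝓝 0) := fun i => by
    rw [tendsto_zero_iff_norm_tendsto_zero]
    have hb : ∀ n, ‖lpClass 2 μ fun z : E d × E d => G z.2 i * (pd i (p n) z.1 * f z)‖ ^ 2 ≤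
        (∫⁻ x in K, ‖pd i (p n) x‖ₑ ^ 2 ∂gibbs Φ₁).toReal * (C ^ 2 * ∫ v, G v i ^ 2 ∂ν) :=
      fun n => by
      have ht : MemLp (K.indicator (pd i (p n))) 2 (gibbs Φ₁) :=
        (memLp_of_mem_testFunctions (pd_mem_testFunctions (hpt n) i) 2).indicator hK.measurableSet
      have e1 : (∫⁻ x in K, ‖pd i (p n) x‖ₑ ^ 2 ∂gibbs Φ₁).toReal =
          ∫ x, K.indicator (pd i (p n)) x ^ 2 ∂gibbs Φ₁ := by
        rw [integral_eq_lintegral_of_nonneg_ae (ae_of_all _ fun x => sq_nonneg _)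
          (ht.1.pow 2), ← lintegral_indicator hK.measurableSet]
        congr 1
        refine lintegral_congr fun x => ?_
        by_cases hx : x ∈ K
        · rw [indicator_of_mem hx, indicator_of_mem hx, Real.enorm_eq_ofReal_abs,
            ← ENNReal.ofReal_pow (abs_nonneg _), sq_abs]
        · rw [indicator_of_notMem hx, indicator_of_notMem hx]
          simp
      rw [norm_sq_lpClass (hRm n i), e1]
      have hi := ht.integrable_sq.mul_prod (hG i).integrable_sq
      calc ∫ z, (G z.2 i * (pd i (p n) z.1 * f z)) ^ 2 ∂μ
          ≤ ∫ z : E d × E d, C ^ 2 * (K.indicator (pd i (p n)) z.1 ^ 2 * G z.2 i ^ 2) ∂μ := by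
            refine integral_mono_of_nonneg (ae_of_all _ fun z => sq_nonneg _) (hi.const_mul _)
              (ae_of_all _ fun z => ?_)
            by_cases hz : z.1 ∈ K
            · have h2 : f z ^ 2 ≤ C ^ 2 := by
                rw [← sq_abs]
                exact pow_le_pow_left₀ (abs_nonneg _) (hC z) 2
              simp only [indicator_of_mem hz]
              nlinarith [mul_nonneg (sq_nonneg (G z.2 i)) (sq_nonneg (pd i (p n) z.1))]
            · simp [image_eq_zero_of_notMem_tsupport (hfK z hz), indicator_of_notMem hz]
        _ = _ := by
            rw [integral_const_mul, integral_prod_mul (f := fun x => K.indicator (pd i (p n)) x ^ 2)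
              (g := fun v => G v i ^ 2)]
            ring
    have hl := ((ENNReal.tendsto_toReal ENNReal.zero_ne_top).comp (hpd i)).mul_const
      (C ^ 2 * ∫ v, G v i ^ 2 ∂ν)
    rw [ENNReal.toReal_zero, zero_mul] at hl
    have h2 := (squeeze_zero (fun n => sq_nonneg _) hb hl).sqrt
    simpa [Real.sqrt_sq (norm_nonneg _)] using h2
  have hlim1 := tendsto_lpClass_mul (memLp_of_mem_testFunctions hf 2) hpm (fun n z => hp1 n z.1)
    (by
      filter_upwards [hΩ] with z hz hfz
      refine hplim z.1 ⟨?_, hz⟩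
      by_contra h
      exact hfz (image_eq_zero_of_notMem_tsupport (hfK z h)))
  have hlim2 := tendsto_lpClass_mul hLf hpm (fun n z => hp1 n z.1) (by
      filter_upwards [hΩ] with z hz hfz
      refine hplim z.1 ⟨?_, hz⟩
      by_contra h
      exact hfz (hamiltonOp_eq_zero hf.1 (hfK z h)))
  have hlim3 : Tendsto (fun n => lpClass 2 μ (hamiltonOp G₁ G fun z => p n z.1 * f z)) atTop
      (𝓝 (lpClass 2 μ (hamiltonOp G₁ G f))) := by
    have h3 := hlim2.add (tendsto_finsetSum Finset.univ fun i _ => hR i)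
    rw [Finset.sum_const_zero, add_zero] at h3
    refine h3.congr fun n => ?_
    have hpL : MemLp (fun z : E d × E d => p n z.1 * hamiltonOp G₁ G f z) 2 μ :=
      MemLp.of_le hLf ((hpm n).mul hLf.1) (ae_of_all _ fun z => by
        rw [norm_mul, Real.norm_of_nonneg (hp1 n z.1).1]
        exact mul_le_of_le_one_left (norm_nonneg _) (hp1 n z.1).2)
    rw [funext (hamiltonOp_fst_mul G₁ G (hpt n).1 hf.1),
      lpClass_add hpL (memLp_finsetSum _ fun i _ => hRm n i),
      lpClass_finsetSum _ fun i _ => hRm n i]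
  exact hΓ.mem_of_tendsto (hlim1.prodMk_nhds hlim3) (Eventually.of_forall fun n => hmem _ (hpf n))

end GeneratorDomain

/-! ### Shifted functions in `L²(μ_{Φ₁})` -/

section Shear

variable {d : ℕ} {Φ₁ : E d → EReal} {G₁ : E d → E d}

theorem PositionAssumptions.exists_measure_closedBall_le (h₁ : PositionAssumptions Φ₁ G₁) (R : ℝ) :
    ∃ C : ℝ, 0 ≤ C ∧ ∀ y, (gibbs Φ₁).real (Metric.closedBall y R) ≤ C := by
  obtain ⟨c, hc⟩ := h₁.bddBelow
  have hle : gibbs Φ₁ ≤ volume.withDensity fun _ => (-(c : EReal)).exp :=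
    withDensity_mono (ae_of_all _ fun x => EReal.exp_monotone (EReal.neg_le_neg_iff.2 (hc x)))
  have hfin : (volume.withDensity fun _ : E d => (-(c : EReal)).exp)
      (Metric.closedBall (0 : E d) R) ≠ ⊤ := by
    rw [withDensity_const, Measure.smul_apply, smul_eq_mul, ← EReal.coe_neg, EReal.exp_coe]
    exact ENNReal.mul_ne_top ENNReal.ofReal_ne_top
      (isCompact_closedBall (0 : E d) R).measure_lt_top.ne
  refine ⟨_, ENNReal.toReal_nonneg, fun y => ENNReal.toReal_mono hfin ((hle _).trans (le_of_eq ?_))⟩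
  rw [withDensity_const, Measure.smul_apply, Measure.smul_apply,
    Measure.addHaar_closedBall_center]

theorem PositionAssumptions.integrable_norm_sq (h₁ : PositionAssumptions Φ₁ G₁) :
    Integrable (fun x => ‖G₁ x‖ ^ 2) (gibbs Φ₁) := h₁.gradient_memLp.norm.integrable_sq

/-- `L²`-norms of sheared functions depend continuously on the shift, and are bounded. -/
theorem continuous_integral_shift (h₁ : PositionAssumptions Φ₁ G₁) {A : E d → ℝ} {b : E d → E d}
    (hA : Continuous A) (hAc : HasCompactSupport A) (hb : Continuous b) {C : ℝ}
    (hbC : ∀ x, ‖b x‖ ≤ C) :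
    (Continuous fun y => ∫ x, (A (x + y) + ⟪G₁ x, b (x + y)⟫) ^ 2 ∂gibbs Φ₁) ∧
      ∃ B, ∀ y, ∫ x, (A (x + y) + ⟪G₁ x, b (x + y)⟫) ^ 2 ∂gibbs Φ₁ ≤ B := by
  have := h₁.finiteOnCompacts
  obtain ⟨D, hD⟩ := hA.bounded_above_of_compact_support hAc
  obtain ⟨R, hR⟩ := hAc.isCompact.isBounded.subset_closedBall 0
  -- The set `S` must contain all `x` whose shift meets the support of `A`: a fixed large ball for
  -- continuity in `y`, a ball moving with `y` for the uniform bound.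
  have hbound : ∀ (S : Set (E d)) (x y : E d), (x + y ∈ Metric.closedBall 0 R → x ∈ S) →
      (A (x + y) + ⟪G₁ x, b (x + y)⟫) ^ 2 ≤
        2 * D ^ 2 * S.indicator (fun _ => (1 : ℝ)) x + 2 * C ^ 2 * ‖G₁ x‖ ^ 2 := by
    intro S x y hS
    have h1 : A (x + y) ^ 2 ≤ D ^ 2 * S.indicator (fun _ => (1 : ℝ)) x := by
      by_cases hx : x ∈ S
      · rw [indicator_of_mem hx, mul_one, ← sq_abs]
        exact pow_le_pow_left₀ (abs_nonneg _) (hD _) 2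
      · rw [image_eq_zero_of_notMem_tsupport fun h => hx (hS (hR h)), indicator_of_notMem hx]
        simp
    have h2 : ⟪G₁ x, b (x + y)⟫ ^ 2 ≤ C ^ 2 * ‖G₁ x‖ ^ 2 := by
      rw [← sq_abs, ← mul_pow]
      refine pow_le_pow_left₀ (abs_nonneg _) ((abs_real_inner_le_norm _ _).trans ?_) 2
      rw [mul_comm]
      exact mul_le_mul_of_nonneg_right (hbC _) (norm_nonneg _)
    nlinarith [sq_nonneg (A (x + y) - ⟪G₁ x, b (x + y)⟫)]
  have hint : ∀ y r, Integrable (fun x => 2 * D ^ 2 *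
      (Metric.closedBall y r).indicator (fun _ => (1 : ℝ)) x + 2 * C ^ 2 * ‖G₁ x‖ ^ 2)
      (gibbs Φ₁) := fun y r => by
    have := (integrable_indicator_iff (f := fun _ : E d => (1 : ℝ)) (μ := gibbs Φ₁)
      Metric.isClosed_closedBall.measurableSet).2
      (integrableOn_const (isCompact_closedBall y r).measure_lt_top.ne)
    exact (this.const_mul _).add (h₁.integrable_norm_sq.const_mul _)
  constructor
  · refine continuous_iff_continuousAt.2 fun y₀ => continuousAt_of_dominated
      (Eventually.of_forall fun y => ?_) ?_ (hint 0 (R + (1 + ‖y₀‖))) (ae_of_all _ fun x => ?_)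
    · refine ((hA.comp (continuous_id.add continuous_const)).aestronglyMeasurable.add ?_).pow 2
      exact h₁.gradient_memLp.1.inner
        (hb.comp (continuous_id.add continuous_const)).aestronglyMeasurable
    · filter_upwards [Metric.ball_mem_nhds y₀ one_pos] with y hy
      refine ae_of_all _ fun x => ?_
      rw [Real.norm_of_nonneg (sq_nonneg _)]
      refine hbound _ _ _ fun hx => ?_
      rw [mem_closedBall_zero_iff] at hx ⊢
      rw [Metric.mem_ball, dist_eq_norm] at hy
      have e : x = (x + y) - ((y - y₀) + y₀) := by abel
      rw [e]
      exact (norm_sub_le _ _).trans (add_le_add hx ((norm_add_le _ _).trans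
        (add_le_add hy.le le_rfl)))
    · have h1 : Continuous fun y => x + y := continuous_const.add continuous_id
      exact (((hA.comp h1).add (continuous_const.inner (hb.comp h1))).pow 2).continuousAt
  · obtain ⟨V, -, hV⟩ := h₁.exists_measure_closedBall_le R
    refine ⟨2 * D ^ 2 * V + 2 * C ^ 2 * ∫ x, ‖G₁ x‖ ^ 2 ∂gibbs Φ₁, fun y => ?_⟩
    refine (integral_mono_of_nonneg (ae_of_all _ fun x => sq_nonneg _) (hint (-y) R)
      (ae_of_all _ fun x => hbound _ x y fun hx => ?_)).trans ?_
    · rw [mem_closedBall_zero_iff] at hx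
      rwa [Metric.mem_closedBall, dist_eq_norm, sub_neg_eq_add]
    · have h3 := (integrable_indicator_iff (f := fun _ : E d => (1 : ℝ)) (μ := gibbs Φ₁)
        Metric.isClosed_closedBall.measurableSet).2
        (integrableOn_const (isCompact_closedBall (-y) R).measure_lt_top.ne)
      rw [integral_add (h3.const_mul _) (h₁.integrable_norm_sq.const_mul _), integral_const_mul,
        integral_const_mul, integral_indicator_const _ Metric.isClosed_closedBall.measurableSet,
        smul_eq_mul, mul_one]
      have := hV (-y)
      gcongr

end Shear

/-! ### Uniform bounds for the velocity cut-offs -/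

section CutoffFamily

variable {d : ℕ} {η : ℝ → testFunctions (univ : Set (E d))}

theorem norm_gradient_eq (f : E d → ℝ) (x : E d) : ‖∇ f x‖ = ‖fderiv ℝ f x‖ := by
  rw [gradient, LinearIsometryEquiv.norm_map]

/-- The value at the origin is `1`, and a gradient of order `ε²` over a distance at most `2 ε⁻²`
changes it by at most `2 C`. -/
theorem IsCutoffFamily.exists_bound (hη : IsCutoffFamily η) :
    ∃ B : ℝ, 0 ≤ B ∧ ∀ ε > 0, ∀ v, |(η ε).1 v| ≤ B := by
  obtain ⟨C, hC⟩ := hη.bounds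
  have hC0 : 0 ≤ C := by simpa using (norm_nonneg _).trans (hC 1 one_pos 0).1
  refine ⟨1 + 2 * C, by positivity, fun ε hε v => ?_⟩
  by_cases hv : v ∈ tsupport (η ε).1
  · have h1 := Convex.norm_image_sub_le_of_norm_fderiv_le (𝕜 := ℝ) (f := (η ε).1) (s := univ)
      (x := 0) (y := v) (C := C * ε ^ 2) (fun x _ => (η ε).2.1.differentiable (by simp) x)
      (fun x _ => (norm_gradient_eq _ x) ▸ (hC ε hε x).1) convex_univ (mem_univ _) (mem_univ _)
    have h2 : (η ε).1 0 = 1 := hη.eq_one ε hε 0 (Metric.mem_ball_self (by positivity))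
    have h3 : ‖v‖ ≤ 2 * (ε ^ 2)⁻¹ := by simpa using hη.support ε hε hv
    rw [h2, sub_zero, Real.norm_eq_abs] at h1
    have h4 : C * ε ^ 2 * ‖v‖ ≤ 2 * C := by
      refine (mul_le_mul_of_nonneg_left h3 (by positivity)).trans (le_of_eq ?_)
      field_simp
    have h5 := abs_sub_abs_le_abs_sub ((η ε).1 v) 1
    rw [abs_one] at h5
    linarith
  · rw [image_eq_zero_of_notMem_tsupport hv, abs_zero]
    positivity

theorem IsCutoffFamily.eventually_eq_one (hη : IsCutoffFamily η) (v : E d) :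
    ∀ᶠ ε in 𝓝[>] (0 : ℝ), (η ε).1 (ε • v) = 1 := by
  have h1 : Tendsto (fun ε : ℝ => ε ^ 2 * ‖ε • v‖) (𝓝[>] 0) (𝓝 0) := by
    have : Continuous fun ε : ℝ => ε ^ 2 * ‖ε • v‖ := by fun_prop
    simpa using (this.tendsto 0).mono_left nhdsWithin_le_nhds
  filter_upwards [h1.eventually_lt_const one_pos, self_mem_nhdsWithin] with ε h2 (h3 : 0 < ε)
  refine hη.eq_one ε h3 _ ?_
  rw [mem_ball_zero_iff, ← one_div, lt_div_iff₀ (by positivity), mul_comm]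
  exact h2

end CutoffFamily

/-! ### The limit of the norms as `ε → 0` -/

section ScalingLimit

variable {d : ℕ} {Φ₁ : E d → EReal} {G₁ : E d → E d} {Φ₂ : E d → ℝ} {G₂ : E d → E d}
  {H₂ : Fin d → E d → ℝ} {η : ℝ → testFunctions (univ : Set (E d))}

/-- Moves `ε` from the measure into the integrand, over the fixed probability measure `μ_{Φ₂}`,
where dominated convergence applies. -/
theorem norm_sq_lpClass_scaled (h₁ : PositionAssumptions Φ₁ G₁) (h₂ : VelocityAssumptions Φ₂ G₂ H₂)
    {ε : ℝ} (hε : 0 < ε) {μ : Measure (E d × E d)}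
    (hμ : μ = (gibbs Φ₁).prod (gibbs fun v => (scaledPotential Φ₂ ε v : EReal)))
    {F : E d × E d → ℝ} (hF : MemLp F 2 μ) :
    ‖lpClass 2 μ F‖ ^ 2 =
      ∫ v, ∫ x, F (x, ε • v) ^ 2 ∂gibbs Φ₁ ∂gibbs fun v => (Φ₂ v : EReal) := by
  have := h₁.finiteOnCompacts
  have := (h₂.velocityMeasure hε).prob
  subst hμ
  rw [norm_sq_lpClass hF, integral_prod_symm _ hF.integrable_sq, h₂.integral_scaled hε]

theorem memLp_cutoff_mul_shear (h₁ : PositionAssumptions Φ₁ G₁)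
    (h₂ : VelocityAssumptions Φ₂ G₂ H₂) {ε : ℝ} (hε : 0 < ε) {μ : Measure (E d × E d)}
    (hμ : μ = (gibbs Φ₁).prod (gibbs fun v => (scaledPotential Φ₂ ε v : EReal)))
    (hη : IsCutoffFamily η) {A : E d → ℝ} (hA : A ∈ testFunctions (univ : Set (E d)))
    {b : E d → E d} (hb : Continuous b) {C : ℝ} (hbC : ∀ x, ‖b x‖ ≤ C) :
    MemLp (fun z : E d × E d =>
      (η ε).1 z.2 * (A (z.1 + z.2) + ⟪G₁ z.1, b (z.1 + z.2)⟫)) 2 μ := by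
  have := h₁.finiteOnCompacts
  have := (h₂.velocityMeasure hε).prob
  subst hμ
  obtain ⟨B, hB0, hB⟩ := hη.exists_bound
  have m1 := memLp_of_mem_testFunctions (μ := (gibbs Φ₁).prod
    (gibbs fun v => (scaledPotential Φ₂ ε v : EReal))) (shearCutoff univ (η ε) ⟨A, hA⟩).2 2
  have hG := h₁.gradient_memLp.comp_fst (gibbs fun v => (scaledPotential Φ₂ ε v : EReal))
  have hc : Continuous fun z : E d × E d => (η ε).1 z.2 := (η ε).2.1.continuous.comp continuous_snd
  have m2 : MemLp (fun z : E d × E d => (η ε).1 z.2 * ⟪G₁ z.1, b (z.1 + z.2)⟫) 2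
      ((gibbs Φ₁).prod (gibbs fun v => (scaledPotential Φ₂ ε v : EReal))) := by
    refine MemLp.of_le_mul (c := B * C) hG (hc.aestronglyMeasurable.mul (hG.1.inner
      (hb.comp (continuous_fst.add continuous_snd)).aestronglyMeasurable)) (ae_of_all _ fun z => ?_)
    rw [norm_mul, mul_assoc]
    refine mul_le_mul (hB ε hε _) ((norm_inner_le_norm _ _).trans ?_) (norm_nonneg _) hB0
    rw [mul_comm]
    exact mul_le_mul_of_nonneg_right (hbC _) (norm_nonneg _)
  refine (memLp_congr_ae (ae_of_all _ fun z => ?_)).1 (m1.add m2)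
  change A (z.1 + z.2) * (η ε).1 z.2 + _ = _
  ring

/-- The norms of the sheared functions with cut-off converge. -/
theorem tendsto_norm_cutoff_mul_shear (h₁ : PositionAssumptions Φ₁ G₁)
    (h₂ : VelocityAssumptions Φ₂ G₂ H₂) (hη : IsCutoffFamily η) {μ : ℝ → Measure (E d × E d)}
    (hμ : ∀ ε, μ ε = (gibbs Φ₁).prod (gibbs fun v => (scaledPotential Φ₂ ε v : EReal)))
    {A : E d → ℝ} (hA : A ∈ testFunctions (univ : Set (E d)))
    {b : E d → E d} (hb : Continuous b) {C : ℝ} (hbC : ∀ x, ‖b x‖ ≤ C) :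
    Tendsto (fun ε => ‖lpClass 2 (μ ε) fun z : E d × E d =>
      (η ε).1 z.2 * (A (z.1 + z.2) + ⟪G₁ z.1, b (z.1 + z.2)⟫)‖) (𝓝[>] 0)
      (𝓝 ‖lpClass 2 (gibbs Φ₁) fun x => A x + ⟪G₁ x, b x⟫‖) := by
  have := h₁.finiteOnCompacts
  have := h₂.isProbabilityMeasure
  set ν := gibbs fun v => (Φ₂ v : EReal) with hν
  obtain ⟨B, hB0, hB⟩ := hη.exists_bound
  obtain ⟨hJ, D, hD⟩ := continuous_integral_shift h₁ hA.1.continuous hA.2.1 hb hbC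
  set J : E d → ℝ := fun y => ∫ x, (A (x + y) + ⟪G₁ x, b (x + y)⟫) ^ 2 ∂gibbs Φ₁ with hJdef
  have hJ0 : ∀ y, 0 ≤ J y := fun y => integral_nonneg fun x => sq_nonneg _
  -- The shift `ε v` tends to zero and the cut-off is eventually one for each `v`; the bounds on `J`
  -- and on the cut-off are uniform, so a constant dominates.
  have hlim : Tendsto (fun ε : ℝ => ∫ v, (η ε).1 (ε • v) ^ 2 * J (ε • v) ∂ν) (𝓝[>] 0)
      (𝓝 (J 0)) := by
    have h3 := tendsto_integral_filter_of_dominated_convergence (μ := ν) (l := 𝓝[>] (0 : ℝ))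
      (F := fun ε v => (η ε).1 (ε • v) ^ 2 * J (ε • v)) (f := fun _ => J 0)
      (fun _ => B ^ 2 * D) (Eventually.of_forall fun ε => ?_) ?_ (integrable_const _)
      (ae_of_all _ fun v => ?_)
    · simpa using h3
    · have hc : Continuous fun v : E d => ε • v := continuous_const_smul ε
      exact ((((η ε).2.1.continuous.comp hc).pow 2).mul (hJ.comp hc)).aestronglyMeasurable
    · filter_upwards [self_mem_nhdsWithin] with ε (hε : 0 < ε)
      refine ae_of_all _ fun v => ?_
      rw [norm_mul, Real.norm_of_nonneg (hJ0 _), norm_pow]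
      exact mul_le_mul (pow_le_pow_left₀ (norm_nonneg _) (hB ε hε _) 2) (hD _) (hJ0 _)
        (by positivity)
    · have h4 : Tendsto (fun ε : ℝ => J (ε • v)) (𝓝[>] 0) (𝓝 (J 0)) := by
        have : Continuous fun ε : ℝ => J (ε • v) := hJ.comp (continuous_id.smul continuous_const)
        have h5 := this.tendsto 0
        rw [zero_smul] at h5
        exact h5.mono_left nhdsWithin_le_nhds
      refine h4.congr' ?_
      filter_upwards [hη.eventually_eq_one v] with ε hε
      rw [hε, one_pow, one_mul]
  have hm0 : MemLp (fun x => A x + ⟪G₁ x, b x⟫) 2 (gibbs Φ₁) := by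
    refine MemLp.add (memLp_of_mem_testFunctions hA 2) (MemLp.of_le_mul (c := C) h₁.gradient_memLp
      (h₁.gradient_memLp.1.inner hb.aestronglyMeasurable) (ae_of_all _ fun x => ?_))
    refine (norm_inner_le_norm _ _).trans ?_
    rw [mul_comm]
    exact mul_le_mul_of_nonneg_right (hbC _) (norm_nonneg _)
  have h0 : ‖lpClass 2 (gibbs Φ₁) fun x => A x + ⟪G₁ x, b x⟫‖ = √(J 0) := by
    rw [← Real.sqrt_sq (norm_nonneg _), norm_sq_lpClass hm0]
    simp only [hJdef, add_zero]
  rw [h0]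
  refine hlim.sqrt.congr' ?_
  filter_upwards [self_mem_nhdsWithin] with ε (hε : 0 < ε)
  rw [← Real.sqrt_sq (norm_nonneg (lpClass 2 (μ ε) _)), norm_sq_lpClass_scaled h₁ h₂ hε (hμ ε)
    (memLp_cutoff_mul_shear h₁ h₂ hε (hμ ε) hη hA hb hbC)]
  congr 1
  refine integral_congr_ae (ae_of_all _ fun v => ?_)
  simp only [mul_pow, hJdef]
  rw [integral_const_mul]

/-- The terms produced by the derivatives of the cut-off. -/
def cutoffRemainder (G₁ G : E d → E d) (u h : E d → ℝ) (z : E d × E d) : ℝ :=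
  2 * ⟪∇ h z.2, ∇ u (z.1 + z.2)⟫ +
    u (z.1 + z.2) * (Δ h z.2 - ⟪G z.2, ∇ h z.2⟫ - ⟪G₁ z.1, ∇ h z.2⟫)

/-- The factor `ε²` in the gradient of the cut-off beats the factor `ε⁻¹` in the scaled drift, so
every term is `O(ε)` in norm. -/
theorem tendsto_norm_cutoffRemainder (h₁ : PositionAssumptions Φ₁ G₁)
    (h₂ : VelocityAssumptions Φ₂ G₂ H₂) (hη : IsCutoffFamily η) {μ : ℝ → Measure (E d × E d)}
    (hμ : ∀ ε, μ ε = (gibbs Φ₁).prod (gibbs fun v => (scaledPotential Φ₂ ε v : EReal)))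
    {u : E d → ℝ} (hu : u ∈ testFunctions (univ : Set (E d)))
    (hm : ∀ ε > 0, MemLp (cutoffRemainder G₁ (scaledGradient G₂ ε) u (η ε).1) 2 (μ ε)) :
    Tendsto (fun ε => ‖lpClass 2 (μ ε) (cutoffRemainder G₁ (scaledGradient G₂ ε) u (η ε).1)‖)
      (𝓝[>] 0) (𝓝 0) := by
  have := h₁.finiteOnCompacts
  have := h₂.isProbabilityMeasure
  set ν := gibbs fun v => (Φ₂ v : EReal) with hν
  obtain ⟨C, hC⟩ := hη.bounds
  have hC0 : 0 ≤ C := by simpa using (norm_nonneg _).trans (hC 1 one_pos 0).1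
  obtain ⟨R, hR⟩ := hu.2.1.isCompact.isBounded.subset_closedBall 0
  obtain ⟨D₁, hD₁0, hD₁⟩ := exists_bound_of_mem_testFunctions hu
  obtain ⟨D₂, hD₂⟩ := (hu.1.continuous_fderiv (by simp)).bounded_above_of_compact_support
    (hu.2.1.fderiv (𝕜 := ℝ))
  obtain ⟨V, hV0, hV⟩ := h₁.exists_measure_closedBall_le R
  set D := max D₁ D₂ with hD
  have hD0 : 0 ≤ D := hD₁0.trans (le_max_left _ _)
  -- Constants: `(a + b)² ≤ 2a² + 2b²` applied twice to `(3 + ‖G₂ v‖) + ‖G₁ x‖`; the indicator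
  -- records that `u (x + ε v)` has compact support in `x`.
  have hbound : ∀ ε, 0 < ε → ε ≤ 1 → ∀ x v,
      cutoffRemainder G₁ (scaledGradient G₂ ε) u (η ε).1 (x, ε • v) ^ 2 ≤
        (ε * (D * C)) ^ 2 * (((Metric.closedBall (-(ε • v)) R).indicator (fun _ => (1 : ℝ)) x) *
          (36 + 4 * ‖G₂ v‖ ^ 2) + 2 * ‖G₁ x‖ ^ 2) := by
    intro ε hε hε1 x v
    by_cases hx : x + ε • v ∈ tsupport u
    · have hxS : x ∈ Metric.closedBall (-(ε • v)) R := by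
        have := hR hx
        rw [mem_closedBall_zero_iff] at this
        rwa [Metric.mem_closedBall, dist_eq_norm, sub_neg_eq_add]
      rw [indicator_of_mem hxS, one_mul]
      have hg : scaledGradient G₂ ε (ε • v) = ε⁻¹ • G₂ v := by
        simp [scaledGradient, smul_smul, hε.ne']
      have b1 : ‖∇ (η ε).1 (ε • v)‖ ≤ ε * C := by
        refine (hC ε hε _).1.trans ?_
        nlinarith [mul_nonneg hC0 hε.le]
      have b2 : |Δ (η ε).1 (ε • v)| ≤ ε * C := by
        refine (hC ε hε _).2.trans ?_
        have : ε ^ 4 ≤ ε := pow_le_of_le_one hε.le hε1 (by norm_num)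
        rw [mul_comm]
        exact mul_le_mul_of_nonneg_right this hC0
      have b3 : |⟪ε⁻¹ • G₂ v, ∇ (η ε).1 (ε • v)⟫| ≤ ε * C * ‖G₂ v‖ := by
        rw [inner_smul_left, abs_mul]
        refine (mul_le_mul_of_nonneg_left ((abs_real_inner_le_norm _ _).trans
          (mul_le_mul_of_nonneg_left (hC ε hε _).1 (norm_nonneg _))) (abs_nonneg _)).trans ?_
        simp only [conj_trivial]
        rw [abs_of_pos (inv_pos.2 hε)]
        refine le_of_eq ?_
        field_simp
      have b4 : |⟪G₁ x, ∇ (η ε).1 (ε • v)⟫| ≤ ε * C * ‖G₁ x‖ :=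
        (abs_real_inner_le_norm _ _).trans (by
          rw [mul_comm]
          exact mul_le_mul_of_nonneg_right b1 (norm_nonneg _))
      have b5 : |⟪∇ (η ε).1 (ε • v), ∇ u (x + ε • v)⟫| ≤ ε * C * D :=
        (abs_real_inner_le_norm _ _).trans (mul_le_mul b1 (by
          rw [norm_gradient_eq]
          exact (hD₂ _).trans (le_max_right _ _)) (norm_nonneg _) (by positivity))
      have b6 : |u (x + ε • v)| ≤ D := (hD₁ _).trans (le_max_left _ _)
      have b7 : |cutoffRemainder G₁ (scaledGradient G₂ ε) u (η ε).1 (x, ε • v)| ≤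
          ε * (D * C) * ((3 + ‖G₂ v‖) + ‖G₁ x‖) := by
        unfold cutoffRemainder
        simp only [hg]
        calc _ ≤ 2 * |⟪∇ (η ε).1 (ε • v), ∇ u (x + ε • v)⟫| + |u (x + ε • v)| *
              (|Δ (η ε).1 (ε • v)| + |⟪ε⁻¹ • G₂ v, ∇ (η ε).1 (ε • v)⟫| +
                |⟪G₁ x, ∇ (η ε).1 (ε • v)⟫|) := by
              refine (abs_add_le _ _).trans ?_
              rw [abs_mul, abs_mul, abs_two]
              have := abs_sub (Δ (η ε).1 (ε • v) - ⟪ε⁻¹ • G₂ v, ∇ (η ε).1 (ε • v)⟫)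
                ⟪G₁ x, ∇ (η ε).1 (ε • v)⟫
              have := abs_sub (Δ (η ε).1 (ε • v)) ⟪ε⁻¹ • G₂ v, ∇ (η ε).1 (ε • v)⟫
              gcongr
              linarith
          _ ≤ 2 * (ε * C * D) + D * (ε * C + ε * C * ‖G₂ v‖ + ε * C * ‖G₁ x‖) := by gcongr
          _ = _ := by ring
      calc _ = |cutoffRemainder G₁ (scaledGradient G₂ ε) u (η ε).1 (x, ε • v)| ^ 2 :=
            (sq_abs _).symm
        _ ≤ (ε * (D * C) * ((3 + ‖G₂ v‖) + ‖G₁ x‖)) ^ 2 :=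
            pow_le_pow_left₀ (abs_nonneg _) b7 2
        _ = (ε * (D * C)) ^ 2 * ((3 + ‖G₂ v‖) + ‖G₁ x‖) ^ 2 := mul_pow _ _ _
        _ ≤ _ := by
            refine mul_le_mul_of_nonneg_left ?_ (sq_nonneg _)
            nlinarith [sq_nonneg (3 + ‖G₂ v‖ - ‖G₁ x‖), sq_nonneg (3 - ‖G₂ v‖)]
    · have h0 : ∇ u (x + ε • v) = 0 := by
        rw [gradient, image_eq_zero_of_notMem_tsupport fun h => hx (tsupport_fderiv_subset ℝ h),
          _root_.map_zero]
      have : cutoffRemainder G₁ (scaledGradient G₂ ε) u (η ε).1 (x, ε • v) = 0 := by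
        simp [cutoffRemainder, h0, image_eq_zero_of_notMem_tsupport hx]
      rw [this, zero_pow two_ne_zero]
      have : 0 ≤ (Metric.closedBall (-(ε • v)) R).indicator (fun _ => (1 : ℝ)) x :=
        indicator_nonneg (fun _ _ => zero_le_one) x
      positivity
  have hG₂ : Integrable (fun v => ‖G₂ v‖ ^ 2) ν := h₂.gradient_memLp.norm.integrable_sq
  set N := ∫ x, ‖G₁ x‖ ^ 2 ∂gibbs Φ₁ with hN
  have hinner : ∀ ε, 0 < ε → ε ≤ 1 → ∀ v,
      ∫ x, cutoffRemainder G₁ (scaledGradient G₂ ε) u (η ε).1 (x, ε • v) ^ 2 ∂gibbs Φ₁ ≤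
        (ε * (D * C)) ^ 2 * (V * (36 + 4 * ‖G₂ v‖ ^ 2) + 2 * N) := by
    intro ε hε hε1 v
    have h3 := (integrable_indicator_iff (f := fun _ : E d => (1 : ℝ)) (μ := gibbs Φ₁)
      Metric.isClosed_closedBall.measurableSet).2
      (integrableOn_const (isCompact_closedBall (-(ε • v)) R).measure_lt_top.ne)
    refine (integral_mono_of_nonneg (ae_of_all _ fun x => sq_nonneg _)
      (((h3.mul_const _).add (h₁.integrable_norm_sq.const_mul _)).const_mul _)
      (ae_of_all _ fun x => hbound ε hε hε1 x v)).trans ?_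
    simp only [Pi.add_apply]
    rw [integral_const_mul, integral_add (h3.mul_const _) (h₁.integrable_norm_sq.const_mul _),
      integral_const_mul, integral_mul_const,
      integral_indicator_const _ Metric.isClosed_closedBall.measurableSet, smul_eq_mul, mul_one]
    have := hV (-(ε • v))
    gcongr
  set M := ∫ v, (V * (36 + 4 * ‖G₂ v‖ ^ 2) + 2 * N) ∂ν with hM
  have hMi : Integrable (fun v => V * (36 + 4 * ‖G₂ v‖ ^ 2) + 2 * N) ν :=
    (((integrable_const _).add (hG₂.const_mul _)).const_mul _).add (integrable_const _)
  have hsq : ∀ᶠ ε in 𝓝[>] (0 : ℝ),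
      ‖lpClass 2 (μ ε) (cutoffRemainder G₁ (scaledGradient G₂ ε) u (η ε).1)‖ ≤
        √((ε * (D * C)) ^ 2 * M) := by
    filter_upwards [Ioc_mem_nhdsGT one_pos] with ε hε
    refine Real.le_sqrt_of_sq_le ?_
    rw [norm_sq_lpClass_scaled h₁ h₂ hε.1 (hμ ε) (hm ε hε.1), hM, ← integral_const_mul]
    exact integral_mono_of_nonneg (ae_of_all _ fun v => integral_nonneg fun x => sq_nonneg _)
      (hMi.const_mul _) (ae_of_all _ fun v => hinner ε hε.1 hε.2 v)
  refine squeeze_zero' (Eventually.of_forall fun _ => norm_nonneg _) hsq ?_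
  have : Continuous fun ε : ℝ => √((ε * (D * C)) ^ 2 * M) := by fun_prop
  simpa using (this.tendsto 0).mono_left nhdsWithin_le_nhds

end ScalingLimit

/-! ### Assembly: convergence of spaces, generators and semigroups -/

section Main

variable {d : ℕ} {Φ₁ : E d → EReal} {G₁ : E d → E d} {Φ₂ : E d → ℝ} {G₂ : E d → E d}
  {H₂ : Fin d → E d → ℝ} {η : ℝ → testFunctions (univ : Set (E d))}

theorem testFunctions_mono {X : Type*} [NormedAddCommGroup X] [NormedSpace ℝ X] {U V : Set X}
    (h : U ⊆ V) : testFunctions U ≤ testFunctions V := fun _ hf => ⟨hf.1, hf.2.1, hf.2.2.trans h⟩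

theorem laplacian_mem_testFunctions {U : Set (E d)} {f : E d → ℝ} (hf : f ∈ testFunctions U) :
    Δ f ∈ testFunctions U := by
  have : Δ f = ∑ i, pd i (pd i f) := by
    funext x
    rw [laplacian_eq_sum_pd hf.1, Finset.sum_apply]
  rw [this]
  exact Submodule.sum_mem _ fun i _ => pd_mem_testFunctions (pd_mem_testFunctions hf i) i

theorem phaseMeasure_scaled_eq (h₁ : PositionAssumptions Φ₁ G₁)
    (h₂ : VelocityAssumptions Φ₂ G₂ H₂) (ε : ℝ) : phaseMeasure Φ₁ (scaledPotential Φ₂ ε) =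
      (gibbs Φ₁).prod (gibbs fun v => (scaledPotential Φ₂ ε v : EReal)) :=
  phaseMeasure_eq h₁ ((h₂.measurable.comp (measurable_const_smul ε⁻¹)).add_const _)

theorem comparisonMap_apply (h₁ : PositionAssumptions Φ₁ G₁) (h₂ : VelocityAssumptions Φ₂ G₂ H₂)
    (ε : ℝ) (u : testFunctions (finiteSet Φ₁)) : comparisonMap h₁ h₂ η ε u =
      lpClass 2 (phaseMeasure Φ₁ (scaledPotential Φ₂ ε))
        (fun z => u.1 (z.1 + z.2) * (η ε).1 z.2) := by
  have := phase_finiteOnCompacts h₁ h₂ ε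
  exact (lpClass_eq (memLp_of_mem_testFunctions (shearCutoff (finiteSet Φ₁) (η ε) u).2 2)).symm

theorem hilbertConverges_comparisonMap (h₁ : PositionAssumptions Φ₁ G₁)
    (h₂ : VelocityAssumptions Φ₂ G₂ H₂) (hη : IsCutoffFamily η) :
    HilbertConverges (𝓝[>] (0 : ℝ)) (inclusionMap h₁) (comparisonMap h₁ h₂ η) := by
  refine ⟨injective_inclusionMap h₁, denseRange_inclusionMap h₁, fun u => ?_⟩
  have := tendsto_norm_cutoff_mul_shear h₁ h₂ hη (phaseMeasure_scaled_eq h₁ h₂)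
    (testFunctions_mono (subset_univ _) u.2) (b := fun _ => 0) continuous_const (C := 0)
    (fun _ => by simp)
  simp only [inner_zero_right, add_zero] at this
  rw [coe_inclusionMap]
  refine this.congr fun ε => ?_
  rw [comparisonMap_apply]
  simp only [mul_comm]

theorem shear_mem_testFunctions {u h : E d → ℝ} (hu : u ∈ testFunctions (univ : Set (E d)))
    (hh : h ∈ testFunctions (univ : Set (E d))) :
    (fun z : E d × E d => u (z.1 + z.2) * h z.2) ∈ testFunctions (univ : Set (E d × E d)) :=
  (shearCutoff univ ⟨h, hh⟩ ⟨u, hu⟩).2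

theorem memLp_hamiltonOp_shear (h₁ : PositionAssumptions Φ₁ G₁)
    (h₂ : VelocityAssumptions Φ₂ G₂ H₂) {ε : ℝ} (hε : 0 < ε) {μ : Measure (E d × E d)}
    (hμ : μ = (gibbs Φ₁).prod (gibbs fun v => (scaledPotential Φ₂ ε v : EReal)))
    {f : E d × E d → ℝ} (hf : f ∈ testFunctions (univ : Set (E d × E d))) :
    MemLp (hamiltonOp G₁ (scaledGradient G₂ ε) f) 2 μ ∧ MemLp f 2 μ := by
  have hν := h₂.velocityMeasure hε
  have := hν.prob
  have := h₁.finiteOnCompacts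
  subst hμ
  exact ⟨(memLp_hamiltonOp h₁.gradient_memLp hν.memLp hf).1, memLp_of_mem_testFunctions hf 2⟩

theorem hamiltonOp_shear_sub (G₁ G : E d → E d) {u h : E d → ℝ} (hu : ContDiff ℝ ∞ u)
    (hh : ContDiff ℝ ∞ h) (φ : E d → ℝ) (z : E d × E d) :
    hamiltonOp G₁ G (fun z => u (z.1 + z.2) * h z.2) z - φ (z.1 + z.2) * h z.2 =
      h z.2 * (Δ u (z.1 + z.2) - φ (z.1 + z.2) + ⟪G₁ z.1, -∇ u (z.1 + z.2)⟫) +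
        cutoffRemainder G₁ G u h z := by
  obtain ⟨x, v⟩ := z
  rw [hamiltonOp_shear G₁ G hu hh x v, cutoffRemainder, inner_neg_right]
  ring

/-- Convergence of the generators on the comparison functions. -/
theorem tendsto_norm_hamiltonOp_shear_sub (h₁ : PositionAssumptions Φ₁ G₁)
    (h₂ : VelocityAssumptions Φ₂ G₂ H₂) (hη : IsCutoffFamily η) {μ : ℝ → Measure (E d × E d)}
    (hμ : ∀ ε, μ ε = (gibbs Φ₁).prod (gibbs fun v => (scaledPotential Φ₂ ε v : EReal)))
    {u φ : E d → ℝ} (hu : u ∈ testFunctions (univ : Set (E d)))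
    (hφ : φ ∈ testFunctions (univ : Set (E d))) :
    Tendsto (fun ε => ‖lpClass 2 (μ ε) (hamiltonOp G₁ (scaledGradient G₂ ε)
        fun z => u (z.1 + z.2) * (η ε).1 z.2) -
          lpClass 2 (μ ε) (fun z => φ (z.1 + z.2) * (η ε).1 z.2)‖) (𝓝[>] 0)
      (𝓝 ‖lpClass 2 (gibbs Φ₁) (overdampedOp G₁ u) - lpClass 2 (gibbs Φ₁) φ‖) := by
  have := h₁.finiteOnCompacts
  obtain ⟨D, hD⟩ := (hu.1.continuous_fderiv (by simp)).bounded_above_of_compact_support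
    (hu.2.1.fderiv (𝕜 := ℝ))
  have hgc : Continuous fun x => -∇ u x :=
    ((InnerProductSpace.toDual ℝ (E d)).symm.continuous.comp
      (hu.1.continuous_fderiv (by simp))).neg
  have hgb : ∀ x, ‖-∇ u x‖ ≤ D := fun x => by
    rw [norm_neg, norm_gradient_eq]
    exact hD x
  have hA : (fun x => Δ u x - φ x) ∈ testFunctions (univ : Set (E d)) :=
    Submodule.sub_mem _ (laplacian_mem_testFunctions hu) hφ
  have hmain := tendsto_norm_cutoff_mul_shear h₁ h₂ hη hμ hA hgc hgb
  have hlim : lpClass 2 (gibbs Φ₁) (overdampedOp G₁ u) - lpClass 2 (gibbs Φ₁) φ =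
      lpClass 2 (gibbs Φ₁) fun x => Δ u x - φ x + ⟪G₁ x, -∇ u x⟫ := by
    rw [← lpClass_sub (memLp_overdampedOp h₁.gradient_memLp hu) (memLp_of_mem_testFunctions hφ 2)]
    congr 1
    funext x
    rw [overdampedOp, inner_neg_right]
    ring
  have hmm := fun ε (hε : 0 < ε) => memLp_cutoff_mul_shear h₁ h₂ hε (hμ ε) hη hA hgc hgb
  have hmL := fun ε (hε : 0 < ε) => (memLp_hamiltonOp_shear h₁ h₂ hε (hμ ε)
    (shear_mem_testFunctions hu (η ε).2)).1
  have hmφ := fun ε (hε : 0 < ε) => (memLp_hamiltonOp_shear h₁ h₂ hε (hμ ε)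
    (shear_mem_testFunctions hφ (η ε).2)).2
  have hsplit := fun ε => hamiltonOp_shear_sub G₁ (scaledGradient G₂ ε) hu.1 (η ε).2.1 φ
  have hmR : ∀ ε > 0, MemLp (cutoffRemainder G₁ (scaledGradient G₂ ε) u (η ε).1) 2 (μ ε) :=
    fun ε hε => by
    have h3 := ((hmL ε hε).sub (hmφ ε hε)).sub (hmm ε hε)
    refine (memLp_congr_ae (ae_of_all _ fun z => ?_)).1 h3
    exact sub_eq_of_eq_add' (hsplit ε z)
  have hrem := tendsto_norm_cutoffRemainder h₁ h₂ hη hμ hu hmR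
  rw [hlim]
  refine tendsto_of_tendsto_of_dist hmain (squeeze_zero' (Eventually.of_forall fun _ =>
    dist_nonneg) ?_ hrem)
  filter_upwards [self_mem_nhdsWithin] with ε (hε : 0 < ε)
  rw [← lpClass_sub (hmL ε hε) (hmφ ε hε), funext (hsplit ε),
    lpClass_add (hmm ε hε) (hmR ε hε), dist_comm, Real.dist_eq]
  refine (abs_norm_sub_norm_le _ _).trans (le_of_eq ?_)
  rw [add_sub_cancel_left]

/-- The generator is closed, so it contains all test functions on phase space, not only those
supported over `{Φ₁ < ∞}`; the comparison functions need this. -/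
theorem exists_unique_isHamiltonSemigroup (h₁ : PositionAssumptions Φ₁ G₁)
    (h₂ : VelocityAssumptions Φ₂ G₂ H₂) {ε : ℝ} (hε : 0 < ε) :
    ∃ T, (∀ T', IsHamiltonSemigroup Φ₁ G₁ (scaledPotential Φ₂ ε) (scaledGradient G₂ ε) T' ↔
        T' = T) ∧ IsContractionSemigroup T ∧
      ∀ f ∈ testFunctions (univ : Set (E d × E d)),
        (lpClass 2 (phaseMeasure Φ₁ (scaledPotential Φ₂ ε)) f,
          lpClass 2 (phaseMeasure Φ₁ (scaledPotential Φ₂ ε))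
            (hamiltonOp G₁ (scaledGradient G₂ ε) f)) ∈ generatorGraph T := by
  have hν := h₂.velocityMeasure hε
  have hμ := phaseMeasure_scaled_eq h₁ h₂ ε
  obtain ⟨T, h1, h2, h3⟩ := exists_unique_hamiltonSemigroup h₁ hν hμ
  exact ⟨T, h1, h2, fun f hf =>
    mem_of_isClosed_of_testFunctions h₁ hν hμ h2.isClosed_generatorGraph h3 hf⟩

theorem strongConverges_hamiltonSemigroup (h₁ : PositionAssumptions Φ₁ G₁)
    (h₂ : VelocityAssumptions Φ₂ G₂ H₂) (hη : IsCutoffFamily η)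
    {T : ∀ ε : ℝ, ℝ≥0 → Lp ℝ 2 (phaseMeasure Φ₁ (scaledPotential Φ₂ ε)) →L[ℝ]
      Lp ℝ 2 (phaseMeasure Φ₁ (scaledPotential Φ₂ ε))}
    {T₀ : ℝ≥0 → Lp ℝ 2 (gibbs Φ₁) →L[ℝ] Lp ℝ 2 (gibbs Φ₁)}
    (hT : ∀ ε > 0,
      IsHamiltonSemigroup Φ₁ G₁ (scaledPotential Φ₂ ε) (scaledGradient G₂ ε) (T ε))
    (hT₀ : IsGeneratedByClosure (overdampedGraph Φ₁ G₁) T₀) (t : ℝ≥0)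
    {f : ∀ ε : ℝ, Lp ℝ 2 (phaseMeasure Φ₁ (scaledPotential Φ₂ ε))} {f₀ : Lp ℝ 2 (gibbs Φ₁)}
    (hf : StrongConverges (𝓝[>] (0 : ℝ)) (inclusionMap h₁) (comparisonMap h₁ h₂ η) f f₀) :
    StrongConverges (𝓝[>] (0 : ℝ)) (inclusionMap h₁) (comparisonMap h₁ h₂ η)
      (fun ε => T ε t (f ε)) (T₀ t f₀) := by
  -- The core of the limit generator is the space of test functions itself, by the definition of
  -- `T₀`; consistency is the norm convergence of the generators.
  refine strongConverges_semigroup (hilbertConverges_comparisonMap h₁ h₂ hη) ?_ hT₀.1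
    (L₀ := fun u => lpClass 2 (gibbs Φ₁) (overdampedOp G₁ u.1))
    (L := fun ε u => lpClass 2 (phaseMeasure Φ₁ (scaledPotential Φ₂ ε))
      (hamiltonOp G₁ (scaledGradient G₂ ε) (shearCutoff (finiteSet Φ₁) (η ε) u).1)) ?_ ?_
    (fun u φ => ?_) t hf
  · filter_upwards [self_mem_nhdsWithin] with ε hε using (hT ε hε).1
  · rw [hT₀.2, overdampedGraph_eq h₁]
  · filter_upwards [self_mem_nhdsWithin] with ε hε u
    -- The given semigroup is identified with the constructed one by uniqueness, and so inherits
    -- what is known about its generator.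
    obtain ⟨S, hS, -, hSD⟩ := exists_unique_isHamiltonSemigroup h₁ h₂ hε
    rw [(hS _).1 (hT ε hε), comparisonMap_apply]
    exact hSD _ (shearCutoff (finiteSet Φ₁) (η ε) u).2
  · rw [coe_inclusionMap]
    refine (tendsto_norm_hamiltonOp_shear_sub h₁ h₂ hη (phaseMeasure_scaled_eq h₁ h₂)
      (testFunctions_mono (subset_univ _) u.2) (testFunctions_mono (subset_univ _) φ.2)).congr
      fun ε => ?_
    rw [comparisonMap_apply]
    rfl

end Main

end Overdamped

end

theorem theorem5p2 (d : ℕ) (Φ₁ : Overdamped.E d → EReal) (G₁ : Overdamped.E d → Overdamped.E d)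
    (Φ₂ : Overdamped.E d → ℝ) (G₂ : Overdamped.E d → Overdamped.E d)
    (H₂ : Fin d → Overdamped.E d → ℝ)
    (h₁ : Overdamped.PositionAssumptions Φ₁ G₁) (h₂ : Overdamped.VelocityAssumptions Φ₂ G₂ H₂)
    (hfin : IsFiniteMeasure (Overdamped.phaseMeasure Φ₁ Φ₂) ∨
      ∃ q : ℝ≥0∞, 2 ≤ q ∧ (d : ℝ≥0∞) < q ∧ Overdamped.LocallyMemLp G₁ q (Overdamped.gibbs Φ₁))
    (η : ℝ → Overdamped.testFunctions (univ : Set (Overdamped.E d)))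
    (hη : Overdamped.IsCutoffFamily η) :
    Overdamped.HilbertConverges (𝓝[>] (0 : ℝ)) (Overdamped.inclusionMap h₁)
        (Overdamped.comparisonMap h₁ h₂ η) ∧
      (∀ ε > 0, ∃! T, Overdamped.IsHamiltonSemigroup Φ₁ G₁ (Overdamped.scaledPotential Φ₂ ε)
        (Overdamped.scaledGradient G₂ ε) T) ∧
      ∀ (T : ∀ ε : ℝ, ℝ≥0 →
          Lp ℝ 2 (Overdamped.phaseMeasure Φ₁ (Overdamped.scaledPotential Φ₂ ε)) →L[ℝ]
            Lp ℝ 2 (Overdamped.phaseMeasure Φ₁ (Overdamped.scaledPotential Φ₂ ε)))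
        (T₀ : ℝ≥0 → Lp ℝ 2 (Overdamped.gibbs Φ₁) →L[ℝ] Lp ℝ 2 (Overdamped.gibbs Φ₁)),
        (∀ ε > 0, Overdamped.IsHamiltonSemigroup Φ₁ G₁ (Overdamped.scaledPotential Φ₂ ε)
          (Overdamped.scaledGradient G₂ ε) (T ε)) →
        Overdamped.IsGeneratedByClosure (Overdamped.overdampedGraph Φ₁ G₁) T₀ →
        ∀ (t : ℝ≥0)
          (f : ∀ ε : ℝ, Lp ℝ 2 (Overdamped.phaseMeasure Φ₁ (Overdamped.scaledPotential Φ₂ ε)))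
          (f₀ : Lp ℝ 2 (Overdamped.gibbs Φ₁)),
          Overdamped.StrongConverges (𝓝[>] (0 : ℝ)) (Overdamped.inclusionMap h₁)
            (Overdamped.comparisonMap h₁ h₂ η) f f₀ →
          Overdamped.StrongConverges (𝓝[>] (0 : ℝ)) (Overdamped.inclusionMap h₁)
            (Overdamped.comparisonMap h₁ h₂ η) (fun ε => T ε t (f ε)) (T₀ t f₀) := by
  refine ⟨Overdamped.hilbertConverges_comparisonMap h₁ h₂ hη, fun ε hε => ?_,
    fun T T₀ hT hT₀ t f f₀ hf =>
      Overdamped.strongConverges_hamiltonSemigroup h₁ h₂ hη hT hT₀ t hf⟩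
  obtain ⟨T, hT, -⟩ := Overdamped.exists_unique_isHamiltonSemigroup h₁ h₂ hε
  exact ⟨T, (hT T).2 rfl, fun T' hT' => (hT T').1 hT'⟩
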